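/- **Setting.** Let $N\ge 1$ and let $F_1,\dots,F_N\in\mathbb{Z}[x,y]$ be binary forms, irreducible over $\mathbb{Q}$ and pairwise coprime over $\mathbb{Q}$, with $d_i=\deg F_i$ and $b_i=F_i(1,0)$. If $b_i\neq 0$, let $\theta_i$ be a root of the monic integer polynomial $\tilde F_i(x,1)$, where $\tilde F_i(x,y)=b_i^{d_i-1}F_i(b_i^{-1}x,y)$, and let $K_i=\mathbb{Q}(\theta_i)$; if $b_i=0$, so that $F_i=cy$ with $c\ne 0$, let $\theta_i=-c$ and $K_i=\mathbb{Q}$. For a number field $K$ with ring of integers $\mathfrak{o}_K$, ideal norm $\mathrm{N}$, and $\Omega_K(\mathfrak b)$ the number of prime ideal factors of $\mathfrak b$ counted with multiplicity, let $\mathcal{M}_K(A,B,\varepsilon)$, for $A,B,\varepsilon>0$, be the class of functions $f\ge 0$ on the non-zero ideals of $\mathfrak o_K$ such that $f(\mathfrak{ab})\le f(\mathfrak a)\min\{A^{\Omega_K(\mathfrak b)},B(\mathrm N\mathfrak b)^{\varepsilon}\}$ for all coprime $\mathfrak a,\mathfrak b$. For $k\in\mathbb{N}$ put $\mathfrak a_k=\prod_{\mathfrak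 p^\nu\|\mathfrak a,\ \gcd(\mathrm N\mathfrak p,k)=1}\mathfrak p^\nu$ and $f_k(\mathfrak a)=f(\mathfrak a_k)$, and for $q\in\mathbb N$ let $q_k=\prod_{p^\nu\| q,\ p\nmid k}p^\nu$. For real $w$ let $W=\prod_{p\le w}p$. For $x>0$ put $$E_f(x;W)=\exp\Big(\sum_{\substack{\mathfrak p\text{ prime},\ w<\mathrm N\mathfrak p\le x\\ \mathfrak p\text{ of residue degree }1}}\frac{f(\mathfrak p)}{\mathrm N\mathfrak p}\Big)$$ if $f(\mathfrak{ab})\le f(\mathfrak a)f(\mathfrak b)$ for all coprime $\mathfrak a,\mathfrak b$, and otherwise $$E_f(x;W)=\sum_{\mathfrak a}\frac{f(\mathfrak a)}{\mathrm N\mathfrak a},$$ where $\mathfrak a$ runs over the square-free ideals, all of whose prime factors have residue degree $1$, with $\mathrm N\mathfrak a\le x$ and $\gcd(\mathrm N\mathfrak a,W)=1$. Let $\bar\rho_i(k)=\#\{x \bmod k: F_i(x,1)\equiv 0 \bmod k\}$ if $b_i\ne 0$ and $\bar\rho_i(k)=1$ if $b_i=0$; let $h^*(k)=\prod_{p\mid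 k}\big(1-\frac{\bar\rho_1(p)+\dots+\bar\rho_N(p)}{p+1}\big)^{-1}$ and $h^*_W(k)=h^*(k_W)$. For a non-empty bounded measurable set $\mathcal R\subset\mathbb R^2$ whose boundary is a union of finitely many differentiable arcs and has finite length $\partial(\mathcal R)$, let $\|\mathcal R\|_\infty=\sup_{(x,y)\in\mathcal R}\max\{|x|,|y|\}$ and $$K_{\mathcal R}=1+\|\mathcal R\|_\infty+\partial(\mathcal R)\log(1+\|\mathcal R\|_\infty)+\frac{\mathrm{vol}(\mathcal R)}{1+\|\mathcal R\|_\infty}.$$ Such an $\mathcal R$ is called regular with exponent $c_1>0$ if no $F_i$ has a zero in $\mathcal R$ and $\mathrm{vol}(\mathcal R)\ge K_{\mathcal R}^{c_1}$. **Theorem.** In this setting, let $A_i>0$. There is $w_0$, depending only on $N$, the $F_i$ and the $A_i$, such that the following holds for every $w>w_0$. Let $c_1,c_2,\varepsilon,M>0$, $m\in\mathbb N$, and $B_i,\varepsilon_i>0$, and put $$\varepsilon_0=\max\Big\{1+\frac4{c_1},\ \frac{4(5+3\max_i\varepsilon_i)}{c_1}\Big\}\sum_{i=1}^N d_i\varepsilon_i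 .$$ Then for all $f_i\in\mathcal M_{K_i}(A_i,B_i,\varepsilon_i)$ with $f_i(\mathfrak o_{K_i})\le M$, all regular $\mathcal R$ with exponent $c_1$ that have at most $m$ connected components, and all full-rank lattices $G\subset\mathbb Z^2$ whose determinant $q_G$ satisfies $q_G\le V^{c_2}$, where $V=\mathrm{vol}(\mathcal R)$, one has $$\sum_{\substack{(s,t)\in\mathcal R\cap G\\ \gcd(s,t)=1}}\ \prod_{i=1}^N f_{i,q_GW}\big((b_is-\theta_it)\big)\ \ll\ \frac{V}{(\log V)^N}\,\frac{h^*_W(q_G)}{q_G}\prod_{i=1}^N E_{f_i}(V;W)+\frac{K_{\mathcal R}^{1+\varepsilon_0+\varepsilon}}{\lambda_G},$$ where $\lambda_G$ is the length of a shortest non-zero vector of $G$, and the implied constant depends at most on $c_1,c_2,A_i,B_i,F_i,\varepsilon,\varepsilon_i,N,W,M,m$. -/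

import Mathlib

open scoped NumberField

noncomputable section

/-! ### Ideals of a number field -/

section Ideals

variable {K : Type*} [Field K] [NumberField K]

/-- `Ω_K(𝔟)`: the number of prime ideal factors of `𝔟`, counted with multiplicity. -/
def idealOmega (𝔟 : Ideal (𝓞 K)) : ℕ :=
  Multiset.card (UniqueFactorizationMonoid.normalizedFactors 𝔟)

/-- The class `M_K(A, B, ε)` of pseudomultiplicative functions on the non-zero ideals of `𝓞 K`
(the value of `f` at the zero ideal plays no role). -/
structure IsPseudomultiplicative (A B ε : ℝ) (f : Ideal (𝓞 K) → ℝ) : Prop where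
  A_pos : 0 < A
  B_pos : 0 < B
  eps_pos : 0 < ε
  nonneg : ∀ 𝔞 : Ideal (𝓞 K), 𝔞 ≠ ⊥ → 0 ≤ f 𝔞
  bound : ∀ 𝔞 𝔟 : Ideal (𝓞 K), 𝔞 ≠ ⊥ → 𝔟 ≠ ⊥ → IsCoprime 𝔞 𝔟 →
    f (𝔞 * 𝔟) ≤ f 𝔞 * min (A ^ idealOmega 𝔟) (B * (Ideal.absNorm 𝔟 : ℝ) ^ ε)

/-- Submultiplicativity: `f(𝔞𝔟) ≤ f(𝔞) f(𝔟)` for coprime non-zero ideals. -/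
def IsSubmultiplicative (f : Ideal (𝓞 K) → ℝ) : Prop :=
  ∀ 𝔞 𝔟 : Ideal (𝓞 K), 𝔞 ≠ ⊥ → 𝔟 ≠ ⊥ → IsCoprime 𝔞 𝔟 → f (𝔞 * 𝔟) ≤ f 𝔞 * f 𝔟

open Classical in
/-- `𝔞_W`: the product of the prime powers `𝔭^ν ∥ 𝔞` with `gcd(N𝔭, W) = 1`. -/
def idealPrimeTo (W : ℕ) (𝔞 : Ideal (𝓞 K)) : Ideal (𝓞 K) :=
  ((UniqueFactorizationMonoid.normalizedFactors 𝔞).filter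
    (fun 𝔭 => Nat.Coprime (Ideal.absNorm 𝔭) W)).prod

/-- `𝒫_K°`: the ideals all of whose prime factors have residue degree one. As `N𝔭 = p ^ f_𝔭` with
`p` a rational prime, `f_𝔭 = 1` says that `N𝔭` is a rational prime. -/
def IsDegreeOneSpan (𝔞 : Ideal (𝓞 K)) : Prop :=
  ∀ 𝔭 : Ideal (𝓞 K), 𝔭.IsPrime → 𝔭 ∣ 𝔞 → Nat.Prime (Ideal.absNorm 𝔭)

variable (K) in
open Classical in
/-- The finite set of non-zero ideals of norm at most `x`. -/
def idealsUpTo (x : ℝ) : Finset (Ideal (𝓞 K)) :=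
  (Ideal.finite_setOfPred_absNorm_le (S := 𝓞 K) ⌊x⌋₊).toFinset.filter
    (fun 𝔞 => 𝔞 ≠ ⊥ ∧ (Ideal.absNorm 𝔞 : ℝ) ≤ x)

open Classical in
/-- `E_f(x; W)` with `W = ∏_{p ≤ w} p`. -/
def eulerMajorant (f : Ideal (𝓞 K) → ℝ) (w x : ℝ) : ℝ :=
  if IsSubmultiplicative f then
    Real.exp (∑ 𝔭 ∈ (idealsUpTo K x).filter
      (fun 𝔭 => 𝔭.IsPrime ∧ IsDegreeOneSpan 𝔭 ∧ w < (Ideal.absNorm 𝔭 : ℝ)),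
        f 𝔭 / (Ideal.absNorm 𝔭 : ℝ))
  else
    ∑ 𝔞 ∈ (idealsUpTo K x).filter
      (fun 𝔞 => IsDegreeOneSpan 𝔞 ∧ Squarefree 𝔞 ∧
        Nat.Coprime (Ideal.absNorm 𝔞) (primorial ⌊w⌋₊)),
        f 𝔞 / (Ideal.absNorm 𝔞 : ℝ)

end Ideals

/-! ### Binary forms -/

/-- `b = F(1, 0)`. -/
def leadCoeffX (F : MvPolynomial (Fin 2) ℤ) : ℤ := MvPolynomial.eval ![1, 0] F

/-- `F̃(x, y) = b^(d-1) F(x / b, y)` for a form `F` of degree `d` with `b = F(1, 0) ≠ 0`. -/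
def monicForm (F : MvPolynomial (Fin 2) ℤ) (d : ℕ) : MvPolynomial (Fin 2) ℚ :=
  MvPolynomial.C ((leadCoeffX F : ℚ) ^ (d - 1)) *
    MvPolynomial.aeval
      ![MvPolynomial.C ((leadCoeffX F : ℚ)⁻¹) * MvPolynomial.X 0, MvPolynomial.X 1] F

/-- `K = ℚ(θ)`, where `θ` is a root of `F̃(x, 1)` if `F(1, 0) ≠ 0`, and `θ = -c` if `F = c y`
(so that `c = F(0, 1)` and `K = ℚ`). -/
structure IsFormRoot {K : Type*} [Field K] [NumberField K]
    (F : MvPolynomial (Fin 2) ℤ) (d : ℕ) (θ : 𝓞 K) : Prop where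
  generates : IntermediateField.adjoin ℚ {(θ : K)} = ⊤
  root : leadCoeffX F ≠ 0 → MvPolynomial.aeval ![(θ : K), 1] (monicForm F d) = 0
  root_of_eq_zero : leadCoeffX F = 0 → θ = -((MvPolynomial.eval ![0, 1] F : ℤ) : 𝓞 K)

/-- `ρ̄(k)`: the number of zeros of `F(x, 1)` modulo `k` if `F(1, 0) ≠ 0`, and `1` otherwise. -/
def rhoBar (F : MvPolynomial (Fin 2) ℤ) (k : ℕ) : ℕ :=
  if leadCoeffX F ≠ 0 then
    Nat.card {x : ZMod k // MvPolynomial.aeval ![x, 1] F = 0}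
  else 1

/-- `h*(k) = ∏_{p ∣ k} (1 - (ρ̄_1(p) + ⋯ + ρ̄_N(p)) / (p + 1))⁻¹`. -/
def hStar {N : ℕ} (F : Fin N → MvPolynomial (Fin 2) ℤ) (k : ℕ) : ℝ :=
  ∏ p ∈ k.primeFactors, (1 - (∑ i, (rhoBar (F i) p : ℝ)) / ((p : ℝ) + 1))⁻¹

/-- `k_W`: the product of the prime powers `p^ν ∥ k` with `gcd(p, W) = 1`. -/
def natPrimeTo (W k : ℕ) : ℕ :=
  ∏ p ∈ k.primeFactors.filter (fun p => Nat.Coprime p W), p ^ k.factorization p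

/-! ### Regions and lattices in the plane -/

/-- The Euclidean plane. -/
abbrev Plane : Type := EuclideanSpace ℝ (Fin 2)

/-- An integer vector as a point of the plane. -/
def toPlane (x : ℤ × ℤ) : Plane := !₂[(x.1 : ℝ), (x.2 : ℝ)]

/-- The area of `R`. -/
def area (R : Set Plane) : ℝ := (MeasureTheory.volume R).toReal

/-- `‖R‖_∞ = sup_{(x,y) ∈ R} max(|x|, |y|)`. -/
def supNorm (R : Set Plane) : ℝ := sSup ((fun v : Plane => max |v 0| |v 1|) '' R)

/-- `∂(R)`: the length (one-dimensional Hausdorff measure) of the boundary of `R`. -/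
def boundaryLength (R : Set Plane) : ℝ :=
  (MeasureTheory.Measure.hausdorffMeasure (1 : ℝ) (frontier R)).toReal

/-- `K_R`. -/
def regionK (R : Set Plane) : ℝ :=
  1 + supNorm R + boundaryLength R * Real.log (1 + supNorm R) + area R / (1 + supNorm R)

/-- Regular regions for the forms `F` with exponent `c₁`. -/
structure IsRegularRegion {N : ℕ} (F : Fin N → MvPolynomial (Fin 2) ℤ) (c₁ : ℝ)
    (R : Set Plane) : Prop where
  nonempty : R.Nonempty
  bounded : Bornology.IsBounded R
  /-- Lebesgue measurability. -/
  measurable : MeasureTheory.NullMeasurableSet R MeasureTheory.volume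
  /-- The boundary consists of finitely many differentiable arcs. -/
  piecewise : ∃ (n : ℕ) (γ : Fin n → ℝ → Plane),
    (∀ j, DifferentiableOn ℝ (γ j) (Set.Icc 0 1)) ∧
      frontier R = ⋃ j, γ j '' Set.Icc 0 1
  /-- The boundary has finite length. -/
  rectifiable : MeasureTheory.Measure.hausdorffMeasure (1 : ℝ) (frontier R) ≠ ⊤
  no_zeros : ∀ v ∈ R, ∀ i, MvPolynomial.aeval (fun j => v j) (F i) ≠ (0 : ℝ)
  area_ge : regionK R ^ c₁ ≤ area R

/-- `λ_G`: the first successive minimum, i.e. the length of a shortest non-zero vector. -/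
def firstMin (G : AddSubgroup (ℤ × ℤ)) : ℝ :=
  sInf {r : ℝ | ∃ x ∈ G, x ≠ 0 ∧ r = ‖toPlane x‖}

/-- `ε₀ = max {1 + 4 / c₁, 4 (5 + 3 max ε_i) / c₁} · ∑ d_i ε_i`. -/
def epsZero {N : ℕ} (c₁ : ℝ) (d : Fin N → ℕ) (ε : Fin N → ℝ) : ℝ :=
  max (1 + 4 / c₁) (4 * (5 + 3 * ⨆ i, ε i) / c₁) * ∑ i, (d i : ℝ) * ε i

end

/-! ### Selberg's upper bound sieve in combinatorial form. -/

section Selberg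
open Finset

/-! This is the Erdős–Wolke–Nair–Tenenbaum method for norms of linear forms, run on small pieces of
the region. Write Y = K_R, V = vol(R), T = ∑ d_i ε_i, and let ℓ₁ ≤ ℓ₂ be the lengths of a reduced
basis of G.

Arithmetic input. Up to sign, the ideal of b s - θ t has norm b^(d-1) F(s, t) (`norm_linearForm`).
When gcd(s, t) = 1 and the primes up to w are removed, its prime factors have residue degree one, at
most one of them lies over each rational prime, and different forms never share a rational prime
(`IsFormSystem.isSeparatedTuple_formIdeals`). For such an ideal 𝔲, divisibility by 𝔲 forces one
linear congruence modulo N𝔲 (`exists_linear_congruence`). So the values behave like a tuple of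
ideals with controlled local densities.

Sieve input. In coordinates with respect to a reduced basis, lattice points in a small square lie in
a box with sides k₁ ≥ k₂. The Chinese remainder theorem, Selberg's sieve and the lower bound in
Mertens' theorem for degree one primes bound the number of points whose ideals are divisible by a
tuple u and have no further prime norm up to ξ. The bound is k₁k₂ h*(q) / (N(u) (1 + log ξ)^N),
times harmless local factors, plus an error (`IsFormSystem.exists_hasSieveBound`). The factor h* is
the price of not sieving by primes dividing the index q of G.

Mean value (`exists_sum_le_of_hasSieveBound`). Put Z = Y^(4T+δ) and order the prime norms of a tuple
increasingly, collecting them while the product stays at most Z. Typically this smooth part u has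
primes at most Z^(1/r), while the remaining primes exceed Z^(1/(r+1)). There are then O(r) remaining
primes, so they change the function by at most a constant to the power r, and the sieve handles the
condition on them. Unless r = 1, N(u) > √Z, so Rankin's trick gains exp(-κr/2), which beats that
loss when κ is large. The sum over smooth u of f(u)/N(u) is compared with the sum over square-free
ideals by `exists_rankin_sum_le`, and from there with E_f by `squarefreeSum_le_eulerMajorant`. The
exceptional tuples, which have a large power of a small prime or a large divisor made of bounded
primes, are so rare (a saving of about Z^(1/4) > Y^T) that the trivial bound Y^T for the function
suffices.

Geometry. R is cut by a grid of mesh L = V/Y, and `card_gridIndex_le` shows that O(Y²/V) cells meet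
it. Each cell contributes O(L²/q) times the expected density, plus (L/ℓ₁) times a small power of Y.
Summing over cells gives the main term V/q and the error Y^(1+ε₀+ε)/ℓ₁. If V is too small relative
to ℓ₁, or if the coordinate box degenerates to a line, trivial estimates are already within the
error term (`IsFormSystem.exists_lattice_sum_le`). -/

/-- The alternating sum over the interval `[S, U]` of finite sets. -/
lemma sum_powerset_filter_superset_neg_one_pow {S U : Finset ℕ} :
    ∑ T ∈ U.powerset with S ⊆ T, (-1 : ℝ) ^ T.card = if S = U then (-1) ^ S.card else 0 := by
  by_cases hSU : S ⊆ U
  · have h1 : (U.powerset.filter (S ⊆ ·)) = (U \ S).powerset.image (S ∪ ·) := by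
      rw [← Finset.Icc_eq_image_powerset hSU]
      ext T
      simp [and_comm]
    rw [h1, sum_image]
    · have h2 : ∀ T ∈ (U \ S).powerset, (-1 : ℝ) ^ (S ∪ T).card
          = (-1) ^ S.card * (-1) ^ T.card := by
        intro T hT
        rw [card_union_of_disjoint, pow_add]
        exact Finset.disjoint_sdiff.mono_right (mem_powerset.1 hT)
      rw [sum_congr rfl h2, ← mul_sum]
      have h3 := Finset.sum_powerset_neg_one_pow_card (x := U \ S)
      have h4 : ∑ T ∈ (U \ S).powerset, (-1 : ℝ) ^ T.card = if U \ S = ∅ then 1 else 0 := by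
        exact_mod_cast h3
      rw [h4]
      by_cases h : S = U
      · simp [h]
      · have : U \ S ≠ ∅ := by
          intro h'
          exact h (subset_antisymm hSU (sdiff_eq_empty_iff_subset.1 h'))
        simp [h, this]
    · intro T hT T' hT' h
      have hd := (Finset.disjoint_sdiff (s := S) (t := U)).mono_right (mem_powerset.1 hT)
      have hd' := (Finset.disjoint_sdiff (s := S) (t := U)).mono_right (mem_powerset.1 hT')
      have e1 : (S ∪ T) \ S = T := by
        rw [union_sdiff_left]; exact sdiff_eq_self_of_disjoint hd.symm
      have e2 : (S ∪ T') \ S = T' := by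
        rw [union_sdiff_left]; exact sdiff_eq_self_of_disjoint hd'.symm
      simp only at h
      rw [← e1, ← e2, h]
  · have : S ≠ U := fun h => hSU (h ▸ subset_rfl)
    rw [if_neg this]
    apply sum_eq_zero
    intro T hT
    simp only [mem_filter, mem_powerset] at hT
    exact absurd (hT.2.trans hT.1) hSU

/-- A set of primes is determined by its product, so these sets inject into the integers up to ξ. -/
lemma card_filter_prod_le {P : Finset ℕ} (hP : ∀ p ∈ P, p.Prime) {ξ : ℝ} (hξ : 1 ≤ ξ) :
    ((P.powerset.filter (fun T => ((∏ p ∈ T, p : ℕ) : ℝ) ≤ ξ)).card : ℝ) ≤ ξ := by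
  have hle : (P.powerset.filter (fun T => ((∏ p ∈ T, p : ℕ) : ℝ) ≤ ξ)).card
      ≤ (Icc 1 ⌊ξ⌋₊).card := by
    apply card_le_card_of_injOn (fun T => ∏ p ∈ T, p)
    · intro T hT
      simp only [coe_filter, mem_powerset, Set.mem_ofPred_eq] at hT
      simp only [coe_Icc, Set.mem_Icc]
      refine ⟨?_, Nat.le_floor hT.2⟩
      exact Nat.one_le_iff_ne_zero.2 (prod_ne_zero_iff.2 fun p hp => (hP p (hT.1 hp)).ne_zero)
    · intro T hT T' hT' h
      simp only [coe_filter, mem_powerset, Set.mem_ofPred_eq] at hT hT'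
      simp only at h
      rw [← Nat.primeFactors_prod (fun p hp => hP p (hT.1 hp)),
        ← Nat.primeFactors_prod (fun p hp => hP p (hT'.1 hp)), h]
  have h2 : ((Icc 1 ⌊ξ⌋₊).card : ℝ) ≤ ξ := by
    simp only [Nat.card_Icc, Nat.add_sub_cancel]
    exact Nat.floor_le (by linarith)
  exact le_trans (by exact_mod_cast hle) h2

/-- Selberg's upper bound sieve, for a finite set of points and a family of conditions indexed by
primes. -/
theorem selberg_upper_bound {α : Type*} (Ω : Finset α) (P : Finset ℕ)
    (hP : ∀ p ∈ P, p.Prime) (bad : ℕ → α → Prop) [∀ p x, Decidable (bad p x)] (g : ℕ → ℝ)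
    (hg0 : ∀ p ∈ P, 0 < g p) (hg1 : ∀ p ∈ P, g p < 1) (hg2 : ∀ p ∈ P, (1 - g p)⁻¹ ≤ p)
    (X E ξ : ℝ) (hE : 0 ≤ E) (hξ : 1 ≤ ξ)
    (hcount : ∀ T ⊆ P, ((∏ p ∈ T, p : ℕ) : ℝ) ≤ ξ ^ 2 →
      |((Ω.filter (fun x => ∀ p ∈ T, bad p x)).card : ℝ) - X * ∏ p ∈ T, g p|
        ≤ E * ((∏ p ∈ T, p : ℕ) : ℝ)) :
    ((Ω.filter (fun x => ∀ p ∈ P, ¬ bad p x)).card : ℝ) ≤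
      X / (∑ T ∈ P.powerset with ((∏ p ∈ T, p : ℕ) : ℝ) ≤ ξ, ∏ p ∈ T, g p / (1 - g p))
        + E * ξ ^ 6 := by
  classical
  set 𝒰 := P.powerset.filter (fun T => ((∏ p ∈ T, p : ℕ) : ℝ) ≤ ξ) with h𝒰
  set h : Finset ℕ → ℝ := fun T => ∏ p ∈ T, g p / (1 - g p) with hh
  set gg : Finset ℕ → ℝ := fun T => ∏ p ∈ T, g p with hgg
  set G := ∑ T ∈ 𝒰, h T with hG
  have hsub : ∀ T ∈ 𝒰, T ⊆ P := fun T hT => mem_powerset.1 (mem_filter.1 hT).1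
  have hpos : ∀ T ⊆ P, 0 < h T := fun T hT => prod_pos fun p hp =>
    div_pos (hg0 p (hT hp)) (by linarith [hg1 p (hT hp)])
  have ggpos : ∀ T ⊆ P, 0 < gg T := fun T hT => prod_pos fun p hp => hg0 p (hT hp)
  have hdown : ∀ U ∈ 𝒰, ∀ T ⊆ U, T ∈ 𝒰 := by
    intro U hU T hT
    refine mem_filter.2 ⟨mem_powerset.2 (hT.trans (hsub U hU)), le_trans ?_ (mem_filter.1 hU).2⟩
    have : ∏ p ∈ T, p ≤ ∏ p ∈ U, p := prod_le_prod_of_subset_of_one_le' hT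
      fun p hp _ => (hP p (hsub U hU hp)).one_lt.le
    exact_mod_cast this
  have hempty : ∅ ∈ 𝒰 := by simp [h𝒰, hξ]
  have hGpos : 0 < G := by
    apply sum_pos (fun T hT => hpos T (hsub T hT)) ⟨∅, hempty⟩
  -- Selberg's weights: with λ_∅ = 1 they make the quadratic form below equal to 1/G.
  set lam : Finset ℕ → ℝ := fun T =>
    (-1) ^ T.card / (gg T * G) * ∑ U ∈ 𝒰 with T ⊆ U, h U with hlam
  have lam_empty : lam ∅ = 1 := by
    simp only [hlam, hgg, card_empty, pow_zero, prod_empty, one_mul, empty_subset, filter_true]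
    rw [← hG]; field_simp
  have prod_cast : ∀ T : Finset ℕ, ((∏ p ∈ T, p : ℕ) : ℝ) = ∏ p ∈ T, (p : ℝ) := by
    intro T; push_cast; rfl
  -- The crude bound ξ replaces the classical bound 1. It needs only (1 - g p)⁻¹ ≤ p and costs a few
  -- powers of ξ in the error.
  have lam_abs : ∀ T ∈ 𝒰, |lam T| ≤ ξ := by
    intro T hT
    have hTP := hsub T hT
    have h1 : ∑ U ∈ 𝒰 with T ⊆ U, h U ≤ h T * G := by
      have : ∀ U ∈ 𝒰.filter (T ⊆ ·), h U = h T * h (U \ T) := by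
        intro U hU
        simp only [hh]
        rw [mul_comm, prod_sdiff (mem_filter.1 hU).2]
      rw [sum_congr rfl this, ← mul_sum]
      apply mul_le_mul_of_nonneg_left _ (hpos T hTP).le
      have hinj : Set.InjOn (fun U => U \ T) (𝒰.filter (T ⊆ ·) : Finset (Finset ℕ)) := by
        intro U hU U' hU' he
        simp only [coe_filter, Set.mem_ofPred_eq] at hU hU'
        simp only at he
        rw [← sdiff_union_of_subset hU.2, ← sdiff_union_of_subset hU'.2, he]
      rw [← sum_image (f := h) hinj]
      apply sum_le_sum_of_subset_of_nonneg
      · intro V hV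
        obtain ⟨U, hU, rfl⟩ := mem_image.1 hV
        exact hdown U (mem_filter.1 hU).1 _ sdiff_subset
      · intro V hV _
        exact (hpos V (hsub V hV)).le
    have h0 : 0 ≤ ∑ U ∈ 𝒰 with T ⊆ U, h U :=
      sum_nonneg fun U hU => (hpos U (hsub U (mem_filter.1 hU).1)).le
    have hgT := ggpos T hTP
    have e : |lam T| = (∑ U ∈ 𝒰 with T ⊆ U, h U) / (gg T * G) := by
      simp only [hlam]
      rw [abs_mul, abs_div, abs_pow, abs_neg, abs_one, one_pow, abs_of_nonneg h0,
        abs_of_pos (mul_pos hgT hGpos)]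
      ring
    rw [e, div_le_iff₀ (mul_pos hgT hGpos)]
    have h2 : h T ≤ gg T * ((∏ p ∈ T, p : ℕ) : ℝ) := by
      rw [prod_cast]
      simp only [hh, hgg]
      rw [← prod_mul_distrib]
      apply prod_le_prod
      · intro p hp
        exact (div_pos (hg0 p (hTP hp)) (by linarith [hg1 p (hTP hp)])).le
      · intro p hp
        rw [div_eq_mul_inv]
        exact mul_le_mul_of_nonneg_left (hg2 p (hTP hp)) (hg0 p (hTP hp)).le
    calc _ ≤ h T * G := h1
      _ ≤ (gg T * ((∏ p ∈ T, p : ℕ) : ℝ)) * G := by gcongr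
      _ ≤ (gg T * ξ) * G := by
          have := (mem_filter.1 hT).2
          gcongr
      _ = ξ * (gg T * G) := by ring
  have hmajorant : ((Ω.filter (fun x => ∀ p ∈ P, ¬ bad p x)).card : ℝ) ≤
      ∑ x ∈ Ω, (∑ T ∈ 𝒰, if ∀ p ∈ T, bad p x then lam T else 0) ^ 2 := by
    rw [card_filter]
    push_cast
    apply sum_le_sum
    intro x _
    split_ifs with hx
    · have : ∑ T ∈ 𝒰, (if ∀ p ∈ T, bad p x then lam T else 0) = 1 := by
        rw [sum_eq_single_of_mem ∅ hempty, if_pos (by simp), lam_empty]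
        intro T hT hne
        rw [if_neg]
        intro hb
        obtain ⟨p, hp⟩ := nonempty_iff_ne_empty.2 hne
        exact hx p (hsub T hT hp) (hb p hp)
      rw [this]; norm_num
    · positivity
  set cnt : Finset ℕ → ℝ := fun T => ((Ω.filter (fun x => ∀ p ∈ T, bad p x)).card : ℝ) with hcnt
  have hexpand : ∑ x ∈ Ω, (∑ T ∈ 𝒰, if ∀ p ∈ T, bad p x then lam T else 0) ^ 2
      = ∑ T ∈ 𝒰, ∑ T' ∈ 𝒰, lam T * lam T' * cnt (T ∪ T') := by
    simp only [sq, sum_mul_sum]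
    rw [sum_comm]
    apply sum_congr rfl
    intro T _
    rw [sum_comm]
    apply sum_congr rfl
    intro T' _
    simp only [hcnt, card_filter]
    push_cast
    rw [mul_sum]
    apply sum_congr rfl
    intro x _
    have : (∀ p ∈ T ∪ T', bad p x) ↔ (∀ p ∈ T, bad p x) ∧ (∀ p ∈ T', bad p x) := by
      simp only [mem_union]
      constructor
      · intro H; exact ⟨fun p hp => H p (Or.inl hp), fun p hp => H p (Or.inr hp)⟩
      · rintro ⟨H1, H2⟩ p (hp | hp)
        exacts [H1 p hp, H2 p hp]
    simp only [this]
    by_cases h1 : ∀ p ∈ T, bad p x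
    · by_cases h2 : ∀ p ∈ T', bad p x
      · rw [if_pos h1, if_pos h2, if_pos ⟨h1, h2⟩, mul_one]
      · rw [if_neg (show ¬ ((∀ p ∈ T, bad p x) ∧ ∀ p ∈ T', bad p x) from fun H => h2 H.2),
          if_neg h2]
        ring
    · rw [if_neg (show ¬ ((∀ p ∈ T, bad p x) ∧ ∀ p ∈ T', bad p x) from fun H => h1 H.1),
        if_neg h1]
      ring
  -- error and main terms
  have hsplit_error : ∑ T ∈ 𝒰, ∑ T' ∈ 𝒰, lam T * lam T' * cnt (T ∪ T') ≤
      X * (∑ T ∈ 𝒰, ∑ T' ∈ 𝒰, lam T * lam T' * gg (T ∪ T')) + E * ξ ^ 6 := by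
    have hb : ∀ T ∈ 𝒰, ∀ T' ∈ 𝒰, lam T * lam T' * cnt (T ∪ T') ≤
        X * (lam T * lam T' * gg (T ∪ T')) + E * ξ ^ 4 := by
      intro T hT T' hT'
      have hle : ((∏ p ∈ T ∪ T', p : ℕ) : ℝ) ≤ ξ ^ 2 := by
        have h1 : ∏ p ∈ T ∪ T', p ≤ (∏ p ∈ T, p) * ∏ p ∈ T', p := by
          rw [← prod_union_inter]
          apply Nat.le_mul_of_pos_right
          exact prod_pos fun p hp => (hP p (hsub T hT (mem_inter.1 hp).1)).pos
        have h2 : ((∏ p ∈ T ∪ T', p : ℕ) : ℝ) ≤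
            ((∏ p ∈ T, p : ℕ) : ℝ) * ((∏ p ∈ T', p : ℕ) : ℝ) := by exact_mod_cast h1
        refine h2.trans ?_
        rw [sq]
        exact mul_le_mul (mem_filter.1 hT).2 (mem_filter.1 hT').2 (by positivity) (by linarith)
      have hc := hcount (T ∪ T') (union_subset (hsub T hT) (hsub T' hT')) hle
      have hc' : |cnt (T ∪ T') - X * gg (T ∪ T')| ≤ E * ξ ^ 2 :=
        hc.trans (mul_le_mul_of_nonneg_left hle hE)
      have : lam T * lam T' * (cnt (T ∪ T') - X * gg (T ∪ T')) ≤ ξ * ξ * (E * ξ ^ 2) := by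
        refine (le_abs_self _).trans ?_
        rw [abs_mul, abs_mul]
        have a1 := lam_abs T hT
        have a2 := lam_abs T' hT'
        gcongr
      nlinarith [this]
    refine (sum_le_sum fun T hT => sum_le_sum fun T' hT' => hb T hT T' hT').trans ?_
    simp only [sum_add_distrib, sum_const, nsmul_eq_mul, ← mul_sum]
    have hcard := card_filter_prod_le hP hξ
    rw [← h𝒰] at hcard
    -- At most ξ² pairs of sets, two weights of size ξ and a remainder E ξ² account for the sixth
    -- power.
    have : (𝒰.card : ℝ) * ((𝒰.card : ℝ) * (E * ξ ^ 4)) ≤ E * ξ ^ 6 := by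
      calc _ ≤ ξ * (ξ * (E * ξ ^ 4)) := by gcongr
        _ = _ := by ring
    linarith
  -- From 1/g = 1 + (1 - g)/g, expanding the product over subsets. Applied to T ∩ T', this
  -- diagonalises the quadratic form.
  have hginv : ∀ T ⊆ P, (gg T)⁻¹ = ∑ S ∈ P.powerset with S ⊆ T, (h S)⁻¹ := by
    intro T hT
    have e1 : P.powerset.filter (· ⊆ T) = T.powerset := by
      ext S; simp only [mem_filter, mem_powerset]
      exact ⟨fun H => H.2, fun H => ⟨H.trans hT, H⟩⟩
    rw [e1]
    have e2 : ∀ S ∈ T.powerset, (h S)⁻¹ = ∏ p ∈ S, (g p / (1 - g p))⁻¹ := by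
      intro S _; simp only [hh, prod_inv_distrib]
    rw [sum_congr rfl e2, ← prod_one_add]
    simp only [hgg, ← prod_inv_distrib]
    apply prod_congr rfl
    intro p hp
    have h1 := hg0 p (hT hp)
    have h2 : 0 < 1 - g p := by linarith [hg1 p (hT hp)]
    field_simp
    ring
  -- The diagonal variables. Interchanging sums leaves an alternating sum over an interval of sets,
  -- which collapses to the single term U = S.
  have hy : ∀ S ∈ P.powerset, ∑ T ∈ 𝒰 with S ⊆ T, lam T * gg T =
      if S ∈ 𝒰 then (-1) ^ S.card * h S / G else 0 := by
    intro S _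
    have e1 : ∀ T ∈ 𝒰.filter (S ⊆ ·), lam T * gg T
        = ∑ U ∈ 𝒰, if T ⊆ U then (-1) ^ T.card * h U / G else 0 := by
      intro T hT
      have := ggpos T (hsub T (mem_filter.1 hT).1)
      rw [← sum_filter]
      simp only [hlam]
      rw [← sum_div, ← mul_sum]
      field_simp
    rw [sum_congr rfl e1, sum_comm]
    have e2 : ∀ U ∈ 𝒰, ∑ T ∈ 𝒰 with S ⊆ T, (if T ⊆ U then (-1 : ℝ) ^ T.card * h U / G else 0)
        = if S = U then (-1) ^ S.card * h U / G else 0 := by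
      intro U hU
      rw [← sum_filter]
      have e3 : (𝒰.filter (S ⊆ ·)).filter (· ⊆ U) = U.powerset.filter (S ⊆ ·) := by
        ext T; simp only [mem_filter, mem_powerset]
        exact ⟨fun H => ⟨H.2, H.1.2⟩, fun H => ⟨⟨hdown U hU T H.1, H.2⟩, H.1⟩⟩
      rw [e3]
      have e4 : ∀ T ∈ U.powerset.filter (S ⊆ ·), (-1 : ℝ) ^ T.card * h U / G
          = (-1 : ℝ) ^ T.card * (h U / G) := fun T _ => by ring
      rw [sum_congr rfl e4, ← sum_mul, sum_powerset_filter_superset_neg_one_pow]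
      split_ifs <;> ring
    rw [sum_congr rfl e2, sum_ite_eq]
  have hmain : ∑ T ∈ 𝒰, ∑ T' ∈ 𝒰, lam T * lam T' * gg (T ∪ T') = 1 / G := by
    have e1 : ∀ T ∈ 𝒰, ∀ T' ∈ 𝒰, lam T * lam T' * gg (T ∪ T') =
        ∑ S ∈ P.powerset, (h S)⁻¹ * ((if S ⊆ T then lam T * gg T else 0) *
          (if S ⊆ T' then lam T' * gg T' else 0)) := by
      intro T hT T' hT'
      have hi : T ∩ T' ⊆ P := inter_subset_left.trans (hsub T hT)
      have e2 : gg (T ∪ T') = gg T * gg T' * (gg (T ∩ T'))⁻¹ := by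
        rw [eq_mul_inv_iff_mul_eq₀ (ggpos _ hi).ne']
        exact prod_union_inter
      rw [e2, hginv _ hi, sum_filter, mul_sum, mul_sum]
      apply sum_congr rfl
      intro S _
      by_cases h1 : S ⊆ T <;> by_cases h2 : S ⊆ T' <;> simp [h1, h2, subset_inter_iff]
      ring
    rw [sum_congr rfl fun T hT => sum_congr rfl fun T' hT' => e1 T hT T' hT']
    have e3 : ∑ T ∈ 𝒰, ∑ T' ∈ 𝒰, ∑ S ∈ P.powerset, (h S)⁻¹ *
        ((if S ⊆ T then lam T * gg T else 0) * (if S ⊆ T' then lam T' * gg T' else 0))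
        = ∑ S ∈ P.powerset, (h S)⁻¹ * (∑ T ∈ 𝒰 with S ⊆ T, lam T * gg T) ^ 2 := by
      rw [sum_congr rfl fun T _ => sum_comm, sum_comm]
      apply sum_congr rfl
      intro S _
      rw [sum_filter (s := 𝒰) (p := (S ⊆ ·)) (f := fun T => lam T * gg T), sq, sum_mul_sum,
        mul_sum]
      exact sum_congr rfl fun _ _ => (mul_sum _ _ _).symm
    rw [e3]
    have e4 : ∀ S ∈ P.powerset, (h S)⁻¹ * (∑ T ∈ 𝒰 with S ⊆ T, lam T * gg T) ^ 2
        = if S ∈ 𝒰 then h S / G ^ 2 else 0 := by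
      intro S hS
      rw [hy S hS]
      have := (hpos S (mem_powerset.1 hS)).ne'
      split_ifs
      · rw [div_pow, mul_pow, ← pow_mul, mul_comm S.card 2, pow_mul]
        norm_num
        field_simp
      · simp
    rw [sum_congr rfl e4, ← sum_filter]
    have e5 : P.powerset.filter (· ∈ 𝒰) = 𝒰 := by
      ext S; simp only [mem_filter, mem_powerset]
      exact ⟨fun H => H.2, fun H => ⟨hsub S H, H⟩⟩
    rw [e5, ← sum_div, ← hG]
    field_simp
  calc _ ≤ _ := hmajorant
    _ = _ := hexpand
    _ ≤ _ := hsplit_error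
    _ = _ := by rw [hmain]; ring

end Selberg

/-! ### The sieve bound with an Euler product as main term. -/

section SelbergAsymptotic
open Finset

/-- Chebyshev's upper bound in Mertens' form: `∑_{p ≤ y} log p / p ≪ log y`. -/
lemma exists_sum_log_div_prime_le :
    ∃ C : ℝ, 0 < C ∧ ∀ y : ℝ, 2 ≤ y →
      ∑ p ∈ (Icc 1 ⌊y⌋₊).filter Nat.Prime, Real.log p / p ≤ C * Real.log y := by
  -- Partial summation against Chebyshev's θ, carried out as an induction: the step uses θ(n)/n -
  -- θ(n)/(n+1) ≤ log 4/(n+1).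
  have key : ∀ n : ℕ, 1 ≤ n → ∑ p ∈ (Icc 1 n).filter Nat.Prime, Real.log p / p
      ≤ Chebyshev.theta n / n + Real.log 4 * (harmonic n : ℝ) := by
    intro n hn
    induction n, hn using Nat.le_induction with
    | base => 
      have h4 : 0 ≤ Real.log 4 := Real.log_nonneg (by norm_num)
      have : (Icc 1 1).filter Nat.Prime = ∅ := by decide
      rw [this, sum_empty]
      have := Chebyshev.theta_nonneg ((1 : ℕ) : ℝ)
      have h5 : (0 : ℝ) ≤ (harmonic 1 : ℝ) := by simp [harmonic]
      positivity
    | succ n hn ih =>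
      have hth : Chebyshev.theta ((n + 1 : ℕ) : ℝ) = Chebyshev.theta (n : ℝ) +
          if (n + 1).Prime then Real.log ((n + 1 : ℕ) : ℝ) else 0 := by
        simp only [Chebyshev.theta, Nat.floor_natCast]
        rw [← Finset.insert_Ioc_right_eq_Ioc_add_one (by omega), filter_insert]
        split_ifs with h
        · rw [sum_insert (by simp)]; ring
        · simp
      have hs : ∑ p ∈ (Icc 1 (n + 1)).filter Nat.Prime, Real.log p / p =
          ∑ p ∈ (Icc 1 n).filter Nat.Prime, Real.log p / p +
          (if (n + 1).Prime then Real.log ((n + 1 : ℕ) : ℝ) else 0) / ((n + 1 : ℕ) : ℝ) := by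
        rw [← Finset.insert_Icc_right_eq_Icc_add_one (by omega), filter_insert]
        split_ifs with h
        · rw [sum_insert (by simp)]; ring
        · simp
      rw [hs, hth, harmonic_succ]
      push_cast
      have hn0 : (0 : ℝ) < n := by exact_mod_cast hn
      have h1 := Chebyshev.theta_le_log4_mul_x (x := (n : ℝ)) hn0.le
      have h2 : Chebyshev.theta (n : ℝ) / n ≤ Chebyshev.theta (n : ℝ) / (n + 1)
          + Real.log 4 * ((n : ℝ) + 1)⁻¹ := by
        have : Chebyshev.theta (n : ℝ) / n - Chebyshev.theta (n : ℝ) / (n + 1)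
            = Chebyshev.theta (n : ℝ) / n * ((n : ℝ) + 1)⁻¹ := by field_simp; ring
        have h3 : Chebyshev.theta (n : ℝ) / n ≤ Real.log 4 := by
          rw [div_le_iff₀ hn0]; exact h1
        have h4 : Chebyshev.theta (n : ℝ) / n * ((n : ℝ) + 1)⁻¹ ≤ Real.log 4 * ((n : ℝ) + 1)⁻¹ := by
          gcongr
        linarith
      rw [add_div]
      linarith
  refine ⟨Real.log 4 * (2 + 2 / Real.log 2), by positivity, fun y hy => ?_⟩
  have hy1 : 1 ≤ ⌊y⌋₊ := Nat.le_floor (by push_cast; linarith)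
  have h1 := key ⌊y⌋₊ hy1
  have hf : (0 : ℝ) < (⌊y⌋₊ : ℝ) := by exact_mod_cast hy1
  have h2 : Chebyshev.theta (⌊y⌋₊ : ℝ) / ⌊y⌋₊ ≤ Real.log 4 := by
    rw [div_le_iff₀ hf]; exact Chebyshev.theta_le_log4_mul_x hf.le
  have h3 : (harmonic ⌊y⌋₊ : ℝ) ≤ 1 + Real.log y :=
    harmonic_floor_le_one_add_log y (by linarith)
  have h4 : 0 < Real.log 4 := Real.log_pos (by norm_num)
  have h5 : Real.log 2 ≤ Real.log y := Real.log_le_log (by norm_num) hy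
  have h6 : 0 < Real.log 2 := Real.log_pos (by norm_num)
  have h7 : 1 ≤ Real.log y / Real.log 2 := by rwa [one_le_div h6]
  have h8 : Real.log 4 * (harmonic ⌊y⌋₊ : ℝ) ≤ Real.log 4 * (1 + Real.log y) := by gcongr
  calc _ ≤ Real.log 4 * (2 * 1 + Real.log y) := by linarith
    _ ≤ Real.log 4 * (2 * (Real.log y / Real.log 2) + 2 * Real.log y) := by
        have : 0 ≤ Real.log y := by linarith
        gcongr; linarith
    _ = _ := by ring

/-- Rankin's trick: most of `∏ (1 + h p)` comes from small products of primes. -/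
lemma exists_half_prod_le_sum_small (B : ℝ) (hB : 0 ≤ B) :
    ∃ s : ℝ, 1 ≤ s ∧ ∀ (P : Finset ℕ) (h : ℕ → ℝ) (z : ℝ), 2 ≤ z →
      (∀ p ∈ P, p.Prime ∧ (p : ℝ) ≤ z) → (∀ p ∈ P, 0 ≤ h p ∧ h p ≤ B / p) →
      (∏ p ∈ P, (1 + h p)) / 2 ≤
        ∑ T ∈ P.powerset with ((∏ p ∈ T, p : ℕ) : ℝ) ≤ z ^ s, ∏ p ∈ T, h p := by
  obtain ⟨C, hC, hlog⟩ := exists_sum_log_div_prime_le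
  refine ⟨2 * B * C + 1, by nlinarith [mul_nonneg hB hC.le], fun P h z hz hP hh => ?_⟩
  set s := 2 * B * C + 1 with hs
  have hz0 : 0 < z := by linarith
  have hlz : 0 < Real.log z := Real.log_pos (by linarith)
  -- The Rankin exponent: p^β stays bounded by e for p ≤ z, while (z^s)^β = e^s.
  set β := 1 / Real.log z with hβ
  have hβ0 : 0 < β := by positivity
  have htot : ∏ p ∈ P, (1 + h p) = ∑ T ∈ P.powerset, ∏ p ∈ T, h p := prod_one_add _
  have hsplit := sum_filter_add_sum_filter_not P.powerset
    (fun T => ((∏ p ∈ T, p : ℕ) : ℝ) ≤ z ^ s) (fun T => ∏ p ∈ T, h p)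
  have hprodpos : 0 ≤ ∏ p ∈ P, (1 + h p) := prod_nonneg fun p hp => by linarith [(hh p hp).1]
  have htail : ∑ T ∈ P.powerset with ¬ ((∏ p ∈ T, p : ℕ) : ℝ) ≤ z ^ s, ∏ p ∈ T, h p
      ≤ (∏ p ∈ P, (1 + h p)) / 2 := by
    have e1 : ∀ T ∈ P.powerset.filter (fun T => ¬ ((∏ p ∈ T, p : ℕ) : ℝ) ≤ z ^ s),
        ∏ p ∈ T, h p ≤ Real.exp (-s) * ∏ p ∈ T, (h p * (p : ℝ) ^ β) := by
      intro T hT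
      simp only [mem_filter, mem_powerset, not_le] at hT
      rw [prod_mul_distrib, ← mul_assoc, mul_comm (Real.exp (-s)), mul_assoc]
      have hn : 0 ≤ ∏ p ∈ T, h p := prod_nonneg fun p hp => (hh p (hT.1 hp)).1
      apply le_mul_of_one_le_right hn
      rw [Real.finsetProd_rpow _ _ (fun p _ => by positivity)]
      have e2 : z ^ s ≤ ∏ p ∈ T, (p : ℝ) := by
        have := hT.2.le; push_cast at this; exact this
      have e3 : Real.exp s = (z ^ s) ^ β := by
        rw [← Real.rpow_mul hz0.le, Real.rpow_def_of_pos hz0, hβ]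
        congr 1; field_simp
      have e4 : Real.exp s ≤ (∏ p ∈ T, (p : ℝ)) ^ β := by
        rw [e3]; exact Real.rpow_le_rpow (by positivity) e2 hβ0.le
      rw [Real.exp_neg, inv_mul_eq_div, one_le_div (Real.exp_pos s)]
      exact e4
    have e5 : ∑ T ∈ P.powerset with ¬ ((∏ p ∈ T, p : ℕ) : ℝ) ≤ z ^ s, ∏ p ∈ T, h p
        ≤ Real.exp (-s) * ∏ p ∈ P, (1 + h p * (p : ℝ) ^ β) := by
      refine (sum_le_sum e1).trans ?_
      rw [← mul_sum, prod_one_add]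
      gcongr
      · intro T hT _
        exact prod_nonneg fun p hp => mul_nonneg (hh p (mem_powerset.1 hT hp)).1 (by positivity)
      · exact filter_subset _ _
    have e6 : ∏ p ∈ P, (1 + h p * (p : ℝ) ^ β) ≤
        ∏ p ∈ P, ((1 + h p) * Real.exp (2 * B * β * (Real.log p / p))) := by
      apply prod_le_prod
      · intro p hp
        have := (hh p hp).1
        positivity
      · intro p hp
        obtain ⟨h1, h2⟩ := hh p hp
        obtain ⟨hpp, hpz⟩ := hP p hp
        have hp0 : (0 : ℝ) < p := by exact_mod_cast hpp.pos
        have hlp : 0 ≤ Real.log p := Real.log_nonneg (by exact_mod_cast hpp.one_lt.le)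
        have hx1 : β * Real.log p ≤ 1 := by
          rw [hβ, one_div, inv_mul_eq_div, div_le_one hlz]
          exact Real.log_le_log hp0 hpz
        have hx0 : 0 ≤ β * Real.log p := by positivity
        have e7 : (p : ℝ) ^ β ≤ 1 + 2 * (β * Real.log p) := by
          rw [Real.rpow_def_of_pos hp0, mul_comm]
          have := Real.abs_exp_sub_one_le (x := β * Real.log p) (by rwa [abs_of_nonneg hx0])
          rw [abs_of_nonneg hx0] at this
          linarith [le_abs_self (Real.exp (β * Real.log p) - 1)]
        have e8 : 1 + h p * (p : ℝ) ^ β ≤ (1 + h p) * (1 + 2 * B * β * (Real.log p / p)) := by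
          have e9 : h p * (p : ℝ) ^ β ≤ h p + h p * (2 * (β * Real.log p)) := by nlinarith
          have e10 : h p * (2 * (β * Real.log p)) ≤ B / p * (2 * (β * Real.log p)) := by gcongr
          have e11 : B / p * (2 * (β * Real.log p)) = 2 * B * β * (Real.log p / p) := by ring
          have e12 : 0 ≤ h p * (2 * B * β * (Real.log p / p)) := by positivity
          nlinarith
        refine e8.trans ?_
        apply mul_le_mul_of_nonneg_left _ (by linarith)
        linarith [Real.add_one_le_exp (2 * B * β * (Real.log p / p))]
    rw [prod_mul_distrib, ← Real.exp_sum, ← mul_sum] at e6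
    have e7 : ∑ p ∈ P, Real.log p / p ≤ C * Real.log z := by
      refine le_trans (sum_le_sum_of_subset_of_nonneg ?_ ?_) (hlog z hz)
      · intro p hp
        obtain ⟨hpp, hpz⟩ := hP p hp
        exact mem_filter.2 ⟨mem_Icc.2 ⟨hpp.one_lt.le, Nat.le_floor hpz⟩, hpp⟩
      · intro p hp _
        exact div_nonneg (Real.log_natCast_nonneg p) (by positivity)
    have e8 : 2 * B * β * ∑ p ∈ P, Real.log p / p ≤ 2 * B * C := by
      calc _ ≤ 2 * B * β * (C * Real.log z) := by gcongr
        _ = _ := by rw [hβ]; field_simp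
    calc _ ≤ _ := e5
      _ ≤ Real.exp (-s) * ((∏ p ∈ P, (1 + h p)) * Real.exp (2 * B * C)) := by
        gcongr
        refine e6.trans ?_
        gcongr
      -- Since s = 2BC + 1, the tail is at most e⁻¹ < 1/2 of the whole product.
      _ = (∏ p ∈ P, (1 + h p)) * Real.exp (-1) := by
        rw [mul_comm, mul_assoc, ← Real.exp_add, hs]; congr 2; ring
      _ ≤ _ := by
        rw [div_eq_mul_inv]
        gcongr
        rw [Real.exp_neg]
        gcongr
        linarith [Real.add_one_le_exp (1 : ℝ)]
  linarith

/-- The sieve bound with the product over the sifting primes. -/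
theorem exists_sieve_bound (B : ℝ) (hB : 0 ≤ B) :
    ∃ s : ℝ, 1 ≤ s ∧ ∀ {α : Type} (Ω : Finset α) (P : Finset ℕ) (bad : ℕ → α → Prop)
      [∀ p x, Decidable (bad p x)] (g : ℕ → ℝ) (X E z : ℝ), 2 ≤ z → 0 ≤ X → 0 ≤ E →
      (∀ p ∈ P, p.Prime ∧ 3 ≤ p ∧ (p : ℝ) ≤ z) →
      (∀ p ∈ P, 0 < g p ∧ g p ≤ 2 / 3 ∧ g p ≤ B / p) →
      (∀ T ⊆ P, ((∏ p ∈ T, p : ℕ) : ℝ) ≤ (z ^ s) ^ 2 →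
        |((Ω.filter (fun x => ∀ p ∈ T, bad p x)).card : ℝ) - X * ∏ p ∈ T, g p|
          ≤ E * ((∏ p ∈ T, p : ℕ) : ℝ)) →
      ((Ω.filter (fun x => ∀ p ∈ P, ¬ bad p x)).card : ℝ) ≤
        2 * X * ∏ p ∈ P, (1 - g p) + E * (z ^ s) ^ 6 := by
  obtain ⟨s, hs, H⟩ := exists_half_prod_le_sum_small (3 * B) (by positivity)
  refine ⟨s, hs, fun {α} Ω P bad _ g X E z hz hX hE hP hg hcount => ?_⟩
  -- The density bound 2/3 gives (1 - g p)⁻¹ ≤ 3 ≤ p, as required by `selberg_upper_bound`. This is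
  -- why the prime 2 is excluded.
  have hinv : ∀ p ∈ P, (1 - g p)⁻¹ ≤ 3 := by
    intro p hp
    have : (1 - g p)⁻¹ ≤ (1 / 3 : ℝ)⁻¹ := by
      apply inv_anti₀ (by norm_num); linarith [(hg p hp).2.1]
    norm_num at this ⊢; exact this
  have hξ : 1 ≤ z ^ s := Real.one_le_rpow (by linarith) (by linarith)
  have h1 := selberg_upper_bound Ω P (fun p hp => (hP p hp).1) bad g (fun p hp => (hg p hp).1)
    (fun p hp => by linarith [(hg p hp).2.1])
    (fun p hp => (hinv p hp).trans (by exact_mod_cast (hP p hp).2.1)) X E (z ^ s) hE hξ hcount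
  refine h1.trans ?_
  have h2 := H P (fun p => g p / (1 - g p)) z hz (fun p hp => ⟨(hP p hp).1, (hP p hp).2.2⟩) (by
    intro p hp
    obtain ⟨a, b, c⟩ := hg p hp
    have hp0 : (0 : ℝ) < p := by exact_mod_cast (hP p hp).1.pos
    refine ⟨div_nonneg a.le (by linarith), ?_⟩
    calc g p / (1 - g p) = g p * (1 - g p)⁻¹ := by ring
      _ ≤ B / p * 3 := by
        have := hinv p hp
        have h0 : 0 ≤ (1 - g p)⁻¹ := inv_nonneg.2 (by linarith)
        gcongr
      _ = _ := by ring)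
  have h3 : ∏ p ∈ P, (1 + g p / (1 - g p)) = (∏ p ∈ P, (1 - g p))⁻¹ := by
    rw [← prod_inv_distrib]
    apply prod_congr rfl
    intro p hp
    have : 1 - g p ≠ 0 := by linarith [(hg p hp).2.1]
    field_simp; ring
  rw [h3] at h2
  have hpos : 0 < ∏ p ∈ P, (1 - g p) := prod_pos fun p hp => by linarith [(hg p hp).2.1]
  gcongr
  calc X / _ ≤ X / ((∏ p ∈ P, (1 - g p))⁻¹ / 2) := by
        gcongr
    _ = _ := by field_simp

end SelbergAsymptotic

/-! ### From sums over multisets to sums over sets. -/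

section MultisetSums
open Finset

/-- A sum over multisets of a function with a one-step bound in each variable is controlled by
the corresponding sum over sets. -/
lemma sum_multiset_mul_prod_le {ι : Type*} [DecidableEq ι] (Q : ι → Prop) (w : ι → ℕ → ℝ)
    (hw : ∀ i v, 0 ≤ w i v) (c η : ι → ℝ) (hc : ∀ i, 0 ≤ c i)
    (P : Finset ι) (hη : ∀ i ∈ P, 0 ≤ η i) (hP : ∀ i ∈ P, Q i) :
    ∀ f : Multiset ι → ℝ, (∀ s, (∀ i ∈ s, Q i) → 0 ≤ f s) →
      (∀ i ∈ P, ∀ s : Multiset ι, (∀ j ∈ s, Q j) → i ∉ s → ∀ V,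
        ∑ v ∈ range V, f (s + Multiset.replicate v i) * w i v
          ≤ (1 + η i) * (f s + c i * f (i ::ₘ s))) →
      ∀ T : Finset (Multiset ι), (∀ s ∈ T, ∀ i ∈ s, i ∈ P) →
        ∑ s ∈ T, f s * ∏ i ∈ P, w i (s.count i)
          ≤ (∏ i ∈ P, (1 + η i)) * ∑ S ∈ P.powerset, (∏ i ∈ S, c i) * f S.val := by
  induction P using Finset.induction_on with
  | empty =>
    intro f hf _ T hT
    have hT' : T ⊆ {0} := by
      intro s hs
      rw [mem_singleton]
      exact Multiset.eq_zero_of_forall_notMem fun i hi => by simpa using hT s hs i hi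
    simp only [prod_empty, mul_one, powerset_empty, sum_singleton, empty_val, one_mul]
    refine (sum_le_sum_of_subset_of_nonneg hT' fun s hs _ => ?_).trans ?_
    · rw [mem_singleton.1 hs]; exact hf 0 (by simp)
    · simp
  | insert q P hq ih =>
    intro f hf H T hT
    have hQq : Q q := hP q (mem_insert_self _ _)
    have hηq : 0 ≤ η q := hη q (mem_insert_self _ _)
    have hcons : ∀ s : Multiset ι, (∀ i ∈ s, Q i) → ∀ i ∈ q ::ₘ s, Q i := by
      intro s hs i hi
      rcases Multiset.mem_cons.1 hi with rfl | h
      exacts [hQq, hs i h]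
    -- All multiplicities of q are summed first; what remains is a function of the multiset away
    -- from q in which q occurs either not at all or once.
    set f' : Multiset ι → ℝ := fun s => f s + c q * f (q ::ₘ s) with hf'
    have hf'0 : ∀ s, (∀ i ∈ s, Q i) → 0 ≤ f' s := fun s hs =>
      add_nonneg (hf s hs) (mul_nonneg (hc q) (hf _ (hcons s hs)))
    set T' := T.image (fun s => s.filter (· ≠ q)) with hT'
    have hT'P : ∀ s ∈ T', ∀ i ∈ s, i ∈ P := by
      intro s hs i hi
      obtain ⟨t, ht, rfl⟩ := mem_image.1 hs
      obtain ⟨h1, h2⟩ := Multiset.mem_filter.1 hi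
      exact (mem_insert.1 (hT t ht i h1)).resolve_left h2
    have hT'q : ∀ s ∈ T', q ∉ s := fun s hs h => hq (hT'P s hs q h)
    have hT'Q : ∀ s ∈ T', ∀ i ∈ s, Q i := fun s hs i hi =>
      hP i (mem_insert_of_mem (hT'P s hs i hi))
    -- The one-step hypothesis passes to f' because it is linear in f and f' is a non-negative
    -- combination of f and its shift by q. For this reason the induction keeps f arbitrary.
    have h1 := ih (fun i hi => hη i (mem_insert_of_mem hi))
      (fun i hi => hP i (mem_insert_of_mem hi)) f' hf'0 (by
        intro i hi s hs his V
        have hne : i ≠ q := fun h => hq (h ▸ hi)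
        have a1 := H i (mem_insert_of_mem hi) s hs his V
        have a2 := H i (mem_insert_of_mem hi) (q ::ₘ s) (hcons s hs) (by
          simp [Multiset.mem_cons, hne, his]) V
        simp only [hf', add_mul, sum_add_distrib]
        have e : ∑ v ∈ range V, c q * f (q ::ₘ (s + Multiset.replicate v i)) * w i v
            = c q * ∑ v ∈ range V, f (q ::ₘ s + Multiset.replicate v i) * w i v := by
          rw [mul_sum]
          exact sum_congr rfl fun v _ => by rw [Multiset.cons_add]; ring
        rw [e, Multiset.cons_swap q i s]
        have a3 := mul_le_mul_of_nonneg_left a2 (hc q)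
        linarith) T' hT'P
    -- the exponents of `q` are bounded on `T`
    set V := T.sup (fun s => s.count q) + 1 with hV
    have h2 : ∑ s ∈ T, f s * ∏ i ∈ insert q P, w i (s.count i) ≤
        ∑ s ∈ T', ∑ v ∈ range V, f (s + Multiset.replicate v q) * w q v *
          ∏ i ∈ P, w i (s.count i) := by
      rw [← sum_product']
      have hdec : ∀ s : Multiset ι, s.filter (· ≠ q) + Multiset.replicate (s.count q) q = s := by
        intro s
        rw [← Multiset.filter_eq', add_comm]
        exact Multiset.filter_add_not _ s
      have hinj : Set.InjOn (fun s : Multiset ι => (s.filter (· ≠ q), s.count q)) T := by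
        intro s _ t _ h
        simp only [Prod.mk.injEq] at h
        rw [← hdec s, ← hdec t, h.1, h.2]
      have himg : T.image (fun s : Multiset ι => (s.filter (· ≠ q), s.count q))
          ⊆ T' ×ˢ range V := by
        intro z hz
        obtain ⟨s, hs, rfl⟩ := mem_image.1 hz
        refine mem_product.2 ⟨mem_image_of_mem _ hs, mem_range.2 ?_⟩
        exact Nat.lt_succ_of_le (le_sup (f := fun s : Multiset ι => s.count q) hs)
      refine le_trans (le_of_eq ?_) (sum_le_sum_of_subset_of_nonneg himg ?_)
      · rw [sum_image hinj]
        apply sum_congr rfl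
        intro s hs
        simp only
        rw [hdec, prod_insert hq, mul_assoc]
        congr 2
        apply prod_congr rfl
        intro i hi
        rw [Multiset.count_filter_of_pos]
        exact fun h => hq (h ▸ hi)
      · intro z hz _
        obtain ⟨hz1, hz2⟩ := mem_product.1 hz
        refine mul_nonneg (mul_nonneg (hf _ ?_) (hw _ _)) (prod_nonneg fun i _ => hw _ _)
        intro i hi
        rcases Multiset.mem_add.1 hi with h | h
        · exact hT'Q _ hz1 i h
        · rw [Multiset.eq_of_mem_replicate h]; exact hQq
    have h3 : ∀ s ∈ T', ∑ v ∈ range V, f (s + Multiset.replicate v q) * w q v *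
        ∏ i ∈ P, w i (s.count i) ≤ (1 + η q) * (f' s * ∏ i ∈ P, w i (s.count i)) := by
      intro s hs
      rw [← sum_mul, ← mul_assoc]
      exact mul_le_mul_of_nonneg_right
        (H q (mem_insert_self _ _) s (hT'Q s hs) (hT'q s hs) V) (prod_nonneg fun i _ => hw _ _)
    have h4 : ∑ S ∈ (insert q P).powerset, (∏ i ∈ S, c i) * f S.val
        = ∑ S ∈ P.powerset, (∏ i ∈ S, c i) * f' S.val := by
      rw [sum_powerset_insert hq, ← sum_add_distrib]
      apply sum_congr rfl
      intro S hS
      have hqS : q ∉ S := fun h => hq (mem_powerset.1 hS h)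
      rw [prod_insert hqS, insert_val_of_notMem hqS]
      simp only [hf']; ring
    rw [prod_insert hq, h4]
    calc _ ≤ _ := h2
      _ ≤ ∑ s ∈ T', (1 + η q) * (f' s * ∏ i ∈ P, w i (s.count i)) := sum_le_sum h3
      _ = (1 + η q) * ∑ s ∈ T', (f' s * ∏ i ∈ P, w i (s.count i)) := by rw [mul_sum]
      _ ≤ (1 + η q) * _ := by
          apply mul_le_mul_of_nonneg_left h1 (by linarith)
      _ = _ := by ring

end MultisetSums

/-! ### Ideals of bounded norm and primes above a rational prime. -/

section IdealBasics
open Finset UniqueFactorizationMonoid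

variable {K : Type*} [Field K] [NumberField K]

lemma mem_idealsUpTo {x : ℝ} {𝔞 : Ideal (𝓞 K)} :
    𝔞 ∈ idealsUpTo K x ↔ 𝔞 ≠ ⊥ ∧ (Ideal.absNorm 𝔞 : ℝ) ≤ x := by
  classical
  simp only [idealsUpTo, mem_filter, Set.Finite.mem_toFinset, Set.mem_ofPred_eq]
  constructor
  · exact fun h => h.2
  · exact fun h => ⟨Nat.le_floor h.2, h⟩

lemma absNorm_pos_of_ne_bot {𝔞 : Ideal (𝓞 K)} (h : 𝔞 ≠ ⊥) : 0 < Ideal.absNorm 𝔞 :=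
  Nat.pos_of_ne_zero fun h' => h (Ideal.absNorm_eq_zero_iff.1 h')

/-- The primes of a given prime norm are at most `[K : ℚ]` in number. -/
lemma card_primes_of_dvd_le (p : ℕ) (hp : p.Prime) (S : Finset (Ideal (𝓞 K)))
    (hS : ∀ 𝔭 ∈ S, 𝔭.IsPrime ∧ 𝔭 ≠ ⊥ ∧ p ∣ Ideal.absNorm 𝔭) :
    S.card ≤ Module.finrank ℚ K := by
  have hmem : ∀ 𝔭 ∈ S, ((p : ℕ) : 𝓞 K) ∈ 𝔭 := by
    intro 𝔭 h𝔭
    obtain ⟨h1, h2, h3⟩ := hS 𝔭 h𝔭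
    have : 𝔭.IsMaximal := h1.isMaximal h2
    obtain ⟨q, n, hn, hqm, hq, hN⟩ := Ideal.exists_prime_and_absNorm_eq_pow 𝔭
    rw [hN] at h3
    rwa [(Nat.prime_dvd_prime_iff_eq hp hq).1 (hp.dvd_of_dvd_pow h3)]
  have hdvd : ∏ 𝔭 ∈ S, 𝔭 ∣ Ideal.span {((p : ℕ) : 𝓞 K)} := by
    apply Finset.prod_primes_dvd
    · intro 𝔭 h𝔭
      exact Ideal.prime_of_isPrime (hS 𝔭 h𝔭).2.1 (hS 𝔭 h𝔭).1
    · intro 𝔭 h𝔭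
      rw [Ideal.dvd_span_singleton]
      exact hmem 𝔭 h𝔭
  have h1 : Ideal.absNorm (∏ 𝔭 ∈ S, 𝔭) ∣ p ^ Module.finrank ℤ (𝓞 K) := by
    rw [← Ideal.absNorm_span_natCast]
    exact map_dvd Ideal.absNorm hdvd
  rw [map_prod] at h1
  have h2 : p ^ S.card ∣ ∏ 𝔭 ∈ S, Ideal.absNorm 𝔭 := by
    rw [← prod_const]
    exact prod_dvd_prod_of_dvd _ _ fun 𝔭 h𝔭 => (hS 𝔭 h𝔭).2.2
  rw [NumberField.RingOfIntegers.rank] at h1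
  exact (Nat.pow_dvd_pow_iff_le_right hp.one_lt).1 (h2.trans h1)

end IdealBasics

/-! ### Degree one primes and the local step of Rankin's trick. -/

noncomputable section Rankin
open Finset UniqueFactorizationMonoid

variable {K : Type*} [Field K] [NumberField K]

/-- The primes of residue degree one and norm coprime to `W`. -/
def IsGoodPrime (W : ℕ) (𝔭 : Ideal (𝓞 K)) : Prop :=
  (Ideal.absNorm 𝔭).Prime ∧ (Ideal.absNorm 𝔭).Coprime W

lemma IsGoodPrime.isPrime {W : ℕ} {𝔭 : Ideal (𝓞 K)} (h : IsGoodPrime W 𝔭) : 𝔭.IsPrime :=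
  Ideal.isPrime_of_irreducible_absNorm h.1

lemma IsGoodPrime.ne_bot {W : ℕ} {𝔭 : Ideal (𝓞 K)} (h : IsGoodPrime W 𝔭) : 𝔭 ≠ ⊥ := by
  rintro rfl
  exact h.1.ne_zero Ideal.absNorm_bot

lemma IsGoodPrime.prime {W : ℕ} {𝔭 : Ideal (𝓞 K)} (h : IsGoodPrime W 𝔭) : Prime 𝔭 :=
  Ideal.prime_of_isPrime h.ne_bot h.isPrime

lemma normalizedFactors_prod_of_good {W : ℕ} {s : Multiset (Ideal (𝓞 K))}
    (hs : ∀ 𝔭 ∈ s, IsGoodPrime W 𝔭) : normalizedFactors s.prod = s :=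
  normalizedFactors_prod_of_prime fun 𝔭 h𝔭 => (hs 𝔭 h𝔭).prime

lemma prod_ne_bot_of_good {W : ℕ} {s : Multiset (Ideal (𝓞 K))}
    (hs : ∀ 𝔭 ∈ s, IsGoodPrime W 𝔭) : s.prod ≠ ⊥ := by
  rw [← Ideal.zero_eq_bot]
  exact Multiset.prod_ne_zero fun h => (hs 0 h).ne_bot Ideal.zero_eq_bot

lemma isCoprime_multiset_prod {R : Type*} [CommRing R] {s : Multiset (Ideal R)} {𝔟 : Ideal R}
    (h : ∀ 𝔮 ∈ s, IsCoprime 𝔮 𝔟) : IsCoprime s.prod 𝔟 := by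
  induction s using Multiset.induction_on with
  | empty => rw [Multiset.prod_zero]; exact isCoprime_one_left
  | cons a s ih =>
    rw [Multiset.prod_cons]
    exact (h a (Multiset.mem_cons_self _ _)).mul_left
      (ih fun 𝔮 h𝔮 => h 𝔮 (Multiset.mem_cons_of_mem h𝔮))

lemma isCoprime_of_isPrime_of_ne {𝔭 𝔮 : Ideal (𝓞 K)} (hp : 𝔭.IsPrime) (hp0 : 𝔭 ≠ ⊥)
    (hq : 𝔮.IsPrime) (hq0 : 𝔮 ≠ ⊥) (hne : 𝔭 ≠ 𝔮) : IsCoprime 𝔭 𝔮 := by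
  have h1 := hp.isMaximal hp0
  have h2 := hq.isMaximal hq0
  exact Ideal.isCoprime_iff_sup_eq.2 (Ideal.IsMaximal.coprime_of_ne h1 h2 hne)

/-- Sums over degree one primes are controlled by sums over rational primes. -/
lemma sum_goodPrime_le {W : ℕ} (S : Finset (Ideal (𝓞 K))) (y : ℝ)
    (hS : ∀ 𝔭 ∈ S, IsGoodPrime W 𝔭 ∧ (Ideal.absNorm 𝔭 : ℝ) ≤ y)
    (g : ℕ → ℝ) (hg : ∀ n, 0 ≤ g n) :
    ∑ 𝔭 ∈ S, g (Ideal.absNorm 𝔭) ≤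
      Module.finrank ℚ K * ∑ p ∈ (Icc 1 ⌊y⌋₊).filter Nat.Prime, g p := by
  classical
  rw [sum_comp, mul_sum]
  refine (sum_le_sum (g := fun p => (Module.finrank ℚ K : ℝ) * g p) ?_).trans
    (sum_le_sum_of_subset_of_nonneg ?_ ?_)
  · intro p hp
    obtain ⟨𝔮, h𝔮, rfl⟩ := mem_image.1 hp
    rw [nsmul_eq_mul]
    apply mul_le_mul_of_nonneg_right _ (hg _)
    have := card_primes_of_dvd_le (Ideal.absNorm 𝔮) (hS 𝔮 h𝔮).1.1
      (S.filter fun 𝔭 => Ideal.absNorm 𝔭 = Ideal.absNorm 𝔮) (by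
        intro 𝔭 h𝔭
        obtain ⟨h1, h2⟩ := mem_filter.1 h𝔭
        exact ⟨(hS 𝔭 h1).1.isPrime, (hS 𝔭 h1).1.ne_bot, h2 ▸ dvd_rfl⟩)
    exact_mod_cast this
  · intro p hp
    obtain ⟨𝔮, h𝔮, rfl⟩ := mem_image.1 hp
    obtain ⟨h1, h2⟩ := hS 𝔮 h𝔮
    exact mem_filter.2 ⟨mem_Icc.2 ⟨h1.1.one_lt.le, Nat.le_floor h2⟩, h1.1⟩
  · intro p _ _
    exact mul_nonneg (by positivity) (hg _)

open Classical in
variable (K) in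
/-- The non-zero ideals of norm at most `x` composed of good primes. -/
def goodIdeals (W : ℕ) (x : ℝ) : Finset (Ideal (𝓞 K)) :=
  (idealsUpTo K x).filter (fun 𝔞 => ∀ 𝔭 ∈ normalizedFactors 𝔞, IsGoodPrime W 𝔭)

lemma mem_goodIdeals {W : ℕ} {x : ℝ} {𝔞 : Ideal (𝓞 K)} :
    𝔞 ∈ goodIdeals K W x ↔ 𝔞 ≠ ⊥ ∧ (Ideal.absNorm 𝔞 : ℝ) ≤ x ∧
      ∀ 𝔭 ∈ normalizedFactors 𝔞, IsGoodPrime W 𝔭 := by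
  classical
  rw [goodIdeals, mem_filter, mem_idealsUpTo, and_assoc]

open Classical in
/-- The sum of `f(𝔰) / N𝔰` over square-free good ideals. -/
def squarefreeSum (f : Ideal (𝓞 K) → ℝ) (W : ℕ) (x : ℝ) : ℝ :=
  ∑ 𝔰 ∈ (goodIdeals K W x).filter Squarefree, f 𝔰 / (Ideal.absNorm 𝔰 : ℝ)

open Classical in
/-- The weight `∏_{𝔭 ∣ 𝔞} (1 + c / N𝔭)`. -/
def primeWeight (c : ℝ) (𝔞 : Ideal (𝓞 K)) : ℝ :=
  ∏ 𝔭 ∈ (normalizedFactors 𝔞).toFinset, (1 + c / (Ideal.absNorm 𝔭 : ℝ))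

lemma IsPseudomultiplicative.le_pow {A B ε : ℝ} {f : Ideal (𝓞 K) → ℝ}
    (hf : IsPseudomultiplicative A B ε f) {𝔞 𝔟 : Ideal (𝓞 K)} (ha : 𝔞 ≠ ⊥) (hb : 𝔟 ≠ ⊥)
    (h : IsCoprime 𝔞 𝔟) : f (𝔞 * 𝔟) ≤ f 𝔞 * A ^ idealOmega 𝔟 :=
  (hf.bound 𝔞 𝔟 ha hb h).trans (mul_le_mul_of_nonneg_left (min_le_left _ _) (hf.nonneg 𝔞 ha))

lemma IsPseudomultiplicative.le_rpow {A B ε : ℝ} {f : Ideal (𝓞 K) → ℝ}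
    (hf : IsPseudomultiplicative A B ε f) {𝔞 𝔟 : Ideal (𝓞 K)} (ha : 𝔞 ≠ ⊥) (hb : 𝔟 ≠ ⊥)
    (h : IsCoprime 𝔞 𝔟) : f (𝔞 * 𝔟) ≤ f 𝔞 * (B * (Ideal.absNorm 𝔟 : ℝ) ^ ε) :=
  (hf.bound 𝔞 𝔟 ha hb h).trans (mul_le_mul_of_nonneg_left (min_le_right _ _) (hf.nonneg 𝔞 ha))

/-- Higher prime powers in Rankin's trick contribute at most N𝔭^(-3v/4) for v ≥ 2; starting at the
square makes the total O(N𝔭^(-3/2)), which is summable over primes. -/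
lemma sum_rpow_geometric_le {q : ℝ} (hq : 2 ≤ q) (V : ℕ) :
    ∑ v ∈ range V, (if 2 ≤ v then q ^ (-(3 / 4 : ℝ) * v) else 0) ≤ 3 * q ^ (-(3 / 2) : ℝ) := by
  have hq0 : 0 < q := by linarith
  set r := q ^ (-(3 / 4) : ℝ) with hr
  have hr0 : 0 < r := by positivity
  have hr1 : r ≤ 2 / 3 := by
    have h1 : r ≤ (2 : ℝ) ^ (-(3 / 4) : ℝ) :=
      Real.rpow_le_rpow_of_nonpos (by norm_num) hq (by norm_num)
    refine h1.trans ?_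
    -- The ratio is at most 2/3 because 2⁻³ = 1/8 < 16/81.
    have h2 : ((2 : ℝ) ^ (-(3 / 4) : ℝ)) ^ 4 = 1 / 8 := by
      rw [← Real.rpow_natCast, ← Real.rpow_mul (by norm_num)]
      norm_num
    by_contra hcon
    push Not at hcon
    have : (2 / 3 : ℝ) ^ 4 < ((2 : ℝ) ^ (-(3 / 4) : ℝ)) ^ 4 :=
      pow_lt_pow_left₀ hcon (by norm_num) (by norm_num)
    rw [h2] at this; norm_num at this
  have e1 : ∀ v : ℕ, q ^ (-(3 / 4 : ℝ) * v) = r ^ v := fun v => by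
    rw [hr, ← Real.rpow_natCast, ← Real.rpow_mul hq0.le]
  have e2 : q ^ (-(3 / 2) : ℝ) = r ^ 2 := by
    rw [hr, ← Real.rpow_natCast, ← Real.rpow_mul hq0.le]; norm_num
  simp only [e1, e2]
  have key : ∀ V : ℕ, ∑ v ∈ range (V + 2), (if 2 ≤ v then r ^ v else 0)
      = r ^ 2 * ∑ v ∈ range V, r ^ v := by
    intro V
    induction V with
    | zero => simp [sum_range_succ]
    | succ V ih =>
      rw [show V + 1 + 2 = (V + 2) + 1 by ring, sum_range_succ, ih, if_pos (by omega),
        sum_range_succ, mul_add]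
      ring
  have hle : ∑ v ∈ range V, (if 2 ≤ v then r ^ v else 0)
      ≤ ∑ v ∈ range (V + 2), (if 2 ≤ v then r ^ v else 0) :=
    sum_le_sum_of_subset_of_nonneg (range_mono (by omega)) fun v _ _ => by
      split_ifs <;> positivity
  refine hle.trans ?_
  rw [key, mul_comm]
  apply mul_le_mul_of_nonneg_right _ (by positivity)
  have h3 : ∑ v ∈ range V, r ^ v ≤ (1 - r)⁻¹ := by
    rw [← tsum_geometric_of_lt_one hr0.le (by linarith)]
    exact (summable_geometric_of_lt_one hr0.le (by linarith)).sum_le_tsum _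
      fun _ _ => by positivity
  refine h3.trans ?_
  have : (1 - r)⁻¹ ≤ (1 / 3 : ℝ)⁻¹ := inv_anti₀ (by norm_num) (by linarith)
  norm_num at this ⊢; exact this

open Classical in
/-- The weight attached to a prime power in Rankin's trick. -/
def rankinWeight (c β : ℝ) (𝔭 : Ideal (𝓞 K)) (v : ℕ) : ℝ :=
  if v = 0 then 1 else (1 + c / (Ideal.absNorm 𝔭 : ℝ)) * (Ideal.absNorm 𝔭 : ℝ) ^ ((β - 1) * v)

-- The exponent v = 0 gives f(𝔞). For v = 1 the part N𝔭⁻¹ of the weight is paired with the true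
-- value f(𝔞𝔭), and only the excess weight is estimated by A f(𝔞). For v ≥ 2 the bound B N𝔭^(εv) is
-- affordable, since ε + β ≤ 1/4. Keeping f(𝔞𝔭) itself is what allows a comparison with square-free
-- ideals for functions that are not multiplicative.
open Classical in
lemma rankin_local_bound {W : ℕ} {A B ε : ℝ} {f : Ideal (𝓞 K) → ℝ}
    (hf : IsPseudomultiplicative A B ε f) (x c β : ℝ) (hc : 0 ≤ c) (hβ0 : 0 ≤ β)
    (hβ : ε + β ≤ 1 / 4) {𝔭 : Ideal (𝓞 K)} (hp : IsGoodPrime W 𝔭)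
    (s : Multiset (Ideal (𝓞 K))) (hs : ∀ 𝔮 ∈ s, IsGoodPrime W 𝔮) (hps : 𝔭 ∉ s) (V : ℕ) :
    ∑ v ∈ range V,
      (if (Ideal.absNorm (s + Multiset.replicate v 𝔭).prod : ℝ) ≤ x
        then f (s + Multiset.replicate v 𝔭).prod else 0) * rankinWeight c β 𝔭 v ≤
      (1 + (A * (((1 + c / (Ideal.absNorm 𝔭 : ℝ)) * (Ideal.absNorm 𝔭 : ℝ) ^ β - 1) /
          (Ideal.absNorm 𝔭 : ℝ)) + 3 * B * (1 + c) * (Ideal.absNorm 𝔭 : ℝ) ^ (-(3 / 2) : ℝ))) *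
        ((if (Ideal.absNorm s.prod : ℝ) ≤ x then f s.prod else 0) +
          (Ideal.absNorm 𝔭 : ℝ)⁻¹ *
          (if (Ideal.absNorm (𝔭 ::ₘ s).prod : ℝ) ≤ x then f (𝔭 ::ₘ s).prod else 0)) := by
  set q : ℝ := (Ideal.absNorm 𝔭 : ℝ) with hq
  have hq2 : 2 ≤ q := by rw [hq]; exact_mod_cast hp.1.two_le
  have hq0 : 0 < q := by linarith
  set 𝔞 := s.prod with h𝔞
  have ha : 𝔞 ≠ ⊥ := prod_ne_bot_of_good hs
  have hcop : IsCoprime 𝔞 𝔭 := isCoprime_multiset_prod fun 𝔮 h𝔮 =>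
    isCoprime_of_isPrime_of_ne (hs 𝔮 h𝔮).isPrime (hs 𝔮 h𝔮).ne_bot hp.isPrime hp.ne_bot
      fun h => hps (h ▸ h𝔮)
  set F : Ideal (𝓞 K) → ℝ := fun 𝔞 => if (Ideal.absNorm 𝔞 : ℝ) ≤ x then f 𝔞 else 0 with hF
  have hFnn : ∀ 𝔟 : Ideal (𝓞 K), 𝔟 ≠ ⊥ → 0 ≤ F 𝔟 := fun 𝔟 h => by
    simp only [hF]; split_ifs
    exacts [hf.nonneg _ h, le_rfl]
  have hpow0 : ∀ v, 𝔭 ^ v ≠ ⊥ := fun v => by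
    rw [← Ideal.zero_eq_bot]; exact pow_ne_zero _ hp.ne_bot
  -- The truncation by norm is compatible with passing to the divisor 𝔞: if 𝔞𝔭^v is within the
  -- range, so is 𝔞.
  have hmono : ∀ v : ℕ, ∀ C : ℝ, 0 ≤ C → f (𝔞 * 𝔭 ^ v) ≤ f 𝔞 * C → F (𝔞 * 𝔭 ^ v) ≤ F 𝔞 * C := by
    intro v C hC h
    simp only [hF]
    by_cases h1 : (Ideal.absNorm (𝔞 * 𝔭 ^ v) : ℝ) ≤ x
    · have h2 : (Ideal.absNorm 𝔞 : ℝ) ≤ x := by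
        refine le_trans ?_ h1
        rw [map_mul]
        exact_mod_cast Nat.le_mul_of_pos_right _ (absNorm_pos_of_ne_bot (hpow0 v))
      rw [if_pos h1, if_pos h2]; exact h
    · rw [if_neg h1]
      exact mul_nonneg (hFnn _ ha) hC
  have hrep : ∀ v, (s + Multiset.replicate v 𝔭).prod = 𝔞 * 𝔭 ^ v := fun v => by
    rw [Multiset.prod_add, Multiset.prod_replicate]
  have hconsprod : (𝔭 ::ₘ s).prod = 𝔞 * 𝔭 ^ 1 := by
    rw [Multiset.prod_cons, pow_one, mul_comm]
  have hA := hf.A_pos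
  have hB := hf.B_pos
  have hΩ : idealOmega (𝔭 ^ 1) = 1 := by
    rw [pow_one, idealOmega, normalizedFactors_irreducible hp.prime.irreducible]
    simp
  have h1 : F (𝔞 * 𝔭 ^ 1) ≤ F 𝔞 * A := by
    have := hf.le_pow ha (hpow0 1) (hcop.pow_right)
    rw [hΩ, pow_one A] at this
    exact hmono 1 A hA.le this
  have hv : ∀ v : ℕ, F (𝔞 * 𝔭 ^ v) ≤ F 𝔞 * (B * q ^ (ε * v)) := by
    intro v
    have := hf.le_rpow ha (hpow0 v) (hcop.pow_right)
    rw [map_pow, Nat.cast_pow, ← hq, ← Real.rpow_natCast, ← Real.rpow_mul hq0.le,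
      mul_comm (v : ℝ)] at this
    exact hmono v _ (by positivity) this
  have hFa := hFnn 𝔞 ha
  set δ := ((1 + c / q) * q ^ β - 1) / q with hδ
  have hqβ : 1 ≤ q ^ β := Real.one_le_rpow (by linarith) hβ0
  have hcq : 0 ≤ c / q := by positivity
  have hδ0 : 0 ≤ δ := div_nonneg (by nlinarith) hq0.le
  have hterm : ∀ v ∈ range V, F (𝔞 * 𝔭 ^ v) * rankinWeight c β 𝔭 v ≤
      (if v = 0 then F 𝔞 else 0) + (if v = 1 then F (𝔞 * 𝔭 ^ 1) * q⁻¹ + F 𝔞 * (A * δ) else 0)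
      + F 𝔞 * (B * (1 + c)) * (if 2 ≤ v then q ^ (-(3 / 4 : ℝ) * v) else 0) := by
    intro v _
    rcases Nat.lt_or_ge v 2 with hv2 | hv2
    · interval_cases v
      · simp [rankinWeight]
      · have e : rankinWeight c β 𝔭 1 = q⁻¹ + δ := by
          rw [rankinWeight, if_neg one_ne_zero, ← hq, hδ]
          rw [Nat.cast_one, mul_one, Real.rpow_sub hq0, Real.rpow_one]
          field_simp; ring
        rw [e]
        norm_num
        have := mul_le_mul_of_nonneg_right h1 hδ0
        rw [pow_one] at this
        nlinarith
    · have e : rankinWeight c β 𝔭 v = (1 + c / q) * q ^ ((β - 1) * v) := by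
        rw [rankinWeight, if_neg (by omega)]
      rw [if_neg (by omega), if_neg (by omega), if_pos hv2, e, zero_add, zero_add]
      have hcq1 : 1 + c / q ≤ 1 + c := by
        have : c / q ≤ c := div_le_self hc (by linarith)
        linarith
      calc F (𝔞 * 𝔭 ^ v) * ((1 + c / q) * q ^ ((β - 1) * v))
          ≤ F 𝔞 * (B * q ^ (ε * v)) * ((1 + c) * q ^ ((β - 1) * v)) := by
            have := hv v
            gcongr
        _ = F 𝔞 * (B * (1 + c)) * q ^ (ε * v + (β - 1) * v) := by
            rw [Real.rpow_add hq0]; ring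
        _ ≤ _ := by
            gcongr
            · linarith
            · have : (0 : ℝ) ≤ v := by positivity
              nlinarith
  have hgeo := sum_rpow_geometric_le hq2 V
  have hsum := sum_le_sum hterm
  rw [sum_add_distrib, sum_add_distrib, ← mul_sum, sum_ite_eq', sum_ite_eq'] at hsum
  simp only [hrep, hconsprod]
  change ∑ v ∈ range V, F (𝔞 * 𝔭 ^ v) * rankinWeight c β 𝔭 v ≤ (1 + (A * δ + _)) *
    (F 𝔞 + q⁻¹ * F (𝔞 * 𝔭 ^ 1))
  refine hsum.trans ?_
  have hFp : 0 ≤ F (𝔞 * 𝔭 ^ 1) := hFnn _ (by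
    rw [← Ideal.zero_eq_bot]; exact mul_ne_zero ha (hpow0 1))
  have i1 : (if 0 ∈ range V then F 𝔞 else 0) ≤ F 𝔞 := by split_ifs <;> linarith
  have i2 : (if 1 ∈ range V then F (𝔞 * 𝔭 ^ 1) * q⁻¹ + F 𝔞 * (A * δ) else 0)
      ≤ F (𝔞 * 𝔭 ^ 1) * q⁻¹ + F 𝔞 * (A * δ) := by
    split_ifs
    · exact le_rfl
    · positivity
  have i3 : F 𝔞 * (B * (1 + c)) * ∑ v ∈ range V, (if 2 ≤ v then q ^ (-(3 / 4 : ℝ) * v) else 0)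
      ≤ F 𝔞 * (B * (1 + c)) * (3 * q ^ (-(3 / 2) : ℝ)) := by gcongr
  have i4 : 0 ≤ (A * δ + 3 * B * (1 + c) * q ^ (-(3 / 2) : ℝ)) * (q⁻¹ * F (𝔞 * 𝔭 ^ 1)) := by
    positivity
  nlinarith

end Rankin

/-! ### Rankin's trick for pseudomultiplicative functions. -/

section RankinSum
open Finset UniqueFactorizationMonoid

variable {K : Type*} [Field K] [NumberField K]

lemma prod_normalizedFactors_ideal {𝔞 : Ideal (𝓞 K)} (h : 𝔞 ≠ ⊥) :
    (normalizedFactors 𝔞).prod = 𝔞 := Ideal.prod_normalizedFactors_eq_self h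

lemma squarefreeSum_nonneg {A B ε : ℝ} {f : Ideal (𝓞 K) → ℝ}
    (hf : IsPseudomultiplicative A B ε f) (W : ℕ) (x : ℝ) : 0 ≤ squarefreeSum f W x := by
  classical
  apply sum_nonneg
  intro 𝔰 h𝔰
  exact div_nonneg (hf.nonneg _ (mem_goodIdeals.1 (mem_filter.1 h𝔰).1).1) (by positivity)

-- Sets of good primes correspond to square-free good ideals, so the right-hand side of
-- `sum_multiset_mul_prod_le` becomes part of the square-free sum.
open Classical in
lemma sum_powerset_le_squarefreeSum {A B ε : ℝ} {f : Ideal (𝓞 K) → ℝ}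
    (hf : IsPseudomultiplicative A B ε f) (W : ℕ) (x : ℝ) (P : Finset (Ideal (𝓞 K)))
    (hP : ∀ 𝔭 ∈ P, IsGoodPrime W 𝔭) :
    ∑ S ∈ P.powerset, (∏ 𝔭 ∈ S, (Ideal.absNorm 𝔭 : ℝ)⁻¹) *
      (if (Ideal.absNorm S.val.prod : ℝ) ≤ x then f S.val.prod else 0) ≤ squarefreeSum f W x := by
  have hgood : ∀ S ∈ P.powerset, ∀ 𝔭 ∈ S.val, IsGoodPrime W 𝔭 := fun S hS 𝔭 h =>
    hP 𝔭 (mem_powerset.1 hS h)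
  have e : ∀ S ∈ P.powerset, (∏ 𝔭 ∈ S, (Ideal.absNorm 𝔭 : ℝ)⁻¹) *
      (if (Ideal.absNorm S.val.prod : ℝ) ≤ x then f S.val.prod else 0) =
      if (Ideal.absNorm S.val.prod : ℝ) ≤ x then f S.val.prod / (Ideal.absNorm S.val.prod : ℝ)
        else 0 := by
    intro S _
    have : ∏ 𝔭 ∈ S, (Ideal.absNorm 𝔭 : ℝ)⁻¹ = (Ideal.absNorm S.val.prod : ℝ)⁻¹ := by
      rw [prod_inv_distrib]
      congr 1
      rw [← Nat.cast_prod, ← map_prod, Finset.prod_val]; rfl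
    rw [this]
    split_ifs <;> ring
  rw [sum_congr rfl e, ← sum_filter, squarefreeSum]
  have hinj : Set.InjOn (fun S : Finset (Ideal (𝓞 K)) => S.val.prod)
      (P.powerset.filter fun S => (Ideal.absNorm S.val.prod : ℝ) ≤ x) := by
    intro S hS S' hS' h
    simp only at h
    apply Finset.val_injective
    rw [← normalizedFactors_prod_of_good (hgood S (mem_filter.1 hS).1),
      ← normalizedFactors_prod_of_good (hgood S' (mem_filter.1 hS').1), h]
  rw [← sum_image (f := fun 𝔰 => f 𝔰 / (Ideal.absNorm 𝔰 : ℝ)) hinj]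
  apply sum_le_sum_of_subset_of_nonneg
  · intro 𝔰 h𝔰
    obtain ⟨S, hS, rfl⟩ := mem_image.1 h𝔰
    obtain ⟨h1, h2⟩ := mem_filter.1 hS
    have hn := normalizedFactors_prod_of_good (hgood S h1)
    refine mem_filter.2 ⟨mem_goodIdeals.2 ⟨prod_ne_bot_of_good (hgood S h1), h2, ?_⟩, ?_⟩
    · rw [hn]; exact hgood S h1
    · rw [squarefree_iff_nodup_normalizedFactors, hn]
      · exact S.nodup
      · exact prod_ne_bot_of_good (hgood S h1)
  · intro 𝔰 h𝔰 _
    exact div_nonneg (hf.nonneg _ (mem_goodIdeals.1 (mem_filter.1 h𝔰).1).1) (by positivity)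

/-- Rankin's trick for pseudomultiplicative functions: a small power of the norm, over ideals
composed of small primes, only changes the size of the sum by a constant. -/
theorem exists_rankin_sum_le (K : Type*) [Field K] [NumberField K] (W : ℕ) (A B ε κ c : ℝ)
    (hε : ε ≤ 1 / 9) (hκ : 0 ≤ κ) (hc : 0 ≤ c) :
    ∃ C y₁ : ℝ, 0 < C ∧ 2 ≤ y₁ ∧ ∀ f : Ideal (𝓞 K) → ℝ, IsPseudomultiplicative A B ε f →
      ∀ y, y₁ ≤ y → ∀ x : ℝ, ∀ T : Finset (Ideal (𝓞 K)), T ⊆ goodIdeals K W x →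
        (∀ 𝔞 ∈ T, ∀ 𝔭 ∈ normalizedFactors 𝔞, (Ideal.absNorm 𝔭 : ℝ) ≤ y) →
        ∑ 𝔞 ∈ T, f 𝔞 * primeWeight c 𝔞 * (Ideal.absNorm 𝔞 : ℝ) ^ (κ / Real.log y - 1) ≤
          C * squarefreeSum f W x := by
  classical
  -- If A or B is not positive, the class of functions is empty.
  by_cases hAB : 0 < A ∧ 0 < B
  swap
  · exact ⟨1, 2, one_pos, le_rfl, fun f hf => absurd ⟨hf.A_pos, hf.B_pos⟩ hAB⟩
  obtain ⟨hA, hB⟩ := hAB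
  obtain ⟨C₁, hC₁, hlog⟩ := exists_sum_log_div_prime_le
  set S := ∑' n : ℕ, (n : ℝ) ^ (-(3 / 2) : ℝ) with hS
  have hsum : Summable (fun n : ℕ => (n : ℝ) ^ (-(3 / 2) : ℝ)) :=
    Real.summable_nat_rpow.2 (by norm_num)
  set d : ℝ := (Module.finrank ℚ K : ℝ) with hd
  set Cη := A * (Real.exp κ * κ * C₁) + (A * (c * Real.exp κ) + 3 * B * (1 + c)) * S with hCη
  -- The threshold exp(8κ) forces κ / log y ≤ 1/8; together with ε ≤ 1/9 this gives the exponent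
  -- bound 1/4 of the local step.
  refine ⟨Real.exp (d * Cη), max 2 (Real.exp (8 * κ)), Real.exp_pos _, le_max_left _ _,
    fun f hf y hy x T hT hTy => ?_⟩
  have hy2 : 2 ≤ y := (le_max_left _ _).trans hy
  have hy0 : 0 < y := by linarith
  have hly : 0 < Real.log y := Real.log_pos (by linarith)
  set β := κ / Real.log y with hβ
  have hβ0 : 0 ≤ β := by positivity
  have hβ1 : β ≤ 1 / 8 := by
    rw [hβ, div_le_iff₀ hly]
    have : 8 * κ ≤ Real.log y := by
      rw [Real.le_log_iff_exp_le hy0]; exact (le_max_right _ _).trans hy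
    linarith
  have hβy : β * Real.log y = κ := by rw [hβ]; field_simp
  set P : Finset (Ideal (𝓞 K)) := (idealsUpTo K y).filter (IsGoodPrime W) with hP
  have hPgood : ∀ 𝔭 ∈ P, IsGoodPrime W 𝔭 := fun 𝔭 h => (mem_filter.1 h).2
  have hPy : ∀ 𝔭 ∈ P, (Ideal.absNorm 𝔭 : ℝ) ≤ y := fun 𝔭 h =>
    (mem_idealsUpTo.1 (mem_filter.1 h).1).2
  set η : Ideal (𝓞 K) → ℝ := fun 𝔭 =>
    A * (((1 + c / (Ideal.absNorm 𝔭 : ℝ)) * (Ideal.absNorm 𝔭 : ℝ) ^ β - 1) /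
          (Ideal.absNorm 𝔭 : ℝ)) + 3 * B * (1 + c) * (Ideal.absNorm 𝔭 : ℝ) ^ (-(3 / 2) : ℝ) with hη
  have hη0 : ∀ 𝔭 ∈ P, 0 ≤ η 𝔭 := by
    intro 𝔭 h𝔭
    have h1 : (1 : ℝ) ≤ Ideal.absNorm 𝔭 := by exact_mod_cast (hPgood 𝔭 h𝔭).1.one_lt.le
    have h2 : (1 : ℝ) ≤ (Ideal.absNorm 𝔭 : ℝ) ^ β := Real.one_le_rpow h1 hβ0
    have h3 : 0 ≤ c / (Ideal.absNorm 𝔭 : ℝ) := by positivity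
    have h4 : 0 ≤ (1 + c / (Ideal.absNorm 𝔭 : ℝ)) * (Ideal.absNorm 𝔭 : ℝ) ^ β - 1 := by nlinarith
    simp only [hη]
    positivity
  set F : Multiset (Ideal (𝓞 K)) → ℝ := fun s =>
    if (Ideal.absNorm s.prod : ℝ) ≤ x then f s.prod else 0 with hF
  have hF0 : ∀ s : Multiset (Ideal (𝓞 K)), (∀ 𝔭 ∈ s, IsGoodPrime W 𝔭) → 0 ≤ F s := by
    intro s hs
    simp only [hF]
    split_ifs
    exacts [hf.nonneg _ (prod_ne_bot_of_good hs), le_rfl]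
  have hcinv : ∀ 𝔭 : Ideal (𝓞 K), 0 ≤ (Ideal.absNorm 𝔭 : ℝ)⁻¹ := fun 𝔭 => by positivity
  have hw0 : ∀ (𝔭 : Ideal (𝓞 K)) (v : ℕ), 0 ≤ rankinWeight c β 𝔭 v := by
    intro 𝔭 v
    unfold rankinWeight
    split_ifs
    · norm_num
    · positivity
  have main := sum_multiset_mul_prod_le (IsGoodPrime W) (rankinWeight (K := K) c β) hw0
    (fun 𝔭 => (Ideal.absNorm 𝔭 : ℝ)⁻¹) η hcinv P hη0 hPgood F hF0
    (fun 𝔭 h𝔭 s hs hps V => rankin_local_bound hf x c β hc hβ0 (by linarith) (hPgood 𝔭 h𝔭)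
      s hs hps V) (T.image normalizedFactors) (by
      intro s hs 𝔭 h𝔭
      obtain ⟨𝔞, h𝔞, rfl⟩ := mem_image.1 hs
      obtain ⟨h1, h2, h3⟩ := mem_goodIdeals.1 (hT h𝔞)
      have h4 := h3 𝔭 h𝔭
      exact mem_filter.2 ⟨mem_idealsUpTo.2 ⟨h4.ne_bot, hTy 𝔞 h𝔞 𝔭 h𝔭⟩, h4⟩)
  have hinj : Set.InjOn (normalizedFactors : Ideal (𝓞 K) → _) T := by
    intro 𝔞 h𝔞 𝔟 h𝔟 h
    rw [← prod_normalizedFactors_ideal (mem_goodIdeals.1 (hT h𝔞)).1,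
      ← prod_normalizedFactors_ideal (mem_goodIdeals.1 (hT h𝔟)).1, h]
  rw [sum_image hinj] at main
  have hleft : ∀ 𝔞 ∈ T, f 𝔞 * primeWeight c 𝔞 * (Ideal.absNorm 𝔞 : ℝ) ^ (β - 1) =
      F (normalizedFactors 𝔞) *
        ∏ 𝔭 ∈ P, rankinWeight c β 𝔭 ((normalizedFactors 𝔞).count 𝔭) := by
    intro 𝔞 h𝔞
    obtain ⟨h1, h2, h3⟩ := mem_goodIdeals.1 (hT h𝔞)
    have hprod := prod_normalizedFactors_ideal h1
    have hsub : (normalizedFactors 𝔞).toFinset ⊆ P := by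
      intro 𝔭 h𝔭
      have h𝔭' := Multiset.mem_toFinset.1 h𝔭
      have h4 := h3 𝔭 h𝔭'
      exact mem_filter.2 ⟨mem_idealsUpTo.2 ⟨h4.ne_bot, hTy 𝔞 h𝔞 𝔭 h𝔭'⟩, h4⟩
    simp only [hF]
    rw [hprod, if_pos h2, mul_assoc]
    congr 1
    rw [← prod_subset hsub (by
      intro 𝔭 _ h
      rw [Multiset.mem_toFinset] at h
      rw [Multiset.count_eq_zero_of_notMem h, rankinWeight, if_pos rfl])]
    have e1 : ∀ 𝔭 ∈ (normalizedFactors 𝔞).toFinset,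
        rankinWeight c β 𝔭 ((normalizedFactors 𝔞).count 𝔭) =
        (1 + c / (Ideal.absNorm 𝔭 : ℝ)) *
          ((Ideal.absNorm 𝔭 : ℝ) ^ ((normalizedFactors 𝔞).count 𝔭)) ^ (β - 1) := by
      intro 𝔭 h𝔭
      have : (normalizedFactors 𝔞).count 𝔭 ≠ 0 :=
        Multiset.count_ne_zero.2 (Multiset.mem_toFinset.1 h𝔭)
      rw [rankinWeight, if_neg this, ← Real.rpow_natCast_mul (by positivity), mul_comm (β - 1)]
    rw [prod_congr rfl e1, prod_mul_distrib, Real.finsetProd_rpow _ _ (fun _ _ => by positivity),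
      primeWeight]
    congr 2
    conv_lhs => rw [← hprod, prod_multiset_count]
    push_cast [map_prod, map_pow]
    rfl
  have hη1 : ∏ 𝔭 ∈ P, (1 + η 𝔭) ≤ Real.exp (d * Cη) := by
    have h1 : ∏ 𝔭 ∈ P, (1 + η 𝔭) ≤ Real.exp (∑ 𝔭 ∈ P, η 𝔭) := by
      rw [Real.exp_sum]
      apply prod_le_prod
      · intro 𝔭 h; linarith [hη0 𝔭 h]
      · intro 𝔭 _; linarith [Real.add_one_le_exp (η 𝔭)]
    refine h1.trans (Real.exp_le_exp.2 ?_)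
    have hS0 : 0 ≤ S := tsum_nonneg fun n => by positivity
    set g : ℕ → ℝ := fun n => A * (Real.exp κ * β) * (Real.log n / n) +
      (A * (c * Real.exp κ) + 3 * B * (1 + c)) * (n : ℝ) ^ (-(3 / 2) : ℝ) with hg
    have hg0 : ∀ n, 0 ≤ g n := by
      intro n
      have : 0 ≤ Real.log n / n := div_nonneg (Real.log_natCast_nonneg n) (by positivity)
      simp only [hg]
      positivity
    -- Up to summable terms the local excess is β log q / q, since q^β - 1 ≤ e^κ β log q for q ≤ y.
    -- By Chebyshev these add up to O(β log y) = O(κ), so the product of the local factors stays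
    -- bounded independently of y.
    have h2 : ∀ 𝔭 ∈ P, η 𝔭 ≤ g (Ideal.absNorm 𝔭) := by
      intro 𝔭 h𝔭
      set q : ℝ := (Ideal.absNorm 𝔭 : ℝ) with hq
      have hq1 : 1 < q := by rw [hq]; exact_mod_cast (hPgood 𝔭 h𝔭).1.one_lt
      have hq0 : 0 < q := by linarith
      have hlq : 0 ≤ Real.log q := Real.log_nonneg hq1.le
      have hlqy : Real.log q ≤ Real.log y := Real.log_le_log hq0 (hPy 𝔭 h𝔭)
      have hu0 : 0 ≤ β * Real.log q := by positivity
      have hu1 : β * Real.log q ≤ κ := by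
        rw [← hβy]; gcongr
      have e1 : q ^ β = Real.exp (β * Real.log q) := by
        rw [Real.rpow_def_of_pos hq0, mul_comm]
      have e2 : q ^ β ≤ Real.exp κ := by rw [e1]; exact Real.exp_le_exp.2 hu1
      have e3 : q ^ β - 1 ≤ Real.exp κ * (β * Real.log q) := by
        have h5 := Real.add_one_le_exp (-(β * Real.log q))
        have h6 : Real.exp (β * Real.log q) * Real.exp (-(β * Real.log q)) = 1 := by
          rw [← Real.exp_add]; simp
        have h7 := Real.exp_pos (β * Real.log q)
        have h8 : Real.exp (β * Real.log q) - 1 ≤ Real.exp (β * Real.log q) * (β * Real.log q) := by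
          nlinarith
        rw [e1]
        refine h8.trans ?_
        have := Real.exp_le_exp.2 hu1
        gcongr
      have e4 : (1 + c / q) * q ^ β - 1 ≤ Real.exp κ * (β * Real.log q) + c / q * Real.exp κ := by
        have : c / q * q ^ β ≤ c / q * Real.exp κ := by gcongr
        linarith
      have e5 : (q ^ 2)⁻¹ ≤ q ^ (-(3 / 2) : ℝ) := by
        rw [← Real.rpow_natCast, ← Real.rpow_neg hq0.le]
        exact Real.rpow_le_rpow_of_exponent_le hq1.le (by norm_num)
      have e6 : A * (((1 + c / q) * q ^ β - 1) / q) ≤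
          A * (Real.exp κ * β) * (Real.log q / q) + A * (c * Real.exp κ) * (q ^ 2)⁻¹ := by
        calc A * (((1 + c / q) * q ^ β - 1) / q)
            ≤ A * ((Real.exp κ * (β * Real.log q) + c / q * Real.exp κ) / q) := by gcongr
          _ = _ := by field_simp
      have e7 : A * (c * Real.exp κ) * (q ^ 2)⁻¹ ≤ A * (c * Real.exp κ) * q ^ (-(3 / 2) : ℝ) := by
        gcongr
      simp only [hη, hg, ← hq]
      linarith
    refine (sum_le_sum h2).trans ((sum_goodPrime_le P y (fun 𝔭 h => ⟨hPgood 𝔭 h, hPy 𝔭 h⟩)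
      g hg0).trans ?_)
    rw [← hd]
    apply mul_le_mul_of_nonneg_left _ (by positivity)
    simp only [hg]
    rw [sum_add_distrib, ← mul_sum, ← mul_sum]
    have h3 : ∑ p ∈ (Icc 1 ⌊y⌋₊).filter Nat.Prime, (p : ℝ) ^ (-(3 / 2) : ℝ) ≤ S :=
      hsum.sum_le_tsum _ fun n _ => by positivity
    have h4 := hlog y hy2
    rw [hCη]
    apply add_le_add
    · calc _ ≤ A * (Real.exp κ * β) * (C₁ * Real.log y) := by gcongr
        _ = A * (Real.exp κ * (β * Real.log y) * C₁) := by ring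
        _ = _ := by rw [hβy]
    · gcongr
  rw [sum_congr rfl hleft]
  refine main.trans ?_
  have h5 := sum_powerset_le_squarefreeSum hf W x P hPgood
  have h6 := squarefreeSum_nonneg hf W x
  have h7 : 0 ≤ ∏ 𝔭 ∈ P, (1 + η 𝔭) := prod_nonneg fun 𝔭 h => by linarith [hη0 𝔭 h]
  calc _ ≤ (∏ 𝔭 ∈ P, (1 + η 𝔭)) * squarefreeSum f W x := mul_le_mul_of_nonneg_left h5 h7
    _ ≤ _ := mul_le_mul_of_nonneg_right hη1 h6

end RankinSum

/-! ### Square-free sums are dominated by E_f. -/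

section EulerMajorant
open Finset UniqueFactorizationMonoid

variable {K : Type*} [Field K] [NumberField K]

lemma coprime_primorial_iff {p n : ℕ} (hp : p.Prime) : p.Coprime (primorial n) ↔ n < p := by
  rw [hp.coprime_iff_not_dvd, hp.dvd_primorial_iff, not_le]

/-- Translates between conditions on each prime factor and the conditions on the ideal that occur in
`eulerMajorant`. -/
lemma forall_isGoodPrime_iff {W : ℕ} {𝔞 : Ideal (𝓞 K)} (h : 𝔞 ≠ ⊥) :
    (∀ 𝔭 ∈ normalizedFactors 𝔞, IsGoodPrime W 𝔭) ↔
      IsDegreeOneSpan 𝔞 ∧ (Ideal.absNorm 𝔞).Coprime W := by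
  constructor
  · intro H
    refine ⟨fun 𝔭 h𝔭 hd => (H 𝔭 ?_).1, ?_⟩
    · have h0 : 𝔭 ≠ ⊥ := fun h' => h (by
        rw [h', ← Ideal.zero_eq_bot, zero_dvd_iff] at hd; exact hd)
      exact (UniqueFactorizationMonoid.mem_normalizedFactors_iff h).2
        ⟨Ideal.prime_of_isPrime h0 h𝔭, hd⟩
    · rw [← prod_normalizedFactors_ideal h, map_multiset_prod]
      refine Multiset.prod_induction (fun n : ℕ => n.Coprime W) _ (fun a b ha hb => ha.mul_left hb)
        (Nat.coprime_one_left W) fun n hn => ?_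
      obtain ⟨𝔭, h𝔭, rfl⟩ := Multiset.mem_map.1 hn
      exact (H 𝔭 h𝔭).2
  · rintro ⟨H1, H2⟩ 𝔭 h𝔭
    obtain ⟨h1, h2⟩ := (UniqueFactorizationMonoid.mem_normalizedFactors_iff h).1 h𝔭
    exact ⟨H1 𝔭 (Ideal.isPrime_of_prime h1) h2,
      Nat.Coprime.coprime_dvd_left (map_dvd Ideal.absNorm h2) H2⟩

/-- The function is not normalised at the unit ideal. The value there enters once, through the empty
product, and this is the source of the factor max(1, M). -/
lemma IsSubmultiplicative.le_prod {f : Ideal (𝓞 K) → ℝ} (hf : IsSubmultiplicative f) {M : ℝ}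
    (hM : f ⊤ ≤ M) {W : ℕ} (hf0 : ∀ 𝔞 : Ideal (𝓞 K), 𝔞 ≠ ⊥ → 0 ≤ f 𝔞)
    (S : Finset (Ideal (𝓞 K))) (hS : ∀ 𝔭 ∈ S, IsGoodPrime W 𝔭) :
    f (∏ 𝔭 ∈ S, 𝔭) ≤ max 1 M * ∏ 𝔭 ∈ S, f 𝔭 := by
  classical
  induction S using Finset.induction_on with
  | empty =>
    rw [prod_empty, prod_empty, mul_one, Ideal.one_eq_top]
    exact hM.trans (le_max_right _ _)
  | insert 𝔮 S h𝔮 ih =>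
    have hS' : ∀ 𝔭 ∈ S, IsGoodPrime W 𝔭 := fun 𝔭 h => hS 𝔭 (mem_insert_of_mem h)
    have hq := hS 𝔮 (mem_insert_self _ _)
    rw [prod_insert h𝔮, prod_insert h𝔮]
    have hne : ∏ 𝔭 ∈ S, 𝔭 ≠ ⊥ := by
      rw [← Ideal.zero_eq_bot]
      exact prod_ne_zero_iff.2 fun 𝔭 h => (hS' 𝔭 h).ne_bot
    have hcop : IsCoprime 𝔮 (∏ 𝔭 ∈ S, 𝔭) := by
      refine IsCoprime.prod_right fun 𝔭 h => isCoprime_of_isPrime_of_ne hq.isPrime hq.ne_bot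
        (hS' 𝔭 h).isPrime (hS' 𝔭 h).ne_bot fun h' => h𝔮 (h' ▸ h)
    refine (hf 𝔮 _ hq.ne_bot hne hcop).trans ?_
    have := mul_le_mul_of_nonneg_left (ih hS') (hf0 𝔮 hq.ne_bot)
    linarith

/-- For a submultiplicative function the sum is bounded by an expanded product ∏ (1 + f(𝔭)/N𝔭),
hence by the exponential. Otherwise the two sums run over the same ideals. -/
theorem squarefreeSum_le_eulerMajorant {A B ε : ℝ} {f : Ideal (𝓞 K) → ℝ}
    (hf : IsPseudomultiplicative A B ε f) {M : ℝ} (hM : f ⊤ ≤ M) {w : ℝ} (hw : 0 ≤ w) (x : ℝ) :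
    squarefreeSum f (primorial ⌊w⌋₊) x ≤ max 1 M * eulerMajorant f w x := by
  classical
  set W := primorial ⌊w⌋₊ with hW
  rw [eulerMajorant]
  split_ifs with hsub
  · set P := (idealsUpTo K x).filter
      (fun 𝔭 => 𝔭.IsPrime ∧ IsDegreeOneSpan 𝔭 ∧ w < (Ideal.absNorm 𝔭 : ℝ)) with hP
    have hPgood : ∀ 𝔭 ∈ P, IsGoodPrime W 𝔭 := by
      intro 𝔭 h𝔭
      obtain ⟨h1, h2, h3, h4⟩ := mem_filter.1 h𝔭
      have hpr : (Ideal.absNorm 𝔭).Prime := h3 𝔭 h2 dvd_rfl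
      refine ⟨hpr, (coprime_primorial_iff hpr).2 ((Nat.floor_lt hw).2 h4)⟩
    have hterm : ∀ 𝔰 ∈ (goodIdeals K W x).filter Squarefree,
        f 𝔰 / (Ideal.absNorm 𝔰 : ℝ) ≤
          max 1 M * ∏ 𝔭 ∈ (normalizedFactors 𝔰).toFinset, f 𝔭 / (Ideal.absNorm 𝔭 : ℝ) := by
      intro 𝔰 h𝔰
      obtain ⟨h1, h2⟩ := mem_filter.1 h𝔰
      obtain ⟨h3, h4, h5⟩ := mem_goodIdeals.1 h1
      have hnd := (squarefree_iff_nodup_normalizedFactors h3).1 h2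
      have hpr : ∏ 𝔭 ∈ (normalizedFactors 𝔰).toFinset, 𝔭 = 𝔰 := by
        conv_rhs => rw [← prod_normalizedFactors_ideal h3]
        rw [Finset.prod, Multiset.toFinset_val, hnd.dedup, Multiset.map_id']
      have h6 := hsub.le_prod hM (W := W) hf.nonneg (normalizedFactors 𝔰).toFinset
        (fun 𝔭 h => h5 𝔭 (Multiset.mem_toFinset.1 h))
      rw [hpr] at h6
      have h7 : ((Ideal.absNorm 𝔰 : ℕ) : ℝ) =
          ∏ 𝔭 ∈ (normalizedFactors 𝔰).toFinset, (Ideal.absNorm 𝔭 : ℝ) := by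
        conv_lhs => rw [← hpr]
        push_cast [map_prod]; rfl
      rw [prod_div_distrib, ← h7, ← mul_div_assoc]
      gcongr
    rw [squarefreeSum]
    refine (sum_le_sum hterm).trans ?_
    rw [← mul_sum]
    have hM1 : 0 ≤ max 1 M := le_trans zero_le_one (le_max_left _ _)
    apply mul_le_mul_of_nonneg_left _ hM1
    have hfnn : ∀ 𝔭 ∈ P, 0 ≤ f 𝔭 / (Ideal.absNorm 𝔭 : ℝ) := fun 𝔭 h =>
      div_nonneg (hf.nonneg _ (hPgood 𝔭 h).ne_bot) (by positivity)
    have hinj : Set.InjOn (fun 𝔰 : Ideal (𝓞 K) => (normalizedFactors 𝔰).toFinset)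
        ((goodIdeals K W x).filter Squarefree) := by
      intro 𝔰 h𝔰 𝔱 h𝔱 h
      obtain ⟨h1, h2⟩ := mem_filter.1 h𝔰
      obtain ⟨h1', h2'⟩ := mem_filter.1 h𝔱
      have h3 := (mem_goodIdeals.1 h1).1
      have h3' := (mem_goodIdeals.1 h1').1
      have hnd := (squarefree_iff_nodup_normalizedFactors h3).1 h2
      have hnd' := (squarefree_iff_nodup_normalizedFactors h3').1 h2'
      simp only at h
      have h8 : normalizedFactors 𝔰 = normalizedFactors 𝔱 := by
        rw [← hnd.dedup, ← hnd'.dedup, ← Multiset.toFinset_val, ← Multiset.toFinset_val, h]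
      rw [← prod_normalizedFactors_ideal h3, ← prod_normalizedFactors_ideal h3', h8]
    rw [← sum_image (f := fun S => ∏ 𝔭 ∈ S, f 𝔭 / (Ideal.absNorm 𝔭 : ℝ)) hinj]
    calc _ ≤ ∑ S ∈ P.powerset, ∏ 𝔭 ∈ S, f 𝔭 / (Ideal.absNorm 𝔭 : ℝ) := by
          apply sum_le_sum_of_subset_of_nonneg
          · intro S hS
            obtain ⟨𝔰, h𝔰, rfl⟩ := mem_image.1 hS
            obtain ⟨h1, h2⟩ := mem_filter.1 h𝔰
            obtain ⟨h3, h4, h5⟩ := mem_goodIdeals.1 h1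
            refine mem_powerset.2 fun 𝔭 h𝔭 => ?_
            have h6 := Multiset.mem_toFinset.1 h𝔭
            have h7 := h5 𝔭 h6
            have h8 := dvd_of_mem_normalizedFactors h6
            refine mem_filter.2 ⟨mem_idealsUpTo.2 ⟨h7.ne_bot, le_trans ?_ h4⟩, h7.isPrime, ?_, ?_⟩
            · exact_mod_cast Nat.le_of_dvd (absNorm_pos_of_ne_bot h3) (map_dvd Ideal.absNorm h8)
            · exact fun 𝔮 hq hd => ((forall_isGoodPrime_iff h3).1 h5).1 𝔮 hq (hd.trans h8)
            · rw [← Nat.floor_lt hw]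
              exact (coprime_primorial_iff h7.1).1 h7.2
          · intro S hS _
            exact prod_nonneg fun 𝔭 h => hfnn 𝔭 (mem_powerset.1 hS h)
      _ = ∏ 𝔭 ∈ P, (1 + f 𝔭 / (Ideal.absNorm 𝔭 : ℝ)) := (prod_one_add _).symm
      _ ≤ Real.exp (∑ 𝔭 ∈ P, f 𝔭 / (Ideal.absNorm 𝔭 : ℝ)) := by
          rw [Real.exp_sum]
          apply prod_le_prod
          · intro 𝔭 h; linarith [hfnn 𝔭 h]
          · intro 𝔭 _; linarith [Real.add_one_le_exp (f 𝔭 / (Ideal.absNorm 𝔭 : ℝ))]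
  · have e : (goodIdeals K W x).filter Squarefree = (idealsUpTo K x).filter
      (fun 𝔞 => IsDegreeOneSpan 𝔞 ∧ Squarefree 𝔞 ∧
        Nat.Coprime (Ideal.absNorm 𝔞) (primorial ⌊w⌋₊)) := by
      ext 𝔞
      rw [mem_filter, mem_filter, mem_goodIdeals, mem_idealsUpTo]
      constructor
      · rintro ⟨⟨h1, h2, h3⟩, h4⟩
        have := (forall_isGoodPrime_iff h1).1 h3
        exact ⟨⟨h1, h2⟩, this.1, h4, this.2⟩
      · rintro ⟨⟨h1, h2⟩, h3, h4, h5⟩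
        exact ⟨⟨h1, h2, (forall_isGoodPrime_iff h1).2 ⟨h3, h5⟩⟩, h4⟩
    have h0 := squarefreeSum_nonneg hf W x
    rw [← e]
    exact le_mul_of_one_le_left h0 (le_max_left _ _)

/-- The unit ideal is one of the summands. This allows bounds that are proportional to f at the unit
ideal to be absorbed into the main term. -/
lemma apply_top_le_squarefreeSum {A B ε : ℝ} {f : Ideal (𝓞 K) → ℝ}
    (hf : IsPseudomultiplicative A B ε f) (W : ℕ) {x : ℝ} (hx : 1 ≤ x) :
    f ⊤ ≤ squarefreeSum f W x := by
  classical
  have hmem : (⊤ : Ideal (𝓞 K)) ∈ (goodIdeals K W x).filter Squarefree := by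
    refine mem_filter.2 ⟨mem_goodIdeals.2 ⟨top_ne_bot, ?_, ?_⟩, ?_⟩
    · rw [Ideal.absNorm_top]; exact_mod_cast hx
    · rw [← Ideal.one_eq_top, normalizedFactors_one]; simp
    · rw [← Ideal.one_eq_top]; exact squarefree_one
  have := single_le_sum (f := fun 𝔰 => f 𝔰 / (Ideal.absNorm 𝔰 : ℝ)) (fun 𝔰 h𝔰 =>
    div_nonneg (hf.nonneg _ (mem_goodIdeals.1 (mem_filter.1 h𝔰).1).1) (by positivity)) hmem
  simpa [squarefreeSum, Ideal.absNorm_top] using this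

end EulerMajorant

/-! ### A Mertens lower bound for degree one primes. -/

section Mertens
open Finset UniqueFactorizationMonoid Filter

variable (K : Type*) [Field K] [NumberField K]

/-- The number of ideals of norm at most n is asymptotic to n times the residue of the Dedekind zeta
function, which is positive. -/
lemma exists_le_card_idealsUpTo :
    ∃ c : ℝ, 0 < c ∧ ∃ n₀ : ℕ, ∀ n : ℕ, n₀ ≤ n → c * n ≤ ((idealsUpTo K n).card : ℝ) := by
  have h := NumberField.Ideal.tendsto_norm_le_div_atTop₀ K
  set L : ℝ := (2 ^ NumberField.InfinitePlace.nrRealPlaces K *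
    (2 * Real.pi) ^ NumberField.InfinitePlace.nrComplexPlaces K *
    NumberField.Units.regulator K * NumberField.classNumber K) /
      (NumberField.Units.torsionOrder K * Real.sqrt |(NumberField.discr K : ℝ)|) with hL
  have hLpos : 0 < L := NumberField.dedekindZeta_residue_pos K
  have h2 := (h.eventually (eventually_gt_nhds (half_lt_self hLpos))).and (eventually_gt_atTop 0)
  obtain ⟨x₀, hx₀⟩ := eventually_atTop.1 h2
  refine ⟨L / 2, by positivity, ⌈x₀⌉₊, fun n hn => ?_⟩
  obtain ⟨h3, h4⟩ := hx₀ n (Nat.ceil_le.1 hn)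
  have hcard : Nat.card {I : nonZeroDivisors (Ideal (𝓞 K)) //
      (Ideal.absNorm (I : Ideal (𝓞 K)) : ℝ) ≤ n} = (idealsUpTo K n).card := by
    have e : {I : nonZeroDivisors (Ideal (𝓞 K)) // (Ideal.absNorm (I : Ideal (𝓞 K)) : ℝ) ≤ n} ≃
        {𝔞 // 𝔞 ∈ idealsUpTo K n} :=
      { toFun := fun I => ⟨I.1.1, mem_idealsUpTo.2 ⟨nonZeroDivisors.coe_ne_zero I.1, I.2⟩⟩
        invFun := fun 𝔞 => ⟨⟨𝔞.1, mem_nonZeroDivisors_of_ne_zero (mem_idealsUpTo.1 𝔞.2).1⟩,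
          (mem_idealsUpTo.1 𝔞.2).2⟩
        left_inv := fun _ => rfl
        right_inv := fun _ => rfl }
    rw [Nat.card_congr e, Nat.card_eq_fintype_card, Fintype.card_coe]
  rw [hcard, lt_div_iff₀ h4] at h3
  exact h3.le

lemma sum_Icc_inv_mul_succ {a b : ℕ} (ha : 1 ≤ a) (hab : a ≤ b + 1) :
    ∑ n ∈ Icc a b, ((n : ℝ) * (n + 1))⁻¹ = (a : ℝ)⁻¹ - ((b : ℝ) + 1)⁻¹ := by
  induction b with
  | zero =>
    have : a = 1 := by omega
    subst this; simp
  | succ b ih =>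
    rcases Nat.lt_or_ge b.succ a with h | h
    · have : a = b + 1 + 1 := by omega
      subst this
      rw [Icc_eq_empty (by omega)]; push_cast; simp
    · rw [← Finset.insert_Icc_right_eq_Icc_add_one h, sum_insert (by simp), ih h]
      have : (a : ℝ) ≠ 0 := by positivity
      push_cast
      field_simp
      ring

/-- The harmonic sum over ideals grows at least like `log x`. -/
lemma exists_log_le_sum_inv_absNorm :
    ∃ c h : ℝ, 0 < c ∧ 0 ≤ h ∧ ∀ x : ℝ, 1 ≤ x →
      c * (Real.log x - h) ≤ ∑ 𝔞 ∈ idealsUpTo K x, (Ideal.absNorm 𝔞 : ℝ)⁻¹ := by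
  classical
  obtain ⟨c, hc, n₀, H⟩ := exists_le_card_idealsUpTo K
  refine ⟨c, (harmonic (n₀ + 1) : ℝ), hc, ?_, fun x hx => ?_⟩
  · exact_mod_cast (harmonic_pos (by omega)).le
  set X := ⌊x⌋₊ with hX
  have hXx : (X : ℝ) ≤ x := Nat.floor_le (by linarith)
  have hsame : ∀ 𝔞 : Ideal (𝓞 K), 𝔞 ∈ idealsUpTo K x ↔ 𝔞 ≠ ⊥ ∧ Ideal.absNorm 𝔞 ≤ X := by
    intro 𝔞
    rw [mem_idealsUpTo, hX, Nat.le_floor_iff (by linarith)]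
  -- Abel summation: 1/N𝔞 is at least the sum of 1/(n(n+1)) over N𝔞 ≤ n ≤ X, and exchanging the sums
  -- brings in the counting function.
  have h1 : ∀ 𝔞 ∈ idealsUpTo K x,
      ∑ n ∈ (Icc 1 X).filter (fun n => Ideal.absNorm 𝔞 ≤ n), ((n : ℝ) * (n + 1))⁻¹
        ≤ (Ideal.absNorm 𝔞 : ℝ)⁻¹ := by
    intro 𝔞 h𝔞
    obtain ⟨h0, h2⟩ := (hsame 𝔞).1 h𝔞
    have hpos := absNorm_pos_of_ne_bot h0
    have : (Icc 1 X).filter (fun n => Ideal.absNorm 𝔞 ≤ n) = Icc (Ideal.absNorm 𝔞) X := by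
      ext n; simp only [mem_filter, mem_Icc]; omega
    rw [this, sum_Icc_inv_mul_succ hpos (by omega)]
    have : (0 : ℝ) ≤ ((X : ℝ) + 1)⁻¹ := by positivity
    linarith
  refine le_trans ?_ (sum_le_sum h1)
  have h2 : ∑ 𝔞 ∈ idealsUpTo K x, ∑ n ∈ (Icc 1 X).filter (fun n => Ideal.absNorm 𝔞 ≤ n),
      ((n : ℝ) * (n + 1))⁻¹ = ∑ n ∈ Icc 1 X, ((idealsUpTo K n).card : ℝ) * ((n : ℝ) * (n + 1))⁻¹ := by
    simp only [sum_filter]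
    rw [sum_comm]
    apply sum_congr rfl
    intro n hn
    rw [← sum_filter, sum_const, nsmul_eq_mul]
    congr 3
    ext 𝔞
    rw [mem_filter, hsame, mem_idealsUpTo, Nat.cast_le]
    have := (mem_Icc.1 hn).2
    constructor
    · exact fun h => ⟨h.1.1, h.2⟩
    · exact fun h => ⟨⟨h.1, h.2.trans this⟩, h.2⟩
  rw [h2]
  have h3 : ∀ n ∈ Icc 1 X, (if n₀ ≤ n then c * ((n : ℝ) + 1)⁻¹ else 0) ≤
      ((idealsUpTo K n).card : ℝ) * ((n : ℝ) * (n + 1))⁻¹ := by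
    intro n hn
    have hn1 : (0 : ℝ) < n := by exact_mod_cast (mem_Icc.1 hn).1
    split_ifs with h
    · calc c * ((n : ℝ) + 1)⁻¹ = c * n * ((n : ℝ) * (n + 1))⁻¹ := by field_simp
        _ ≤ _ := by
          have := H n h
          gcongr
    · positivity
  refine le_trans ?_ (sum_le_sum h3)
  have h4 : ∀ X : ℕ, c * ((harmonic (X + 1) : ℝ) - harmonic (n₀ + 1)) ≤
      ∑ n ∈ Icc 1 X, (if n₀ ≤ n then c * ((n : ℝ) + 1)⁻¹ else 0) := by
    intro X
    induction X with
    | zero =>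
      have : (harmonic (0 + 1) : ℝ) ≤ harmonic (n₀ + 1) := by
        have : harmonic (0 + 1) ≤ harmonic (n₀ + 1) := by
          unfold harmonic
          exact sum_le_sum_of_subset_of_nonneg (range_mono (by omega)) fun i _ _ => by positivity
        exact_mod_cast this
      simp only [Icc_eq_empty (show ¬ (1 ≤ 0) by omega), sum_empty]
      nlinarith
    | succ X ih =>
      rw [← Finset.insert_Icc_right_eq_Icc_add_one (by omega), sum_insert (by simp)]
      split_ifs with h
      · rw [harmonic_succ]; push_cast at ih ⊢; linarith
      · have : (harmonic (X + 1 + 1) : ℝ) ≤ harmonic (n₀ + 1) := by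
          have : harmonic (X + 1 + 1) ≤ harmonic (n₀ + 1) := by
            unfold harmonic
            exact sum_le_sum_of_subset_of_nonneg (range_mono (by omega)) fun i _ _ => by positivity
          exact_mod_cast this
        have h5 : 0 ≤ ∑ n ∈ Icc 1 X, (if n₀ ≤ n then c * ((n : ℝ) + 1)⁻¹ else 0) :=
          sum_nonneg fun n _ => by split_ifs <;> positivity
        nlinarith
  refine le_trans ?_ (h4 X)
  apply mul_le_mul_of_nonneg_left _ hc.le
  have h5 := log_add_one_le_harmonic (X + 1)
  have h6 : Real.log x ≤ Real.log ((X + 1 : ℕ) + 1 : ℝ) := by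
    apply Real.log_le_log (by linarith)
    have := Nat.lt_floor_add_one x
    push_cast; linarith
  have h7 : Real.log x ≤ harmonic (X + 1) := by
    refine h6.trans ?_
    exact_mod_cast h5
  linarith

-- The least prime factor of N𝔭 is the rational prime below 𝔭, and at most [K : ℚ] primes lie above
-- it. Unlike `sum_goodPrime_le`, this covers primes of every residue degree.
variable {K} in
lemma sum_prime_minFac_le (S : Finset (Ideal (𝓞 K))) (hS : ∀ 𝔭 ∈ S, 𝔭.IsPrime ∧ 𝔭 ≠ ⊥)
    (g : ℕ → ℝ) (hg : ∀ n, 0 ≤ g n) (hsum : Summable g) :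
    ∑ 𝔭 ∈ S, g (Ideal.absNorm 𝔭).minFac ≤ Module.finrank ℚ K * ∑' n, g n := by
  classical
  rw [sum_comp g (fun 𝔭 : Ideal (𝓞 K) => (Ideal.absNorm 𝔭).minFac)]
  refine (sum_le_sum (g := fun p => (Module.finrank ℚ K : ℝ) * g p) ?_).trans ?_
  · intro p hp
    obtain ⟨𝔮, h𝔮, rfl⟩ := mem_image.1 hp
    rw [nsmul_eq_mul]
    apply mul_le_mul_of_nonneg_right _ (hg _)
    have hne1 : Ideal.absNorm 𝔮 ≠ 1 := fun h =>
      (hS 𝔮 h𝔮).1.ne_top (Ideal.absNorm_eq_one_iff.1 h)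
    have := card_primes_of_dvd_le _ (Nat.minFac_prime hne1)
      (S.filter fun 𝔭 => (Ideal.absNorm 𝔭).minFac = (Ideal.absNorm 𝔮).minFac) (by
        intro 𝔭 h𝔭
        obtain ⟨h1, h2⟩ := mem_filter.1 h𝔭
        exact ⟨(hS 𝔭 h1).1, (hS 𝔭 h1).2, h2 ▸ Nat.minFac_dvd _⟩)
    exact_mod_cast this
  · rw [← mul_sum]
    apply mul_le_mul_of_nonneg_left _ (by positivity)
    exact hsum.sum_le_tsum _ fun n _ => hg n

open Classical in
/-- The lower bound in Mertens' theorem for the degree one primes of a number field. -/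
theorem exists_mertens_lower (W : ℕ) (hW : W ≠ 0) :
    ∃ C : ℝ, ∀ x : ℝ, 2 ≤ x → Real.log (Real.log x) - C ≤
      ∑ 𝔭 ∈ (idealsUpTo K x).filter (IsGoodPrime W), (Ideal.absNorm 𝔭 : ℝ)⁻¹ := by
  obtain ⟨c, h, hc, hh, H⟩ := exists_log_le_sum_inv_absNorm K
  set d : ℝ := (Module.finrank ℚ K : ℝ) with hd
  set S := ∑' n : ℕ, ((n : ℝ) ^ 2)⁻¹ with hS
  have hsum : Summable (fun n : ℕ => ((n : ℝ) ^ 2)⁻¹) :=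
    Real.summable_nat_pow_inv.2 (by norm_num)
  set C₁ := ((idealsUpTo K W).card : ℝ) with hC₁
  have hlow : ∀ x : ℝ, 2 ≤ x → c * (Real.log x - h) ≤
      Real.exp (∑ 𝔭 ∈ (idealsUpTo K x).filter (IsGoodPrime W), (Ideal.absNorm 𝔭 : ℝ)⁻¹
        + C₁ + d * (3 * S)) := by
    intro x hx
    refine (H x (by linarith)).trans ?_
    set P := (idealsUpTo K x).filter (fun 𝔭 => 𝔭.IsPrime) with hP
    have hPp : ∀ 𝔭 ∈ P, 𝔭.IsPrime ∧ 𝔭 ≠ ⊥ := fun 𝔭 h =>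
      ⟨(mem_filter.1 h).2, (mem_idealsUpTo.1 (mem_filter.1 h).1).1⟩
    have hN2 : ∀ 𝔭 : Ideal (𝓞 K), 𝔭.IsPrime ∧ 𝔭 ≠ ⊥ → 2 ≤ Ideal.absNorm 𝔭 := by
      intro 𝔭 h𝔭
      have h1 := absNorm_pos_of_ne_bot h𝔭.2
      have h2 : Ideal.absNorm 𝔭 ≠ 1 := fun h => h𝔭.1.ne_top (Ideal.absNorm_eq_one_iff.1 h)
      omega
    -- With c = 0 and f = 1 the sum over sets reduces to the empty set, so the general lemma becomes
    -- the Euler product bound for the harmonic sum over ideals.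
    have main := sum_multiset_mul_prod_le (ι := Ideal (𝓞 K)) (fun 𝔭 => 𝔭.IsPrime ∧ 𝔭 ≠ ⊥)
      (fun 𝔭 v => ((Ideal.absNorm 𝔭 : ℝ)⁻¹) ^ v) (fun 𝔭 v => by positivity) (fun _ => 0)
      (fun 𝔭 => ((Ideal.absNorm 𝔭 : ℝ) - 1)⁻¹) (fun _ => le_rfl) P (by
        intro 𝔭 h𝔭
        have : (2 : ℝ) ≤ Ideal.absNorm 𝔭 := by exact_mod_cast hN2 𝔭 (hPp 𝔭 h𝔭)
        exact inv_nonneg.2 (by linarith)) hPp (fun _ => 1) (fun _ _ => zero_le_one) (by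
        intro 𝔭 h𝔭 s _ _ V
        have h2 : (2 : ℝ) ≤ Ideal.absNorm 𝔭 := by exact_mod_cast hN2 𝔭 (hPp 𝔭 h𝔭)
        have h0 : (0 : ℝ) ≤ (Ideal.absNorm 𝔭 : ℝ)⁻¹ := by positivity
        have h1 : (Ideal.absNorm 𝔭 : ℝ)⁻¹ < 1 := inv_lt_one_of_one_lt₀ (by linarith)
        simp only [one_mul, add_zero, mul_one]
        have h3 : ∑ v ∈ range V, ((Ideal.absNorm 𝔭 : ℝ)⁻¹) ^ v ≤ (1 - (Ideal.absNorm 𝔭 : ℝ)⁻¹)⁻¹ := by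
          rw [← tsum_geometric_of_lt_one h0 h1]
          exact (summable_geometric_of_lt_one h0 h1).sum_le_tsum _ fun _ _ => by positivity
        refine h3.trans (le_of_eq ?_)
        have h4 : (Ideal.absNorm 𝔭 : ℝ) - 1 ≠ 0 := by linarith
        have h5 : (Ideal.absNorm 𝔭 : ℝ) ≠ 0 := by linarith
        field_simp; ring)
      ((idealsUpTo K x).image normalizedFactors) (by
        intro s hs 𝔭 h𝔭
        obtain ⟨𝔞, h𝔞, rfl⟩ := mem_image.1 hs
        obtain ⟨h1, h2⟩ := mem_idealsUpTo.1 h𝔞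
        obtain ⟨h3, h4⟩ := (UniqueFactorizationMonoid.mem_normalizedFactors_iff h1).1 h𝔭
        refine mem_filter.2 ⟨mem_idealsUpTo.2 ⟨h3.ne_zero, le_trans ?_ h2⟩, Ideal.isPrime_of_prime h3⟩
        exact_mod_cast Nat.le_of_dvd (absNorm_pos_of_ne_bot h1) (map_dvd Ideal.absNorm h4))
    have hinj : Set.InjOn (normalizedFactors : Ideal (𝓞 K) → _) (idealsUpTo K x) := by
      intro 𝔞 h𝔞 𝔟 h𝔟 h
      rw [← prod_normalizedFactors_ideal (mem_idealsUpTo.1 h𝔞).1,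
        ← prod_normalizedFactors_ideal (mem_idealsUpTo.1 h𝔟).1, h]
    rw [sum_image hinj] at main
    have hone : ∑ T ∈ P.powerset, (∏ _i ∈ T, (0 : ℝ)) * 1 = 1 := by
      rw [sum_eq_single_of_mem ∅ (empty_mem_powerset _)]
      · simp
      · intro T _ hT
        simp only [prod_const, mul_one]
        exact zero_pow (card_ne_zero.2 (nonempty_iff_ne_empty.2 hT))
    rw [hone, mul_one] at main
    have hleft : ∀ 𝔞 ∈ idealsUpTo K x, (Ideal.absNorm 𝔞 : ℝ)⁻¹ =
        1 * ∏ 𝔭 ∈ P, ((Ideal.absNorm 𝔭 : ℝ)⁻¹) ^ ((normalizedFactors 𝔞).count 𝔭) := by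
      intro 𝔞 h𝔞
      obtain ⟨h1, h2⟩ := mem_idealsUpTo.1 h𝔞
      have hprod := prod_normalizedFactors_ideal h1
      have hsub : (normalizedFactors 𝔞).toFinset ⊆ P := by
        intro 𝔭 h𝔭
        obtain ⟨h3, h4⟩ := (UniqueFactorizationMonoid.mem_normalizedFactors_iff h1).1
          (Multiset.mem_toFinset.1 h𝔭)
        refine mem_filter.2 ⟨mem_idealsUpTo.2 ⟨h3.ne_zero, le_trans ?_ h2⟩, Ideal.isPrime_of_prime h3⟩
        exact_mod_cast Nat.le_of_dvd (absNorm_pos_of_ne_bot h1) (map_dvd Ideal.absNorm h4)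
      rw [one_mul, ← prod_subset hsub (by
        intro 𝔭 _ h
        rw [Multiset.mem_toFinset] at h
        rw [Multiset.count_eq_zero_of_notMem h, pow_zero])]
      conv_lhs => rw [← hprod, prod_multiset_count]
      push_cast [map_prod, map_pow]
      rw [← prod_inv_distrib]
      exact prod_congr rfl fun 𝔭 _ => (inv_pow _ _).symm
    rw [sum_congr rfl hleft]
    refine main.trans ?_
    have hexp : ∏ 𝔭 ∈ P, (1 + ((Ideal.absNorm 𝔭 : ℝ) - 1)⁻¹) ≤
        Real.exp (∑ 𝔭 ∈ P, ((Ideal.absNorm 𝔭 : ℝ) - 1)⁻¹) := by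
      rw [Real.exp_sum]
      apply Finset.prod_le_prod
      · intro 𝔭 h𝔭
        have : (2 : ℝ) ≤ Ideal.absNorm 𝔭 := by exact_mod_cast hN2 𝔭 (hPp 𝔭 h𝔭)
        have : 0 ≤ ((Ideal.absNorm 𝔭 : ℝ) - 1)⁻¹ := inv_nonneg.2 (by linarith)
        linarith
      · intro 𝔭 _; linarith [Real.add_one_le_exp (((Ideal.absNorm 𝔭 : ℝ) - 1)⁻¹)]
    refine hexp.trans (Real.exp_le_exp.2 ?_)
    -- Passing from all primes to good ones loses a bounded amount: a prime of higher degree has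
    -- norm at least p² with p below it, a degree one prime with norm not coprime to W has norm at
    -- most W, and 1/(q-1) - 1/q is at most 2/q².
    have hterm : ∀ 𝔭 ∈ P, ((Ideal.absNorm 𝔭 : ℝ) - 1)⁻¹ ≤
        (if IsGoodPrime W 𝔭 then (Ideal.absNorm 𝔭 : ℝ)⁻¹ else 0) +
        (if 𝔭 ∈ idealsUpTo K W then 1 else 0) +
        3 * (((Ideal.absNorm 𝔭).minFac : ℝ) ^ 2)⁻¹ := by
      intro 𝔭 h𝔭
      have h2 : (2 : ℝ) ≤ Ideal.absNorm 𝔭 := by exact_mod_cast hN2 𝔭 (hPp 𝔭 h𝔭)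
      set q : ℝ := (Ideal.absNorm 𝔭 : ℝ) with hq
      have hN1 : Ideal.absNorm 𝔭 ≠ 1 := by have := hN2 𝔭 (hPp 𝔭 h𝔭); omega
      have hmp := Nat.minFac_prime hN1
      have hm0 : (0 : ℝ) < (Ideal.absNorm 𝔭).minFac := by exact_mod_cast hmp.pos
      have hmq : ((Ideal.absNorm 𝔭).minFac : ℝ) ≤ q := by
        rw [hq]; exact_mod_cast Nat.minFac_le (absNorm_pos_of_ne_bot (hPp 𝔭 h𝔭).2)
      have e1 : (q - 1)⁻¹ ≤ q⁻¹ + 2 * (q ^ 2)⁻¹ := by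
        have : q - 1 ≠ 0 := by linarith
        have hq1 : 0 < q - 1 := by linarith
        rw [← sub_nonneg]
        have : q⁻¹ + 2 * (q ^ 2)⁻¹ - (q - 1)⁻¹ = (q - 2) / (q ^ 2 * (q - 1)) := by
          field_simp; ring
        rw [this]
        apply div_nonneg (by linarith) (by positivity)
      have e2 : (q ^ 2)⁻¹ ≤ (((Ideal.absNorm 𝔭).minFac : ℝ) ^ 2)⁻¹ := by gcongr
      have e3 : 0 ≤ (((Ideal.absNorm 𝔭).minFac : ℝ) ^ 2)⁻¹ := by positivity
      by_cases hg : IsGoodPrime W 𝔭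
      · rw [if_pos hg]
        split_ifs <;> linarith
      · rw [if_neg hg]
        by_cases hpr : (Ideal.absNorm 𝔭).Prime
        · have hdvd : Ideal.absNorm 𝔭 ∣ W := by
            by_contra hcon
            exact hg ⟨hpr, (hpr.coprime_iff_not_dvd).2 hcon⟩
          rw [if_pos (mem_idealsUpTo.2 ⟨(hPp 𝔭 h𝔭).2, by
            exact_mod_cast Nat.le_of_dvd (Nat.pos_of_ne_zero hW) hdvd⟩)]
          have : q⁻¹ ≤ 1 := inv_le_one_of_one_le₀ (by linarith)
          linarith
        · have hsq : (((Ideal.absNorm 𝔭).minFac : ℝ)) ^ 2 ≤ q := by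
            have := Nat.minFac_sq_le_self (absNorm_pos_of_ne_bot (hPp 𝔭 h𝔭).2) hpr
            rw [hq]; exact_mod_cast this
          have : q⁻¹ ≤ (((Ideal.absNorm 𝔭).minFac : ℝ) ^ 2)⁻¹ := by gcongr
          split_ifs <;> linarith
    refine (sum_le_sum hterm).trans ?_
    rw [sum_add_distrib, sum_add_distrib]
    apply add_le_add (add_le_add _ _)
    · have := sum_prime_minFac_le P hPp (fun n => 3 * ((n : ℝ) ^ 2)⁻¹) (fun n => by positivity)
        (hsum.mul_left 3)
      rw [tsum_mul_left] at this
      exact this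
    · rw [← sum_filter]
      apply sum_le_sum_of_subset_of_nonneg
      · intro 𝔭 h
        obtain ⟨h1, h2⟩ := mem_filter.1 h
        exact mem_filter.2 ⟨(mem_filter.1 h1).1, h2⟩
      · intro 𝔭 _ _; positivity
    · rw [← sum_filter, sum_const, nsmul_eq_mul, mul_one, hC₁]
      exact_mod_cast card_le_card fun 𝔭 h => (mem_filter.1 h).2
  set D := C₁ + d * (3 * S) with hD
  -- The lower bound c(log x - h) is useful only when log x exceeds 2h + 1; below that the sum is
  -- merely non-negative and the second constant takes over.
  refine ⟨max (D - Real.log (c / 2)) (Real.log (2 * h + 1)), fun x hx => ?_⟩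
  have hlx : 0 < Real.log x := Real.log_pos (by linarith)
  have hnn : 0 ≤ ∑ 𝔭 ∈ (idealsUpTo K x).filter (IsGoodPrime W), (Ideal.absNorm 𝔭 : ℝ)⁻¹ :=
    sum_nonneg fun _ _ => by positivity
  rcases le_or_gt (Real.log x) (2 * h + 1) with hle | hgt
  · have := Real.log_le_log hlx hle
    have := le_max_right (D - Real.log (c / 2)) (Real.log (2 * h + 1))
    linarith
  · have h1 := hlow x hx
    have h2 : c / 2 * Real.log x ≤ c * (Real.log x - h) := by nlinarith
    have h3 := Real.log_le_log (by positivity) (h2.trans h1)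
    rw [Real.log_exp, Real.log_mul (by positivity) hlx.ne'] at h3
    have := le_max_left (D - Real.log (c / 2)) (Real.log (2 * h + 1))
    linarith

end Mertens

/-! ### Residue classes: boxes, Chinese remainders and changes of coordinates. -/

section ClassCount
open Finset

/-- A predicate on integer vectors that only depends on the residues modulo `e`. -/
def IsPeriodic (e : ℕ) (P : ℤ × ℤ → Prop) : Prop :=
  ∀ x y : ℤ × ℤ, x.1 ≡ y.1 [ZMOD e] → x.2 ≡ y.2 [ZMOD e] → (P x ↔ P y)

open Classical in
/-- The number of residue classes modulo `e` satisfying a predicate. -/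
noncomputable def classCount (e : ℕ) (P : ℤ × ℤ → Prop) : ℕ :=
  ((range e ×ˢ range e).filter (fun z => P ((z.1 : ℤ), (z.2 : ℤ)))).card

lemma abs_card_Ico_modEq_sub_le (a : ℤ) (k : ℕ) {e : ℕ} (he : 0 < e) (v : ℤ) :
    |(((Ico a (a + k)).filter (· ≡ v [ZMOD e])).card : ℝ) - (k : ℝ) / e| ≤ 1 := by
  have he' : (0 : ℤ) < e := by exact_mod_cast he
  have h := Int.Ico_filter_modEq_card a (a + k) he' v
  have he0 : (0 : ℚ) < e := by exact_mod_cast he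
  set A : ℚ := ((a + k : ℤ) - v : ℚ) / ((e : ℤ) : ℚ) with hA
  set B : ℚ := ((a : ℤ) - v : ℚ) / ((e : ℤ) : ℚ) with hB
  have hAB : A - B = (k : ℚ) / e := by
    rw [hA, hB]; push_cast; field_simp; ring
  have hle : B ≤ A := by
    have : (0 : ℚ) ≤ (k : ℚ) / e := by positivity
    linarith
  have hmax : max (⌈A⌉ - ⌈B⌉) 0 = ⌈A⌉ - ⌈B⌉ :=
    max_eq_left (by linarith [Int.ceil_le_ceil hle])
  rw [hmax] at h
  have h1 := Int.ceil_lt_add_one A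
  have h2 := Int.le_ceil A
  have h3 := Int.ceil_lt_add_one B
  have h4 := Int.le_ceil B
  have h5 : |((((Ico a (a + k)).filter (· ≡ v [ZMOD e])).card : ℤ) : ℚ) - (k : ℚ) / e| ≤ 1 := by
    rw [h, abs_le]; push_cast
    constructor <;> linarith
  have h6 : ((|((((Ico a (a + k)).filter (· ≡ v [ZMOD e])).card : ℤ) : ℚ) - (k : ℚ) / e| : ℚ) : ℝ)
      ≤ 1 := by exact_mod_cast h5
  push_cast at h6
  exact h6

open Classical in
/-- Counting the points of a box satisfying a congruence condition. -/
lemma abs_card_box_sub_le (a b : ℤ) (k l : ℕ) {e : ℕ} (he : 0 < e) {P : ℤ × ℤ → Prop}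
    (hP : IsPeriodic e P) :
    |(((Ico a (a + k) ×ˢ Ico b (b + l)).filter P).card : ℝ)
      - (k : ℝ) * l * (classCount e P / (e : ℝ) ^ 2)|
      ≤ classCount e P * (((k : ℝ) + l) / e + 1) := by
  set R := (range e ×ˢ range e).filter (fun z => P ((z.1 : ℤ), (z.2 : ℤ))) with hR
  have he' : (0 : ℤ) < e := by exact_mod_cast he
  have he0 : (0 : ℝ) < e := by exact_mod_cast he
  have hmap : ∀ x ∈ (Ico a (a + k) ×ˢ Ico b (b + l)).filter P,
      ((fun x : ℤ × ℤ => ((x.1 % (e : ℤ)).toNat, (x.2 % (e : ℤ)).toNat)) x) ∈ R := by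
    intro x hx
    have h1 := Int.emod_nonneg x.1 he'.ne'
    have h2 := Int.emod_nonneg x.2 he'.ne'
    have h3 := Int.emod_lt_of_pos x.1 he'
    have h4 := Int.emod_lt_of_pos x.2 he'
    refine mem_filter.2 ⟨mem_product.2 ⟨mem_range.2 ?_, mem_range.2 ?_⟩, ?_⟩
    · show (x.1 % (e : ℤ)).toNat < e
      omega
    · show (x.2 % (e : ℤ)).toNat < e
      omega
    refine (hP _ x ?_ ?_).2 (mem_filter.1 hx).2
    · simp only [Int.toNat_of_nonneg h1]; exact Int.mod_modEq _ _
    · simp only [Int.toNat_of_nonneg h2]; exact Int.mod_modEq _ _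
  have hcard := card_eq_sum_card_fiberwise hmap
  have hfib : ∀ z ∈ R, (((Ico a (a + k) ×ˢ Ico b (b + l)).filter P).filter
      (fun x => ((x.1 % (e : ℤ)).toNat, (x.2 % (e : ℤ)).toNat) = z)).card =
      ((Ico a (a + k)).filter (· ≡ z.1 [ZMOD e])).card *
        ((Ico b (b + l)).filter (· ≡ z.2 [ZMOD e])).card := by
    intro z hz
    obtain ⟨hz1, hz2⟩ := mem_filter.1 hz
    obtain ⟨hz3, hz4⟩ := mem_product.1 hz1
    rw [mem_range] at hz3 hz4
    rw [← card_product]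
    congr 1
    ext x
    have key : ∀ (u : ℤ) (i : ℕ), i < e → ((u % e).toNat = i ↔ u ≡ i [ZMOD e]) := by
      intro u i hi
      have h1 := Int.emod_nonneg u he'.ne'
      have h2 : ((i : ℤ)) % e = i := Int.emod_eq_of_lt (by omega) (by omega)
      unfold Int.ModEq
      rw [h2]
      omega
    simp only [mem_filter, mem_product, Prod.ext_iff]
    rw [key _ _ hz3, key _ _ hz4]
    constructor
    · rintro ⟨⟨⟨h1, h2⟩, h3⟩, h4, h5⟩; exact ⟨⟨h1, h4⟩, h2, h5⟩
    · rintro ⟨⟨h1, h4⟩, h2, h5⟩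
      exact ⟨⟨⟨h1, h2⟩, (hP x ((z.1 : ℤ), (z.2 : ℤ)) h4 h5).2 hz2⟩, h4, h5⟩
  rw [hcard, sum_congr rfl hfib]
  have hcc : classCount e P = R.card := rfl
  rw [hcc]
  push_cast
  have e1 : (k : ℝ) * l * ((R.card : ℝ) / (e : ℝ) ^ 2) = ∑ z ∈ R, (k : ℝ) / e * ((l : ℝ) / e) := by
    rw [sum_const, nsmul_eq_mul]; field_simp
  rw [e1, ← sum_sub_distrib]
  refine (abs_sum_le_sum_abs _ _).trans ?_
  rw [← nsmul_eq_mul, ← sum_const]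
  apply sum_le_sum
  intro z _
  have h1 := abs_card_Ico_modEq_sub_le a k he (z.1 : ℤ)
  have h2 := abs_card_Ico_modEq_sub_le b l he (z.2 : ℤ)
  set u : ℝ := (((Ico a (a + k)).filter (· ≡ (z.1 : ℤ) [ZMOD e])).card : ℝ)
  set v : ℝ := (((Ico b (b + l)).filter (· ≡ (z.2 : ℤ) [ZMOD e])).card : ℝ)
  have e2 : u * v - (k : ℝ) / e * ((l : ℝ) / e) = (u - (k : ℝ) / e) * (v - (l : ℝ) / e)
      + (k : ℝ) / e * (v - (l : ℝ) / e) + (u - (k : ℝ) / e) * ((l : ℝ) / e) := by ring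
  have hk : (0 : ℝ) ≤ (k : ℝ) / e := by positivity
  have hl : (0 : ℝ) ≤ (l : ℝ) / e := by positivity
  rw [e2]
  calc _ ≤ |u - (k : ℝ) / e| * |v - (l : ℝ) / e| + (k : ℝ) / e * |v - (l : ℝ) / e|
        + |u - (k : ℝ) / e| * ((l : ℝ) / e) := by
        refine (abs_add_le _ _).trans (add_le_add ((abs_add_le _ _).trans (add_le_add ?_ ?_)) ?_)
        · rw [abs_mul]
        · rw [abs_mul, abs_of_nonneg hk]
        · rw [abs_mul, abs_of_nonneg hl]
    _ ≤ 1 * 1 + (k : ℝ) / e * 1 + 1 * ((l : ℝ) / e) := by gcongr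
    _ = _ := by ring

lemma IsPeriodic.of_dvd {e e' : ℕ} (h : e ∣ e') {P : ℤ × ℤ → Prop} (hP : IsPeriodic e P) :
    IsPeriodic e' P := fun x y h1 h2 =>
  hP x y (h1.of_dvd (by exact_mod_cast h)) (h2.of_dvd (by exact_mod_cast h))

lemma IsPeriodic.and {e : ℕ} {P Q : ℤ × ℤ → Prop} (hP : IsPeriodic e P) (hQ : IsPeriodic e Q) :
    IsPeriodic e (fun x => P x ∧ Q x) := fun x y h1 h2 => and_congr (hP x y h1 h2) (hQ x y h1 h2)

/-- The Chinese remainder theorem for counts of residue classes. -/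
lemma classCount_mul {e₁ e₂ : ℕ} (h1 : 0 < e₁) (h2 : 0 < e₂) (hco : e₁.Coprime e₂)
    {P Q : ℤ × ℤ → Prop} (hP : IsPeriodic e₁ P) (hQ : IsPeriodic e₂ Q) :
    classCount (e₁ * e₂) (fun x => P x ∧ Q x) = classCount e₁ P * classCount e₂ Q := by
  classical
  unfold classCount
  rw [← card_product]
  have hP' : ∀ (i j : ℕ), P ((i : ℤ), (j : ℤ)) ↔ P (((i % e₁ : ℕ) : ℤ), ((j % e₁ : ℕ) : ℤ)) := by
    intro i j
    apply hP
    · push_cast; exact (Int.mod_modEq _ _).symm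
    · push_cast; exact (Int.mod_modEq _ _).symm
  have hQ' : ∀ (i j : ℕ), Q ((i : ℤ), (j : ℤ)) ↔ Q (((i % e₂ : ℕ) : ℤ), ((j % e₂ : ℕ) : ℤ)) := by
    intro i j
    apply hQ
    · push_cast; exact (Int.mod_modEq _ _).symm
    · push_cast; exact (Int.mod_modEq _ _).symm
  have huniq : ∀ i j, i < e₁ * e₂ → j < e₁ * e₂ → i % e₁ = j % e₁ → i % e₂ = j % e₂ → i = j := by
    intro i j hi hj ha hb
    have := (Nat.modEq_and_modEq_iff_modEq_mul hco).1 ⟨ha, hb⟩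
    exact Nat.ModEq.eq_of_lt_of_lt this hi hj
  apply card_bij (fun z _ => ((z.1 % e₁, z.2 % e₁), (z.1 % e₂, z.2 % e₂)))
  · intro z hz
    simp only [mem_filter, mem_product, mem_range] at hz ⊢
    obtain ⟨-, h3, h4⟩ := hz
    exact ⟨⟨⟨Nat.mod_lt _ h1, Nat.mod_lt _ h1⟩, (hP' _ _).1 h3⟩,
      ⟨⟨Nat.mod_lt _ h2, Nat.mod_lt _ h2⟩, (hQ' _ _).1 h4⟩⟩
  · intro z hz z' hz' h
    simp only [mem_filter, mem_product, mem_range] at hz hz'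
    simp only [Prod.mk.injEq] at h
    exact Prod.ext (huniq _ _ hz.1.1 hz'.1.1 h.1.1 h.2.1) (huniq _ _ hz.1.2 hz'.1.2 h.1.2 h.2.2)
  · rintro ⟨⟨i, j⟩, ⟨i', j'⟩⟩ hz
    simp only [mem_filter, mem_product, mem_range] at hz
    obtain ⟨⟨⟨hi, hj⟩, h3⟩, ⟨⟨hi', hj'⟩, h4⟩⟩ := hz
    set m := Nat.chineseRemainder hco i i' with hm
    set n := Nat.chineseRemainder hco j j' with hn
    have e1 : (m : ℕ) % e₁ = i := by
      have := m.2.1; unfold Nat.ModEq at this; rw [this, Nat.mod_eq_of_lt hi]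
    have e2 : (m : ℕ) % e₂ = i' := by
      have := m.2.2; unfold Nat.ModEq at this; rw [this, Nat.mod_eq_of_lt hi']
    have e3 : (n : ℕ) % e₁ = j := by
      have := n.2.1; unfold Nat.ModEq at this; rw [this, Nat.mod_eq_of_lt hj]
    have e4 : (n : ℕ) % e₂ = j' := by
      have := n.2.2; unfold Nat.ModEq at this; rw [this, Nat.mod_eq_of_lt hj']
    refine ⟨((m : ℕ), (n : ℕ)), ?_, ?_⟩
    · simp only [mem_filter, mem_product, mem_range]
      refine ⟨⟨Nat.chineseRemainder_lt_mul hco _ _ h1.ne' h2.ne',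
        Nat.chineseRemainder_lt_mul hco _ _ h1.ne' h2.ne'⟩, ?_, ?_⟩
      · rw [hP', e1, e3]; exact h3
      · rw [hQ', e2, e4]; exact h4
    · simp only [e1, e2, e3, e4]

lemma IsPeriodic.forall_prod {ι : Type*} {T : Finset ι} {e : ι → ℕ} {P : ι → ℤ × ℤ → Prop}
    (hP : ∀ i ∈ T, IsPeriodic (e i) (P i)) :
    IsPeriodic (∏ i ∈ T, e i) (fun x => ∀ i ∈ T, P i x) := fun x y h1 h2 =>
  forall₂_congr fun i hi => (hP i hi).of_dvd (dvd_prod_of_mem e hi) x y h1 h2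

lemma classCount_prod {ι : Type*} (T : Finset ι) (e : ι → ℕ) (P : ι → ℤ × ℤ → Prop)
    (he : ∀ i ∈ T, 0 < e i) (hco : ∀ i ∈ T, ∀ j ∈ T, i ≠ j → (e i).Coprime (e j))
    (hP : ∀ i ∈ T, IsPeriodic (e i) (P i)) :
    classCount (∏ i ∈ T, e i) (fun x => ∀ i ∈ T, P i x) = ∏ i ∈ T, classCount (e i) (P i) := by
  classical
  induction T using Finset.induction_on with
  | empty => simp [classCount]
  | insert a T ha ih =>
    have hT := ih (fun i hi => he i (mem_insert_of_mem hi))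
      (fun i hi j hj => hco i (mem_insert_of_mem hi) j (mem_insert_of_mem hj))
      (fun i hi => hP i (mem_insert_of_mem hi))
    rw [prod_insert ha, prod_insert ha, ← hT]
    have hiff : (fun x => ∀ i ∈ insert a T, P i x) = fun x => P a x ∧ ∀ i ∈ T, P i x := by
      funext x; simp only [forall_mem_insert]
    rw [hiff]
    refine classCount_mul (he a (mem_insert_self _ _))
      (prod_pos fun i hi => he i (mem_insert_of_mem hi)) ?_ (hP a (mem_insert_self _ _))
      (IsPeriodic.forall_prod fun i hi => hP i (mem_insert_of_mem hi))
    exact Nat.Coprime.prod_right fun i hi => hco a (mem_insert_self _ _) i (mem_insert_of_mem hi)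
      fun h => ha (h ▸ hi)

/-- The linear map with columns `v₁` and `v₂`. -/
def columnsMap (v₁ v₂ : ℤ × ℤ) (z : ℤ × ℤ) : ℤ × ℤ :=
  (z.1 * v₁.1 + z.2 * v₂.1, z.1 * v₁.2 + z.2 * v₂.2)

lemma IsPeriodic.comp_columnsMap {e : ℕ} {P : ℤ × ℤ → Prop} (hP : IsPeriodic e P)
    (v₁ v₂ : ℤ × ℤ) : IsPeriodic e (fun z => P (columnsMap v₁ v₂ z)) := fun _ _ h1 h2 =>
  hP _ _ ((h1.mul_right _).add (h2.mul_right _)) ((h1.mul_right _).add (h2.mul_right _))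

/-- A matrix whose determinant is invertible modulo e permutes the residue classes. Thus local
densities on a sublattice agree with those on ℤ² at moduli coprime to the index. -/
lemma classCount_comp_columnsMap {e : ℕ} (he : 0 < e) {P : ℤ × ℤ → Prop} (hP : IsPeriodic e P)
    (v₁ v₂ : ℤ × ℤ) (hdet : IsCoprime (v₁.1 * v₂.2 - v₁.2 * v₂.1) (e : ℤ)) :
    classCount e (fun z => P (columnsMap v₁ v₂ z)) = classCount e P := by
  classical
  unfold classCount
  have he' : (0 : ℤ) < e := by exact_mod_cast he
  set S := range e ×ˢ range e with hS
  set g : ℕ × ℕ → ℕ × ℕ := fun z =>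
    (((columnsMap v₁ v₂ ((z.1 : ℤ), (z.2 : ℤ))).1 % e).toNat,
      ((columnsMap v₁ v₂ ((z.1 : ℤ), (z.2 : ℤ))).2 % e).toNat) with hg
  have hcast : ∀ u : ℤ, (((u % e).toNat : ℕ) : ℤ) ≡ u [ZMOD e] := fun u => by
    rw [Int.toNat_of_nonneg (Int.emod_nonneg u he'.ne')]; exact Int.mod_modEq _ _
  have hgS : ∀ z, g z ∈ S := by
    intro z
    have h1 := Int.emod_nonneg (columnsMap v₁ v₂ ((z.1 : ℤ), (z.2 : ℤ))).1 he'.ne'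
    have h2 := Int.emod_nonneg (columnsMap v₁ v₂ ((z.1 : ℤ), (z.2 : ℤ))).2 he'.ne'
    have h3 := Int.emod_lt_of_pos (columnsMap v₁ v₂ ((z.1 : ℤ), (z.2 : ℤ))).1 he'
    have h4 := Int.emod_lt_of_pos (columnsMap v₁ v₂ ((z.1 : ℤ), (z.2 : ℤ))).2 he'
    refine mem_product.2 ⟨mem_range.2 ?_, mem_range.2 ?_⟩
    · simp only [hg]; omega
    · simp only [hg]; omega
  have hinj : Set.InjOn g S := by
    intro z hz z' hz' h
    have hz1 := mem_range.1 (mem_product.1 hz).1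
    have hz2 := mem_range.1 (mem_product.1 hz).2
    have hz1' := mem_range.1 (mem_product.1 hz').1
    have hz2' := mem_range.1 (mem_product.1 hz').2
    have h1 : (columnsMap v₁ v₂ ((z.1 : ℤ), (z.2 : ℤ))).1 ≡
        (columnsMap v₁ v₂ ((z'.1 : ℤ), (z'.2 : ℤ))).1 [ZMOD e] := by
      refine (hcast _).symm.trans (Int.ModEq.trans ?_ (hcast _))
      rw [show ((columnsMap v₁ v₂ ((z.1 : ℤ), (z.2 : ℤ))).1 % e).toNat =
        ((columnsMap v₁ v₂ ((z'.1 : ℤ), (z'.2 : ℤ))).1 % e).toNat from congrArg Prod.fst h]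
    have h2 : (columnsMap v₁ v₂ ((z.1 : ℤ), (z.2 : ℤ))).2 ≡
        (columnsMap v₁ v₂ ((z'.1 : ℤ), (z'.2 : ℤ))).2 [ZMOD e] := by
      refine (hcast _).symm.trans (Int.ModEq.trans ?_ (hcast _))
      rw [show ((columnsMap v₁ v₂ ((z.1 : ℤ), (z.2 : ℤ))).2 % e).toNat =
        ((columnsMap v₁ v₂ ((z'.1 : ℤ), (z'.2 : ℤ))).2 % e).toNat from congrArg Prod.snd h]
    have d1 := h1.dvd
    have d2 := h2.dvd
    simp only [columnsMap] at d1 d2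
    have d3 : (e : ℤ) ∣ (v₁.1 * v₂.2 - v₁.2 * v₂.1) * ((z'.1 : ℤ) - z.1) := by
      obtain ⟨c1, hc1⟩ := d1
      obtain ⟨c2, hc2⟩ := d2
      exact ⟨c1 * v₂.2 - c2 * v₂.1, by linear_combination v₂.2 * hc1 - v₂.1 * hc2⟩
    have d4 : (e : ℤ) ∣ (v₁.1 * v₂.2 - v₁.2 * v₂.1) * ((z'.2 : ℤ) - z.2) := by
      obtain ⟨c1, hc1⟩ := d1
      obtain ⟨c2, hc2⟩ := d2
      exact ⟨c2 * v₁.1 - c1 * v₁.2, by linear_combination v₁.1 * hc2 - v₁.2 * hc1⟩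
    have d5 := hdet.symm.dvd_of_dvd_mul_left d3
    have d6 := hdet.symm.dvd_of_dvd_mul_left d4
    have e5 := Int.eq_zero_of_abs_lt_dvd d5 (by rw [abs_lt]; constructor <;> omega)
    have e6 := Int.eq_zero_of_abs_lt_dvd d6 (by rw [abs_lt]; constructor <;> omega)
    exact Prod.ext (by omega) (by omega)
  have himg : S.image g = S :=
    eq_of_subset_of_card_le (fun z hz => by
      obtain ⟨y, -, rfl⟩ := mem_image.1 hz; exact hgS y)
      (by rw [card_image_of_injOn hinj])
  have hiff : ∀ z : ℕ × ℕ, P (columnsMap v₁ v₂ ((z.1 : ℤ), (z.2 : ℤ))) ↔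
      P (((g z).1 : ℤ), ((g z).2 : ℤ)) := fun z => hP _ _ (hcast _).symm (hcast _).symm
  have himg' : (S.filter fun z => P (columnsMap v₁ v₂ ((z.1 : ℤ), (z.2 : ℤ)))).image g =
      S.filter fun z => P ((z.1 : ℤ), (z.2 : ℤ)) := by
    ext z
    simp only [mem_image, mem_filter]
    constructor
    · rintro ⟨y, ⟨-, hy⟩, rfl⟩; exact ⟨hgS y, (hiff y).1 hy⟩
    · rintro ⟨hz, hPz⟩
      obtain ⟨y, hy, rfl⟩ := mem_image.1 (himg.symm ▸ hz)
      exact ⟨y, ⟨hy, (hiff y).2 hPz⟩, rfl⟩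
  rw [← himg', card_image_of_injOn (hinj.mono fun z hz => (mem_filter.1 hz).1)]

/-- A linear form with one coefficient invertible modulo `n` has `n` zeros modulo `n`. -/
lemma classCount_linear {n : ℕ} (hn : 0 < n) (α β : ℤ)
    (h : IsCoprime α (n : ℤ) ∨ IsCoprime β (n : ℤ)) :
    classCount n (fun x => (n : ℤ) ∣ α * x.1 + β * x.2) = n := by
  classical
  have hn' : (0 : ℤ) < n := by exact_mod_cast hn
  have key : ∀ α β : ℤ, IsCoprime α (n : ℤ) → ∀ t : ℕ,
      ∃! s : ℕ, s < n ∧ (n : ℤ) ∣ α * s + β * t := by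
    rintro α β ⟨u, v, huv⟩ t
    refine ⟨((-(u * β * t)) % n).toNat, ⟨?_, ?_⟩, ?_⟩
    · have h1 := Int.emod_nonneg (-(u * β * t)) hn'.ne'
      have h2 := Int.emod_lt_of_pos (-(u * β * t)) hn'
      omega
    · rw [Int.toNat_of_nonneg (Int.emod_nonneg _ hn'.ne'), Int.emod_def]
      refine ⟨v * β * t - α * ((-(u * β * t)) / n), ?_⟩
      linear_combination (-β * t) * huv
    · rintro s ⟨h1, h2⟩
      have h3 := Int.emod_nonneg (-(u * β * t)) hn'.ne'
      have h4 := Int.emod_lt_of_pos (-(u * β * t)) hn'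
      have h5 : (n : ℤ) ∣ (s : ℤ) - (-(u * β * t)) % n := by
        rw [Int.emod_def]
        obtain ⟨c, hc⟩ := h2
        refine ⟨u * c + v * s + (-(u * β * t)) / n, ?_⟩
        linear_combination u * hc - (s : ℤ) * huv
      have h6 := Int.eq_zero_of_abs_lt_dvd h5 (by rw [abs_lt]; constructor <;> omega)
      omega
  unfold classCount
  rcases h with h | h
  · choose s hs hu using key α β h
    refine Eq.trans (Eq.symm ?_) (card_range n)
    apply card_bij (fun t _ => (s t, t))
    · intro t ht
      simp only [mem_filter, mem_product, mem_range] at ht ⊢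
      exact ⟨⟨(hs t).1, ht⟩, (hs t).2⟩
    · intro t _ t' _ h; exact congrArg Prod.snd h
    · rintro ⟨i, j⟩ hz
      simp only [mem_filter, mem_product, mem_range] at hz
      obtain ⟨⟨h3, h4⟩, h2⟩ := hz
      exact ⟨j, by simpa using h4, Prod.ext (hu j i ⟨h3, h2⟩).symm rfl⟩
  · choose s hs hu using key β α h
    refine Eq.trans (Eq.symm ?_) (card_range n)
    apply card_bij (fun t _ => (t, s t))
    · intro t ht
      simp only [mem_filter, mem_product, mem_range] at ht ⊢
      exact ⟨⟨ht, (hs t).1⟩, by rw [add_comm]; exact (hs t).2⟩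
    · intro t _ t' _ h; exact congrArg Prod.fst h
    · rintro ⟨i, j⟩ hz
      simp only [mem_filter, mem_product, mem_range] at hz
      obtain ⟨⟨h3, h4⟩, h2⟩ := hz
      exact ⟨i, by simpa using h3, Prod.ext rfl (hu i j ⟨h4, by
        rwa [add_comm] at h2⟩).symm⟩

end ClassCount

/-! ### Binary forms and their dehomogenisations. -/

section FormAlgebra
open Polynomial

/-- The polynomial `F(x, 1)`. -/
noncomputable def dehomogenize (F : MvPolynomial (Fin 2) ℤ) : ℤ[X] := MvPolynomial.aeval ![X, 1] F

variable {F : MvPolynomial (Fin 2) ℤ} {d : ℕ}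

lemma homogenize_dehomogenize (h : F.IsHomogeneous d) : (dehomogenize F).homogenize d = F :=
  homogenize_eq_of_isHomogeneous h rfl

lemma natDegree_dehomogenize_le (h : F.IsHomogeneous d) : (dehomogenize F).natDegree ≤ d := by
  unfold dehomogenize
  rw [MvPolynomial.aeval_def, MvPolynomial.eval₂_eq']
  refine natDegree_sum_le_of_forall_le _ _ fun m hm => ?_
  have h1 : m 0 + m 1 = d := by
    have := h (MvPolynomial.mem_support_iff.1 hm)
    simpa [Finsupp.weight_apply, Finsupp.sum_fintype, Fin.sum_univ_two] using this
  simp only [Fin.prod_univ_two, Matrix.cons_val_zero, Matrix.cons_val_one, one_pow, mul_one]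
  refine (natDegree_C_mul_X_pow_le (MvPolynomial.coeff m F) (m 0)).trans (by omega)

/-- Expresses values of the form, in any commutative ring, through the coefficients of F(x, 1); the
scaling and specialisation rules that follow come from it. -/
lemma aeval_eq_sum_dehomogenize (h : F.IsHomogeneous d) {A : Type*} [CommRing A] (s t : A) :
    MvPolynomial.aeval ![s, t] F =
      ∑ k ∈ Finset.range (d + 1), ((dehomogenize F).coeff k : A) * s ^ k * t ^ (d - k) := by
  conv_lhs => rw [← homogenize_dehomogenize h]
  simp only [homogenize, map_sum, Finset.Nat.sum_antidiagonal_eq_sum_range_succ_mk]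
  refine Finset.sum_congr rfl fun k _ => ?_
  rw [MvPolynomial.aeval_monomial, Finsupp.update_eq_add_single (by simp),
    Finsupp.prod_add_index' (by simp) (fun _ => pow_add _),
    Finsupp.prod_single_index (by simp), Finsupp.prod_single_index (by simp)]
  simp [mul_assoc]

lemma leadCoeffX_eq_coeff (h : F.IsHomogeneous d) :
    leadCoeffX F = (dehomogenize F).coeff d := by
  have h1 := aeval_eq_sum_dehomogenize h (1 : ℤ) 0
  rw [Finset.sum_range_succ, Finset.sum_eq_zero] at h1
  · simpa [leadCoeffX, MvPolynomial.aeval_eq_eval] using h1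
  · intro k hk
    have := Finset.mem_range.1 hk
    rw [zero_pow (by omega), mul_zero]

lemma aeval_apply_zero (h : F.IsHomogeneous d) {A : Type*} [CommRing A] (s : A) :
    MvPolynomial.aeval ![s, 0] F = (leadCoeffX F : A) * s ^ d := by
  rw [aeval_eq_sum_dehomogenize h, Finset.sum_range_succ, Finset.sum_eq_zero,
    leadCoeffX_eq_coeff h]
  · simp
  · intro k hk
    have := Finset.mem_range.1 hk
    rw [zero_pow (by omega), mul_zero]

lemma aeval_mul_apply (h : F.IsHomogeneous d) {A : Type*} [CommRing A] (c s t : A) :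
    MvPolynomial.aeval ![c * s, c * t] F = c ^ d * MvPolynomial.aeval ![s, t] F := by
  rw [aeval_eq_sum_dehomogenize h, aeval_eq_sum_dehomogenize h, Finset.mul_sum]
  refine Finset.sum_congr rfl fun k hk => ?_
  have := Finset.mem_range.1 hk
  rw [mul_pow, mul_pow, show c ^ d = c ^ k * c ^ (d - k) by rw [← pow_add]; congr 1; omega]
  ring

lemma aeval_apply_one {A : Type*} [CommRing A] (s : A) :
    MvPolynomial.aeval ![s, 1] F = aeval s (dehomogenize F) := by
  unfold dehomogenize
  have : (MvPolynomial.aeval ![s, 1] : MvPolynomial (Fin 2) ℤ →ₐ[ℤ] A) =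
      (aeval s).comp (MvPolynomial.aeval ![X, 1]) := by
    ext i; fin_cases i <;> simp
  rw [this]; rfl

lemma aeval_intCast {A : Type*} [CommRing A] (s t : ℤ) :
    MvPolynomial.aeval ![(s : A), (t : A)] F = ((MvPolynomial.eval ![s, t] F : ℤ) : A) := by
  have : (MvPolynomial.aeval ![(s : A), (t : A)] : MvPolynomial (Fin 2) ℤ →ₐ[ℤ] A) =
      (Algebra.ofId ℤ A).comp (MvPolynomial.aeval ![s, t]) := by
    ext i; fin_cases i <;> simp
  rw [this, AlgHom.comp_apply, MvPolynomial.aeval_eq_eval]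
  simp

lemma map_eq_homogenize (h : F.IsHomogeneous d) :
    MvPolynomial.map (Int.castRingHom ℚ) F =
      ((dehomogenize F).map (Int.castRingHom ℚ)).homogenize d := by
  rw [homogenize_map, homogenize_dehomogenize h]

lemma natDegree_dehomogenize_map (h : F.IsHomogeneous d) (hb : leadCoeffX F ≠ 0) :
    ((dehomogenize F).map (Int.castRingHom ℚ)).natDegree = d := by
  refine le_antisymm ((natDegree_map_le).trans (natDegree_dehomogenize_le h)) ?_
  apply le_natDegree_of_ne_zero
  rw [coeff_map, ← leadCoeffX_eq_coeff h]
  simpa using hb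

lemma isUnit_of_isUnit_homogenize {g : ℚ[X]} {n : ℕ} (hn : g.natDegree ≤ n)
    (h : IsUnit (g.homogenize n)) : IsUnit g := by
  have := h.map (MvPolynomial.aeval (R := ℚ) ![(X : ℚ[X]), 1])
  rwa [aeval_homogenize_X_one g hn] at this

/-- Since F(1, 0) ≠ 0, dehomogenising preserves the degree, so a factorisation of F(x, 1)
homogenises to one of F. -/
lemma irreducible_dehomogenize (h : F.IsHomogeneous d)
    (hirr : Irreducible (MvPolynomial.map (Int.castRingHom ℚ) F)) (hb : leadCoeffX F ≠ 0) :
    Irreducible ((dehomogenize F).map (Int.castRingHom ℚ)) := by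
  have hd := natDegree_dehomogenize_map h hb
  rw [map_eq_homogenize h] at hirr
  set f := (dehomogenize F).map (Int.castRingHom ℚ)
  constructor
  · intro hu
    obtain ⟨c, hc, hcf⟩ := isUnit_iff.1 hu
    have hd0 : d = 0 := by rw [← hd, ← hcf, natDegree_C]
    apply hirr.not_isUnit
    rw [← hcf, homogenize_C, hd0, pow_zero, mul_one]
    exact hc.map _
  · intro a b hab
    have hne : f ≠ 0 := by
      intro h0; exact hirr.ne_zero (by rw [h0, homogenize_zero])
    have ha : a ≠ 0 := by rintro rfl; exact hne (by rw [hab, zero_mul])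
    have hb' : b ≠ 0 := by rintro rfl; exact hne (by rw [hab, mul_zero])
    have hdeg : d = a.natDegree + b.natDegree := by rw [← hd, hab, natDegree_mul ha hb']
    have h1 := hirr.isUnit_or_isUnit (a := a.homogenize a.natDegree)
      (b := b.homogenize b.natDegree) (by
        rw [← homogenize_mul _ _ le_rfl le_rfl, ← hab, hdeg])
    exact h1.imp (isUnit_of_isUnit_homogenize le_rfl) (isUnit_of_isUnit_homogenize le_rfl)

/-- Over ℚ a form of degree zero is zero or a unit. -/
lemma degree_pos (h : F.IsHomogeneous d)
    (hirr : Irreducible (MvPolynomial.map (Int.castRingHom ℚ) F)) : 0 < d := by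
  rcases Nat.eq_zero_or_pos d with rfl | h0
  · exfalso
    have h1 := map_eq_homogenize h
    have h2 : ((dehomogenize F).map (Int.castRingHom ℚ)).natDegree ≤ 0 :=
      (natDegree_map_le).trans (natDegree_dehomogenize_le h)
    rw [eq_C_of_natDegree_le_zero h2, homogenize_C, pow_zero, mul_one] at h1
    rw [h1] at hirr
    have h3 := hirr.ne_zero
    refine hirr.not_isUnit (IsUnit.map _ (isUnit_iff_ne_zero.2 ?_))
    intro h4; rw [h4, map_zero] at h3; exact h3 rfl
  · exact h0

/-- An irreducible form vanishing at `(1, 0)` is a multiple of `y`. -/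
lemma eq_const_of_leadCoeffX_eq_zero (h : F.IsHomogeneous d)
    (hirr : Irreducible (MvPolynomial.map (Int.castRingHom ℚ) F)) (hb : leadCoeffX F = 0) :
    d = 1 ∧ ∃ c : ℤ, c ≠ 0 ∧ dehomogenize F = C c := by
  have hd := degree_pos h hirr
  have hle : (dehomogenize F).natDegree ≤ d - 1 := by
    have h1 := natDegree_dehomogenize_le h
    by_contra hcon
    have h2 : (dehomogenize F).natDegree = d := by omega
    have h3 : dehomogenize F ≠ 0 := by rintro h0; rw [h0, natDegree_zero] at h2; omega
    apply h3
    rw [← leadingCoeff_eq_zero, leadingCoeff, h2, ← leadCoeffX_eq_coeff h, hb]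
  rw [map_eq_homogenize h] at hirr
  have hle' : ((dehomogenize F).map (Int.castRingHom ℚ)).natDegree ≤ d - 1 :=
    (natDegree_map_le).trans hle
  have hX : ¬ IsUnit (MvPolynomial.X 1 : MvPolynomial (Fin 2) ℚ) := by
    intro hu
    have := hu.map (MvPolynomial.aeval (R := ℚ) ![(0 : ℚ), 0])
    simp at this
  have h1 := hirr.isUnit_or_isUnit
    (a := ((dehomogenize F).map (Int.castRingHom ℚ)).homogenize (d - 1))
    (b := (1 : ℚ[X]).homogenize 1) (by
      rw [← homogenize_mul _ _ hle' (by simp), mul_one, Nat.sub_add_cancel hd])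
  rw [homogenize_one, pow_one] at h1
  have h2 := h1.resolve_right hX
  have h3 := isUnit_of_isUnit_homogenize hle' h2
  have h4 : ((dehomogenize F).map (Int.castRingHom ℚ)).natDegree = 0 := natDegree_eq_zero_of_isUnit h3
  have hinj : Function.Injective (Int.castRingHom ℚ) := Int.cast_injective
  rw [natDegree_map_eq_of_injective hinj] at h4
  obtain ⟨c, hc⟩ := natDegree_eq_zero.1 h4
  rw [← hc] at h2 h3
  rw [map_C] at h2 h3
  refine ⟨?_, c, ?_, hc.symm⟩
  · by_contra hd1
    rw [homogenize_C] at h2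
    have h5 := isUnit_of_mul_isUnit_right h2
    exact hX ((isUnit_pow_iff (by omega)).1 h5)
  · rintro rfl
    rw [map_zero, map_zero] at h3
    exact not_isUnit_zero h3

lemma eval_of_leadCoeffX_eq_zero (h : F.IsHomogeneous d)
    (hirr : Irreducible (MvPolynomial.map (Int.castRingHom ℚ) F)) (hb : leadCoeffX F = 0) :
    d = 1 ∧ ∃ c : ℤ, c ≠ 0 ∧ MvPolynomial.eval ![0, 1] F = c ∧ dehomogenize F = C c ∧
      ∀ s t : ℤ, MvPolynomial.eval ![s, t] F = c * t := by
  obtain ⟨rfl, c, hc, hf⟩ := eq_const_of_leadCoeffX_eq_zero h hirr hb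
  have key : ∀ s t : ℤ, MvPolynomial.eval ![s, t] F = c * t := by
    intro s t
    have := aeval_eq_sum_dehomogenize h s t
    rw [MvPolynomial.aeval_eq_eval] at this
    rw [this, hf]
    rw [Finset.sum_range_succ, Finset.sum_range_one, coeff_C_zero,
      coeff_C_of_ne_zero one_ne_zero]
    simp
  exact ⟨rfl, c, hc, by simpa using key 0 1, hf, key⟩

/-- Two coprime irreducible forms satisfy a Bézout identity at `(x, 1)`. -/
lemma exists_bezout_dehomogenize {F₁ F₂ : MvPolynomial (Fin 2) ℤ} {d₁ d₂ : ℕ}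
    (h₁ : F₁.IsHomogeneous d₁) (h₂ : F₂.IsHomogeneous d₂)
    (hirr₁ : Irreducible (MvPolynomial.map (Int.castRingHom ℚ) F₁))
    (hirr₂ : Irreducible (MvPolynomial.map (Int.castRingHom ℚ) F₂))
    (hcop : IsRelPrime (MvPolynomial.map (Int.castRingHom ℚ) F₁)
      (MvPolynomial.map (Int.castRingHom ℚ) F₂)) :
    ∃ (m : ℤ) (U V : ℤ[X]), m ≠ 0 ∧ U * dehomogenize F₁ + V * dehomogenize F₂ = C m := by
  by_cases hb₁ : leadCoeffX F₁ = 0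
  · obtain ⟨-, c, hc, hf⟩ := eq_const_of_leadCoeffX_eq_zero h₁ hirr₁ hb₁
    exact ⟨c, 1, 0, hc, by rw [hf]; simp⟩
  by_cases hb₂ : leadCoeffX F₂ = 0
  · obtain ⟨-, c, hc, hf⟩ := eq_const_of_leadCoeffX_eq_zero h₂ hirr₂ hb₂
    exact ⟨c, 0, 1, hc, by rw [hf]; simp⟩
  have i₁ := irreducible_dehomogenize h₁ hirr₁ hb₁
  have i₂ := irreducible_dehomogenize h₂ hirr₂ hb₂
  -- A common factor would make F₁(x, 1) divide F₂(x, 1), by irreducibility. Homogenising in the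
  -- correct degrees contradicts coprimality of the forms.
  have hco : IsCoprime ((dehomogenize F₁).map (Int.castRingHom ℚ))
      ((dehomogenize F₂).map (Int.castRingHom ℚ)) := by
    rw [i₁.coprime_iff_not_dvd]
    intro hdvd
    have h3 := homogenize_dvd hdvd
    rw [natDegree_dehomogenize_map h₁ hb₁, natDegree_dehomogenize_map h₂ hb₂,
      ← map_eq_homogenize h₁, ← map_eq_homogenize h₂] at h3
    exact hirr₁.not_isUnit (hcop (dvd_refl _) h3)
  obtain ⟨u, v, huv⟩ := hco
  obtain ⟨a, ha0, ha⟩ := IsLocalization.integerNormalization_spec (nonZeroDivisors ℤ) u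
  obtain ⟨b, hb0, hb⟩ := IsLocalization.integerNormalization_spec (nonZeroDivisors ℤ) v
  rw [algebraMap_int_eq] at ha hb
  refine ⟨a * b, C b * IsLocalization.integerNormalization (nonZeroDivisors ℤ) u,
    C a * IsLocalization.integerNormalization (nonZeroDivisors ℤ) v,
    mul_ne_zero (nonZeroDivisors.ne_zero ha0) (nonZeroDivisors.ne_zero hb0), ?_⟩
  apply map_injective (Int.castRingHom ℚ) Int.cast_injective
  rw [Polynomial.map_add, Polynomial.map_mul, Polynomial.map_mul, Polynomial.map_mul,
    Polynomial.map_mul, ha, hb, map_C, map_C, map_C, zsmul_eq_mul, zsmul_eq_mul]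
  have e1 : ((a : ℤ) : ℚ[X]) = C ((Int.castRingHom ℚ) a) := by simp
  have e2 : ((b : ℤ) : ℚ[X]) = C ((Int.castRingHom ℚ) b) := by simp
  rw [e1, e2, map_mul, C_mul]
  linear_combination (C ((Int.castRingHom ℚ) a) * C ((Int.castRingHom ℚ) b)) * huv

end FormAlgebra

/-! ### The norm of the linear form b s - θ t. -/

section FormNorm
open Polynomial

variable {K : Type*} [Field K] [NumberField K]

/-- For a generator of the field, the characteristic polynomial of multiplication by α is monic, is
divisible by the minimal polynomial, and has the same degree. -/
lemma norm_algebraMap_sub_eq_eval_minpoly {α : K} (h : IntermediateField.adjoin ℚ {α} = ⊤)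
    (x : ℚ) : Algebra.norm ℚ (algebraMap ℚ K x - α) = (minpoly ℚ α).eval x := by
  have hdeg : (minpoly ℚ α).natDegree = Module.finrank ℚ K :=
    (Field.primitive_element_iff_minpoly_natDegree_eq ℚ α).1 h
  have hch : (Algebra.lmul ℚ K α).charpoly = minpoly ℚ α := by
    refine Polynomial.eq_of_monic_of_dvd_of_natDegree_le (minpoly.monic (Algebra.IsIntegral.isIntegral α))
      (LinearMap.charpoly_monic (Algebra.lmul ℚ K α)) (minpoly.dvd _ _ (Algebra.aeval_self_charpoly_lmul α)) ?_
    rw [LinearMap.charpoly_natDegree, hdeg]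
  rw [Algebra.norm_apply, ← hch, LinearMap.eval_charpoly]
  congr 1
  ext y
  simp [Algebra.smul_def]

variable {F : MvPolynomial (Fin 2) ℤ} {d : ℕ} {θ : 𝓞 K}

lemma aeval_div_dehomogenize_eq_zero (hθ : IsFormRoot F d θ)
    (hb : leadCoeffX F ≠ 0) :
    aeval ((θ : K) / (leadCoeffX F : K)) (dehomogenize F) = 0 := by
  have h1 := hθ.root hb
  unfold monicForm at h1
  rw [map_mul] at h1
  have hbK : (leadCoeffX F : K) ≠ 0 := by exact_mod_cast hb
  have h2 := (mul_eq_zero.1 h1).resolve_left (by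
    rw [MvPolynomial.aeval_C]
    simpa using fun h0 => absurd h0 hb)
  rw [← aeval_apply_one]
  have h3 : (MvPolynomial.aeval ![(θ : K) / (leadCoeffX F : K), 1] :
      MvPolynomial (Fin 2) ℤ →ₐ[ℤ] K) =
      ((MvPolynomial.aeval ![(θ : K), 1] : MvPolynomial (Fin 2) ℚ →ₐ[ℚ] K).restrictScalars ℤ).comp
        (MvPolynomial.aeval
      ![MvPolynomial.C ((leadCoeffX F : ℚ)⁻¹) * MvPolynomial.X 0, MvPolynomial.X 1]) := by
    ext i; fin_cases i
    · simp [div_eq_inv_mul]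
    · simp
  rw [h3]; exact h2

lemma adjoin_div_eq_top (hθ : IsFormRoot F d θ) (hb : leadCoeffX F ≠ 0) :
    IntermediateField.adjoin ℚ {(θ : K) / (leadCoeffX F : K)} = ⊤ := by
  rw [eq_top_iff, ← hθ.generates, IntermediateField.adjoin_le_iff]
  rintro _ rfl
  have hbK : (leadCoeffX F : K) ≠ 0 := by exact_mod_cast hb
  have h1 := IntermediateField.mem_adjoin_simple_self ℚ ((θ : K) / (leadCoeffX F : K))
  have h2 := mul_mem h1 (intCast_mem (IntermediateField.adjoin ℚ {(θ : K) / (leadCoeffX F : K)})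
    (leadCoeffX F))
  rwa [div_mul_cancel₀ _ hbK] at h2

/-- The quotient θ/b is a root of F(x, 1) itself, which is irreducible with leading coefficient b.
-/
lemma minpoly_div_eq (h : F.IsHomogeneous d)
    (hirr : Irreducible (MvPolynomial.map (Int.castRingHom ℚ) F)) (hθ : IsFormRoot F d θ)
    (hb : leadCoeffX F ≠ 0) :
    minpoly ℚ ((θ : K) / (leadCoeffX F : K)) =
      C ((leadCoeffX F : ℚ)⁻¹) * (dehomogenize F).map (Int.castRingHom ℚ) := by
  have hbQ : (leadCoeffX F : ℚ) ≠ 0 := by exact_mod_cast hb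
  have hlead : ((dehomogenize F).map (Int.castRingHom ℚ)).leadingCoeff = leadCoeffX F := by
    rw [leadingCoeff, natDegree_dehomogenize_map h hb, coeff_map, ← leadCoeffX_eq_coeff h]; rfl
  symm
  rw [mul_comm, ← hlead]
  apply minpoly.eq_of_irreducible (irreducible_dehomogenize h hirr hb)
  have := aeval_div_dehomogenize_eq_zero hθ hb
  rw [← algebraMap_int_eq, aeval_map_algebraMap]
  exact this

/-- When b = 0 both sides are 1: the form is a multiple of y and θ is rational, so the field it
generates is ℚ. -/
lemma finrank_eq_degree (h : F.IsHomogeneous d)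
    (hirr : Irreducible (MvPolynomial.map (Int.castRingHom ℚ) F)) (hθ : IsFormRoot F d θ) :
    Module.finrank ℚ K = d := by
  by_cases hb : leadCoeffX F = 0
  · obtain ⟨rfl, c, hc, h01, hf, hev⟩ := eval_of_leadCoeffX_eq_zero h hirr hb
    have h1 := hθ.root_of_eq_zero hb
    have h2 := hθ.generates
    have h3 : (θ : K) ∈ (⊥ : IntermediateField ℚ K) := by
      rw [h1]; push_cast
      exact neg_mem (intCast_mem _ _)
    rw [IntermediateField.adjoin_simple_eq_bot_iff.2 h3] at h2
    rw [← IntermediateField.finrank_top', ← h2, IntermediateField.finrank_bot]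
  · rw [← (Field.primitive_element_iff_minpoly_natDegree_eq ℚ _).1 (adjoin_div_eq_top hθ hb),
      minpoly_div_eq h hirr hθ hb, natDegree_C_mul (by simpa using hb),
      natDegree_dehomogenize_map h hb]

/-- The norm of the linear form `b s - θ t`. -/
lemma norm_linearForm (h : F.IsHomogeneous d)
    (hirr : Irreducible (MvPolynomial.map (Int.castRingHom ℚ) F)) (hθ : IsFormRoot F d θ)
    (s t : ℤ) :
    Algebra.norm ℤ ((leadCoeffX F : 𝓞 K) * (s : 𝓞 K) - θ * (t : 𝓞 K)) =
      leadCoeffX F ^ (d - 1) * MvPolynomial.eval ![s, t] F := by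
  have hinj : Function.Injective (algebraMap ℤ ℚ) := Int.cast_injective
  apply hinj
  rw [← Algebra.norm_localization ℤ (nonZeroDivisors ℤ) (Sₘ := K)]
  rw [map_mul, map_pow]
  have hd := degree_pos h hirr
  have hfin := finrank_eq_degree h hirr hθ
  have hcast : (algebraMap (𝓞 K) K) ((leadCoeffX F : 𝓞 K) * (s : 𝓞 K) - θ * (t : 𝓞 K)) =
      (leadCoeffX F : K) * s - θ * t := by simp
  rw [hcast]
  simp only [algebraMap_int_eq, eq_intCast]
  by_cases hb : leadCoeffX F = 0
  · obtain ⟨rfl, c, hc, h01, hf, hev⟩ := eval_of_leadCoeffX_eq_zero h hirr hb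
    have h1 := hθ.root_of_eq_zero hb
    rw [h01] at h1
    have : (leadCoeffX F : K) * s - θ * t = algebraMap ℚ K (c * t) := by
      rw [hb, h1]; simp
    rw [this, Algebra.norm_algebraMap, hfin, hev]
    simp
  · have hbQ : (leadCoeffX F : ℚ) ≠ 0 := by exact_mod_cast hb
    have hbK : (leadCoeffX F : K) ≠ 0 := by exact_mod_cast hb
    -- For t ≠ 0 one factors out b t and evaluates the minimal polynomial of θ/b at s/t. The case t
    -- = 0 cannot be normalised this way, but there the element is rational.
    rcases eq_or_ne t 0 with rfl | ht
    · have : (leadCoeffX F : K) * s - θ * (0 : ℤ) = algebraMap ℚ K (leadCoeffX F * s) := by simp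
      have h2 := aeval_apply_zero h (s : ℤ)
      rw [MvPolynomial.aeval_eq_eval] at h2
      rw [this, Algebra.norm_algebraMap, hfin]
      have h3 : MvPolynomial.eval ![s, 0] F = leadCoeffX F * s ^ d := by simpa using h2
      rw [h3]
      push_cast
      rw [mul_pow, ← mul_assoc, ← pow_succ, Nat.sub_add_cancel hd]
    · have htK : (t : K) ≠ 0 := by exact_mod_cast ht
      have htQ : (t : ℚ) ≠ 0 := by exact_mod_cast ht
      have : (leadCoeffX F : K) * s - θ * t = algebraMap ℚ K (leadCoeffX F * t) *
          (algebraMap ℚ K ((s : ℚ) / t) - (θ : K) / (leadCoeffX F : K)) := by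
        simp only [map_mul, map_div₀, map_intCast]
        field_simp
      rw [this, map_mul, Algebra.norm_algebraMap, hfin,
        norm_algebraMap_sub_eq_eval_minpoly (adjoin_div_eq_top hθ hb), minpoly_div_eq h hirr hθ hb,
        eval_mul, eval_C]
      have h4 : eval ((s : ℚ) / t) ((dehomogenize F).map (Int.castRingHom ℚ)) =
          aeval ((s : ℚ) / t) (dehomogenize F) := by
        rw [eval_map, aeval_def]; rfl
      have h5 := aeval_mul_apply h (t : ℚ) ((s : ℚ) / t) 1
      rw [mul_div_cancel₀ _ htQ, mul_one, aeval_intCast, aeval_apply_one] at h5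
      rw [h4, h5, mul_pow]
      obtain ⟨e, rfl⟩ : ∃ e, d = e + 1 := ⟨d - 1, by omega⟩
      simp only [Nat.add_sub_cancel, pow_succ]
      field_simp

lemma absNorm_linearForm (h : F.IsHomogeneous d)
    (hirr : Irreducible (MvPolynomial.map (Int.castRingHom ℚ) F)) (hθ : IsFormRoot F d θ)
    (s t : ℤ) :
    Ideal.absNorm (Ideal.span {(leadCoeffX F : 𝓞 K) * (s : 𝓞 K) - θ * (t : 𝓞 K)}) =
      (leadCoeffX F ^ (d - 1) * MvPolynomial.eval ![s, t] F).natAbs := by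
  rw [Ideal.absNorm_span_singleton, norm_linearForm h hirr hθ]

end FormNorm

/-! ### Divisibility of b s - θ t by ideals of good norm. -/

section GoodModulus
open Polynomial

variable {K : Type*} [Field K]

/-- The linear factor `b s - θ t` of the form. -/
noncomputable def linearForm (F : MvPolynomial (Fin 2) ℤ) (θ : 𝓞 K) (s t : ℤ) : 𝓞 K :=
  (leadCoeffX F : 𝓞 K) * (s : 𝓞 K) - θ * (t : 𝓞 K)

/-- Moduli coprime to the index of `ℤ[θ]` and to the coefficients that matter. -/
structure IsGoodModulus (F : MvPolynomial (Fin 2) ℤ) (θ : 𝓞 K) (n : ℕ) : Prop where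
  index : ∃ j : ℤ, IsCoprime j (n : ℤ) ∧ ∀ a : 𝓞 K, ∃ P : ℤ[X], (j : 𝓞 K) * a = aeval θ P
  lead : leadCoeffX F ≠ 0 → IsCoprime (leadCoeffX F) (n : ℤ)
  const : leadCoeffX F = 0 → IsCoprime (MvPolynomial.eval ![0, 1] F) (n : ℤ)

lemma IsGoodModulus.pow {F : MvPolynomial (Fin 2) ℤ} {θ : 𝓞 K} {n : ℕ}
    (h : IsGoodModulus F θ n) (k : ℕ) : IsGoodModulus F θ (n ^ k) := by
  obtain ⟨j, hj, hP⟩ := h.index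
  refine ⟨⟨j, by push_cast; exact hj.pow_right, hP⟩, fun h0 => ?_, fun h0 => ?_⟩
  · push_cast; exact (h.lead h0).pow_right
  · push_cast; exact (h.const h0).pow_right

lemma natCast_dvd_of_mem_of_isMaximal {𝔭 : Ideal (𝓞 K)} {p : ℕ}
    (h : 𝔭.under ℤ = Ideal.span {(p : ℤ)}) {k : ℤ} (hk : (k : 𝓞 K) ∈ 𝔭) : (p : ℤ) ∣ k := by
  rw [← Ideal.mem_span_singleton, ← h, Ideal.under_def, Ideal.mem_comap]
  simpa using hk

variable [NumberField K]

/-- Each ring element has a denominator with respect to ℤ[θ]; the product of the denominators of an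
integral basis serves all of them at once. -/
lemma exists_index_mul_mem_adjoin {θ : 𝓞 K} (h : IntermediateField.adjoin ℚ {(θ : K)} = ⊤) :
    ∃ j : ℤ, j ≠ 0 ∧ ∀ a : 𝓞 K, ∃ P : ℤ[X], (j : 𝓞 K) * a = aeval θ P := by
  classical
  have h1 : ∀ a : 𝓞 K, ∃ (j : ℤ) (P : ℤ[X]), j ≠ 0 ∧ (j : 𝓞 K) * a = aeval θ P := by
    intro a
    have h2 : (a : K) ∈ IntermediateField.adjoin ℚ {(θ : K)} := by rw [h]; trivial
    rw [← IntermediateField.mem_toSubalgebra, IntermediateField.adjoin_simple_toSubalgebra_of_isAlgebraic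
      (Algebra.IsAlgebraic.isAlgebraic _), Algebra.adjoin_singleton_eq_range_aeval] at h2
    obtain ⟨Q, hQ⟩ := h2
    obtain ⟨j, hj0, hj⟩ := IsLocalization.integerNormalization_spec (nonZeroDivisors ℤ) Q
    refine ⟨j, IsLocalization.integerNormalization (nonZeroDivisors ℤ) Q,
      nonZeroDivisors.ne_zero hj0, ?_⟩
    apply NumberField.RingOfIntegers.coe_injective
    have h3 := congrArg (aeval (θ : K)) hj
    rw [aeval_map_algebraMap] at h3
    change aeval (θ : K) Q = _ at hQ
    rw [map_zsmul, hQ] at h3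
    have h4 : ((aeval θ (IsLocalization.integerNormalization (nonZeroDivisors ℤ) Q) : 𝓞 K) : K) =
        aeval (θ : K) (IsLocalization.integerNormalization (nonZeroDivisors ℤ) Q) :=
      (aeval_algebraMap_apply K θ _).symm
    change _ = ((aeval θ (IsLocalization.integerNormalization (nonZeroDivisors ℤ) Q) : 𝓞 K) : K)
    rw [h4, h3]
    simp
  choose j P hj hP using h1
  set ι := Module.Free.ChooseBasisIndex ℤ (𝓞 K)
  set e := NumberField.RingOfIntegers.basis K
  refine ⟨∏ i : ι, j (e i), Finset.prod_ne_zero_iff.2 fun i _ => hj _, fun a => ?_⟩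
  refine ⟨∑ i : ι, C (e.repr a i * ∏ k ∈ Finset.univ.erase i, j (e k)) * P (e i), ?_⟩
  rw [map_sum]
  conv_lhs => rw [← e.sum_repr a]
  rw [Finset.mul_sum]
  refine Finset.sum_congr rfl fun i _ => ?_
  rw [map_mul, ← hP, ← Finset.mul_prod_erase _ _ (Finset.mem_univ i), aeval_C]
  simp only [zsmul_eq_mul, algebraMap_int_eq, eq_intCast]
  push_cast
  ring

lemma isCoprime_of_forall_prime_lt {a : ℤ} (ha : a ≠ 0) {n : ℕ}
    (h : ∀ p : ℕ, p.Prime → p ∣ n → a.natAbs < p) : IsCoprime a (n : ℤ) := by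
  rw [Int.isCoprime_iff_gcd_eq_one]
  by_contra hne
  obtain ⟨p, hp, hpd⟩ := Nat.exists_prime_and_dvd hne
  have h1 : (p : ℕ) ∣ a.natAbs := hpd.trans (Int.gcd_dvd_natAbs_left _ _)
  have h2 : (p : ℕ) ∣ n := by
    have := hpd.trans (Int.gcd_dvd_natAbs_right a (n : ℤ))
    simpa using this
  exact absurd (Nat.le_of_dvd (Int.natAbs_pos.2 ha) h1) (not_le.2 (h p hp h2))

lemma exists_forall_isGoodModulus {F : MvPolynomial (Fin 2) ℤ} {d : ℕ} {θ : 𝓞 K}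
    (h : F.IsHomogeneous d)
    (hirr : Irreducible (MvPolynomial.map (Int.castRingHom ℚ) F)) (hθ : IsFormRoot F d θ) :
    ∃ w₀ : ℕ, ∀ n : ℕ, (∀ p : ℕ, p.Prime → p ∣ n → w₀ < p) → IsGoodModulus F θ n := by
  obtain ⟨j, hj, hP⟩ := exists_index_mul_mem_adjoin hθ.generates
  refine ⟨max j.natAbs (max (leadCoeffX F).natAbs (MvPolynomial.eval ![0, 1] F).natAbs),
    fun n hn => ⟨⟨j, isCoprime_of_forall_prime_lt hj fun p hp hpn => ?_, hP⟩, fun h0 =>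
      isCoprime_of_forall_prime_lt h0 fun p hp hpn => ?_, fun h0 =>
      isCoprime_of_forall_prime_lt ?_ fun p hp hpn => ?_⟩⟩
  · have := hn p hp hpn; omega
  · have := hn p hp hpn; omega
  · obtain ⟨-, c, hc, h01, -⟩ := eval_of_leadCoeffX_eq_zero h hirr h0
    rwa [h01]
  · have := hn p hp hpn; omega

variable {F : MvPolynomial (Fin 2) ℤ} {d : ℕ} {θ : 𝓞 K}

/-- If every residue class contains an integer, the quotient is cyclic and 1 has additive order N𝔲.
-/
lemma absNorm_dvd_of_mem_of_surjective {𝔲 : Ideal (𝓞 K)}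
    (hsurj : ∀ a : 𝓞 K, ∃ k : ℤ, a - k ∈ 𝔲) {k : ℤ} (hk : (k : 𝓞 K) ∈ 𝔲) :
    (Ideal.absNorm 𝔲 : ℤ) ∣ k := by
  have h1 : addOrderOf (1 : 𝓞 K ⧸ 𝔲) = Ideal.absNorm 𝔲 := by
    rw [Ideal.absNorm_apply, Submodule.cardQuot_apply]
    apply addOrderOf_eq_card_of_forall_mem_zmultiples
    intro x
    obtain ⟨a, rfl⟩ := Ideal.Quotient.mk_surjective x
    obtain ⟨k, hk⟩ := hsurj a
    refine ⟨k, ?_⟩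
    rw [← Ideal.Quotient.eq] at hk
    rw [hk]; simp
  rw [← h1, addOrderOf_dvd_iff_zsmul_eq_zero]
  simpa using Ideal.Quotient.eq_zero_iff_mem.2 hk

/-- Multiplication by the index j lands in ℤ[θ], where θ can be replaced by the integer r. As j is
invertible modulo n, and n lies in 𝔲, the same holds for the whole ring. -/
lemma exists_int_sub_mem_of_index {𝔲 : Ideal (𝓞 K)} {n : ℕ} (hn : (n : 𝓞 K) ∈ 𝔲)
    (hG : IsGoodModulus F θ n) {r : ℤ} (hr : θ - r ∈ 𝔲) (a : 𝓞 K) : ∃ k : ℤ, a - k ∈ 𝔲 := by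
  obtain ⟨j, ⟨j', k', hj⟩, hP⟩ := hG.index
  obtain ⟨P, hP⟩ := hP a
  refine ⟨j' * P.eval r, ?_⟩
  have h1 : aeval θ P - ((P.eval r : ℤ) : 𝓞 K) ∈ 𝔲 := by
    have h2 := sub_dvd_eval_sub θ (r : 𝓞 K) (P.map (Int.castRingHom (𝓞 K)))
    rw [eval_map, eval_intCast_map] at h2
    exact 𝔲.mem_of_dvd h2 hr
  have h3 : (j' : 𝓞 K) * j + k' * n = 1 := by exact_mod_cast hj
  have h4 : a - ((j' * P.eval r : ℤ) : 𝓞 K) =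
      j' * (aeval θ P - ((P.eval r : ℤ) : 𝓞 K)) + (k' * a) * n := by
    rw [← hP]; push_cast
    linear_combination -a * h3
  rw [h4]
  exact 𝔲.add_mem (𝔲.mul_mem_left _ h1) (𝔲.mul_mem_left _ hn)

/-- When b ≠ 0, t is invertible modulo N𝔲, so b s - θ t ≡ 0 can be solved as θ ≡ b s t⁻¹. When b =
0, θ is already an integer. -/
lemma exists_root_mod {𝔲 : Ideal (𝓞 K)}
    (hG : IsGoodModulus F θ (Ideal.absNorm 𝔲)) (hθ : IsFormRoot F d θ) {s t : ℤ} (hst : IsCoprime s t)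
    (hmem : linearForm F θ s t ∈ 𝔲) :
    ∃ r : ℤ, θ - r ∈ 𝔲 ∧ (leadCoeffX F = 0 → IsCoprime r (Ideal.absNorm 𝔲 : ℤ)) := by
  by_cases hb : leadCoeffX F = 0
  · refine ⟨-(MvPolynomial.eval ![0, 1] F), ?_, fun h0 => (hG.const h0).neg_left⟩
    rw [hθ.root_of_eq_zero hb]; simp
  -- A prime p dividing both t and N𝔲 has a prime 𝔭 above it dividing 𝔲. Then b s lies in 𝔭, so p
  -- divides b s, contradicting goodness of the modulus or gcd(s, t) = 1.
  have hcop : IsCoprime t (Ideal.absNorm 𝔲 : ℤ) := by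
    rw [Int.isCoprime_iff_gcd_eq_one]
    by_contra hne
    obtain ⟨p, hp, hpd⟩ := Nat.exists_prime_and_dvd hne
    have h1 : (p : ℤ) ∣ t := (Int.natCast_dvd_natCast.2 hpd).trans (Int.gcd_dvd_left _ _)
    have h2 : (p : ℕ) ∣ Ideal.absNorm 𝔲 := by
      exact_mod_cast (Int.natCast_dvd_natCast.2 hpd).trans (Int.gcd_dvd_right _ _)
    obtain ⟨𝔭, hmax, hunder, hdvd⟩ := Ideal.exists_isMaximal_dvd_of_dvd_absNorm' hp 𝔲 h2
    have h3 : linearForm F θ s t ∈ 𝔭 := Ideal.le_of_dvd hdvd hmem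
    have hp𝔭 : ((p : ℤ) : 𝓞 K) ∈ 𝔭 := by
      have : (p : ℤ) ∈ 𝔭.under ℤ := by rw [hunder]; exact Ideal.mem_span_singleton_self _
      simpa [Ideal.under_def] using this
    have ht𝔭 : (t : 𝓞 K) ∈ 𝔭 := 𝔭.mem_of_dvd (by exact_mod_cast (Int.cast_dvd_cast (α := 𝓞 K) _ _ h1)) hp𝔭
    have h5 : (((leadCoeffX F * s : ℤ)) : 𝓞 K) ∈ 𝔭 := by
      have := 𝔭.add_mem h3 (𝔭.mul_mem_left θ ht𝔭)
      unfold linearForm at this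
      push_cast
      simpa using this
    have h6 := natCast_dvd_of_mem_of_isMaximal hunder h5
    have hp' : Prime (p : ℤ) := Nat.prime_iff_prime_int.1 hp
    rcases hp'.dvd_or_dvd h6 with h7 | h7
    · have := (hG.lead hb).isUnit_of_dvd' h7 (by exact_mod_cast h2)
      exact hp'.not_isUnit this
    · exact hp'.not_isUnit (hst.isUnit_of_dvd' h7 h1)
  obtain ⟨t', k, htk⟩ := hcop
  refine ⟨leadCoeffX F * s * t', ?_, fun h0 => absurd h0 hb⟩
  have h1 : (t' : 𝓞 K) * t + k * (Ideal.absNorm 𝔲 : ℕ) = 1 := by exact_mod_cast htk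
  have h2 : θ - ((leadCoeffX F * s * t' : ℤ) : 𝓞 K) =
      -t' * linearForm F θ s t + k * θ * (Ideal.absNorm 𝔲 : ℕ) := by
    unfold linearForm
    push_cast
    linear_combination -θ * h1
  rw [h2]
  exact 𝔲.add_mem (𝔲.mul_mem_left _ hmem) (𝔲.mul_mem_left _ (Ideal.absNorm_mem 𝔲))

/-- Divisibility of `b s - θ t` by an ideal with good norm is a linear congruence. -/
lemma exists_linear_congruence {𝔲 : Ideal (𝓞 K)}
    (hG : IsGoodModulus F θ (Ideal.absNorm 𝔲)) (hθ : IsFormRoot F d θ) {s t : ℤ}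
    (hst : IsCoprime s t) (hmem : linearForm F θ s t ∈ 𝔲) :
    ∃ α β : ℤ, (IsCoprime α (Ideal.absNorm 𝔲 : ℤ) ∨ IsCoprime β (Ideal.absNorm 𝔲 : ℤ)) ∧
      ∀ s' t' : ℤ, linearForm F θ s' t' ∈ 𝔲 → (Ideal.absNorm 𝔲 : ℤ) ∣ α * s' + β * t' := by
  obtain ⟨r, hr, hr0⟩ := exists_root_mod hG hθ hst hmem
  refine ⟨leadCoeffX F, -r, ?_, fun s' t' h => ?_⟩
  · by_cases hb : leadCoeffX F = 0
    · exact Or.inr (hr0 hb).neg_left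
    · exact Or.inl (hG.lead hb)
  · refine absNorm_dvd_of_mem_of_surjective
      (exists_int_sub_mem_of_index (Ideal.absNorm_mem 𝔲) hG hr) ?_
    have h1 : ((leadCoeffX F * s' + -r * t' : ℤ) : 𝓞 K) =
        linearForm F θ s' t' + t' * (θ - r) := by
      unfold linearForm; push_cast; ring
    rw [h1]
    exact 𝔲.add_mem h (𝔲.mul_mem_left _ hr)

/-- Because θ is congruent to an integer modulo 𝔲, the quotient by 𝔲 is cyclic. Consequently the
integers in 𝔲 are the multiples of N𝔲; both the degree one property and the separation of primes
follow from this. -/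
lemma absNorm_dvd_of_natCast_mem {𝔲 : Ideal (𝓞 K)}
    (hG : IsGoodModulus F θ (Ideal.absNorm 𝔲)) (hθ : IsFormRoot F d θ) {s t : ℤ}
    (hst : IsCoprime s t) (hmem : linearForm F θ s t ∈ 𝔲) {k : ℕ} (hk : (k : 𝓞 K) ∈ 𝔲) :
    Ideal.absNorm 𝔲 ∣ k := by
  obtain ⟨r, hr, -⟩ := exists_root_mod hG hθ hst hmem
  have := absNorm_dvd_of_mem_of_surjective
    (exists_int_sub_mem_of_index (Ideal.absNorm_mem 𝔲) hG hr) (k := k) (by exact_mod_cast hk)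
  exact_mod_cast this

/-- Good primes dividing `b s - θ t` have residue degree one. -/
lemma prime_absNorm_of_linearForm_mem {𝔭 : Ideal (𝓞 K)} (hp : 𝔭.IsPrime) (hne : 𝔭 ≠ ⊥)
    (hG : IsGoodModulus F θ (Ideal.absNorm 𝔭)) (hθ : IsFormRoot F d θ) {s t : ℤ}
    (hst : IsCoprime s t) (hmem : linearForm F θ s t ∈ 𝔭) : (Ideal.absNorm 𝔭).Prime := by
  have : 𝔭.IsMaximal := hp.isMaximal hne
  obtain ⟨q, n, hn, hqm, hq, hN⟩ := Ideal.exists_prime_and_absNorm_eq_pow 𝔭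
  have h1 := absNorm_dvd_of_natCast_mem hG hθ hst hmem hqm
  rcases (Nat.dvd_prime hq).1 h1 with h2 | h2
  · exact absurd (Ideal.absNorm_eq_one_iff.1 h2) hp.ne_top
  · rw [h2]; exact hq

/-- At most one prime of a given good norm divides `b s - θ t`. -/
lemma eq_of_linearForm_mem {𝔭 𝔮 : Ideal (𝓞 K)} {p : ℕ} (hp : p.Prime)
    (hG : IsGoodModulus F θ p) (hθ : IsFormRoot F d θ) (h𝔭 : Ideal.absNorm 𝔭 = p)
    (h𝔮 : Ideal.absNorm 𝔮 = p) {s t : ℤ} (hst : IsCoprime s t)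
    (h1 : linearForm F θ s t ∈ 𝔭) (h2 : linearForm F θ s t ∈ 𝔮) : 𝔭 = 𝔮 := by
  by_contra hne
  have g1 : IsGoodPrime 1 𝔭 := ⟨by rwa [h𝔭], Nat.coprime_one_right _⟩
  have g2 : IsGoodPrime 1 𝔮 := ⟨by rwa [h𝔮], Nat.coprime_one_right _⟩
  have hco : IsCoprime 𝔭 𝔮 := isCoprime_of_isPrime_of_ne g1.isPrime g1.ne_bot g2.isPrime g2.ne_bot hne
  have hN : Ideal.absNorm (𝔭 * 𝔮) = p ^ 2 := by rw [map_mul, h𝔭, h𝔮, sq]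
  have hinf : 𝔭 * 𝔮 = 𝔭 ⊓ 𝔮 := by
    exact Ideal.mul_eq_inf_of_isCoprime hco
  have hpm : (p : 𝓞 K) ∈ 𝔭 * 𝔮 := by
    rw [hinf]
    exact ⟨by rw [← h𝔭]; exact Ideal.absNorm_mem 𝔭, by rw [← h𝔮]; exact Ideal.absNorm_mem 𝔮⟩
  -- The integer p lies in 𝔭𝔮, whose norm is p², so p² would divide p.
  have h3 := absNorm_dvd_of_natCast_mem (𝔲 := 𝔭 * 𝔮)
    (by rw [hN]; exact hG.pow 2) hθ hst (by rw [hinf]; exact ⟨h1, h2⟩) hpm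
  rw [hN] at h3
  have := Nat.le_of_dvd hp.pos h3
  nlinarith [hp.two_le]

end GoodModulus

/-! ### Zeros of the forms modulo primes. -/

section FormCounts
open Polynomial

variable {K : Type*} [Field K] {F : MvPolynomial (Fin 2) ℤ} {d : ℕ} {θ : 𝓞 K}

/-- If b = 0 then d = 1 and the power is the empty product. This is why no separate treatment is
needed when the norm is compared with the value of the form. -/
lemma isCoprime_lead_pow {p : ℕ} (h : F.IsHomogeneous d)
    (hirr : Irreducible (MvPolynomial.map (Int.castRingHom ℚ) F)) (hG : IsGoodModulus F θ p) :
    IsCoprime (leadCoeffX F ^ (d - 1)) (p : ℤ) := by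
  by_cases hb : leadCoeffX F = 0
  · obtain ⟨rfl, -⟩ := eq_const_of_leadCoeffX_eq_zero h hirr hb
    simpa using isCoprime_one_left
  · exact (hG.lead hb).pow_left

lemma eval_zmod_eq_zero_iff (p : ℕ) (s t : ℤ) :
    MvPolynomial.aeval ![(s : ZMod p), (t : ZMod p)] F = 0 ↔
      (p : ℤ) ∣ MvPolynomial.eval ![s, t] F := by
  rw [aeval_intCast, ZMod.intCast_zmod_eq_zero_iff_dvd]

lemma dvd_eval_iff_of_modEq {e : ℕ} {x y : ℤ × ℤ} (h1 : x.1 ≡ y.1 [ZMOD e])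
    (h2 : x.2 ≡ y.2 [ZMOD e]) :
    (e : ℤ) ∣ MvPolynomial.eval ![x.1, x.2] F ↔ (e : ℤ) ∣ MvPolynomial.eval ![y.1, y.2] F := by
  rw [← eval_zmod_eq_zero_iff, ← eval_zmod_eq_zero_iff, (ZMod.intCast_eq_intCast_iff _ _ _).2 h1,
    (ZMod.intCast_eq_intCast_iff _ _ _).2 h2]

lemma isPeriodic_dvd_eval (e : ℕ) (F : MvPolynomial (Fin 2) ℤ) :
    IsPeriodic e (fun x => (e : ℤ) ∣ MvPolynomial.eval ![x.1, x.2] F) :=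
  fun _ _ => dvd_eval_iff_of_modEq

/-- The number of zeros of a form modulo a good prime. -/
lemma classCount_dvd_eval {p : ℕ} (hp : p.Prime) (h : F.IsHomogeneous d)
    (hirr : Irreducible (MvPolynomial.map (Int.castRingHom ℚ) F)) (hG : IsGoodModulus F θ p) :
    classCount p (fun x => (p : ℤ) ∣ MvPolynomial.eval ![x.1, x.2] F) =
      1 + rhoBar F p * (p - 1) := by
  classical
  have : Fact p.Prime := ⟨hp⟩
  have hpi : Prime (p : ℤ) := Nat.prime_iff_prime_int.1 hp
  have hfib : classCount p (fun x => (p : ℤ) ∣ MvPolynomial.eval ![x.1, x.2] F) =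
      ∑ j ∈ Finset.range p, ((Finset.range p).filter
        (fun i : ℕ => (p : ℤ) ∣ MvPolynomial.eval ![(i : ℤ), (j : ℤ)] F)).card := by
    unfold classCount
    rw [Finset.card_filter, Finset.sum_product_right]
    refine Finset.sum_congr rfl fun j _ => ?_
    rw [Finset.card_filter]
    refine Finset.sum_congr rfl fun i _ => ?_
    by_cases hd : (p : ℤ) ∣ MvPolynomial.eval ![(i : ℤ), (j : ℤ)] F
    · exact (if_pos hd).trans (if_pos hd).symm
    · exact (if_neg hd).trans (if_neg hd).symm
  have hzmod : ∀ j : ℕ, ((Finset.range p).filter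
      (fun i : ℕ => (p : ℤ) ∣ MvPolynomial.eval ![(i : ℤ), (j : ℤ)] F)).card =
      Nat.card {x : ZMod p // MvPolynomial.aeval ![x, (j : ZMod p)] F = 0} := by
    intro j
    rw [← Fintype.card_coe, ← Nat.card_eq_fintype_card]
    refine Nat.card_congr (Equiv.ofBijective
      (fun i => (⟨((i.1 : ℕ) : ZMod p), ?_⟩ :
        {x : ZMod p // MvPolynomial.aeval ![x, (j : ZMod p)] F = 0})) ⟨?_, ?_⟩)
    · have := (Finset.mem_filter.1 i.2).2
      rw [← eval_zmod_eq_zero_iff] at this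
      simpa using this
    · rintro ⟨i, hi⟩ ⟨i', hi'⟩ heq
      simp only [Subtype.mk.injEq] at heq ⊢
      rw [ZMod.natCast_eq_natCast_iff] at heq
      exact heq.eq_of_lt_of_lt (Finset.mem_range.1 (Finset.mem_filter.1 hi).1)
        (Finset.mem_range.1 (Finset.mem_filter.1 hi').1)
    · rintro ⟨x, hx⟩
      refine ⟨⟨x.val, Finset.mem_filter.2 ⟨Finset.mem_range.2 x.val_lt, ?_⟩⟩, ?_⟩
      · rw [← eval_zmod_eq_zero_iff]; simpa using hx
      · simp
  rw [hfib, Finset.range_eq_Ico, Finset.sum_eq_sum_Ico_succ_bot hp.pos]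
  by_cases hb : leadCoeffX F = 0
  · obtain ⟨rfl, c, hc, h01, hf, hev⟩ := eval_of_leadCoeffX_eq_zero h hirr hb
    have hcop := hG.const hb
    rw [h01] at hcop
    have hdiv : ∀ i j : ℤ, (p : ℤ) ∣ MvPolynomial.eval ![i, j] F ↔ (p : ℤ) ∣ j := by
      intro i j
      rw [hev]
      exact ⟨fun h' => hcop.symm.dvd_of_dvd_mul_left h', fun h' => h'.mul_left _⟩
    simp only [hdiv]
    rw [Finset.sum_eq_zero]
    · simp [rhoBar, hb]
      have := hp.one_le
      omega
    · intro j hj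
      rw [Finset.mem_Ico] at hj
      rw [Finset.card_eq_zero, Finset.filter_eq_empty_iff]
      intro i _ hd
      have := Nat.le_of_dvd (by omega) (Int.natCast_dvd_natCast.1 hd)
      omega
  · have hcop := hG.lead hb
    -- On the line t = 0 the form is b s^d with b invertible, so only the origin counts. Each line t
    -- = j ≠ 0 is a scaled copy of t = 1.
    have h0 : ((Finset.Ico 0 p).filter
        (fun i : ℕ => (p : ℤ) ∣ MvPolynomial.eval ![(i : ℤ), ((0 : ℕ) : ℤ)] F)) = {0} := by
      ext i
      have hev : MvPolynomial.eval ![(i : ℤ), ((0 : ℕ) : ℤ)] F = leadCoeffX F * (i : ℤ) ^ d := by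
        have := aeval_apply_zero h (i : ℤ)
        rw [MvPolynomial.aeval_eq_eval] at this
        simpa using this
      rw [Finset.mem_filter, hev, Finset.mem_singleton, Finset.mem_Ico]
      constructor
      · rintro ⟨⟨-, h1⟩, h2⟩
        have h3 := hpi.dvd_of_dvd_pow (hcop.symm.dvd_of_dvd_mul_left h2)
        exact Nat.eq_zero_of_dvd_of_lt (Int.natCast_dvd_natCast.1 h3) h1
      · rintro rfl
        refine ⟨⟨le_rfl, hp.pos⟩, ?_⟩
        rw [Nat.cast_zero, zero_pow (degree_pos h hirr).ne', mul_zero]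
        exact dvd_zero _
    have hj : ∀ j ∈ Finset.Ico (0 + 1) p, ((Finset.Ico 0 p).filter
        (fun i : ℕ => (p : ℤ) ∣ MvPolynomial.eval ![(i : ℤ), (j : ℤ)] F)).card = rhoBar F p := by
      intro j hj
      rw [← Finset.range_eq_Ico, hzmod, rhoBar, if_pos hb]
      rw [Finset.mem_Ico] at hj
      have hj0 : (j : ZMod p) ≠ 0 := by
        rw [Ne, ZMod.natCast_eq_zero_iff]
        intro hd
        have := Nat.le_of_dvd (by omega) hd
        omega
      refine (Nat.card_congr (Equiv.subtypeEquiv (Equiv.mulLeft₀ _ hj0) fun x => ?_)).symm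
      have := aeval_mul_apply h (j : ZMod p) x 1
      rw [mul_one] at this
      rw [Equiv.mulLeft₀_apply, this, mul_eq_zero, or_iff_right (pow_ne_zero _ hj0)]
    rw [h0, Finset.sum_congr rfl hj]
    simp [mul_comm]

variable [NumberField K]

lemma dvd_eval_of_linearForm_mem {p : ℕ} (h : F.IsHomogeneous d)
    (hirr : Irreducible (MvPolynomial.map (Int.castRingHom ℚ) F)) (hθ : IsFormRoot F d θ)
    (hG : IsGoodModulus F θ p) {𝔭 : Ideal (𝓞 K)} (hN : p ∣ Ideal.absNorm 𝔭) {s t : ℤ}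
    (hmem : linearForm F θ s t ∈ 𝔭) : (p : ℤ) ∣ MvPolynomial.eval ![s, t] F := by
  have h1 : Ideal.absNorm 𝔭 ∣ Ideal.absNorm (Ideal.span {linearForm F θ s t}) :=
    map_dvd Ideal.absNorm (Ideal.dvd_span_singleton.2 hmem)
  have h1 := hN.trans h1
  unfold linearForm at h1
  rw [absNorm_linearForm h hirr hθ, ← Int.natCast_dvd] at h1
  exact (isCoprime_lead_pow h hirr hG).symm.dvd_of_dvd_mul_left h1

/-- The number of degree one primes over `p` is at most the number of roots modulo `p`. -/
lemma card_primes_le_rhoBar {p : ℕ} (hp : p.Prime) (h : F.IsHomogeneous d)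
    (hirr : Irreducible (MvPolynomial.map (Int.castRingHom ℚ) F)) (hθ : IsFormRoot F d θ)
    (hG : IsGoodModulus F θ p) (S : Finset (Ideal (𝓞 K))) (hS : ∀ 𝔭 ∈ S, Ideal.absNorm 𝔭 = p) :
    S.card ≤ rhoBar F p := by
  classical
  unfold rhoBar
  have hgood : ∀ 𝔭 ∈ S, IsGoodPrime 1 𝔭 := fun 𝔭 h𝔭 =>
    ⟨by rw [hS 𝔭 h𝔭]; exact hp, Nat.coprime_one_right _⟩
  split_ifs with hb
  · have hmod : ∀ 𝔭 ∈ S, ∃ s : ℤ, linearForm F θ s 1 ∈ 𝔭 := by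
      intro 𝔭 h𝔭
      have hcard : Nat.card (𝓞 K ⧸ 𝔭) = p := by
        rw [← hS 𝔭 h𝔭, Ideal.absNorm_apply, Submodule.cardQuot_apply]
      have : Fact p.Prime := ⟨hp⟩
      have : Nontrivial (𝓞 K ⧸ 𝔭) := Ideal.Quotient.nontrivial_iff.2 (hgood 𝔭 h𝔭).isPrime.ne_top
      have h1 := mem_zmultiples_of_prime_card hcard (g := (1 : 𝓞 K ⧸ 𝔭))
        (g' := Ideal.Quotient.mk 𝔭 θ) one_ne_zero
      obtain ⟨r, hr⟩ := h1
      have hr' : θ - (r : 𝓞 K) ∈ 𝔭 := by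
        rw [← Ideal.Quotient.eq, map_intCast, ← hr]; simp
      obtain ⟨b', k, hbk⟩ := hG.lead hb
      refine ⟨b' * r, ?_⟩
      have h2 : (b' : 𝓞 K) * leadCoeffX F + k * (p : ℕ) = 1 := by exact_mod_cast hbk
      have h3 : linearForm F θ (b' * r) 1 = -(θ - r) + (-k * r) * ((p : ℕ) : 𝓞 K) := by
        unfold linearForm; push_cast
        linear_combination r * h2
      rw [h3]
      refine 𝔭.add_mem (𝔭.neg_mem hr') (𝔭.mul_mem_left _ ?_)
      rw [← hS 𝔭 h𝔭]; exact Ideal.absNorm_mem 𝔭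
    -- A degree one prime 𝔭 over p yields the residue s with b s - θ in 𝔭, a zero of F(x, 1). The
    -- map is injective because at most one prime of norm p divides b s - θ.
    choose! s hs using hmod
    have : NeZero p := ⟨hp.ne_zero⟩
    rw [← Fintype.card_coe S, ← Nat.card_eq_fintype_card]
    refine Nat.card_le_card_of_injective
      (fun 𝔭 : S => (⟨((s 𝔭 : ℤ) : ZMod p), ?_⟩ :
        {x : ZMod p // MvPolynomial.aeval ![x, 1] F = 0})) ?_
    · have := (eval_zmod_eq_zero_iff p (s 𝔭) 1).2 (dvd_eval_of_linearForm_mem h hirr hθ hG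
        (by rw [hS 𝔭 𝔭.2]) (hs 𝔭 𝔭.2))
      simpa using this
    · rintro ⟨𝔭, h𝔭⟩ ⟨𝔮, h𝔮⟩ heq
      simp only [Subtype.mk.injEq] at heq ⊢
      have h1 : (p : ℤ) ∣ s 𝔭 - s 𝔮 := by
        rw [← ZMod.intCast_zmod_eq_zero_iff_dvd]; push_cast; rw [heq, sub_self]
      refine eq_of_linearForm_mem hp hG hθ (hS 𝔭 h𝔭) (hS 𝔮 h𝔮) isCoprime_one_right (hs 𝔭 h𝔭) ?_
      obtain ⟨c, hc⟩ := h1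
      have h2 : linearForm F θ (s 𝔭) 1 = linearForm F θ (s 𝔮) 1 + (leadCoeffX F * c) * ((p : ℕ) : 𝓞 K) := by
        have : (s 𝔭 : 𝓞 K) - s 𝔮 = p * c := by exact_mod_cast hc
        unfold linearForm
        linear_combination (leadCoeffX F : 𝓞 K) * this
      rw [h2]
      refine 𝔮.add_mem (hs 𝔮 h𝔮) (𝔮.mul_mem_left _ ?_)
      rw [← hS 𝔮 h𝔮]; exact Ideal.absNorm_mem 𝔮
  · obtain ⟨rfl, -⟩ := eq_const_of_leadCoeffX_eq_zero h hirr (not_not.1 hb)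
    rw [← finrank_eq_degree h hirr hθ]
    exact card_primes_of_dvd_le p hp S fun 𝔭 h𝔭 =>
      ⟨(hgood 𝔭 h𝔭).isPrime, (hgood 𝔭 h𝔭).ne_bot, by rw [hS 𝔭 h𝔭]⟩

/-- With b invertible modulo p, the reduction of F(x, 1) is a non-zero polynomial of degree at most
d. -/
lemma rhoBar_le {p : ℕ} (hp : p.Prime) (h : F.IsHomogeneous d)
    (hirr : Irreducible (MvPolynomial.map (Int.castRingHom ℚ) F))
    (hG : leadCoeffX F ≠ 0 → IsCoprime (leadCoeffX F) (p : ℤ)) : rhoBar F p ≤ d := by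
  classical
  have : Fact p.Prime := ⟨hp⟩
  unfold rhoBar
  split_ifs with hb
  · set f := (dehomogenize F).map (Int.castRingHom (ZMod p)) with hf
    have hne : f ≠ 0 := by
      intro h0
      have h1 : f.coeff d = 0 := by rw [h0, coeff_zero]
      rw [hf, coeff_map, ← leadCoeffX_eq_coeff h, eq_intCast, ZMod.intCast_zmod_eq_zero_iff_dvd] at h1
      exact (Nat.prime_iff_prime_int.1 hp).not_isUnit ((hG hb).isUnit_of_dvd' h1 dvd_rfl)
    have h2 : Nat.card {x : ZMod p // MvPolynomial.aeval ![x, 1] F = 0} ≤ f.roots.toFinset.card := by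
      rw [← Fintype.card_coe, ← Nat.card_eq_fintype_card]
      refine Nat.card_le_card_of_injective (fun x => ⟨x.1, ?_⟩) ?_
      · rw [Multiset.mem_toFinset, mem_roots hne, IsRoot.def, hf, eval_map]
        have := x.2
        rw [aeval_apply_one] at this
        exact this
      · intro x y hxy
        exact Subtype.ext (by simpa using hxy)
    refine h2.trans ((Multiset.toFinset_card_le _).trans ((card_roots' f).trans ?_))
    exact natDegree_map_le.trans (natDegree_dehomogenize_le h)
  · exact degree_pos h hirr

/-- For all but finitely many primes, two coprime forms have no common zero modulo `p`. -/
lemma exists_forall_dvd_of_dvd_eval {F₁ F₂ : MvPolynomial (Fin 2) ℤ} {d₁ d₂ : ℕ}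
    (h₁ : F₁.IsHomogeneous d₁) (h₂ : F₂.IsHomogeneous d₂)
    (hirr₁ : Irreducible (MvPolynomial.map (Int.castRingHom ℚ) F₁))
    (hirr₂ : Irreducible (MvPolynomial.map (Int.castRingHom ℚ) F₂))
    (hcop : IsRelPrime (MvPolynomial.map (Int.castRingHom ℚ) F₁)
      (MvPolynomial.map (Int.castRingHom ℚ) F₂)) :
    ∃ w₀ : ℕ, ∀ p : ℕ, p.Prime → w₀ < p → ∀ s t : ℤ, (p : ℤ) ∣ MvPolynomial.eval ![s, t] F₁ →
      (p : ℤ) ∣ MvPolynomial.eval ![s, t] F₂ → (p : ℤ) ∣ s ∧ (p : ℤ) ∣ t := by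
  obtain ⟨m, U, V, hm, hUV⟩ := exists_bezout_dehomogenize h₁ h₂ hirr₁ hirr₂ hcop
  -- Coprime forms cannot both be multiples of y; the form with F(1, 0) ≠ 0 is needed to show that p
  -- divides s once it divides t.
  have hb : leadCoeffX F₁ ≠ 0 ∨ leadCoeffX F₂ ≠ 0 := by
    by_contra! hcon
    obtain ⟨rfl, c, hc, hf⟩ := eq_const_of_leadCoeffX_eq_zero h₁ hirr₁ hcon.1
    obtain ⟨rfl, c', hc', hf'⟩ := eq_const_of_leadCoeffX_eq_zero h₂ hirr₂ hcon.2
    have e1 := map_eq_homogenize h₁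
    have e2 := map_eq_homogenize h₂
    rw [hf, map_C, homogenize_C, pow_one] at e1
    rw [hf', map_C, homogenize_C, pow_one] at e2
    have hX : IsUnit (MvPolynomial.X 1 : MvPolynomial (Fin 2) ℚ) :=
      hcop (Dvd.intro_left _ e1.symm) (Dvd.intro_left _ e2.symm)
    have := hX.map (MvPolynomial.aeval (R := ℚ) ![(0 : ℚ), 0])
    simp at this
  refine ⟨max m.natAbs (max (leadCoeffX F₁).natAbs (leadCoeffX F₂).natAbs),
    fun p hp hlt s t hd₁ hd₂ => ?_⟩
  have : Fact p.Prime := ⟨hp⟩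
  have hpi : Prime (p : ℤ) := Nat.prime_iff_prime_int.1 hp
  have hnd : ∀ a : ℤ, a ≠ 0 → a.natAbs < p → ¬ (p : ℤ) ∣ a := by
    intro a ha hlt hd
    have := Nat.le_of_dvd (Int.natAbs_pos.2 ha) (Int.natCast_dvd.1 hd)
    omega
  -- If t were invertible, s/t would be a common zero of both dehomogenisations modulo p, and the
  -- Bézout identity would give p ∣ m.
  have ht : (p : ℤ) ∣ t := by
    by_contra ht
    have ht0 : (t : ZMod p) ≠ 0 := by rwa [Ne, ZMod.intCast_zmod_eq_zero_iff_dvd]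
    have key : ∀ {G : MvPolynomial (Fin 2) ℤ} {e : ℕ}, G.IsHomogeneous e →
        (p : ℤ) ∣ MvPolynomial.eval ![s, t] G →
        aeval ((t : ZMod p)⁻¹ * s) (dehomogenize G) = 0 := by
      intro G e hG hd
      rw [← eval_zmod_eq_zero_iff] at hd
      have := aeval_mul_apply hG (t : ZMod p)⁻¹ s t
      rw [inv_mul_cancel₀ ht0, hd, mul_zero, aeval_apply_one] at this
      exact this
    have h3 := congrArg (aeval ((t : ZMod p)⁻¹ * (s : ZMod p))) hUV
    rw [map_add, map_mul, map_mul, key h₁ hd₁, key h₂ hd₂, mul_zero, mul_zero, add_zero, aeval_C,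
      algebraMap_int_eq, eq_intCast, eq_comm, ZMod.intCast_zmod_eq_zero_iff_dvd] at h3
    exact hnd m hm (by omega) h3
  refine ⟨?_, ht⟩
  have key : ∀ {G : MvPolynomial (Fin 2) ℤ} {e : ℕ}, G.IsHomogeneous e →
      (p : ℤ) ∣ MvPolynomial.eval ![s, t] G → leadCoeffX G ≠ 0 → (leadCoeffX G).natAbs < p →
      (p : ℤ) ∣ s := by
    intro G e hG hd hb hlt
    rw [← eval_zmod_eq_zero_iff, (ZMod.intCast_zmod_eq_zero_iff_dvd t p).2 ht,
      aeval_apply_zero hG] at hd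
    have h4 : (p : ℤ) ∣ leadCoeffX G * s ^ e := by
      rw [← ZMod.intCast_zmod_eq_zero_iff_dvd]; push_cast; exact hd
    exact hpi.dvd_of_dvd_pow ((hpi.dvd_or_dvd h4).resolve_left (hnd _ hb hlt))
  rcases hb with hb | hb
  · exact key h₁ hd₁ hb (by omega)
  · exact key h₂ hd₂ hb (by omega)

end FormCounts

/-! ### Splitting a product of primes at a threshold. -/

section SmoothParts
open Finset

lemma Multiset.filter_lt_succ_prod (S : Multiset ℕ) (q : ℕ) :
    (S.filter (· < q + 1)).prod = (S.filter (· < q)).prod * q ^ S.count q := by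
  have h : S.filter (· < q + 1) = S.filter (· < q) + S.filter (· = q) := by
    rw [Multiset.filter_add_filter]
    have : S.filter (fun a => a < q ∧ a = q) = 0 := by
      rw [Multiset.filter_eq_nil]; intro a _ h; omega
    rw [this, add_zero]
    apply Multiset.filter_congr
    intro a _; omega
  rw [h, Multiset.prod_add, Multiset.filter_eq', Multiset.prod_replicate]

/-- A dichotomy for the smooth parts of a product of primes. -/
lemma exists_smooth_part (S : Multiset ℕ) (hS : ∀ p ∈ S, p.Prime) {Z y : ℝ} (hZ : y ≤ Z)
    (hy : 2 ≤ y) :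
    (∃ r t : ℕ, 1 ≤ r ∧ ((S.filter (· < t)).prod : ℝ) ≤ Z ∧
      (r = 1 ∨ √Z < ((S.filter (· < t)).prod : ℝ)) ∧
      (∀ p ∈ S, p < t → (p : ℝ) ≤ Z ^ ((1 : ℝ) / r)) ∧
      (∀ p ∈ S, t ≤ p → Z ^ ((1 : ℝ) / (r + 1)) < p) ∧ y ≤ Z ^ ((1 : ℝ) / r)) ∨
    (∃ p ∈ S, ∃ j, j ≤ S.count p ∧ (p : ℝ) ≤ √Z ∧ √Z < (p : ℝ) ^ j ∧ (p : ℝ) ^ j ≤ Z) ∨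
    (∃ t : ℕ, √Z < ((S.filter (· < t)).prod : ℝ) ∧ ((S.filter (· < t)).prod : ℝ) ≤ Z ∧
      ∀ p ∈ S, p < t → (p : ℝ) < y) := by
  have hZ2 : 2 ≤ Z := hy.trans hZ
  have hZ0 : 0 < Z := by linarith
  have hle : ∀ t, ∀ p ∈ S, p < t → (p : ℝ) ≤ ((S.filter (· < t)).prod : ℝ) := by
    intro t p hp hpt
    have h1 : p ∣ (S.filter (· < t)).prod :=
      Multiset.dvd_prod (Multiset.mem_filter.2 ⟨hp, hpt⟩)
    have h2 : (S.filter (· < t)).prod ≠ 0 :=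
      Multiset.prod_ne_zero fun h => (hS 0 (Multiset.mem_filter.1 h).1).ne_zero rfl
    exact_mod_cast Nat.le_of_dvd (Nat.pos_of_ne_zero h2) h1
  by_cases hall : ∀ t : ℕ, ((S.filter (· < t)).prod : ℝ) ≤ Z
  · left
    refine ⟨1, S.sum + 1, le_rfl, hall _, Or.inl rfl, fun p hp hpt => ?_, fun p hp hpt => ?_, ?_⟩
    · simpa using (hle _ p hp hpt).trans (hall _)
    · have := Multiset.single_le_sum (fun x _ => Nat.zero_le x) p hp
      omega
    · simpa using hZ
  push Not at hall
  classical
  -- The first threshold at which the product exceeds Z. Its predecessor q is therefore a prime of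
  -- S, whose full power pushes the product past Z.
  set t₀ := Nat.find hall with ht₀
  have h1 : Z < ((S.filter (· < t₀)).prod : ℝ) := Nat.find_spec hall
  obtain ⟨q, hq⟩ : ∃ q, t₀ = q + 1 := by
    refine Nat.exists_eq_succ_of_ne_zero fun h0 => ?_
    have h3 : S.filter (· < 0) = 0 := by
      rw [Multiset.filter_eq_nil]; intro a _ h; omega
    rw [h0, h3, Multiset.prod_zero] at h1
    norm_num at h1
    linarith
  have h2 : ((S.filter (· < q)).prod : ℝ) ≤ Z := by
    have := Nat.find_min hall (m := q) (by omega)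
    exact not_lt.1 this
  rw [hq, Multiset.filter_lt_succ_prod] at h1
  rw [Nat.cast_mul, Nat.cast_pow] at h1
  have hcount : S.count q ≠ 0 := by
    intro h0; rw [h0, pow_zero, mul_one] at h1; linarith
  have hqS : q ∈ S := Multiset.count_ne_zero.1 hcount
  have hqp := hS q hqS
  have hq2 : (2 : ℝ) ≤ q := by exact_mod_cast hqp.two_le
  have hsq : √Z * √Z = Z := Real.mul_self_sqrt hZ0.le
  have hsq0 : 0 < √Z := Real.sqrt_pos.2 hZ0
  by_cases hc1 : √Z < q
  · left
    refine ⟨1, q, le_rfl, h2, Or.inl rfl, fun p hp hpt => ?_, fun p hp hpt => ?_, by simpa using hZ⟩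
    · simpa using (hle _ p hp hpt).trans h2
    · have : Z ^ ((1 : ℝ) / ((1 : ℕ) + 1)) = √Z := by
        rw [Real.sqrt_eq_rpow]; norm_num
      rw [this]
      exact hc1.trans_le (by exact_mod_cast hpt)
  push Not at hc1
  by_cases hc2 : √Z < (q : ℝ) ^ S.count q
  · right; left
    have hex : ∃ j, √Z < (q : ℝ) ^ j := ⟨_, hc2⟩
    refine ⟨q, hqS, Nat.find hex, Nat.find_min' hex hc2, hc1, Nat.find_spec hex, ?_⟩
    obtain ⟨j, hj⟩ : ∃ j, Nat.find hex = j + 1 := by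
      refine Nat.exists_eq_succ_of_ne_zero fun h0 => ?_
      have := Nat.find_spec hex
      rw [h0, pow_zero, Real.sqrt_lt' one_pos] at this
      norm_num at this
      linarith
    have h3 := not_lt.1 (Nat.find_min hex (m := j) (by omega))
    rw [hj, pow_succ, ← hsq]
    exact mul_le_mul h3 hc1 (by linarith) hsq0.le
  push Not at hc2
  -- Otherwise both the smooth part and the power of q would be at most √Z, and their product would
  -- not exceed Z.
  have h3 : √Z < ((S.filter (· < q)).prod : ℝ) := by
    by_contra! hcon
    have : ((S.filter (· < q)).prod : ℝ) * (q : ℝ) ^ S.count q ≤ √Z * √Z :=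
      mul_le_mul hcon hc2 (by positivity) hsq0.le
    linarith
  by_cases hqy : (q : ℝ) < y
  · right; right
    exact ⟨q, h3, h2, fun p _ hpq => lt_trans (by exact_mod_cast hpq) hqy⟩
  push Not at hqy
  left
  have hlq : 0 < Real.log q := Real.log_pos (by linarith)
  have hlZ : 0 < Real.log Z := Real.log_pos (by linarith)
  -- This r satisfies Z^(1/(r+1)) < q ≤ Z^(1/r). Splitting at q gives the two bounds on the primes.
  set r := ⌊Real.log Z / Real.log q⌋₊ with hr
  have hr1 : (r : ℝ) ≤ Real.log Z / Real.log q := Nat.floor_le (by positivity)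
  have hr2 : Real.log Z / Real.log q < r + 1 := Nat.lt_floor_add_one _
  have hr3 : 1 ≤ r := by
    apply Nat.le_floor
    rw [Nat.cast_one, le_div_iff₀ hlq, one_mul]
    refine Real.log_le_log (by linarith) (hc1.trans ?_)
    rw [Real.sqrt_le_left hZ0.le]; nlinarith
  have hr0 : (0 : ℝ) < r := by exact_mod_cast hr3
  have hqr : (q : ℝ) ≤ Z ^ ((1 : ℝ) / r) := by
    rw [Real.le_rpow_iff_log_le (by linarith) hZ0, div_mul_eq_mul_div, one_mul, le_div_iff₀ hr0,
      mul_comm]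
    rwa [le_div_iff₀ hlq] at hr1
  refine ⟨r, q, hr3, h2, Or.inr h3, fun p hp hpq => ?_, fun p hp hpq => ?_, hqy.trans hqr⟩
  · exact le_trans (by exact_mod_cast hpq.le) hqr
  · refine lt_of_lt_of_le ?_ (show (q : ℝ) ≤ p by exact_mod_cast hpq)
    rw [Real.rpow_lt_iff_lt_log hZ0 (by linarith)]
    rw [div_mul_eq_mul_div, one_mul, div_lt_iff₀ (by positivity), mul_comm]
    rwa [div_lt_iff₀ hlq] at hr2

end SmoothParts

/-! ### Auxiliary sums over good and smooth ideals. -/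

section IdealSums
open Finset UniqueFactorizationMonoid

/-- The Euler product upper bound, obtained from `sum_multiset_mul_prod_le` with c = 0 and f = 1. -/
lemma sum_multiset_prod_pow_le {ι : Type*} [DecidableEq ι] (x : ι → ℝ) (P : Finset ι)
    (hx0 : ∀ i, 0 ≤ x i) (hx1 : ∀ i ∈ P, x i < 1) (T : Finset (Multiset ι))
    (hT : ∀ s ∈ T, ∀ i ∈ s, i ∈ P) :
    ∑ s ∈ T, ∏ i ∈ P, x i ^ s.count i ≤ ∏ i ∈ P, (1 - x i)⁻¹ := by
  have h := sum_multiset_mul_prod_le (fun i => i ∈ P) (fun i v => x i ^ v)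
    (fun i v => pow_nonneg (hx0 i) v) (fun _ => 0) (fun i => (1 - x i)⁻¹ - 1) (fun _ => le_rfl) P
    (fun i hi => by
      have : 1 ≤ (1 - x i)⁻¹ := (one_le_inv₀ (by linarith [hx1 i hi])).2 (by linarith [hx0 i])
      linarith) (fun i hi => hi) (fun _ => 1) (fun _ _ => zero_le_one) (by
      intro i hi s _ _ V
      simp only [one_mul, add_zero, mul_one, add_sub_cancel]
      rw [← tsum_geometric_of_lt_one (hx0 i) (hx1 i hi)]
      exact (summable_geometric_of_lt_one (hx0 i) (hx1 i hi)).sum_le_tsum _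
        fun _ _ => pow_nonneg (hx0 i) _) T hT
  simp only [one_mul, mul_one, add_sub_cancel] at h
  rw [← Finset.prod_one_add] at h
  simpa using h

variable {K : Type*} [Field K] [NumberField K] {W : ℕ}

lemma absNorm_eq_prod_count [DecidableEq (Ideal (𝓞 K))] {𝔞 : Ideal (𝓞 K)} (h : 𝔞 ≠ ⊥)
    {P : Finset (Ideal (𝓞 K))} (hP : ∀ 𝔭 ∈ normalizedFactors 𝔞, 𝔭 ∈ P) :
    Ideal.absNorm 𝔞 = ∏ 𝔭 ∈ P, Ideal.absNorm 𝔭 ^ (normalizedFactors 𝔞).count 𝔭 := by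
  conv_lhs => rw [← prod_normalizedFactors_ideal h, map_multiset_prod]
  exact Finset.prod_multiset_map_count _ _ |>.trans (Finset.prod_subset
    (fun 𝔭 h𝔭 => hP 𝔭 (Multiset.mem_toFinset.1 h𝔭)) fun 𝔭 _ h𝔭 => by
      rw [Multiset.count_eq_zero_of_notMem (fun h' => h𝔭 (Multiset.mem_toFinset.2 h')), pow_zero])

lemma sum_absNorm_rpow_neg_le {s : ℝ} (hs : 0 < s) {x : ℝ} {T P : Finset (Ideal (𝓞 K))}
    (hT : T ⊆ goodIdeals K W x) (hP : ∀ 𝔭 ∈ P, IsGoodPrime W 𝔭)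
    (hTP : ∀ 𝔞 ∈ T, ∀ 𝔭 ∈ normalizedFactors 𝔞, 𝔭 ∈ P) :
    ∑ 𝔞 ∈ T, (Ideal.absNorm 𝔞 : ℝ) ^ (-s) ≤
      ∏ 𝔭 ∈ P, (1 - (Ideal.absNorm 𝔭 : ℝ) ^ (-s))⁻¹ := by
  classical
  have hinj : Set.InjOn (fun 𝔞 : Ideal (𝓞 K) => normalizedFactors 𝔞) T := by
    intro 𝔞 h𝔞 𝔟 h𝔟 h
    rw [← prod_normalizedFactors_ideal (mem_goodIdeals.1 (hT h𝔞)).1,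
      ← prod_normalizedFactors_ideal (mem_goodIdeals.1 (hT h𝔟)).1]
    exact congrArg Multiset.prod h
  refine le_trans (le_of_eq ?_) (sum_multiset_prod_pow_le
    (fun 𝔭 : Ideal (𝓞 K) => (Ideal.absNorm 𝔭 : ℝ) ^ (-s)) P (fun _ => by positivity) ?_
    (T.image normalizedFactors) ?_)
  · rw [sum_image hinj]
    refine sum_congr rfl fun 𝔞 h𝔞 => ?_
    rw [absNorm_eq_prod_count (mem_goodIdeals.1 (hT h𝔞)).1 (hTP 𝔞 h𝔞)]
    push_cast
    rw [← Real.finsetProd_rpow _ _ fun _ _ => by positivity]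
    refine Finset.prod_congr rfl fun 𝔭 _ => ?_
    rw [← Real.rpow_natCast, ← Real.rpow_natCast, ← Real.rpow_mul (by positivity),
      ← Real.rpow_mul (by positivity), mul_comm]
  · intro 𝔭 h𝔭
    have : (1 : ℝ) < Ideal.absNorm 𝔭 := by exact_mod_cast (hP 𝔭 h𝔭).1.one_lt
    exact Real.rpow_lt_one_of_one_lt_of_neg this (by linarith)
  · intro m hm
    obtain ⟨𝔞, h𝔞, rfl⟩ := mem_image.1 hm
    exact hTP 𝔞 h𝔞

-- Serves as a crude count of ideals: the number with norm at most Z is O(Z²), which is enough for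
-- the sieve's error terms.
variable (K W) in
lemma exists_sum_absNorm_rpow_neg_two_le :
    ∃ C : ℝ, 0 < C ∧ ∀ x : ℝ, ∑ 𝔞 ∈ goodIdeals K W x, (Ideal.absNorm 𝔞 : ℝ) ^ (-2 : ℝ) ≤ C := by
  classical
  have hsum : Summable (fun n : ℕ => (n : ℝ) ^ (-2 : ℝ)) := Real.summable_nat_rpow.2 (by norm_num)
  refine ⟨Real.exp (2 * (Module.finrank ℚ K * ∑' n : ℕ, (n : ℝ) ^ (-2 : ℝ))), Real.exp_pos _,
    fun x => ?_⟩
  set P : Finset (Ideal (𝓞 K)) := (idealsUpTo K x).filter (IsGoodPrime W) with hP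
  have hPgood : ∀ 𝔭 ∈ P, IsGoodPrime W 𝔭 ∧ (Ideal.absNorm 𝔭 : ℝ) ≤ x := fun 𝔭 h =>
    ⟨(mem_filter.1 h).2, (mem_idealsUpTo.1 (mem_filter.1 h).1).2⟩
  refine (sum_absNorm_rpow_neg_le two_pos (Subset.refl _) (fun 𝔭 h => (hPgood 𝔭 h).1) ?_).trans ?_
  · intro 𝔞 h𝔞 𝔭 h𝔭
    obtain ⟨h1, h2, h3⟩ := mem_goodIdeals.1 h𝔞
    refine mem_filter.2 ⟨mem_idealsUpTo.2 ⟨(h3 𝔭 h𝔭).ne_bot, le_trans ?_ h2⟩, h3 𝔭 h𝔭⟩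
    exact_mod_cast Nat.le_of_dvd (absNorm_pos_of_ne_bot h1)
      (map_dvd Ideal.absNorm (dvd_of_mem_normalizedFactors h𝔭))
  · have h1 : ∀ 𝔭 ∈ P, (1 - (Ideal.absNorm 𝔭 : ℝ) ^ (-2 : ℝ))⁻¹ ≤
        Real.exp (2 * (Ideal.absNorm 𝔭 : ℝ) ^ (-2 : ℝ)) := by
      intro 𝔭 h𝔭
      have h2 : (2 : ℝ) ≤ Ideal.absNorm 𝔭 := by exact_mod_cast (hPgood 𝔭 h𝔭).1.1.two_le
      have h3 : (Ideal.absNorm 𝔭 : ℝ) ^ (-2 : ℝ) ≤ 1 / 4 := by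
        calc _ ≤ (2 : ℝ) ^ (-2 : ℝ) := Real.rpow_le_rpow_of_nonpos two_pos h2 (by norm_num)
          _ = 1 / 4 := by rw [Real.rpow_neg two_pos.le]; norm_num
      set u := (Ideal.absNorm 𝔭 : ℝ) ^ (-2 : ℝ)
      have h4 : 0 ≤ u := by positivity
      refine le_trans ?_ (Real.add_one_le_exp _)
      rw [inv_le_iff_one_le_mul₀ (by linarith)]
      nlinarith
    refine (Finset.prod_le_prod (fun 𝔭 h𝔭 => ?_) h1).trans ?_
    · have h2 : (1 : ℝ) < Ideal.absNorm 𝔭 := by exact_mod_cast (hPgood 𝔭 h𝔭).1.1.one_lt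
      have := Real.rpow_lt_one_of_one_lt_of_neg h2 (show (-2 : ℝ) < 0 by norm_num)
      exact inv_nonneg.2 (by linarith)
    · rw [← Real.exp_sum, ← mul_sum]
      refine Real.exp_le_exp.2 (mul_le_mul_of_nonneg_left ?_ two_pos.le)
      refine (sum_goodPrime_le P x hPgood (fun n => (n : ℝ) ^ (-2 : ℝ))
        fun _ => by positivity).trans ?_
      exact mul_le_mul_of_nonneg_left (hsum.sum_le_tsum _ fun _ _ => by positivity) (by positivity)

-- The bound y on the primes is fixed, so only finitely many primes occur. The Euler product then
-- converges for every positive exponent, and the weights are bounded.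
variable (K W) in
lemma exists_sum_smooth_le (y s c : ℝ) (hs : 0 < s) (hc : 0 ≤ c) :
    ∃ C : ℝ, 1 ≤ C ∧ ∀ x : ℝ, ∀ T ⊆ goodIdeals K W x,
      (∀ 𝔞 ∈ T, ∀ 𝔭 ∈ normalizedFactors 𝔞, (Ideal.absNorm 𝔭 : ℝ) ≤ y) →
      ∑ 𝔞 ∈ T, (Ideal.absNorm 𝔞 : ℝ) ^ (-s) ≤ C ∧ ∀ 𝔞 ∈ T, primeWeight c 𝔞 ≤ C := by
  classical
  set P : Finset (Ideal (𝓞 K)) := (idealsUpTo K y).filter (IsGoodPrime W) with hP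
  have hPgood : ∀ 𝔭 ∈ P, IsGoodPrime W 𝔭 := fun 𝔭 h => (mem_filter.1 h).2
  refine ⟨max (∏ 𝔭 ∈ P, (1 - (Ideal.absNorm 𝔭 : ℝ) ^ (-s))⁻¹)
    (∏ 𝔭 ∈ P, (1 + c / (Ideal.absNorm 𝔭 : ℝ))), le_max_of_le_right ?_, fun x T hT hTy => ?_⟩
  · exact Finset.one_le_prod fun 𝔭 _ => by
      have : 0 ≤ c / (Ideal.absNorm 𝔭 : ℝ) := by positivity
      linarith
  · have hmem : ∀ 𝔞 ∈ T, ∀ 𝔭 ∈ normalizedFactors 𝔞, 𝔭 ∈ P := fun 𝔞 h𝔞 𝔭 h𝔭 => by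
      have h3 := (mem_goodIdeals.1 (hT h𝔞)).2.2 𝔭 h𝔭
      exact mem_filter.2 ⟨mem_idealsUpTo.2 ⟨h3.ne_bot, hTy 𝔞 h𝔞 𝔭 h𝔭⟩, h3⟩
    refine ⟨(sum_absNorm_rpow_neg_le hs hT hPgood hmem).trans (le_max_left _ _), fun 𝔞 h𝔞 => ?_⟩
    refine le_trans ?_ (le_max_right _ _)
    unfold primeWeight
    refine Finset.prod_le_prod_of_subset_of_one_le
      (fun 𝔭 h𝔭 => hmem 𝔞 h𝔞 𝔭 (Multiset.mem_toFinset.1 h𝔭)) (fun 𝔭 _ => by positivity) fun 𝔭 _ _ => ?_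
    have : 0 ≤ c / (Ideal.absNorm 𝔭 : ℝ) := by positivity
    linarith

lemma primeWeight_nonneg {c : ℝ} (hc : 0 ≤ c) (𝔞 : Ideal (𝓞 K)) : 0 ≤ primeWeight c 𝔞 :=
  prod_nonneg fun 𝔭 _ => by positivity

lemma primeWeight_pow_le {c : ℝ} (hc : 0 ≤ c) {𝔭 : Ideal (𝓞 K)} (h : IsGoodPrime W 𝔭) (j : ℕ) :
    primeWeight c (𝔭 ^ j) ≤ 1 + c := by
  classical
  unfold primeWeight
  have h1 : (normalizedFactors (𝔭 ^ j)).toFinset ⊆ {𝔭} := by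
    rw [normalizedFactors_pow, normalizedFactors_irreducible h.prime.irreducible, normalize_eq]
    intro 𝔮 h𝔮
    rw [Multiset.mem_toFinset] at h𝔮
    exact Finset.mem_singleton.2 (Multiset.mem_singleton.1 (Multiset.mem_of_mem_nsmul h𝔮))
  refine (Finset.prod_le_prod_of_subset_of_one_le h1 (fun 𝔭 _ => by positivity) fun 𝔮 _ _ => ?_).trans ?_
  · have : 0 ≤ c / (Ideal.absNorm 𝔮 : ℝ) := by positivity
    linarith
  · rw [prod_singleton]
    have : (1 : ℝ) ≤ Ideal.absNorm 𝔭 := by exact_mod_cast h.1.one_lt.le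
    have := div_le_self hc this
    linarith

end IdealSums

/-! ### Tuples of ideals and their smooth parts. -/

noncomputable section

section IdealTuples
open Finset UniqueFactorizationMonoid

lemma Multiset.filter_finset_sum {ι α : Type*} (s : Finset ι) (g : ι → Multiset α) (p : α → Prop)
    [DecidablePred p] : (∑ i ∈ s, g i).filter p = ∑ i ∈ s, (g i).filter p := by
  classical
  induction s using Finset.induction_on with
  | empty => simp
  | insert a s ha ih => rw [sum_insert ha, sum_insert ha, Multiset.filter_add, ih]

variable {N : ℕ} {K : Fin N → Type*} [∀ i, Field (K i)] [∀ i, NumberField (K i)]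

/-- The product of the norms of a tuple of ideals. -/
def tupleNorm (u : ∀ i, Ideal (𝓞 (K i))) : ℕ := ∏ i, Ideal.absNorm (u i)

/-- The norms of the prime factors of a tuple of ideals. -/
def primeNorms (u : ∀ i, Ideal (𝓞 (K i))) : Multiset ℕ :=
  ∑ i, (normalizedFactors (u i)).map Ideal.absNorm

/-- The part of a tuple of ideals composed of primes of norm less than `t`. -/
def smoothPart (t : ℕ) (u : ∀ i, Ideal (𝓞 (K i))) (i : Fin N) : Ideal (𝓞 (K i)) :=
  ((normalizedFactors (u i)).filter (fun 𝔭 => Ideal.absNorm 𝔭 < t)).prod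

/-- Tuples of ideals composed of good primes. -/
structure IsGoodTuple (W : ℕ) (u : ∀ i, Ideal (𝓞 (K i))) : Prop where
  ne_bot : ∀ i, u i ≠ ⊥
  good : ∀ i, ∀ 𝔭 ∈ normalizedFactors (u i), IsGoodPrime W 𝔭

/-- Tuples of ideals whose prime factors have different norms. -/
structure IsSeparatedTuple (W : ℕ) (u : ∀ i, Ideal (𝓞 (K i))) : Prop
    extends IsGoodTuple W u where
  inj : ∀ i, ∀ 𝔭 ∈ normalizedFactors (u i), ∀ 𝔮 ∈ normalizedFactors (u i),
    Ideal.absNorm 𝔭 = Ideal.absNorm 𝔮 → 𝔭 = 𝔮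
  disj : ∀ i j, i ≠ j → ∀ 𝔭 ∈ normalizedFactors (u i), ∀ 𝔮 ∈ normalizedFactors (u j),
    Ideal.absNorm 𝔭 ≠ Ideal.absNorm 𝔮

variable {W : ℕ} {u : ∀ i, Ideal (𝓞 (K i))}

lemma mem_primeNorms {p : ℕ} :
    p ∈ primeNorms u ↔ ∃ i, ∃ 𝔭 ∈ normalizedFactors (u i), Ideal.absNorm 𝔭 = p := by
  simp [primeNorms, Multiset.mem_sum]

lemma IsGoodTuple.prime_of_mem (h : IsGoodTuple W u) {p : ℕ} (hp : p ∈ primeNorms u) : p.Prime := by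
  obtain ⟨i, 𝔭, h𝔭, rfl⟩ := mem_primeNorms.1 hp
  exact (h.good i 𝔭 h𝔭).1

lemma prod_primeNorms (h : ∀ i, u i ≠ ⊥) : (primeNorms u).prod = tupleNorm u := by
  unfold primeNorms tupleNorm
  rw [Multiset.prod_sum]
  refine Finset.prod_congr rfl fun i _ => ?_
  rw [← map_multiset_prod, prod_normalizedFactors_ideal (h i)]

lemma normalizedFactors_smoothPart (h : IsGoodTuple W u) (t : ℕ) (i : Fin N) :
    normalizedFactors (smoothPart t u i) =
      (normalizedFactors (u i)).filter (fun 𝔭 => Ideal.absNorm 𝔭 < t) :=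
  normalizedFactors_prod_of_good fun 𝔭 h𝔭 => h.good i 𝔭 (Multiset.mem_filter.1 h𝔭).1

lemma IsGoodTuple.smoothPart (h : IsGoodTuple W u) (t : ℕ) : IsGoodTuple W (smoothPart t u) where
  ne_bot i := prod_ne_bot_of_good fun 𝔭 h𝔭 => h.good i 𝔭 (Multiset.mem_filter.1 h𝔭).1
  good i 𝔭 h𝔭 := by
    rw [normalizedFactors_smoothPart h] at h𝔭
    exact h.good i 𝔭 (Multiset.mem_filter.1 h𝔭).1

lemma primeNorms_smoothPart (h : IsGoodTuple W u) (t : ℕ) :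
    primeNorms (smoothPart t u) = (primeNorms u).filter (· < t) := by
  unfold primeNorms
  rw [Multiset.filter_finset_sum]
  refine Finset.sum_congr rfl fun i _ => ?_
  rw [normalizedFactors_smoothPart h, Multiset.filter_map]
  rfl

lemma tupleNorm_smoothPart (h : IsGoodTuple W u) (t : ℕ) :
    tupleNorm (smoothPart t u) = ((primeNorms u).filter (· < t)).prod := by
  rw [← prod_primeNorms (h.smoothPart t).ne_bot, primeNorms_smoothPart h]

lemma tupleNorm_pos (h : ∀ i, u i ≠ ⊥) : 0 < tupleNorm u :=
  prod_pos fun i _ => absNorm_pos_of_ne_bot (h i)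

lemma smoothPart_dvd (h : ∀ i, u i ≠ ⊥) (t : ℕ) (i : Fin N) : smoothPart t u i ∣ u i := by
  conv_rhs => rw [← prod_normalizedFactors_ideal (h i)]
  exact Multiset.prod_dvd_prod_of_le (Multiset.filter_le _ _)

/-- The smooth part and the rest are coprime since their prime norms lie on different sides of t, so
the bound A^Ω applies to the rest. Replacing A by a common A' lets the forms be combined. -/
lemma le_smoothPart_mul_pow (h : IsSeparatedTuple W u) (t : ℕ) (i : Fin N) {A A' B ε : ℝ}
    {f : Ideal (𝓞 (K i)) → ℝ} (hf : IsPseudomultiplicative A B ε f) (hA : A ≤ A') :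
    f (u i) ≤ f (smoothPart t u i) *
      A' ^ ((normalizedFactors (u i)).filter (fun 𝔭 => ¬ Ideal.absNorm 𝔭 < t)).card := by
  set r := (normalizedFactors (u i)).filter (fun 𝔭 => ¬ Ideal.absNorm 𝔭 < t) with hr
  have hrg : ∀ 𝔭 ∈ r, IsGoodPrime W 𝔭 := fun 𝔭 h𝔭 => h.good i 𝔭 (Multiset.mem_filter.1 h𝔭).1
  have hmul : u i = smoothPart t u i * r.prod := by
    rw [smoothPart, ← Multiset.prod_add, Multiset.filter_add_not,
      prod_normalizedFactors_ideal (h.ne_bot i)]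
  have hsne := (h.toIsGoodTuple.smoothPart t).ne_bot i
  have hcop : IsCoprime (smoothPart t u i) r.prod := by
    refine isCoprime_multiset_prod fun 𝔭 h𝔭 => (isCoprime_multiset_prod fun 𝔮 h𝔮 => ?_).symm
    obtain ⟨h1, h2⟩ := Multiset.mem_filter.1 h𝔭
    obtain ⟨h3, h4⟩ := Multiset.mem_filter.1 h𝔮
    have g1 := h.good i 𝔭 h1
    have g2 := h.good i 𝔮 h3
    exact isCoprime_of_isPrime_of_ne g2.isPrime g2.ne_bot g1.isPrime g1.ne_bot
      (fun h' => by subst h'; exact absurd h2 (by omega))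
  have h5 := hf.le_pow hsne (prod_ne_bot_of_good hrg) hcop
  rw [← hmul, idealOmega, normalizedFactors_prod_of_good hrg] at h5
  exact h5.trans (mul_le_mul_of_nonneg_left (pow_le_pow_left₀ hf.A_pos.le hA _)
    (hf.nonneg _ hsne))

lemma prod_le_smoothPart_mul_pow (h : IsSeparatedTuple W u) (t : ℕ) {A B ε : Fin N → ℝ} {A' : ℝ}
    {f : ∀ i, Ideal (𝓞 (K i)) → ℝ} (hf : ∀ i, IsPseudomultiplicative (A i) (B i) (ε i) (f i))
    (hA : ∀ i, A i ≤ A') :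
    ∏ i, f i (u i) ≤ (∏ i, f i (smoothPart t u i)) *
      A' ^ ((primeNorms u).filter (fun p => ¬ p < t)).card := by
  refine (Finset.prod_le_prod (fun i _ => (hf i).nonneg _ (h.ne_bot i))
    fun i _ => le_smoothPart_mul_pow h t i (hf i) (hA i)).trans (le_of_eq ?_)
  rw [prod_mul_distrib, prod_pow_eq_pow_sum]
  congr 2
  unfold primeNorms
  rw [Multiset.filter_finset_sum, Multiset.card_sum]
  refine Finset.sum_congr rfl fun i _ => ?_
  rw [Multiset.filter_map, Multiset.card_map]
  rfl

/-- Bounds the number of large prime factors by log of the norm over log b, and so the power of A'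
lost in `prod_le_smoothPart_mul_pow`. -/
lemma card_filter_mul_log_le (h : IsGoodTuple W u) (t : ℕ) {b : ℝ} (hb : 1 ≤ b)
    (hbt : ∀ p ∈ primeNorms u, t ≤ p → b ≤ p) :
    ((primeNorms u).filter (fun p => ¬ p < t)).card * Real.log b ≤ Real.log (tupleNorm u) := by
  have h1 : b ^ ((primeNorms u).filter (fun p => ¬ p < t)).card ≤
      (((primeNorms u).filter (fun p => ¬ p < t)).prod : ℕ) := by
    have : ∀ S : Multiset ℕ, (∀ p ∈ S, b ≤ p) → b ^ S.card ≤ ((S.prod : ℕ) : ℝ) := by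
      intro S
      induction S using Multiset.induction_on with
      | empty => simp
      | cons p S ih =>
        intro hS
        rw [Multiset.card_cons, Multiset.prod_cons, pow_succ, mul_comm, Nat.cast_mul]
        exact mul_le_mul (hS p (Multiset.mem_cons_self _ _))
          (ih fun q hq => hS q (Multiset.mem_cons_of_mem hq)) (by positivity) (by positivity)
    exact this _ fun p hp => hbt p (Multiset.mem_filter.1 hp).1 (not_lt.1 (Multiset.mem_filter.1 hp).2)
  have h2 : ((primeNorms u).filter (fun p => ¬ p < t)).prod ≤ tupleNorm u := by
    rw [← prod_primeNorms h.ne_bot]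
    refine Nat.le_of_dvd ?_ (Multiset.prod_dvd_prod_of_le (Multiset.filter_le _ _))
    rw [prod_primeNorms h.ne_bot]; exact tupleNorm_pos h.ne_bot
  rw [← Real.log_pow]
  exact Real.log_le_log (by positivity) (h1.trans (by exact_mod_cast h2))

/-- In a separated tuple all occurrences of the norm p come from one prime ideal of one component.
-/
lemma exists_pow_dvd_of_le_count (h : IsSeparatedTuple W u) {p j : ℕ} (hp : p ∈ primeNorms u)
    (hj : j ≤ (primeNorms u).count p) :
    ∃ i, ∃ 𝔭 : Ideal (𝓞 (K i)), IsGoodPrime W 𝔭 ∧ Ideal.absNorm 𝔭 = p ∧ 𝔭 ^ j ∣ u i := by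
  classical
  obtain ⟨i, 𝔭, h𝔭, hN⟩ := mem_primeNorms.1 hp
  refine ⟨i, 𝔭, h.good i 𝔭 h𝔭, hN, ?_⟩
  have h1 : (primeNorms u).count p = (normalizedFactors (u i)).count 𝔭 := by
    unfold primeNorms
    rw [Multiset.count_sum', Finset.sum_eq_single i]
    · rw [Multiset.count_map, ← Multiset.countP_eq_card_filter, Multiset.count]
      refine Multiset.countP_congr rfl fun 𝔮 h𝔮 => ?_
      rw [← hN]
      exact propext ⟨fun h' => h.inj i 𝔭 h𝔭 𝔮 h𝔮 h', fun h' => by rw [h']⟩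
    · intro k _ hk
      rw [Multiset.count_eq_zero, Multiset.mem_map]
      rintro ⟨𝔮, h𝔮, h'⟩
      exact h.disj k i hk 𝔮 h𝔮 𝔭 h𝔭 (by rw [h', hN])
    · simp
  rw [h1] at hj
  have h2 : Multiset.replicate j 𝔭 ≤ normalizedFactors (u i) := Multiset.le_count_iff_replicate_le.1 hj
  have h3 := Multiset.prod_dvd_prod_of_le h2
  rwa [Multiset.prod_replicate, prod_normalizedFactors_ideal (h.ne_bot i)] at h3

lemma apply_le_top_mul_rpow {L : Type*} [Field L] [NumberField L] {A B ε : ℝ}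
    {f : Ideal (𝓞 L) → ℝ} (hf : IsPseudomultiplicative A B ε f) {𝔞 : Ideal (𝓞 L)} (h : 𝔞 ≠ ⊥) :
    f 𝔞 ≤ f ⊤ * (B * (Ideal.absNorm 𝔞 : ℝ) ^ ε) := by
  have := hf.le_rpow (𝔞 := ⊤) (𝔟 := 𝔞) top_ne_bot h
    (by rw [← Ideal.one_eq_top]; exact isCoprime_one_left)
  rwa [← Ideal.one_eq_top, one_mul, Ideal.one_eq_top] at this

end IdealTuples
end

/-! ### Sieve hypotheses and the tuples with a useful smooth part. -/

noncomputable section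

section SieveSums
open Finset UniqueFactorizationMonoid

lemma sum_le_sum_of_cover {α β : Type*} (X : Finset α) (U : Finset β) (R : β → α → Prop)
    [∀ u, DecidablePred (R u)] (g : α → ℝ) (hg : ∀ x ∈ X, 0 ≤ g x)
    (hcov : ∀ x ∈ X, ∃ u ∈ U, R u x) :
    ∑ x ∈ X, g x ≤ ∑ u ∈ U, ∑ x ∈ X.filter (R u), g x := by
  simp only [sum_filter]
  rw [sum_comm]
  refine sum_le_sum fun x hx => ?_
  obtain ⟨u, hu, hR⟩ := hcov x hx
  refine le_trans (by rw [if_pos hR]) (single_le_sum (f := fun u => if R u x then g x else 0)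
    (fun v _ => ?_) hu)
  have := hg x hx
  positivity

/-- Pairs the refined bound a with the main term of the count and the trivial bound b with its
error. Both follow from using min(a, b). -/
lemma sum_le_of_card_le {α : Type*} {S : Finset α} {g : α → ℝ} {a b m e : ℝ}
    (ha : ∀ x ∈ S, g x ≤ a) (hb : ∀ x ∈ S, g x ≤ b) (ha0 : 0 ≤ a) (hb0 : 0 ≤ b) (hm : 0 ≤ m)
    (he : 0 ≤ e) (hcard : (S.card : ℝ) ≤ m + e) : ∑ x ∈ S, g x ≤ a * m + b * e := by
  have h1 : ∑ x ∈ S, g x ≤ S.card * min a b := by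
    rw [← nsmul_eq_mul, ← sum_const]
    exact sum_le_sum fun x hx => le_min (ha x hx) (hb x hx)
  have h2 : (S.card : ℝ) * min a b ≤ (m + e) * min a b :=
    mul_le_mul_of_nonneg_right hcard (le_min ha0 hb0)
  have h3 := mul_le_mul_of_nonneg_left (min_le_left a b) hm
  have h4 := mul_le_mul_of_nonneg_left (min_le_right a b) he
  linarith

variable {N : ℕ} {K : Fin N → Type*} [∀ i, Field (K i)]

lemma prod_sum_piFinset (T : ∀ i, Finset (Ideal (𝓞 (K i)))) (φ : ∀ i, Ideal (𝓞 (K i)) → ℝ) :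
    ∑ u ∈ Fintype.piFinset T, ∏ i, φ i (u i) = ∏ i, ∑ 𝔞 ∈ T i, φ i 𝔞 :=
  (Finset.prod_univ_sum T fun i 𝔞 => φ i 𝔞).symm

variable [∀ i, NumberField (K i)]

open Classical in
/-- The points of `X` whose ideals are divisible by `u` and otherwise free of primes up to `ξ`. -/
def siftedSet {α : Type} (X : Finset α) (𝔫 : α → ∀ i, Ideal (𝓞 (K i)))
    (u : ∀ i, Ideal (𝓞 (K i))) (ξ : ℝ) : Finset α :=
  X.filter (fun x => (∀ i, u i ∣ 𝔫 x i) ∧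
    ∀ p ∈ primeNorms (𝔫 x), (p : ℝ) ≤ ξ → p ∣ tupleNorm u)

/-- An upper bound sieve for a finite family of tuples of ideals. -/
def HasSieveBound {α : Type} (W : ℕ) (c : ℝ) (s : ℕ) (X : Finset α)
    (𝔫 : α → ∀ i, Ideal (𝓞 (K i))) (H E k : ℝ) : Prop :=
  ∀ u : ∀ i, Ideal (𝓞 (K i)), IsGoodTuple W u → ∀ ξ : ℝ, 1 ≤ ξ → (tupleNorm u : ℝ) * ξ ^ s ≤ k →
    ((siftedSet X 𝔫 u ξ).card : ℝ) ≤
      H * (∏ i, primeWeight c (u i)) / (tupleNorm u * (1 + Real.log ξ) ^ N) + E * ξ ^ s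

variable {W : ℕ} {c : ℝ} {s : ℕ} {α : Type} {X : Finset α} {𝔫 : α → ∀ i, Ideal (𝓞 (K i))}
  {H E k : ℝ}

lemma isGoodTuple_of_mem {V : ℝ} {u : ∀ i, Ideal (𝓞 (K i))}
    (h : ∀ i, u i ∈ goodIdeals (K i) W V) : IsGoodTuple W u :=
  ⟨fun i => (mem_goodIdeals.1 (h i)).1, fun i => (mem_goodIdeals.1 (h i)).2.2⟩

lemma absNorm_le_tupleNorm {u : ∀ i, Ideal (𝓞 (K i))} (h : ∀ i, u i ≠ ⊥) (i : Fin N) :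
    Ideal.absNorm (u i) ≤ tupleNorm u :=
  Nat.le_of_dvd (tupleNorm_pos h) (dvd_prod_of_mem _ (mem_univ i))

lemma rpow_tupleNorm (u : ∀ i, Ideal (𝓞 (K i))) (a : ℝ) :
    (tupleNorm u : ℝ) ^ a = ∏ i, (Ideal.absNorm (u i) : ℝ) ^ a := by
  rw [tupleNorm, Nat.cast_prod, Real.finsetProd_rpow _ _ fun _ _ => by positivity]

/-- A smooth part of a separated tuple belongs to the expected box. -/
lemma smoothPart_mem_goodIdeals {V Z y : ℝ} (hZV : Z ≤ V) {t : ℕ} {v : ∀ i, Ideal (𝓞 (K i))}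
    (hv : IsGoodTuple W v) (h1 : (((primeNorms v).filter (· < t)).prod : ℝ) ≤ Z)
    (h2 : ∀ p ∈ primeNorms v, p < t → (p : ℝ) ≤ y) (i : Fin N) :
    smoothPart t v i ∈ goodIdeals (K i) W V ∧
      ∀ 𝔭 ∈ normalizedFactors (smoothPart t v i), (Ideal.absNorm 𝔭 : ℝ) ≤ y := by
  have hg := hv.smoothPart t
  refine ⟨mem_goodIdeals.2 ⟨hg.ne_bot i, ?_, hg.good i⟩, fun 𝔭 h𝔭 => ?_⟩
  · refine le_trans ?_ (h1.trans hZV)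
    rw [← tupleNorm_smoothPart hv]
    exact_mod_cast absNorm_le_tupleNorm hg.ne_bot i
  · rw [normalizedFactors_smoothPart hv] at h𝔭
    obtain ⟨h3, h4⟩ := Multiset.mem_filter.1 h𝔭
    exact h2 _ (mem_primeNorms.2 ⟨i, 𝔭, h3, rfl⟩) h4

lemma dvd_tupleNorm_smoothPart {t p : ℕ} {v : ∀ i, Ideal (𝓞 (K i))} (hv : IsGoodTuple W v)
    (hp : p ∈ primeNorms v) (hpt : p < t) : p ∣ tupleNorm (smoothPart t v) := by
  rw [tupleNorm_smoothPart hv]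
  exact Multiset.dvd_prod (Multiset.mem_filter.2 ⟨hp, hpt⟩)

/-- The tuples with a smooth part of moderate size and all other primes large. -/
def HasSmoothPart (r : ℕ) (Z : ℝ) (v : ∀ i, Ideal (𝓞 (K i))) : Prop :=
  ∃ t : ℕ, (((primeNorms v).filter (· < t)).prod : ℝ) ≤ Z ∧
    (r = 1 ∨ √Z < (((primeNorms v).filter (· < t)).prod : ℝ)) ∧
    (∀ p ∈ primeNorms v, p < t → (p : ℝ) ≤ Z ^ ((1 : ℝ) / r)) ∧
    (∀ p ∈ primeNorms v, t ≤ p → Z ^ ((1 : ℝ) / (r + 1)) < p)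

-- Points are grouped by their smooth part u. The other primes exceed Z^(1/(r+1)), so there are at
-- most Q(r+1) of them and the sieve to level ξ = Z^(η/(r+1)) counts the group. The resulting sum
-- over u is the one treated by Rankin's trick.
open Classical in
lemma sum_hasSmoothPart_le (hS : HasSieveBound W c s X 𝔫 H E k) (hc : 0 ≤ c) (hH : 0 ≤ H)
    (hE : 0 ≤ E) (hsep : ∀ x ∈ X, IsSeparatedTuple W (𝔫 x)) {A B ε : Fin N → ℝ} {A' : ℝ}
    {f : ∀ i, Ideal (𝓞 (K i)) → ℝ} (hf : ∀ i, IsPseudomultiplicative (A i) (B i) (ε i) (f i))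
    (hA : ∀ i, A i ≤ A') (hA1 : 1 ≤ A') {Z V P η κ C₂ : ℝ} {Q r : ℕ} (hZ : 2 ≤ Z) (hZV : Z ≤ V)
    (hQ : ∀ x ∈ X, Real.log (tupleNorm (𝔫 x)) ≤ Q * Real.log Z)
    (hP : ∀ x ∈ X, ∏ i, f i (𝔫 x i) ≤ P) (hP0 : 0 ≤ P) (hη : 0 < η) (hη1 : η ≤ 1) (hr : 1 ≤ r)
    (hk : Z * Z ^ (η * s / 2) ≤ k) (hκ : 0 ≤ κ) {C₁ : Fin N → ℝ}
    (hR : ∀ i, ∀ T ⊆ goodIdeals (K i) W V,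
      (∀ 𝔞 ∈ T, ∀ 𝔭 ∈ normalizedFactors 𝔞, (Ideal.absNorm 𝔭 : ℝ) ≤ Z ^ ((1 : ℝ) / r)) →
      ∑ 𝔞 ∈ T, f i 𝔞 * primeWeight c 𝔞 *
        (Ideal.absNorm 𝔞 : ℝ) ^ (κ / Real.log (Z ^ ((1 : ℝ) / r)) - 1) ≤ C₁ i)
    (hC₂ : ∏ i, ∑ 𝔞 ∈ goodIdeals (K i) W V, (Ideal.absNorm 𝔞 : ℝ) ^ (-2 : ℝ) ≤ C₂) :
    ∑ x ∈ X.filter (fun x => HasSmoothPart r Z (𝔫 x)), ∏ i, f i (𝔫 x i) ≤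
      A' ^ (Q * (r + 1)) * H * ((r + 1) / (η * Real.log Z)) ^ N *
        Real.exp (κ / 2 - κ * r / 2) * ∏ i, C₁ i + P * E * Z ^ (η * s / 2) * (C₂ * Z ^ (2 : ℝ)) := by
  have hZ0 : 0 < Z := by linarith
  have hlZ : 0 < Real.log Z := Real.log_pos (by linarith)
  have hr0 : (0 : ℝ) < r := by exact_mod_cast hr
  have hr1 : (1 : ℝ) ≤ r := by exact_mod_cast hr
  set y := Z ^ ((1 : ℝ) / r) with hy
  have hly : Real.log y = Real.log Z / r := by rw [hy, Real.log_rpow hZ0]; ring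
  -- Since η ≤ 1, ξ stays below every remaining prime. Since r ≥ 1, ξ^s is at most Z^(ηs/2).
  set ξ := Z ^ (η / (r + 1)) with hξ
  have hξ1 : 1 ≤ ξ := Real.one_le_rpow (by linarith) (by positivity)
  have hlξ : Real.log ξ = η / (r + 1) * Real.log Z := by rw [hξ, Real.log_rpow hZ0]
  have hξle : ξ ≤ Z ^ ((1 : ℝ) / (r + 1)) :=
    Real.rpow_le_rpow_of_exponent_le (by linarith) (by gcongr)
  have hξs : ξ ^ s ≤ Z ^ (η * s / 2) := by
    rw [hξ, ← Real.rpow_natCast, ← Real.rpow_mul hZ0.le]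
    refine Real.rpow_le_rpow_of_exponent_le (by linarith) ?_
    rw [div_mul_eq_mul_div]
    exact div_le_div_of_nonneg_left (by positivity) (by norm_num) (by linarith)
  set T : ∀ i, Finset (Ideal (𝓞 (K i))) := fun i => (goodIdeals (K i) W V).filter
    (fun 𝔞 => ∀ 𝔭 ∈ normalizedFactors 𝔞, (Ideal.absNorm 𝔭 : ℝ) ≤ y) with hT
  set U := (Fintype.piFinset T).filter
    (fun u => (tupleNorm u : ℝ) ≤ Z ∧ (r = 1 ∨ √Z < (tupleNorm u : ℝ))) with hU
  have hUg : ∀ u ∈ U, IsGoodTuple W u := fun u hu => isGoodTuple_of_mem fun i =>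
    (mem_filter.1 (Fintype.mem_piFinset.1 (mem_filter.1 hu).1 i)).1
  set X' := X.filter (fun x => HasSmoothPart r Z (𝔫 x)) with hX'
  have hfnn : ∀ x ∈ X', 0 ≤ ∏ i, f i (𝔫 x i) := fun x hx =>
    prod_nonneg fun i _ => (hf i).nonneg _ ((hsep x (mem_filter.1 hx).1).ne_bot i)
  set R : (∀ i, Ideal (𝓞 (K i))) → α → Prop := fun u x =>
    ∃ t : ℕ, u = smoothPart t (𝔫 x) ∧ ∀ p ∈ primeNorms (𝔫 x), t ≤ p → Z ^ ((1 : ℝ) / (r + 1)) < p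
    with hRdef
  have hcov : ∀ x ∈ X', ∃ u ∈ U, R u x := by
    intro x hx
    obtain ⟨hxX, t, h1, h2, h3, h4⟩ := mem_filter.1 hx
    have hg := (hsep x hxX).toIsGoodTuple
    refine ⟨smoothPart t (𝔫 x), mem_filter.2 ⟨Fintype.mem_piFinset.2 fun i => mem_filter.2
      (smoothPart_mem_goodIdeals hZV hg h1 h3 i), ?_⟩, t, rfl, h4⟩
    rw [tupleNorm_smoothPart hg]
    exact ⟨h1, h2⟩
  refine (sum_le_sum_of_cover X' U R _ hfnn hcov).trans ?_
  have hterm : ∀ u ∈ U, ∑ x ∈ X'.filter (R u), ∏ i, f i (𝔫 x i) ≤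
      (∏ i, f i (u i)) * A' ^ (Q * (r + 1)) *
        (H * (∏ i, primeWeight c (u i)) / (tupleNorm u * (1 + Real.log ξ) ^ N)) +
        P * (E * ξ ^ s) := by
    intro u hu
    have hug := hUg u hu
    have hNZ := (mem_filter.1 hu).2.1
    have hlξ0 : 0 ≤ Real.log ξ := Real.log_nonneg hξ1
    refine sum_le_of_card_le ?_ ?_ (mul_nonneg (prod_nonneg fun i _ => (hf i).nonneg _ (hug.ne_bot i))
      (by positivity)) hP0 ?_ (by positivity) ?_
    · intro x hx
      obtain ⟨hx1, t, rfl, h4⟩ := mem_filter.1 hx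
      have hxX := (mem_filter.1 hx1).1
      have hs := hsep x hxX
      refine (prod_le_smoothPart_mul_pow hs t hf hA).trans (mul_le_mul_of_nonneg_left
        (pow_le_pow_right₀ hA1 ?_) (prod_nonneg fun i _ => (hf i).nonneg _ (hug.ne_bot i)))
      have h5 := (card_filter_mul_log_le hs.toIsGoodTuple t
        (b := Z ^ ((1 : ℝ) / (r + 1))) (Real.one_le_rpow (by linarith) (by positivity))
        (fun p hp hpt => (h4 p hp hpt).le)).trans (hQ x hxX)
      rw [Real.log_rpow hZ0] at h5
      have h6 : (((primeNorms (𝔫 x)).filter (fun p => ¬ p < t)).card : ℝ) ≤ Q * (r + 1) := by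
        have h7 : (((primeNorms (𝔫 x)).filter (fun p => ¬ p < t)).card : ℝ) / (r + 1) ≤ Q := by
          refine le_of_mul_le_mul_right ?_ hlZ
          calc _ = _ := by ring
            _ ≤ _ := h5
        rwa [div_le_iff₀ (by positivity)] at h7
      exact_mod_cast h6
    · intro x hx
      exact hP x (mem_filter.1 (mem_filter.1 hx).1).1
    · exact div_nonneg (mul_nonneg hH (prod_nonneg fun i _ => primeWeight_nonneg hc _))
        (by positivity)
    · refine le_trans ?_ (hS u hug ξ hξ1 ?_)
      · refine Nat.cast_le.2 (card_le_card fun x hx => ?_)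
        obtain ⟨hx1, t, rfl, h4⟩ := mem_filter.1 hx
        have hxX := (mem_filter.1 hx1).1
        have hs := hsep x hxX
        refine mem_filter.2 ⟨hxX, fun i => smoothPart_dvd hs.ne_bot t i, fun p hp hpξ => ?_⟩
        refine dvd_tupleNorm_smoothPart hs.toIsGoodTuple hp ?_
        by_contra! hcon
        have := h4 p hp hcon
        linarith
      · exact (mul_le_mul hNZ hξs (by positivity) hZ0.le).trans hk
  refine (sum_le_sum hterm).trans ?_
  rw [sum_add_distrib]
  refine add_le_add ?_ ?_
  · have hL : (η * Real.log Z / (r + 1)) ≤ 1 + Real.log ξ := by rw [hlξ]; ring_nf; linarith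
    have hL0 : 0 < η * Real.log Z / (r + 1) := by positivity
    have hb : ∀ u ∈ U, (∏ i, f i (u i)) * A' ^ (Q * (r + 1)) *
        (H * (∏ i, primeWeight c (u i)) / (tupleNorm u * (1 + Real.log ξ) ^ N)) ≤
        A' ^ (Q * (r + 1)) * H * ((r + 1) / (η * Real.log Z)) ^ N *
          Real.exp (κ / 2 - κ * r / 2) * ∏ i, (f i (u i) * primeWeight c (u i) *
            (Ideal.absNorm (u i) : ℝ) ^ (κ / Real.log y - 1)) := by
      intro u hu
      have hug := hUg u hu
      obtain ⟨hNZ, hN⟩ := (mem_filter.1 hu).2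
      have hN1 : (1 : ℝ) ≤ tupleNorm u := by exact_mod_cast tupleNorm_pos hug.ne_bot
      have hN0 : (0 : ℝ) < tupleNorm u := by linarith
      -- With log y = (log Z)/r, the condition N(u) > √Z makes N(u)^(κ/log y) at least exp(κr/2).
      -- For r = 1 the prefactor is 1, which is why κ/2 appears there.
      have hone : 1 ≤ Real.exp (κ / 2 - κ * r / 2) * (tupleNorm u : ℝ) ^ (κ / Real.log y) := by
        rcases hN with h1 | h1
        · rw [h1]
          have e0 : κ / 2 - κ * ((1 : ℕ) : ℝ) / 2 = 0 := by push_cast; ring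
          rw [e0, Real.exp_zero, one_mul]
          exact Real.one_le_rpow hN1 (by rw [hly]; positivity)
        · rw [Real.rpow_def_of_pos hN0, ← Real.exp_add]
          refine Real.one_le_exp ?_
          have h2 : Real.log Z / 2 ≤ Real.log (tupleNorm u) := by
            rw [← Real.log_sqrt hZ0.le]
            exact Real.log_le_log (Real.sqrt_pos.2 hZ0) h1.le
          have h3 : κ * r / 2 ≤ Real.log (tupleNorm u) * (κ / Real.log y) := by
            calc κ * r / 2 = Real.log Z / 2 * (κ / Real.log y) := by rw [hly]; field_simp
              _ ≤ _ := mul_le_mul_of_nonneg_right h2 (by rw [hly]; positivity)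
          linarith
      rw [prod_mul_distrib, prod_mul_distrib, ← rpow_tupleNorm, Real.rpow_sub hN0, Real.rpow_one]
      set φ := ∏ i, f i (u i) with hφ
      set ψ := ∏ i, primeWeight c (u i) with hψ
      have hφ0 : 0 ≤ φ := prod_nonneg fun i _ => (hf i).nonneg _ (hug.ne_bot i)
      have hψ0 : 0 ≤ ψ := prod_nonneg fun i _ => primeWeight_nonneg hc _
      have hinv : ((1 + Real.log ξ) ^ N)⁻¹ ≤ ((r + 1) / (η * Real.log Z)) ^ N := by
        rw [show ((r : ℝ) + 1) / (η * Real.log Z) = (η * Real.log Z / (r + 1))⁻¹ by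
          rw [inv_div], inv_pow]
        exact inv_anti₀ (by positivity) (pow_le_pow_left₀ hL0.le hL N)
      have hbase : 0 ≤ φ * ψ * A' ^ (Q * (r + 1)) * H * (tupleNorm u : ℝ)⁻¹ := by positivity
      calc φ * A' ^ (Q * (r + 1)) * (H * ψ / (tupleNorm u * (1 + Real.log ξ) ^ N))
          = (φ * ψ * A' ^ (Q * (r + 1)) * H * (tupleNorm u : ℝ)⁻¹) * ((1 + Real.log ξ) ^ N)⁻¹ := by
            rw [div_eq_mul_inv, mul_inv]; ring
        _ ≤ (φ * ψ * A' ^ (Q * (r + 1)) * H * (tupleNorm u : ℝ)⁻¹) *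
            (((r + 1) / (η * Real.log Z)) ^ N *
              (Real.exp (κ / 2 - κ * r / 2) * (tupleNorm u : ℝ) ^ (κ / Real.log y))) := by
            refine mul_le_mul_of_nonneg_left ?_ hbase
            exact hinv.trans (le_mul_of_one_le_right (by positivity) hone)
        _ = _ := by rw [div_eq_mul_inv ((tupleNorm u : ℝ) ^ (κ / Real.log y))]; ring
    refine (sum_le_sum hb).trans ?_
    rw [← mul_sum]
    refine mul_le_mul_of_nonneg_left ?_ (by positivity)
    refine (sum_le_sum_of_subset_of_nonneg (filter_subset _ _) ?_).trans ?_
    · intro u hu _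
      refine prod_nonneg fun i _ => ?_
      have := (mem_goodIdeals.1 (mem_filter.1 (Fintype.mem_piFinset.1 hu i)).1).1
      exact mul_nonneg (mul_nonneg ((hf i).nonneg _ this) (primeWeight_nonneg hc _)) (by positivity)
    · rw [prod_sum_piFinset T fun i 𝔞 => f i 𝔞 * primeWeight c 𝔞 *
        (Ideal.absNorm 𝔞 : ℝ) ^ (κ / Real.log y - 1)]
      refine Finset.prod_le_prod (fun i _ => sum_nonneg fun 𝔞 h𝔞 => ?_) fun i _ => ?_
      · exact mul_nonneg (mul_nonneg ((hf i).nonneg _ (mem_goodIdeals.1 (mem_filter.1 h𝔞).1).1)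
          (primeWeight_nonneg hc _)) (by positivity)
      · exact hR i (T i) (filter_subset _ _) fun 𝔞 h𝔞 => (mem_filter.1 h𝔞).2
  · rw [sum_const, nsmul_eq_mul]
    -- Each u with N(u) ≤ Z is counted with weight (Z/N(u))² ≥ 1.
    have hcard : (U.card : ℝ) ≤ C₂ * Z ^ (2 : ℝ) := by
      have h1 : ∀ u ∈ U, (1 : ℝ) ≤ Z ^ (2 : ℝ) * ∏ i, (Ideal.absNorm (u i) : ℝ) ^ (-2 : ℝ) := by
        intro u hu
        have hN1 : (0 : ℝ) < tupleNorm u := by exact_mod_cast tupleNorm_pos (hUg u hu).ne_bot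
        rw [← rpow_tupleNorm, Real.rpow_neg hN1.le, ← div_eq_mul_inv, one_le_div (by positivity)]
        exact Real.rpow_le_rpow hN1.le (mem_filter.1 hu).2.1 two_pos.le
      calc (U.card : ℝ) = ∑ u ∈ U, (1 : ℝ) := by simp
        _ ≤ _ := sum_le_sum h1
        _ = Z ^ (2 : ℝ) * ∑ u ∈ U, ∏ i, (Ideal.absNorm (u i) : ℝ) ^ (-2 : ℝ) := by rw [mul_sum]
        _ ≤ Z ^ (2 : ℝ) * ∑ u ∈ Fintype.piFinset (fun i => goodIdeals (K i) W V),
            ∏ i, (Ideal.absNorm (u i) : ℝ) ^ (-2 : ℝ) := by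
            refine mul_le_mul_of_nonneg_left (sum_le_sum_of_subset_of_nonneg (fun u hu => ?_)
              fun u _ _ => prod_nonneg fun i _ => by positivity) (by positivity)
            exact Fintype.mem_piFinset.2 fun i =>
              (mem_filter.1 (Fintype.mem_piFinset.1 (mem_filter.1 hu).1 i)).1
        _ ≤ Z ^ (2 : ℝ) * C₂ := by
            rw [prod_sum_piFinset _ fun i 𝔞 => (Ideal.absNorm 𝔞 : ℝ) ^ (-2 : ℝ)]
            exact mul_le_mul_of_nonneg_left hC₂ (by positivity)
        _ = _ := mul_comm _ _
    calc (U.card : ℝ) * (P * (E * ξ ^ s)) ≤ (C₂ * Z ^ (2 : ℝ)) * (P * (E * Z ^ (η * s / 2))) := by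
          refine mul_le_mul hcard ?_ (by positivity) ((Nat.cast_nonneg _).trans hcard)
          gcongr
      _ = _ := by ring

end SieveSums
end

/-! ### Exceptional tuples are rare. -/

noncomputable section

section ExceptionalTuples
open Finset UniqueFactorizationMonoid

variable {N : ℕ} {K : Fin N → Type*} [∀ i, Field (K i)] [∀ i, NumberField (K i)]
variable {W : ℕ} {c : ℝ} {s : ℕ} {α : Type} {X : Finset α} {𝔫 : α → ∀ i, Ideal (𝓞 (K i))}
  {H E k : ℝ}

lemma primeWeight_top {L : Type*} [Field L] [NumberField L] (c : ℝ) :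
    primeWeight c (⊤ : Ideal (𝓞 L)) = 1 := by
  rw [primeWeight, ← Ideal.one_eq_top, normalizedFactors_one]; simp

/-- The sieve hypothesis at ξ = 1, where nothing is sieved, for the tuple with 𝔭^j in one place and
unit ideals elsewhere. -/
lemma card_siftedSet_prime_pow_le (hS : HasSieveBound W c s X 𝔫 H E k) (hc : 0 ≤ c) (hH : 0 ≤ H)
    {i : Fin N} {𝔭 : Ideal (𝓞 (K i))} (h𝔭 : IsGoodPrime W 𝔭) (j : ℕ)
    (hk : (Ideal.absNorm 𝔭 : ℝ) ^ j ≤ k) :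
    ((siftedSet X 𝔫 (Function.update (fun _ => ⊤) i (𝔭 ^ j)) 1).card : ℝ) ≤
      H * (1 + c) / (Ideal.absNorm 𝔭 : ℝ) ^ j + E := by
  set u : ∀ i, Ideal (𝓞 (K i)) := Function.update (fun _ => ⊤) i (𝔭 ^ j) with hu
  have hui : u i = 𝔭 ^ j := Function.update_self ..
  have huj : ∀ l, l ≠ i → u l = ⊤ := fun l hl => Function.update_of_ne hl ..
  have hgood : IsGoodTuple W u := by
    constructor
    · intro l
      by_cases hl : l = i
      · subst hl; rw [hui]; exact pow_ne_zero _ h𝔭.ne_bot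
      · rw [huj l hl]; exact top_ne_bot
    · intro l
      by_cases hl : l = i
      · subst hl
        rw [hui, normalizedFactors_pow, normalizedFactors_irreducible h𝔭.prime.irreducible,
          normalize_eq]
        intro 𝔮 h𝔮
        rw [Multiset.mem_singleton.1 (Multiset.mem_of_mem_nsmul h𝔮)]
        exact h𝔭
      · rw [huj l hl, ← Ideal.one_eq_top, normalizedFactors_one]; simp
  have hnorm : (tupleNorm u : ℝ) = (Ideal.absNorm 𝔭 : ℝ) ^ j := by
    unfold tupleNorm
    rw [Finset.prod_eq_single i, hui, map_pow, Nat.cast_pow]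
    · intro l _ hl; rw [huj l hl, Ideal.absNorm_top]
    · simp
  have hpw : ∏ l, primeWeight c (u l) ≤ 1 + c := by
    rw [Finset.prod_eq_single i, hui]
    · exact primeWeight_pow_le hc h𝔭 j
    · intro l _ hl; rw [huj l hl, primeWeight_top]
    · simp
  have h1 := hS u hgood 1 le_rfl (by rw [hnorm, one_pow, mul_one]; exact hk)
  rw [hnorm, Real.log_one, add_zero, one_pow, one_pow, mul_one, mul_one] at h1
  refine h1.trans ?_
  gcongr

open Classical in
/-- Few tuples are divisible by a large power of a small prime. -/
lemma card_large_prime_pow_le (hS : HasSieveBound W c s X 𝔫 H E k) (hc : 0 ≤ c) (hH : 0 ≤ H)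
    (hE : 0 ≤ E) (hsep : ∀ x ∈ X, IsSeparatedTuple W (𝔫 x)) {Z : ℝ} (hZ : 2 ≤ Z) (hk : Z ≤ k) :
    ((X.filter (fun x => ∃ p ∈ primeNorms (𝔫 x), ∃ j, j ≤ (primeNorms (𝔫 x)).count p ∧
      (p : ℝ) ≤ √Z ∧ √Z < (p : ℝ) ^ j ∧ (p : ℝ) ^ j ≤ Z)).card : ℝ) ≤
      (∑ i, (Module.finrank ℚ (K i) : ℝ)) *
        (H * (1 + c) * Z ^ (-(1 / 4) : ℝ) * (1 + Real.log Z) + E * √Z) := by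
  have hZ0 : 0 < Z := by linarith
  have hsq1 : 1 ≤ √Z := by rw [Real.one_le_sqrt]; linarith
  set X' := X.filter (fun x => ∃ p ∈ primeNorms (𝔫 x), ∃ j, j ≤ (primeNorms (𝔫 x)).count p ∧
      (p : ℝ) ≤ √Z ∧ √Z < (p : ℝ) ^ j ∧ (p : ℝ) ^ j ≤ Z) with hX'
  set a := H * (1 + c) * Z ^ (-(1 / 4) : ℝ) with ha
  have ha0 : 0 ≤ a := by positivity
  set T : ∀ i, Finset (Ideal (𝓞 (K i))) := fun i => (idealsUpTo (K i) √Z).filter (IsGoodPrime W)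
  have hT : ∀ i, ∀ 𝔭 ∈ T i, IsGoodPrime W 𝔭 ∧ (Ideal.absNorm 𝔭 : ℝ) ≤ √Z := fun i 𝔭 h =>
    ⟨(mem_filter.1 h).2, (mem_idealsUpTo.1 (mem_filter.1 h).1).2⟩
  have h1 : (X'.card : ℝ) ≤ ∑ z ∈ univ.sigma T, ∑ x ∈ X'.filter (fun x => ∃ j,
      √Z < (Ideal.absNorm z.2 : ℝ) ^ j ∧ (Ideal.absNorm z.2 : ℝ) ^ j ≤ Z ∧ z.2 ^ j ∣ 𝔫 x z.1),
      (1 : ℝ) := by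
    have := sum_le_sum_of_cover X' (univ.sigma T) (fun z x => ∃ j,
      √Z < (Ideal.absNorm z.2 : ℝ) ^ j ∧ (Ideal.absNorm z.2 : ℝ) ^ j ≤ Z ∧ z.2 ^ j ∣ 𝔫 x z.1)
      (fun _ => (1 : ℝ)) (fun _ _ => zero_le_one) (by
        intro x hx
        obtain ⟨hxX, p, hp, j, hj, h2, h3, h4⟩ := mem_filter.1 hx
        obtain ⟨i, 𝔭, hg, rfl, hd⟩ := exists_pow_dvd_of_le_count (hsep x hxX) hp hj
        exact ⟨⟨i, 𝔭⟩, mem_sigma.2 ⟨mem_univ _, mem_filter.2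
          ⟨mem_idealsUpTo.2 ⟨hg.ne_bot, h2⟩, hg⟩⟩, j, h3, h4, hd⟩)
    simpa using this
  refine h1.trans ?_
  rw [sum_sigma, sum_mul]
  refine sum_le_sum fun i _ => ?_
  have h2 : ∀ 𝔭 ∈ T i, ∑ x ∈ X'.filter (fun x => ∃ j,
      √Z < (Ideal.absNorm 𝔭 : ℝ) ^ j ∧ (Ideal.absNorm 𝔭 : ℝ) ^ j ≤ Z ∧ 𝔭 ^ j ∣ 𝔫 x i), (1 : ℝ) ≤
      a / (Ideal.absNorm 𝔭 : ℝ) + E := by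
    intro 𝔭 h𝔭
    obtain ⟨hg, hle⟩ := hT i 𝔭 h𝔭
    have hp2 : (2 : ℝ) ≤ Ideal.absNorm 𝔭 := by exact_mod_cast hg.1.two_le
    have hp0 : (0 : ℝ) < Ideal.absNorm 𝔭 := by linarith
    rw [sum_const, nsmul_eq_mul, mul_one]
    by_cases hex : ∃ j, √Z < (Ideal.absNorm 𝔭 : ℝ) ^ j ∧ (Ideal.absNorm 𝔭 : ℝ) ^ j ≤ Z
    swap
    · rw [filter_eq_empty_iff.2 fun x _ h => hex (h.imp fun j hj => ⟨hj.1, hj.2.1⟩)]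
      rw [card_empty, Nat.cast_zero]; positivity
    -- For a fixed prime the least admissible exponent covers all others, so each prime is counted
    -- once.
    have hmin : ∀ j, √Z < (Ideal.absNorm 𝔭 : ℝ) ^ j → Nat.find hex ≤ j := by
      intro j hj
      by_contra! hlt
      have h3 := Nat.find_min hex hlt
      have h4 := (Nat.find_spec hex).2
      refine h3 ⟨hj, le_trans (pow_le_pow_right₀ (by linarith) hlt.le) h4⟩
    set j := Nat.find hex with hj
    obtain ⟨hj1, hj2⟩ := Nat.find_spec hex
    have hsub : X'.filter (fun x => ∃ j,
        √Z < (Ideal.absNorm 𝔭 : ℝ) ^ j ∧ (Ideal.absNorm 𝔭 : ℝ) ^ j ≤ Z ∧ 𝔭 ^ j ∣ 𝔫 x i) ⊆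
        siftedSet X 𝔫 (Function.update (fun _ => ⊤) i (𝔭 ^ j)) 1 := by
      intro x hx
      obtain ⟨hx1, l, hl1, hl2, hl3⟩ := mem_filter.1 hx
      have hxX := (mem_filter.1 hx1).1
      refine mem_filter.2 ⟨hxX, fun i' => ?_, fun p hp hp1 => ?_⟩
      · by_cases h5 : i' = i
        · subst h5
          rw [Function.update_self]
          exact (pow_dvd_pow 𝔭 (hmin l hl1)).trans hl3
        · rw [Function.update_of_ne h5, ← Ideal.one_eq_top]
          exact one_dvd _
      · exfalso
        have h5 := ((hsep x hxX).toIsGoodTuple.prime_of_mem hp).two_le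
        have h6 : p ≤ 1 := by exact_mod_cast hp1
        omega
    refine (Nat.cast_le.2 (card_le_card hsub)).trans ?_
    refine (card_siftedSet_prime_pow_le hS hc hH hg j (hj2.trans hk)).trans ?_
    -- The exponents 0 and 1 are impossible because 1 ≤ √Z and N𝔭 ≤ √Z.
    have hj3 : 2 ≤ j := by
      by_contra! hlt
      interval_cases h7 : j
      · rw [← hj, pow_zero] at hj1; linarith
      · rw [← hj, pow_one] at hj1; linarith
    -- Multiplying N𝔭^j > √Z by N𝔭^j ≥ N𝔭² and taking square roots. The saving Z^(-1/4) then leaves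
    -- a harmonic sum over primes.
    have hpow : Z ^ ((1 / 4) : ℝ) * (Ideal.absNorm 𝔭 : ℝ) ≤ (Ideal.absNorm 𝔭 : ℝ) ^ j := by
      have h8 : (Ideal.absNorm 𝔭 : ℝ) ^ 2 ≤ (Ideal.absNorm 𝔭 : ℝ) ^ j :=
        pow_le_pow_right₀ (by linarith) hj3
      have h9 : (Z ^ ((1 / 4) : ℝ)) ^ 2 = √Z := by
        rw [← Real.rpow_natCast, ← Real.rpow_mul hZ0.le, Real.sqrt_eq_rpow]; norm_num
      refine le_of_sq_le_sq ?_ (by positivity)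
      rw [mul_pow, h9]
      calc √Z * (Ideal.absNorm 𝔭 : ℝ) ^ 2 ≤ (Ideal.absNorm 𝔭 : ℝ) ^ j * (Ideal.absNorm 𝔭 : ℝ) ^ j :=
            mul_le_mul hj1.le h8 (by positivity) (by positivity)
        _ = _ := by ring
    have h10 : H * (1 + c) / (Ideal.absNorm 𝔭 : ℝ) ^ j ≤ a / (Ideal.absNorm 𝔭 : ℝ) := by
      rw [ha, Real.rpow_neg hZ0.le, ← div_eq_mul_inv, div_div]
      exact div_le_div_of_nonneg_left (by positivity) (by positivity) hpow
    linarith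
  refine (sum_le_sum h2).trans ?_
  refine (sum_goodPrime_le (T i) √Z (hT i) (fun n => a / n + E) fun n => by positivity).trans ?_
  refine mul_le_mul_of_nonneg_left ?_ (by positivity)
  refine (sum_le_sum_of_subset_of_nonneg (filter_subset _ _) fun n _ _ => by positivity).trans ?_
  rw [sum_add_distrib]
  have hfl : (⌊√Z⌋₊ : ℝ) ≤ √Z := Nat.floor_le (by positivity)
  have hfl1 : 1 ≤ ⌊√Z⌋₊ := Nat.le_floor (by exact_mod_cast hsq1)
  have hharm : ∑ n ∈ Icc 1 ⌊√Z⌋₊, a / (n : ℝ) ≤ a * (1 + Real.log Z) := by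
    have h3 := harmonic_le_one_add_log ⌊√Z⌋₊
    rw [harmonic_eq_sum_Icc] at h3
    push_cast at h3
    simp only [div_eq_mul_inv]
    rw [← mul_sum]
    refine mul_le_mul_of_nonneg_left (h3.trans ?_) ha0
    have h4 : Real.log ⌊√Z⌋₊ ≤ Real.log Z := by
      refine Real.log_le_log (by exact_mod_cast hfl1) (hfl.trans ?_)
      rw [Real.sqrt_le_left hZ0.le]; nlinarith
    linarith
  have hconst : ∑ n ∈ Icc 1 ⌊√Z⌋₊, E ≤ E * √Z := by
    rw [sum_const, Nat.card_Icc, nsmul_eq_mul, Nat.add_sub_cancel, mul_comm]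
    exact mul_le_mul_of_nonneg_left hfl hE
  linarith

open Classical in
/-- Few tuples have a large divisor composed of very small primes. -/
lemma card_large_smooth_le (hS : HasSieveBound W c s X 𝔫 H E k) (hc : 0 ≤ c) (hH : 0 ≤ H)
    (hE : 0 ≤ E) (hsep : ∀ x ∈ X, IsSeparatedTuple W (𝔫 x)) {Z V y : ℝ} (hZ : 2 ≤ Z) (hZV : Z ≤ V)
    (hk : Z ≤ k) {C : Fin N → ℝ}
    (hC : ∀ i, ∀ T ⊆ goodIdeals (K i) W V,
      (∀ 𝔞 ∈ T, ∀ 𝔭 ∈ normalizedFactors 𝔞, (Ideal.absNorm 𝔭 : ℝ) ≤ y) →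
      ∑ 𝔞 ∈ T, (Ideal.absNorm 𝔞 : ℝ) ^ (-(1 / 4) : ℝ) ≤ C i ∧ ∀ 𝔞 ∈ T, primeWeight c 𝔞 ≤ C i) :
    ((X.filter (fun x => ∃ t : ℕ, √Z < (((primeNorms (𝔫 x)).filter (· < t)).prod : ℝ) ∧
      (((primeNorms (𝔫 x)).filter (· < t)).prod : ℝ) ≤ Z ∧
      ∀ p ∈ primeNorms (𝔫 x), p < t → (p : ℝ) < y)).card : ℝ) ≤
      (∏ i, C i) * (H * (∏ i, C i) * Z ^ (-(3 / 8) : ℝ) + E * Z ^ ((1 / 4) : ℝ)) := by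
  have hZ0 : 0 < Z := by linarith
  set X' := X.filter (fun x => ∃ t : ℕ, √Z < (((primeNorms (𝔫 x)).filter (· < t)).prod : ℝ) ∧
      (((primeNorms (𝔫 x)).filter (· < t)).prod : ℝ) ≤ Z ∧
      ∀ p ∈ primeNorms (𝔫 x), p < t → (p : ℝ) < y) with hX'
  set T : ∀ i, Finset (Ideal (𝓞 (K i))) := fun i => (goodIdeals (K i) W V).filter
    (fun 𝔞 => ∀ 𝔭 ∈ normalizedFactors 𝔞, (Ideal.absNorm 𝔭 : ℝ) ≤ y) with hT
  have hTC := fun i => hC i (T i) (filter_subset _ _) fun 𝔞 h𝔞 => (mem_filter.1 h𝔞).2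
  set U := (Fintype.piFinset T).filter
    (fun u => (tupleNorm u : ℝ) ≤ Z ∧ √Z < (tupleNorm u : ℝ)) with hU
  have h1 : (X'.card : ℝ) ≤ ∑ u ∈ U, ∑ x ∈ X'.filter (fun x => ∀ i, u i ∣ 𝔫 x i), (1 : ℝ) := by
    have := sum_le_sum_of_cover X' U (fun u x => ∀ i, u i ∣ 𝔫 x i) (fun _ => (1 : ℝ))
      (fun _ _ => zero_le_one) (by
        intro x hx
        obtain ⟨hxX, t, h1, h2, h3⟩ := mem_filter.1 hx
        have hg := (hsep x hxX).toIsGoodTuple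
        refine ⟨smoothPart t (𝔫 x), mem_filter.2 ⟨Fintype.mem_piFinset.2 fun i => mem_filter.2
          (smoothPart_mem_goodIdeals hZV hg h2 (fun p hp hpt => (h3 p hp hpt).le) i), ?_⟩,
          smoothPart_dvd hg.ne_bot t⟩
        rw [tupleNorm_smoothPart hg]
        exact ⟨h2, h1⟩)
    simpa using this
  refine h1.trans ?_
  have h2 : ∀ u ∈ U, ∑ x ∈ X'.filter (fun x => ∀ i, u i ∣ 𝔫 x i), (1 : ℝ) ≤
      (H * (∏ i, C i) * Z ^ (-(3 / 8) : ℝ) + E * Z ^ ((1 / 4) : ℝ)) *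
        ∏ i, (Ideal.absNorm (u i) : ℝ) ^ (-(1 / 4) : ℝ) := by
    intro u hu
    obtain ⟨hu1, hu2, hu3⟩ := mem_filter.1 hu
    have huT := Fintype.mem_piFinset.1 hu1
    have hug : IsGoodTuple W u := isGoodTuple_of_mem fun i => (mem_filter.1 (huT i)).1
    have hN0 : (0 : ℝ) < tupleNorm u := by exact_mod_cast tupleNorm_pos hug.ne_bot
    rw [sum_const, nsmul_eq_mul, mul_one, ← rpow_tupleNorm]
    have hsub : X'.filter (fun x => ∀ i, u i ∣ 𝔫 x i) ⊆ siftedSet X 𝔫 u 1 := by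
      intro x hx
      obtain ⟨hx1, hx2⟩ := mem_filter.1 hx
      have hxX := (mem_filter.1 hx1).1
      refine mem_filter.2 ⟨hxX, hx2, fun p hp hp1 => ?_⟩
      exfalso
      have h5 := ((hsep x hxX).toIsGoodTuple.prime_of_mem hp).two_le
      have h6 : p ≤ 1 := by exact_mod_cast hp1
      omega
    refine (Nat.cast_le.2 (card_le_card hsub)).trans ?_
    have h3 := hS u hug 1 le_rfl (by rw [one_pow, mul_one]; exact hu2.trans hk)
    rw [Real.log_one, add_zero, one_pow, one_pow, mul_one, mul_one] at h3
    refine h3.trans ?_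
    have h4 : ∏ i, primeWeight c (u i) ≤ ∏ i, C i :=
      Finset.prod_le_prod (fun i _ => primeWeight_nonneg hc _) fun i _ => (hTC i).2 _ (huT i)
    -- Of the exponent 1, three quarters are spent using N(u) > √Z and one quarter is kept for the
    -- convergent sum over smooth ideals.
    have h5 : (tupleNorm u : ℝ)⁻¹ ≤ Z ^ (-(3 / 8) : ℝ) * (tupleNorm u : ℝ) ^ (-(1 / 4) : ℝ) := by
      have h6 : (tupleNorm u : ℝ) ^ (-(3 / 4) : ℝ) ≤ Z ^ (-(3 / 8) : ℝ) := by
        calc _ ≤ (√Z) ^ (-(3 / 4) : ℝ) :=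
              Real.rpow_le_rpow_of_nonpos (Real.sqrt_pos.2 hZ0) hu3.le (by norm_num)
          _ = _ := by rw [Real.sqrt_eq_rpow, ← Real.rpow_mul hZ0.le]; norm_num
      calc (tupleNorm u : ℝ)⁻¹ = (tupleNorm u : ℝ) ^ (-(3 / 4) : ℝ) *
            (tupleNorm u : ℝ) ^ (-(1 / 4) : ℝ) := by
            rw [← Real.rpow_add hN0, ← Real.rpow_neg_one]; norm_num
        _ ≤ _ := mul_le_mul_of_nonneg_right h6 (by positivity)
    have h7 : 1 ≤ Z ^ ((1 / 4) : ℝ) * (tupleNorm u : ℝ) ^ (-(1 / 4) : ℝ) := by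
      rw [Real.rpow_neg hN0.le, ← div_eq_mul_inv, one_le_div (by positivity)]
      exact Real.rpow_le_rpow hN0.le hu2 (by norm_num)
    have hpw0 : 0 ≤ ∏ i, primeWeight c (u i) := prod_nonneg fun i _ => primeWeight_nonneg hc _
    have hC0 : 0 ≤ ∏ i, C i := hpw0.trans h4
    have h8 : H * (∏ i, primeWeight c (u i)) / tupleNorm u ≤
        H * (∏ i, C i) * (Z ^ (-(3 / 8) : ℝ) * (tupleNorm u : ℝ) ^ (-(1 / 4) : ℝ)) := by
      rw [div_eq_mul_inv]
      exact mul_le_mul (mul_le_mul_of_nonneg_left h4 hH) h5 (by positivity) (by positivity)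
    have h9 := mul_le_mul_of_nonneg_left h7 hE
    linarith
  refine (sum_le_sum h2).trans ?_
  rw [← mul_sum, mul_comm]
  have hsum : ∑ u ∈ U, ∏ i, (Ideal.absNorm (u i) : ℝ) ^ (-(1 / 4) : ℝ) ≤ ∏ i, C i := by
    refine (sum_le_sum_of_subset_of_nonneg (filter_subset _ _) fun u _ _ =>
      prod_nonneg fun i _ => by positivity).trans ?_
    rw [prod_sum_piFinset T fun i 𝔞 => (Ideal.absNorm 𝔞 : ℝ) ^ (-(1 / 4) : ℝ)]
    exact Finset.prod_le_prod (fun i _ => sum_nonneg fun 𝔞 _ => by positivity) fun i _ => (hTC i).1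
  have hC0 : 0 ≤ ∏ i, C i :=
    (sum_nonneg fun u _ => prod_nonneg fun i _ => by positivity).trans hsum
  exact mul_le_mul_of_nonneg_right hsum (by positivity)

end ExceptionalTuples
end

/-! ### The mean value theorem for sieved families. -/

noncomputable section

section NairTenenbaum
open Finset UniqueFactorizationMonoid

/-- Lets powers of log Y be absorbed by the small power Y^(δ/4) left over in the exceptional
classes. -/
lemma exists_one_add_log_pow_le (n : ℕ) {a : ℝ} (ha : 0 < a) :
    ∃ C : ℝ, 0 < C ∧ ∀ Y : ℝ, 1 ≤ Y → (1 + Real.log Y) ^ n ≤ C * Y ^ a := by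
  set b := a / (n + 1) with hb
  have hb0 : 0 < b := by positivity
  refine ⟨(1 + 1 / b) ^ n, by positivity, fun Y hY => ?_⟩
  have h1 : 1 + Real.log Y ≤ (1 + 1 / b) * Y ^ b := by
    have h2 := Real.log_le_rpow_div (by linarith : (0 : ℝ) ≤ Y) hb0
    have h3 : 1 ≤ Y ^ b := Real.one_le_rpow hY hb0.le
    calc 1 + Real.log Y ≤ Y ^ b + Y ^ b / b := add_le_add h3 h2
      _ = _ := by ring
  have h0 : 0 ≤ Real.log Y := Real.log_nonneg hY
  calc (1 + Real.log Y) ^ n ≤ ((1 + 1 / b) * Y ^ b) ^ n := pow_le_pow_left₀ (by linarith) h1 n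
    _ = (1 + 1 / b) ^ n * Y ^ (b * n) := by
        rw [mul_pow, ← Real.rpow_natCast (Y ^ b), ← Real.rpow_mul (by linarith)]
    _ ≤ _ := by
        refine mul_le_mul_of_nonneg_left (Real.rpow_le_rpow_of_exponent_le hY ?_) (by positivity)
        rw [hb, div_mul_eq_mul_div, div_le_iff₀ (by positivity)]
        nlinarith

set_option maxHeartbeats 4000000 in
/-- A mean value bound for pseudomultiplicative functions over a sieved family of ideals. -/
theorem exists_sum_le_of_hasSieveBound (N : ℕ) (K : Fin N → Type*) [∀ i, Field (K i)]
    [∀ i, NumberField (K i)] (W : ℕ) (A B ε : Fin N → ℝ) (d : Fin N → ℕ)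
    (hε : ∀ i, ε i ≤ 1 / 9) (c : ℝ) (hc : 0 ≤ c) (s : ℕ) (M D δ : ℝ) (hD : 1 ≤ D) (hδ : 0 < δ) :
    ∃ C Y₀ : ℝ, 0 < C ∧ 2 ≤ Y₀ ∧ ∀ f : ∀ i, Ideal (𝓞 (K i)) → ℝ,
      (∀ i, IsPseudomultiplicative (A i) (B i) (ε i) (f i)) → (∀ i, f i ⊤ ≤ M) →
      ∀ (α : Type) (X : Finset α) (𝔫 : α → ∀ i, Ideal (𝓞 (K i))) (H E k Y V : ℝ),
        Y₀ ≤ Y → 0 ≤ H → 0 ≤ E → (∀ x ∈ X, IsSeparatedTuple W (𝔫 x)) →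
        (∀ x ∈ X, ∀ i, (Ideal.absNorm (𝔫 x i) : ℝ) ≤ D * Y ^ d i) →
        Y ^ (4 * ∑ i, d i * ε i + δ) ≤ V → (Y ^ (4 * ∑ i, d i * ε i + δ)) ^ ((5 : ℝ) / 4) ≤ k →
        HasSieveBound W c s X 𝔫 H E k →
        ∑ x ∈ X, ∏ i, f i (𝔫 x i) ≤
          C * (H * (∏ i, squarefreeSum (f i) W V) / Real.log Y ^ N +
            E * Y ^ (10 * ∑ i, d i * ε i + 3 * δ)) := by
  classical
  by_cases hpos : ∀ i, 0 < A i ∧ 0 < B i ∧ 0 < ε i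
  swap
  · exact ⟨1, 2, one_pos, le_rfl, fun f hf => absurd
      (fun i => ⟨(hf i).A_pos, (hf i).B_pos, (hf i).eps_pos⟩) hpos⟩
  set T := ∑ i, d i * ε i with hTdef
  have hT0 : 0 ≤ T := sum_nonneg fun i _ => mul_nonneg (by positivity) (hpos i).2.2.le
  -- With Z = Y^e the saving Z^(-1/4) = Y^(-T-δ/4) of the exceptional classes outweighs the trivial
  -- bound Y^T.
  set e := 4 * T + δ with he
  have he0 : 0 < e := by positivity
  -- Makes ηs/2 at most 1/8, so the sieve costs only Z^(1/8) and stays within the level Z^(5/4).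
  set η : ℝ := 1 / (4 * (s + 1)) with hη
  have hη0 : 0 < η := by positivity
  have hη1 : η ≤ 1 := by
    rw [hη, div_le_one (by positivity)]; nlinarith [(Nat.cast_nonneg s : (0 : ℝ) ≤ s)]
  have hηs : η * s / 2 ≤ 1 / 8 := by
    rw [hη, div_mul_eq_mul_div, one_mul, div_div, div_le_div_iff₀ (by positivity) (by norm_num)]
    linarith
  -- Once Y ≥ D, the product of the norms is at most Y^(N + ∑ d_i), and hence at most Z^Q.
  set Q := ⌈((N : ℝ) + ∑ i, (d i : ℝ)) / e⌉₊ with hQ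
  set A' := 1 + ∑ i, A i with hA'
  have hAA : ∀ i, A i ≤ A' := fun i => by
    have := single_le_sum (f := A) (fun j _ => (hpos j).1.le) (mem_univ i)
    linarith
  have hA1 : 1 ≤ A' := by
    have := sum_nonneg (f := A) (s := univ) fun j _ => (hpos j).1.le
    linarith
  have hA0 : 0 < A' := by linarith
  set L := Real.log A' with hL
  have hL0 : 0 ≤ L := Real.log_nonneg hA1
  -- Large enough that exp(-κr/2) beats A'^(Qr) (r+1)^N with a factor e^(-r) to spare, so the series
  -- over r converges geometrically.
  set κ : ℝ := 2 * (N + Q * L + 1) with hκ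
  have hκ0 : 0 ≤ κ := by positivity
  choose C₁ y₁ hC₁ hy₁ hrankin using fun i => exists_rankin_sum_le (K i) W (A i) (B i) (ε i) κ c
    (hε i) hκ0 hc
  set y := 2 + ∑ i, y₁ i with hy
  have hy2 : 2 ≤ y := by
    have := sum_nonneg (f := y₁) (s := univ) fun j _ => by linarith [hy₁ j]
    linarith
  have hyi : ∀ i, y₁ i ≤ y := fun i => by
    have := single_le_sum (f := y₁) (fun j _ => by linarith [hy₁ j]) (mem_univ i)
    linarith
  choose C₂ hC₂ hsq using fun i => exists_sum_absNorm_rpow_neg_two_le (K i) W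
  choose C₃ hC₃ hsm using fun i => exists_sum_smooth_le (K i) W y (1 / 4) c (by norm_num) hc
  obtain ⟨C₄, hC₄, hlog⟩ := exists_one_add_log_pow_le (N + 1) (a := δ / 4) (by positivity)
  set Cf := ∏ i, (B i * D ^ ε i) with hCf
  have hCf0 : 0 < Cf := prod_pos fun i _ => mul_pos (hpos i).2.1 (by positivity)
  set M' := (max 0 M) ^ N with hM'
  have hM'0 : 0 ≤ M' := by positivity
  set F := ∑ i, (Module.finrank ℚ (K i) : ℝ) with hF
  have hF0 : 0 ≤ F := by positivity
  set P₁ := ∏ i, C₁ i with hP₁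
  set P₂ := ∏ i, C₂ i with hP₂
  set P₃ := ∏ i, C₃ i with hP₃
  have hP₁0 : 0 < P₁ := prod_pos fun i _ => hC₁ i
  have hP₂0 : 0 < P₂ := prod_pos fun i _ => hC₂ i
  have hP₃0 : 0 < P₃ := prod_pos fun i _ => by linarith [hC₃ i]
  set G₁ := 2 * Real.exp (Q * L + κ / 2) * ((η * e)⁻¹) ^ N * P₁ with hG₁
  set G₂ := Cf * (F * (1 + c) + P₃ * P₃) * (C₄ * (1 + e)) with hG₂
  set G₃ := M' * Cf * (16 * P₂ + F + P₃) with hG₃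
  have hG₁0 : 0 < G₁ := by positivity
  have hG₂0 : 0 < G₂ := by positivity
  have hG₃0 : 0 ≤ G₃ := by positivity
  -- The threshold ensures D ≤ Y and y ≤ Z, where y exceeds all the Rankin thresholds y₁.
  refine ⟨G₁ + G₂ + G₃, max (max 2 D) (y ^ e⁻¹), by positivity,
    (le_max_left _ _).trans (le_max_left _ _), ?_⟩
  intro f hf hM α X 𝔫 H E k Y V hY hH hE hsep hnorm hYV hYk hS
  have hY2 : 2 ≤ Y := ((le_max_left _ _).trans (le_max_left _ _)).trans hY
  have hYD : D ≤ Y := ((le_max_right _ _).trans (le_max_left _ _)).trans hY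
  have hYy : y ^ e⁻¹ ≤ Y := (le_max_right _ _).trans hY
  have hY0 : 0 < Y := by linarith
  have hY1 : 1 ≤ Y := by linarith
  have hlY : 0 < Real.log Y := Real.log_pos (by linarith)
  set Z := Y ^ e with hZdef
  have hZy : y ≤ Z := by
    calc y = (y ^ e⁻¹) ^ e := by
          rw [← Real.rpow_mul (by linarith), inv_mul_cancel₀ he0.ne', Real.rpow_one]
      _ ≤ Y ^ e := Real.rpow_le_rpow (by positivity) hYy he0.le
  have hZ2 : 2 ≤ Z := hy2.trans hZy
  have hZ0 : 0 < Z := by linarith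
  have hZ1 : 1 ≤ Z := by linarith
  have hlZ : Real.log Z = e * Real.log Y := by rw [hZdef, Real.log_rpow hY0]
  have hlZ0 : 0 < Real.log Z := by rw [hlZ]; positivity
  have hZk : Z ≤ k := by
    refine le_trans ?_ hYk
    calc Z = Z ^ (1 : ℝ) := (Real.rpow_one Z).symm
      _ ≤ Z ^ ((5 : ℝ) / 4) := Real.rpow_le_rpow_of_exponent_le hZ1 (by norm_num)
  have hη8 : Z ^ (η * s / 2) ≤ Z ^ ((1 : ℝ) / 8) := Real.rpow_le_rpow_of_exponent_le hZ1 hηs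
  have hkη : Z * Z ^ (η * s / 2) ≤ k := by
    refine le_trans ?_ hYk
    calc Z * Z ^ (η * s / 2) ≤ Z ^ (1 : ℝ) * Z ^ ((1 : ℝ) / 4) := by
          rw [Real.rpow_one]
          exact mul_le_mul_of_nonneg_left
            (Real.rpow_le_rpow_of_exponent_le hZ1 (by linarith)) hZ0.le
      _ = Z ^ ((5 : ℝ) / 4) := by rw [← Real.rpow_add hZ0]; norm_num
  -- the trivial bound
  set Φ := ∏ i, f i ⊤ with hΦ
  have hftop : ∀ i, 0 ≤ f i ⊤ := fun i => (hf i).nonneg _ top_ne_bot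
  have hΦ0 : 0 ≤ Φ := prod_nonneg fun i _ => hftop i
  set S := ∏ i, squarefreeSum (f i) W V with hSdef
  have hΦS : Φ ≤ S := Finset.prod_le_prod (fun i _ => hftop i) fun i _ =>
    apply_top_le_squarefreeSum (hf i) W (hZ1.trans hYV)
  have hS0 : 0 ≤ S := hΦ0.trans hΦS
  have hΦM : Φ ≤ M' := by
    calc Φ ≤ ∏ _i : Fin N, max 0 M :=
          Finset.prod_le_prod (fun i _ => hftop i) fun i _ => (hM i).trans (le_max_right _ _)
      _ = M' := by simp [hM']
  set P := Φ * (Cf * Y ^ T) with hPdef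
  have hP0 : 0 ≤ P := by positivity
  have hP : ∀ x ∈ X, ∏ i, f i (𝔫 x i) ≤ P := by
    intro x hx
    have hne := (hsep x hx).ne_bot
    calc ∏ i, f i (𝔫 x i) ≤ ∏ i, (f i ⊤ * ((B i * D ^ ε i) * Y ^ (d i * ε i))) := by
          refine Finset.prod_le_prod (fun i _ => (hf i).nonneg _ (hne i)) fun i _ => ?_
          refine (apply_le_top_mul_rpow (hf i) (hne i)).trans
            (mul_le_mul_of_nonneg_left ?_ (hftop i))
          rw [mul_assoc]
          refine mul_le_mul_of_nonneg_left ?_ (hpos i).2.1.le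
          refine (Real.rpow_le_rpow (by positivity) (hnorm x hx i) (hpos i).2.2.le).trans ?_
          rw [Real.mul_rpow (by linarith) (by positivity), ← Real.rpow_natCast Y,
            ← Real.rpow_mul hY0.le]
      _ = P := by
          rw [prod_mul_distrib, prod_mul_distrib, ← Real.rpow_sum_of_pos hY0]
  -- the number of prime factors
  have hQlog : ∀ x ∈ X, Real.log (tupleNorm (𝔫 x)) ≤ Q * Real.log Z := by
    intro x hx
    have hne := (hsep x hx).ne_bot
    have h1 : Real.log (tupleNorm (𝔫 x)) ≤ (N + ∑ i, (d i : ℝ)) * Real.log Y := by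
      rw [tupleNorm, Nat.cast_prod, Real.log_prod (fun i _ => by
        exact_mod_cast (absNorm_pos_of_ne_bot (hne i)).ne')]
      calc ∑ i, Real.log (Ideal.absNorm (𝔫 x i) : ℝ) ≤ ∑ i, (1 + (d i : ℝ)) * Real.log Y := by
            refine sum_le_sum fun i _ => ?_
            have h2 : (0 : ℝ) < Ideal.absNorm (𝔫 x i) := by
              exact_mod_cast absNorm_pos_of_ne_bot (hne i)
            have h3 := Real.log_le_log h2 ((hnorm x hx i).trans
              (mul_le_mul_of_nonneg_right hYD (by positivity)))
            rw [Real.log_mul hY0.ne' (by positivity), Real.log_pow] at h3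
            linarith
        _ = _ := by rw [← sum_mul, sum_add_distrib]; simp
    refine h1.trans ?_
    rw [hlZ, ← mul_assoc]
    refine mul_le_mul_of_nonneg_right ?_ hlY.le
    rw [← div_le_iff₀ he0]
    exact Nat.le_ceil _
  -- the decomposition
  have hfnn : ∀ x ∈ X, 0 ≤ ∏ i, f i (𝔫 x i) := fun x hx =>
    prod_nonneg fun i _ => (hf i).nonneg _ ((hsep x hx).ne_bot i)
  -- Only r with Z^(1/r) ≥ y occur, and as y ≥ 2 this leaves O(log Z) values.
  set R := (Icc 1 ⌊2 * Real.log Z⌋₊).filter (fun r : ℕ => y ≤ Z ^ ((1 : ℝ) / r)) with hR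
  set X₂ := X.filter (fun x => ∃ p ∈ primeNorms (𝔫 x), ∃ j, j ≤ (primeNorms (𝔫 x)).count p ∧
      (p : ℝ) ≤ √Z ∧ √Z < (p : ℝ) ^ j ∧ (p : ℝ) ^ j ≤ Z) with hX₂
  set X₃ := X.filter (fun x => ∃ t : ℕ, √Z < (((primeNorms (𝔫 x)).filter (· < t)).prod : ℝ) ∧
      (((primeNorms (𝔫 x)).filter (· < t)).prod : ℝ) ≤ Z ∧
      ∀ p ∈ primeNorms (𝔫 x), p < t → (p : ℝ) < y) with hX₃
  have hdecomp : ∑ x ∈ X, ∏ i, f i (𝔫 x i) ≤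
      ∑ r ∈ R, ∑ x ∈ X.filter (fun x => HasSmoothPart r Z (𝔫 x)), ∏ i, f i (𝔫 x i) +
        (∑ x ∈ X₂, ∏ i, f i (𝔫 x i) + ∑ x ∈ X₃, ∏ i, f i (𝔫 x i)) := by
    set X₀ := X.filter (fun x => ¬ (x ∈ X₂ ∨ x ∈ X₃)) with hX₀
    have h1 : ∑ x ∈ X₀, ∏ i, f i (𝔫 x i) ≤
        ∑ r ∈ R, ∑ x ∈ X.filter (fun x => HasSmoothPart r Z (𝔫 x)), ∏ i, f i (𝔫 x i) := by
      refine (sum_le_sum_of_cover X₀ R (fun r x => HasSmoothPart r Z (𝔫 x)) _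
        (fun x hx => hfnn x (mem_filter.1 hx).1) fun x hx => ?_).trans
        (sum_le_sum fun r _ => sum_le_sum_of_subset_of_nonneg
          (filter_subset_filter _ (filter_subset _ _)) fun x hx _ => hfnn x (mem_filter.1 hx).1)
      obtain ⟨hxX, hnot⟩ := mem_filter.1 hx
      rcases exists_smooth_part (primeNorms (𝔫 x))
        (fun p hp => (hsep x hxX).toIsGoodTuple.prime_of_mem hp) hZy hy2 with h | h | h
      · obtain ⟨r, t, hr, h1, h2, h3, h4, h5⟩ := h
        refine ⟨r, mem_filter.2 ⟨mem_Icc.2 ⟨hr, Nat.le_floor ?_⟩, h5⟩, t, h1, h2, h3, h4⟩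
        have hr0 : (0 : ℝ) < r := by exact_mod_cast hr
        have h6 := Real.log_le_log (by linarith) h5
        rw [Real.log_rpow hZ0, div_mul_eq_mul_div, one_mul, le_div_iff₀ hr0] at h6
        have h7 : (1 / 2 : ℝ) ≤ Real.log y :=
          le_trans (by linarith [Real.log_two_gt_d9]) (Real.log_le_log two_pos hy2)
        have h8 := mul_le_mul_of_nonneg_right h7 hr0.le
        linarith only [h6, h8]
      · exact absurd (Or.inl (mem_filter.2 ⟨hxX, h⟩)) hnot
      · exact absurd (Or.inr (mem_filter.2 ⟨hxX, h⟩)) hnot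
    have h2 : X ⊆ X₀ ∪ (X₂ ∪ X₃) := by
      intro x hx
      by_cases h : x ∈ X₂ ∨ x ∈ X₃
      · exact mem_union_right _ (mem_union.2 h)
      · exact mem_union_left _ (mem_filter.2 ⟨hx, h⟩)
    have hnn : ∀ x ∈ X₀ ∪ (X₂ ∪ X₃), 0 ≤ ∏ i, f i (𝔫 x i) := by
      intro x hx
      refine hfnn x ?_
      rcases mem_union.1 hx with h | h
      · exact (mem_filter.1 h).1
      · rcases mem_union.1 h with h | h
        · exact (mem_filter.1 h).1
        · exact (mem_filter.1 h).1
    refine (sum_le_sum_of_subset_of_nonneg h2 fun x hx _ => hnn x hx).trans ?_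
    have hun : ∀ U V : Finset α, (∀ x ∈ U ∪ V, 0 ≤ ∏ i, f i (𝔫 x i)) →
        ∑ x ∈ U ∪ V, ∏ i, f i (𝔫 x i) ≤
          ∑ x ∈ U, ∏ i, f i (𝔫 x i) + ∑ x ∈ V, ∏ i, f i (𝔫 x i) := by
      intro U V h
      rw [← sum_union_inter]
      exact le_add_of_nonneg_right (sum_nonneg fun x hx =>
        h x (mem_union_left _ (mem_inter.1 hx).1))
    refine (hun _ _ hnn).trans (add_le_add h1 (hun _ _ fun x hx => hnn x (mem_union_right _ hx)))
  -- the three classes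
  have hI : ∀ r ∈ R, ∑ x ∈ X.filter (fun x => HasSmoothPart r Z (𝔫 x)), ∏ i, f i (𝔫 x i) ≤
      Real.exp (Q * L + κ / 2) * ((1 / 2 : ℝ) ^ r) * (H * ((η * e)⁻¹ / Real.log Y) ^ N * (P₁ * S)) +
        P * E * (P₂ * Z ^ ((17 : ℝ) / 8)) := by
    intro r hr
    obtain ⟨hr1, hr2⟩ := mem_filter.1 hr
    have hr3 : 1 ≤ r := (mem_Icc.1 hr1).1
    have h1 := sum_hasSmoothPart_le hS hc hH hE hsep hf hAA hA1 hZ2 hYV hQlog hP hP0 hη0 hη1 hr3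
      hkη hκ0 (C₁ := fun i => C₁ i * squarefreeSum (f i) W V) (fun i T' hT' hT'y =>
        hrankin i (f i) (hf i) _ ((hyi i).trans hr2) V T' hT' hT'y)
      (C₂ := P₂) (Finset.prod_le_prod (fun i _ => sum_nonneg fun _ _ => by positivity)
        fun i _ => hsq i V)
    refine h1.trans (add_le_add ?_ ?_)
    · rw [prod_mul_distrib]
      have h2 : A' ^ (Q * (r + 1)) = Real.exp (Q * (r + 1) * L) := by
        rw [show Q * ((r : ℝ) + 1) * L = L * ((Q * (r + 1) : ℕ) : ℝ) by push_cast; ring,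
          Real.exp_mul, hL, Real.exp_log hA0, Real.rpow_natCast]
      have h3 : ((r : ℝ) + 1) ^ N ≤ Real.exp (r * N) := by
        rw [Real.exp_mul, Real.rpow_natCast]
        exact pow_le_pow_left₀ (by positivity) (Real.add_one_le_exp _) N
      have h4 : Real.exp (-(r : ℝ)) ≤ (1 / 2 : ℝ) ^ r := by
        have : Real.exp (-(r : ℝ)) = (Real.exp (-1)) ^ r := by rw [← Real.exp_nat_mul]; congr 1; ring
        rw [this]
        refine pow_le_pow_left₀ (Real.exp_pos _).le ?_ r
        rw [Real.exp_neg, one_div]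
        exact inv_anti₀ two_pos (by linarith [Real.add_one_le_exp (1 : ℝ)])
      have h5 : ((r : ℝ) + 1) / (η * Real.log Z) = (r + 1) * ((η * e)⁻¹ / Real.log Y) := by
        rw [hlZ]; field_simp
      rw [h2, h5, mul_pow]
      set q := ((η * e)⁻¹ / Real.log Y) ^ N with hq
      have hq0 : 0 ≤ q := by positivity
      calc Real.exp (Q * (r + 1) * L) * H * (((r : ℝ) + 1) ^ N * q) * Real.exp (κ / 2 - κ * r / 2) *
            (P₁ * S)
          = (Real.exp (Q * (r + 1) * L) * ((r : ℝ) + 1) ^ N * Real.exp (κ / 2 - κ * r / 2)) *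
            (H * q * (P₁ * S)) := by ring
        _ ≤ (Real.exp (Q * L + κ / 2) * (1 / 2 : ℝ) ^ r) * (H * q * (P₁ * S)) := by
            refine mul_le_mul_of_nonneg_right ?_ (by positivity)
            calc _ ≤ Real.exp (Q * (r + 1) * L) * Real.exp (r * N) *
                  Real.exp (κ / 2 - κ * r / 2) := by gcongr
              _ = Real.exp (Q * L + κ / 2) * Real.exp (-(r : ℝ)) := by
                  rw [← Real.exp_add, ← Real.exp_add, ← Real.exp_add, hκ]; congr 1; ring
              _ ≤ _ := by gcongr
    · calc P * E * Z ^ (η * s / 2) * (P₂ * Z ^ (2 : ℝ)) ≤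
            P * E * Z ^ ((1 : ℝ) / 8) * (P₂ * Z ^ (2 : ℝ)) := by gcongr
        _ = P * E * (P₂ * (Z ^ ((1 : ℝ) / 8) * Z ^ (2 : ℝ))) := by ring
        _ = _ := by rw [← Real.rpow_add hZ0]; norm_num
  have hIsum : ∑ r ∈ R, ∑ x ∈ X.filter (fun x => HasSmoothPart r Z (𝔫 x)), ∏ i, f i (𝔫 x i) ≤
      G₁ * (H * S / Real.log Y ^ N) + P * E * (16 * P₂ * Z ^ ((9 : ℝ) / 4)) := by
    refine (sum_le_sum hI).trans ?_
    rw [sum_add_distrib]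
    refine add_le_add ?_ ?_
    · rw [← sum_mul, ← mul_sum]
      have h1 : ∑ r ∈ R, (1 / 2 : ℝ) ^ r ≤ 2 := by
        exact (Summable.sum_le_tsum R (fun _ _ => by positivity) summable_geometric_two).trans
          tsum_geometric_two.le
      calc _ ≤ Real.exp (Q * L + κ / 2) * 2 * (H * ((η * e)⁻¹ / Real.log Y) ^ N * (P₁ * S)) := by
            gcongr
        _ = _ := by rw [hG₁, div_pow]; ring
    · rw [sum_const, nsmul_eq_mul]
      have h1 : (R.card : ℝ) ≤ 16 * Z ^ ((1 : ℝ) / 8) := by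
        have h2 : (R.card : ℝ) ≤ 2 * Real.log Z := by
          refine le_trans (Nat.cast_le.2 (card_filter_le _ _)) ?_
          rw [Nat.card_Icc, Nat.add_sub_cancel]
          exact Nat.floor_le (by positivity)
        have h3 := Real.log_le_rpow_div hZ0.le (show (0 : ℝ) < 1 / 8 by norm_num)
        have : Z ^ ((1 : ℝ) / 8) / (1 / 8) = 8 * Z ^ ((1 : ℝ) / 8) := by ring
        linarith
      calc (R.card : ℝ) * (P * E * (P₂ * Z ^ ((17 : ℝ) / 8))) ≤
            16 * Z ^ ((1 : ℝ) / 8) * (P * E * (P₂ * Z ^ ((17 : ℝ) / 8))) := by gcongr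
        _ = P * E * (16 * P₂ * (Z ^ ((1 : ℝ) / 8) * Z ^ ((17 : ℝ) / 8))) := by ring
        _ = _ := by rw [← Real.rpow_add hZ0]; norm_num
  have hII : ∑ x ∈ X₂, ∏ i, f i (𝔫 x i) ≤
      P * (F * (H * (1 + c) * Z ^ (-(1 / 4) : ℝ) * (1 + Real.log Z) + E * Z ^ ((9 : ℝ) / 4))) := by
    have h1 := card_large_prime_pow_le hS hc hH hE hsep hZ2 hZk
    have h2 : √Z ≤ Z ^ ((9 : ℝ) / 4) := by
      rw [Real.sqrt_eq_rpow]
      exact Real.rpow_le_rpow_of_exponent_le hZ1 (by norm_num)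
    calc ∑ x ∈ X₂, ∏ i, f i (𝔫 x i) ≤ X₂.card * P := by
          rw [← nsmul_eq_mul, ← sum_const]
          exact sum_le_sum fun x hx => hP x (mem_filter.1 hx).1
      _ ≤ (F * (H * (1 + c) * Z ^ (-(1 / 4) : ℝ) * (1 + Real.log Z) + E * √Z)) * P :=
          mul_le_mul_of_nonneg_right h1 hP0
      _ ≤ (F * (H * (1 + c) * Z ^ (-(1 / 4) : ℝ) * (1 + Real.log Z) + E * Z ^ ((9 : ℝ) / 4))) * P := by
          gcongr
      _ = _ := mul_comm _ _
  have hIII : ∑ x ∈ X₃, ∏ i, f i (𝔫 x i) ≤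
      P * (P₃ * (H * P₃ * (Z ^ (-(1 / 4) : ℝ) * (1 + Real.log Z)) + E * Z ^ ((9 : ℝ) / 4))) := by
    have h1 := card_large_smooth_le hS hc hH hE hsep hZ2 hYV hZk (y := y) (C := C₃)
      (fun i T' hT' hT'y => hsm i V T' hT' hT'y)
    have h2 : Z ^ ((1 : ℝ) / 4) ≤ Z ^ ((9 : ℝ) / 4) :=
      Real.rpow_le_rpow_of_exponent_le hZ1 (by norm_num)
    have h3 : Z ^ (-(3 / 8) : ℝ) ≤ Z ^ (-(1 / 4) : ℝ) * (1 + Real.log Z) := by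
      calc Z ^ (-(3 / 8) : ℝ) ≤ Z ^ (-(1 / 4) : ℝ) :=
            Real.rpow_le_rpow_of_exponent_le hZ1 (by norm_num)
        _ ≤ _ := le_mul_of_one_le_right (by positivity) (by linarith)
    calc ∑ x ∈ X₃, ∏ i, f i (𝔫 x i) ≤ X₃.card * P := by
          rw [← nsmul_eq_mul, ← sum_const]
          exact sum_le_sum fun x hx => hP x (mem_filter.1 hx).1
      _ ≤ (P₃ * (H * P₃ * Z ^ (-(3 / 8) : ℝ) + E * Z ^ ((1 / 4) : ℝ))) * P :=
          mul_le_mul_of_nonneg_right h1 hP0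
      _ ≤ (P₃ * (H * P₃ * (Z ^ (-(1 / 4) : ℝ) * (1 + Real.log Z)) + E * Z ^ ((9 : ℝ) / 4))) * P := by
          gcongr
      _ = _ := mul_comm _ _
  have hsmall : Y ^ T * (Z ^ (-(1 / 4) : ℝ) * (1 + Real.log Z)) ≤
      C₄ * (1 + e) / Real.log Y ^ N := by
    have h1 : Z ^ (-(1 / 4) : ℝ) = Y ^ (-T - δ / 4) := by
      rw [hZdef, ← Real.rpow_mul hY0.le]; congr 1; rw [he]; ring
    have h2 : 1 + Real.log Z ≤ (1 + e) * (1 + Real.log Y) := by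
      have h3 : (1 + e) * (1 + Real.log Y) = 1 + Real.log Y + e + e * Real.log Y := by ring
      rw [hlZ, h3]
      linarith only [hlY, he0]
    have h3 : Y ^ T * Y ^ (-T - δ / 4) = (Y ^ (δ / 4))⁻¹ := by
      rw [← Real.rpow_add hY0, ← Real.rpow_neg hY0.le]; congr 1; ring
    have h4 := hlog Y hY1
    have h5 : Real.log Y ^ N ≤ (1 + Real.log Y) ^ N := pow_le_pow_left₀ hlY.le (by linarith) N
    rw [h1, ← mul_assoc, h3, inv_mul_eq_div, div_le_div_iff₀ (by positivity) (by positivity)]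
    calc (1 + Real.log Z) * Real.log Y ^ N ≤
          ((1 + e) * (1 + Real.log Y)) * (1 + Real.log Y) ^ N := by
          refine mul_le_mul h2 h5 (by positivity) (by positivity)
      _ = (1 + e) * (1 + Real.log Y) ^ (N + 1) := by ring
      _ ≤ (1 + e) * (C₄ * Y ^ (δ / 4)) := by gcongr
      _ = _ := by ring
  -- The exponent 9/4 is 2 from counting tuples, 1/8 from ξ^s and 1/8 from the number of values of
  -- r.
  have hlarge : Y ^ T * Z ^ ((9 : ℝ) / 4) ≤ Y ^ (10 * T + 3 * δ) := by
    rw [hZdef, ← Real.rpow_mul hY0.le, ← Real.rpow_add hY0]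
    refine Real.rpow_le_rpow_of_exponent_le hY1 ?_
    rw [he]; linarith
  -- The trivial bound carries the factor ∏ f_i(⊤), which is at most the product of square-free
  -- sums; this gives the exceptional classes the shape of the main term.
  have hHpart : P * (F * (H * (1 + c) * Z ^ (-(1 / 4) : ℝ) * (1 + Real.log Z))) +
      P * (P₃ * (H * P₃ * (Z ^ (-(1 / 4) : ℝ) * (1 + Real.log Z)))) ≤
      G₂ * (H * S / Real.log Y ^ N) := by
    calc _ = (Φ * H * Cf * (F * (1 + c) + P₃ * P₃)) *
          (Y ^ T * (Z ^ (-(1 / 4) : ℝ) * (1 + Real.log Z))) := by rw [hPdef]; ring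
      _ ≤ (S * H * Cf * (F * (1 + c) + P₃ * P₃)) * (C₄ * (1 + e) / Real.log Y ^ N) := by
          refine mul_le_mul ?_ hsmall (by positivity) (by positivity)
          gcongr
      _ = _ := by rw [hG₂]; ring
  have hEpart : P * E * (16 * P₂ * Z ^ ((9 : ℝ) / 4)) + P * (F * (E * Z ^ ((9 : ℝ) / 4))) +
      P * (P₃ * (E * Z ^ ((9 : ℝ) / 4))) ≤ G₃ * (E * Y ^ (10 * T + 3 * δ)) := by
    calc _ = (Φ * Cf * (16 * P₂ + F + P₃) * E) * (Y ^ T * Z ^ ((9 : ℝ) / 4)) := by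
          rw [hPdef]; ring
      _ ≤ (M' * Cf * (16 * P₂ + F + P₃) * E) * Y ^ (10 * T + 3 * δ) := by
          refine mul_le_mul ?_ hlarge (by positivity) (by positivity)
          gcongr
      _ = _ := by rw [hG₃]; ring
  have hfin1 : 0 ≤ H * S / Real.log Y ^ N := by positivity
  have hfin2 : 0 ≤ E * Y ^ (10 * T + 3 * δ) := by positivity
  have hmul1 := mul_nonneg hG₃0 hfin1
  have hmul2 := mul_nonneg hG₁0.le hfin2
  have hmul3 := mul_nonneg hG₂0.le hfin2
  have hexp : (G₁ + G₂ + G₃) * (H * S / Real.log Y ^ N + E * Y ^ (10 * T + 3 * δ)) =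
      G₁ * (H * S / Real.log Y ^ N) + G₂ * (H * S / Real.log Y ^ N) +
      G₃ * (H * S / Real.log Y ^ N) + G₁ * (E * Y ^ (10 * T + 3 * δ)) +
      G₂ * (E * Y ^ (10 * T + 3 * δ)) + G₃ * (E * Y ^ (10 * T + 3 * δ)) := by ring
  rw [hexp]
  rw [mul_add P₃, mul_add P] at hIII
  rw [mul_add F, mul_add P] at hII
  linarith only [hdecomp, hIsum, hII, hIII, hHpart, hEpart, hmul1, hmul2, hmul3]

end NairTenenbaum
end

/-! ### The ideals attached to a system of forms. -/

noncomputable section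

section FormSystem
open Finset UniqueFactorizationMonoid

variable {N : ℕ} {K : Fin N → Type*} [∀ i, Field (K i)] [∀ i, NumberField (K i)]
  {F : Fin N → MvPolynomial (Fin 2) ℤ} {d : Fin N → ℕ} {θ : ∀ i, 𝓞 (K i)} {W : ℕ}

variable (F d θ W) in
/-- A system of coprime irreducible forms, with `W` divisible by all exceptional primes. -/
structure IsFormSystem : Prop where
  hom : ∀ i, (F i).IsHomogeneous (d i)
  irr : ∀ i, Irreducible (MvPolynomial.map (Int.castRingHom ℚ) (F i))
  root : ∀ i, IsFormRoot (F i) (d i) (θ i)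
  ne_zero : W ≠ 0
  good : ∀ n : ℕ, n.Coprime W → ∀ i, IsGoodModulus (F i) (θ i) n
  cross : ∀ p : ℕ, p.Prime → p.Coprime W → ∀ i j, i ≠ j → ∀ s t : ℤ,
    (p : ℤ) ∣ MvPolynomial.eval ![s, t] (F i) → (p : ℤ) ∣ MvPolynomial.eval ![s, t] (F j) →
      (p : ℤ) ∣ s ∧ (p : ℤ) ∣ t
  large : ∀ p : ℕ, p.Prime → p.Coprime W → 2 * (∑ i, d i) + 2 < p

/-- Each condition fails only at finitely many primes. Once w passes them all, every prime coprime
to the primorial satisfies them. -/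
lemma exists_isFormSystem (hhom : ∀ i, (F i).IsHomogeneous (d i))
    (hirr : ∀ i, Irreducible (MvPolynomial.map (Int.castRingHom ℚ) (F i)))
    (hcop : ∀ i j, i ≠ j → IsRelPrime (MvPolynomial.map (Int.castRingHom ℚ) (F i))
      (MvPolynomial.map (Int.castRingHom ℚ) (F j)))
    (hθ : ∀ i, IsFormRoot (F i) (d i) (θ i)) :
    ∃ w₀ : ℝ, 0 ≤ w₀ ∧ ∀ w : ℝ, w₀ < w → IsFormSystem F d θ (primorial ⌊w⌋₊) := by
  choose a ha using fun i => exists_forall_isGoodModulus (hhom i) (hirr i) (hθ i)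
  have hb : ∀ i j, ∃ w₀ : ℕ, i ≠ j → ∀ p : ℕ, p.Prime → w₀ < p → ∀ s t : ℤ,
      (p : ℤ) ∣ MvPolynomial.eval ![s, t] (F i) → (p : ℤ) ∣ MvPolynomial.eval ![s, t] (F j) →
        (p : ℤ) ∣ s ∧ (p : ℤ) ∣ t := by
    intro i j
    by_cases h : i = j
    · exact ⟨0, fun h' => absurd h h'⟩
    · obtain ⟨w₀, hw⟩ := exists_forall_dvd_of_dvd_eval (hhom i) (hhom j) (hirr i) (hirr j)
        (hcop i j h)
      exact ⟨w₀, fun _ => hw⟩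
  choose b hb using hb
  set w₁ : ℕ := ∑ i, a i + ∑ i, ∑ j, b i j + (2 * (∑ i, d i) + 2) with hw₁
  refine ⟨w₁, by positivity, fun w hw => ?_⟩
  have hle : w₁ ≤ ⌊w⌋₊ := Nat.le_floor hw.le
  have hai : ∀ i, a i ≤ ⌊w⌋₊ := fun i => by
    have := single_le_sum (f := a) (fun _ _ => Nat.zero_le _) (mem_univ i); omega
  have hbi : ∀ i j, b i j ≤ ⌊w⌋₊ := fun i j => by
    have h1 := single_le_sum (f := fun i => ∑ j, b i j) (fun _ _ => Nat.zero_le _) (mem_univ i)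
    have h2 := single_le_sum (f := b i) (fun _ _ => Nat.zero_le _) (mem_univ j)
    omega
  refine ⟨hhom, hirr, hθ, (primorial_pos _).ne', fun n hn i => ha i n fun p hp hpn => ?_,
    fun p hp hpW i j hij => ?_, fun p hp hpW => ?_⟩
  · have := (coprime_primorial_iff hp).1 (hn.coprime_dvd_left hpn)
    exact (hai i).trans_lt this
  · exact hb i j hij p hp ((hbi i j).trans_lt ((coprime_primorial_iff hp).1 hpW))
  · have := (coprime_primorial_iff hp).1 hpW
    omega

variable (F θ) in
/-- The ideals `(b s - θ t)_n` attached to a point `(s, t)`. -/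
def formIdeals (n : ℕ) (x : ℤ × ℤ) (i : Fin N) : Ideal (𝓞 (K i)) :=
  idealPrimeTo n (Ideal.span {linearForm (F i) (θ i) x.1 x.2})

namespace IsFormSystem

variable {n : ℕ} {x : ℤ × ℤ}

/-- The norm b^(d-1) F(s, t) is non-zero; if b = 0, then d = 1 and the first factor is 1. -/
lemma span_ne_bot (hS : IsFormSystem F d θ W) {i : Fin N} (h : MvPolynomial.eval ![x.1, x.2] (F i) ≠ 0) :
    Ideal.span {linearForm (F i) (θ i) x.1 x.2} ≠ ⊥ := by
  intro h0
  have h1 := absNorm_linearForm (hS.hom i) (hS.irr i) (hS.root i) x.1 x.2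
  rw [linearForm] at h0
  rw [h0, Ideal.absNorm_bot, eq_comm, Int.natAbs_eq_zero, mul_eq_zero] at h1
  rcases h1 with h1 | h1
  · by_cases hd : d i = 1
    · simp [hd] at h1
    · exact hd (eval_of_leadCoeffX_eq_zero (hS.hom i) (hS.irr i)
        (pow_eq_zero_iff (by have := degree_pos (hS.hom i) (hS.irr i); omega) |>.1 h1)).1
  · exact h h1

lemma isGoodPrime_of_mem (hS : IsFormSystem F d θ W) (hx : IsCoprime x.1 x.2) {i : Fin N} {𝔭 : Ideal (𝓞 (K i))}
    (h𝔭 : 𝔭 ∈ normalizedFactors (Ideal.span {linearForm (F i) (θ i) x.1 x.2}))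
    (hW : (Ideal.absNorm 𝔭).Coprime W) : IsGoodPrime W 𝔭 := by
  have hp := prime_of_normalized_factor 𝔭 h𝔭
  refine ⟨prime_absNorm_of_linearForm_mem (Ideal.isPrime_of_prime hp) hp.ne_zero
    (hS.good _ hW i) (hS.root i) hx ?_, hW⟩
  exact Ideal.dvd_span_singleton.1 (dvd_of_mem_normalizedFactors h𝔭)

lemma mem_normalizedFactors_formIdeals (hS : IsFormSystem F d θ W) (hx : IsCoprime x.1 x.2)
    (hn : W ∣ n) {i : Fin N} {𝔭 : Ideal (𝓞 (K i))} : 𝔭 ∈ normalizedFactors (formIdeals F θ n x i) ↔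
      𝔭 ∈ normalizedFactors (Ideal.span {linearForm (F i) (θ i) x.1 x.2}) ∧
        (Ideal.absNorm 𝔭).Coprime n := by
  unfold formIdeals idealPrimeTo
  rw [normalizedFactors_prod_of_good (W := W) fun 𝔮 h𝔮 => ?_, Multiset.mem_filter]
  obtain ⟨h1, h2⟩ := Multiset.mem_filter.1 h𝔮
  exact hS.isGoodPrime_of_mem hx h1 (h2.coprime_dvd_right hn)

lemma formIdeals_dvd (hS : IsFormSystem F d θ W) (h : MvPolynomial.eval ![x.1, x.2] (F i) ≠ 0) :
    formIdeals F θ n x i ∣ Ideal.span {linearForm (F i) (θ i) x.1 x.2} := by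
  conv_rhs => rw [← prod_normalizedFactors_ideal (hS.span_ne_bot h)]
  exact Multiset.prod_dvd_prod_of_le (Multiset.filter_le _ _)

/-- Primes of one component have different norms by `eq_of_linearForm_mem`. A shared norm for two
components would be a common prime divisor of F_i(s, t) and F_j(s, t), and so of s and t. -/
lemma isSeparatedTuple_formIdeals (hS : IsFormSystem F d θ W) (hx : IsCoprime x.1 x.2) (hn : W ∣ n)
    (h : ∀ i, MvPolynomial.eval ![x.1, x.2] (F i) ≠ 0) :
    IsSeparatedTuple W (formIdeals F θ n x) where
  ne_bot i := ne_zero_of_dvd_ne_zero (hS.span_ne_bot (h i)) (hS.formIdeals_dvd (h i))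
  good i 𝔭 h𝔭 := by
    obtain ⟨h1, h2⟩ := (hS.mem_normalizedFactors_formIdeals hx hn).1 h𝔭
    exact hS.isGoodPrime_of_mem hx h1 (h2.coprime_dvd_right hn)
  inj i 𝔭 h𝔭 𝔮 h𝔮 hN := by
    obtain ⟨h1, h2⟩ := (hS.mem_normalizedFactors_formIdeals hx hn).1 h𝔭
    obtain ⟨h3, h4⟩ := (hS.mem_normalizedFactors_formIdeals hx hn).1 h𝔮
    have hg := hS.isGoodPrime_of_mem hx h1 (h2.coprime_dvd_right hn)
    exact eq_of_linearForm_mem hg.1 (hS.good _ hg.2 i) (hS.root i) rfl hN.symm hx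
      (Ideal.dvd_span_singleton.1 (dvd_of_mem_normalizedFactors h1))
      (Ideal.dvd_span_singleton.1 (dvd_of_mem_normalizedFactors h3))
  disj i j hij 𝔭 h𝔭 𝔮 h𝔮 hN := by
    obtain ⟨h1, h2⟩ := (hS.mem_normalizedFactors_formIdeals hx hn).1 h𝔭
    obtain ⟨h3, h4⟩ := (hS.mem_normalizedFactors_formIdeals hx hn).1 h𝔮
    have hg := hS.isGoodPrime_of_mem hx h1 (h2.coprime_dvd_right hn)
    have e1 := dvd_eval_of_linearForm_mem (hS.hom i) (hS.irr i) (hS.root i) (hS.good _ hg.2 i)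
      dvd_rfl (Ideal.dvd_span_singleton.1 (dvd_of_mem_normalizedFactors h1))
    have e2 := dvd_eval_of_linearForm_mem (hS.hom j) (hS.irr j) (hS.root j) (hS.good _ hg.2 j)
      hN.dvd (Ideal.dvd_span_singleton.1 (dvd_of_mem_normalizedFactors h3))
    obtain ⟨d1, d2⟩ := hS.cross _ hg.1 hg.2 i j hij _ _ e1 e2
    have := hx.isUnit_of_dvd' d1 d2
    rw [Int.isUnit_iff] at this
    have := hg.1.two_le
    omega

/-- The converse link needed by the sieve: a prime p dividing a value of a form appears as the norm
of a prime factor. Some prime above p divides the ideal, and it has degree one, so its norm is p. -/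
lemma mem_primeNorms_of_dvd (hS : IsFormSystem F d θ W) (hx : IsCoprime x.1 x.2) (hn : W ∣ n) {i : Fin N}
    (h : MvPolynomial.eval ![x.1, x.2] (F i) ≠ 0) {p : ℕ} (hp : p.Prime) (hpn : p.Coprime n)
    (hdvd : (p : ℤ) ∣ MvPolynomial.eval ![x.1, x.2] (F i)) :
    p ∈ primeNorms (formIdeals F θ n x) := by
  have h1 : p ∣ Ideal.absNorm (Ideal.span {linearForm (F i) (θ i) x.1 x.2}) := by
    have h2 := absNorm_linearForm (hS.hom i) (hS.irr i) (hS.root i) x.1 x.2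
    rw [linearForm, h2, ← Int.natCast_dvd]
    exact hdvd.mul_left _
  obtain ⟨P, hP, hPp, hPd⟩ := Ideal.exists_isMaximal_dvd_of_dvd_absNorm' hp _ h1
  have hne := hS.span_ne_bot h
  have hP0 : P ≠ ⊥ := ne_zero_of_dvd_ne_zero hne hPd
  have hPmem : P ∈ normalizedFactors (Ideal.span {linearForm (F i) (θ i) x.1 x.2}) :=
    (Ideal.mem_normalizedFactors_iff hne).2 ⟨hP.isPrime, Ideal.le_of_dvd hPd⟩
  have h3 : Ideal.absNorm P ∣ p ^ Module.finrank ℤ (𝓞 (K i)) := by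
    have h4 : (p : 𝓞 (K i)) ∈ P := by
      have : (p : ℤ) ∈ Ideal.under ℤ P := by rw [hPp]; exact Ideal.mem_span_singleton_self _
      simpa [Ideal.under, Ideal.mem_comap] using this
    have h5 := Ideal.absNorm_dvd_absNorm_of_le ((Ideal.span_singleton_le_iff_mem _).2 h4)
    rwa [Ideal.absNorm_span_natCast] at h5
  have hcop : (Ideal.absNorm P).Coprime n := (hpn.pow_left _).coprime_dvd_left h3
  have hg := hS.isGoodPrime_of_mem hx hPmem (hcop.coprime_dvd_right hn)
  have h6 : Ideal.absNorm P = p := (Nat.prime_dvd_prime_iff_eq hg.1 hp).1 (hg.1.dvd_of_dvd_pow h3)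
  exact mem_primeNorms.2 ⟨i, P, (hS.mem_normalizedFactors_formIdeals hx hn).2 ⟨hPmem, hcop⟩, h6⟩

end IsFormSystem

/-- A form of degree `d` is `O(Y ^ d)` on a box of size `Y`. -/
lemma exists_abs_eval_le {F : MvPolynomial (Fin 2) ℤ} {d : ℕ} (h : F.IsHomogeneous d) :
    ∃ C : ℝ, 1 ≤ C ∧ ∀ (s t : ℤ) (Y : ℝ), |(s : ℝ)| ≤ Y → |(t : ℝ)| ≤ Y →
      |((MvPolynomial.eval ![s, t] F : ℤ) : ℝ)| ≤ C * Y ^ d := by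
  refine ⟨1 + ∑ m ∈ F.support, |((F.coeff m : ℤ) : ℝ)|, ?_, fun s t Y hs ht => ?_⟩
  · have : 0 ≤ ∑ m ∈ F.support, |((F.coeff m : ℤ) : ℝ)| := sum_nonneg fun _ _ => abs_nonneg _
    linarith
  have hY : 0 ≤ Y := (abs_nonneg _).trans hs
  rw [MvPolynomial.eval_eq']
  push_cast
  refine (abs_sum_le_sum_abs _ _).trans ?_
  rw [add_mul, sum_mul]
  refine le_trans (sum_le_sum fun m hm => ?_) (le_add_of_nonneg_left (by positivity))
  rw [abs_mul]
  refine mul_le_mul_of_nonneg_left ?_ (abs_nonneg _)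
  have hd : m 0 + m 1 = d := by
    have := h (MvPolynomial.mem_support_iff.1 hm)
    rw [Finsupp.weight_apply, Finsupp.sum_fintype _ _ (by simp)] at this
    simpa using this
  rw [Fin.prod_univ_two, abs_mul, abs_pow, abs_pow, ← hd, pow_add]
  simp only [Matrix.cons_val_zero, Matrix.cons_val_one]
  gcongr

lemma IsFormSystem.exists_absNorm_formIdeals_le (hS : IsFormSystem F d θ W) :
    ∃ D : ℝ, 1 ≤ D ∧ ∀ (n : ℕ) (x : ℤ × ℤ) (Y : ℝ), |(x.1 : ℝ)| ≤ Y → |(x.2 : ℝ)| ≤ Y →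
      (∀ i, MvPolynomial.eval ![x.1, x.2] (F i) ≠ 0) →
      ∀ i, (Ideal.absNorm (formIdeals F θ n x i) : ℝ) ≤ D * Y ^ d i := by
  choose C hC1 hC using fun i => exists_abs_eval_le (hS.hom i)
  set D := 1 + ∑ i, |(leadCoeffX (F i) : ℝ)| ^ (d i - 1) * C i with hD
  have hnn : ∀ i, 0 ≤ |(leadCoeffX (F i) : ℝ)| ^ (d i - 1) * C i := fun i =>
    mul_nonneg (by positivity) (by linarith [hC1 i])
  refine ⟨D, by have := sum_nonneg fun i (_ : i ∈ univ) => hnn i; linarith,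
    fun n x Y h1 h2 hne i => ?_⟩
  have hY : 0 ≤ Y := (abs_nonneg _).trans h1
  have h3 : Ideal.absNorm (formIdeals F θ n x i) ≤
      (leadCoeffX (F i) ^ (d i - 1) * MvPolynomial.eval ![x.1, x.2] (F i)).natAbs := by
    rw [← absNorm_linearForm (hS.hom i) (hS.irr i) (hS.root i) x.1 x.2]
    refine Nat.le_of_dvd (absNorm_pos_of_ne_bot (hS.span_ne_bot (hne i))) ?_
    exact map_dvd Ideal.absNorm (hS.formIdeals_dvd (hne i))
  calc (Ideal.absNorm (formIdeals F θ n x i) : ℝ) ≤ _ := Nat.cast_le.2 h3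
    _ = |(leadCoeffX (F i) : ℝ)| ^ (d i - 1) *
        |((MvPolynomial.eval ![x.1, x.2] (F i) : ℤ) : ℝ)| := by
        rw [Nat.cast_natAbs]; push_cast; rw [abs_mul, abs_pow]
    _ ≤ |(leadCoeffX (F i) : ℝ)| ^ (d i - 1) * (C i * Y ^ d i) := by
        gcongr; exact hC i _ _ _ h1 h2
    _ = (|(leadCoeffX (F i) : ℝ)| ^ (d i - 1) * C i) * Y ^ d i := by ring
    _ ≤ D * Y ^ d i := by
        gcongr
        have := single_le_sum (fun i _ => hnn i) (mem_univ i)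
        linarith

end FormSystem
end

/-! ### Local densities of the sieve. -/

noncomputable section

section FormSieve
open Finset UniqueFactorizationMonoid

variable {N : ℕ} {K : Fin N → Type*} [∀ i, Field (K i)] [∀ i, NumberField (K i)]
  {F : Fin N → MvPolynomial (Fin 2) ℤ} {d : Fin N → ℕ} {θ : ∀ i, 𝓞 (K i)} {W : ℕ}

lemma prod_le_prod_of_subset_of_one_le_real {ι : Type*} [DecidableEq ι] {S T : Finset ι} {g : ι → ℝ}
    (h : S ⊆ T) (hg : ∀ a ∈ T, 1 ≤ g a) : ∏ a ∈ S, g a ≤ ∏ a ∈ T, g a := by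
  rw [← prod_sdiff h]
  refine le_mul_of_one_le_left (prod_nonneg fun a ha => zero_le_one.trans (hg a (h ha))) ?_
  calc (1 : ℝ) = ∏ a ∈ T \ S, 1 := by simp
    _ ≤ _ := Finset.prod_le_prod (fun _ _ => zero_le_one) fun a ha => hg a (sdiff_subset ha)

lemma prod_le_prod_of_cover {ι κ : Type*} [DecidableEq κ] {S : Finset ι} {T : Finset κ}
    {r : κ → ι} {g : ι → ℝ} (hg : ∀ a ∈ T, 1 ≤ g (r a)) (h : ∀ p ∈ S, ∃ a ∈ T, r a = p) :
    ∏ p ∈ S, g p ≤ ∏ a ∈ T, g (r a) := by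
  classical
  rcases S.eq_empty_or_nonempty with rfl | ⟨p₀, hp₀⟩
  · rw [prod_empty]
    calc (1 : ℝ) = ∏ a ∈ T, 1 := by simp
      _ ≤ _ := Finset.prod_le_prod (fun _ _ => zero_le_one) hg
  have : Nonempty κ := ⟨(h p₀ hp₀).choose⟩
  choose! σ hσT hσ using h
  have hinj : Set.InjOn σ S := fun p hp p' hp' he => by rw [← hσ p hp, ← hσ p' hp', he]
  calc ∏ p ∈ S, g p = ∏ a ∈ S.image σ, g (r a) := by
        rw [prod_image hinj]
        exact Finset.prod_congr rfl fun p hp => by rw [hσ p hp]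
    _ ≤ _ := prod_le_prod_of_subset_of_one_le_real
        (image_subset_iff.2 fun p hp => hσT p hp) hg

lemma IsGoodTuple.exists_absNorm_eq {u : ∀ i, Ideal (𝓞 (K i))} (h : IsGoodTuple W u) {p : ℕ}
    (hp : p.Prime) {i : Fin N} (hdvd : p ∣ Ideal.absNorm (u i)) :
    ∃ 𝔭 ∈ normalizedFactors (u i), Ideal.absNorm 𝔭 = p := by
  rw [← prod_normalizedFactors_ideal (h.ne_bot i), map_multiset_prod] at hdvd
  obtain ⟨𝔭, h𝔭, hd⟩ := hp.prime.exists_mem_multiset_map_dvd hdvd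
  exact ⟨𝔭, h𝔭, ((Nat.prime_dvd_prime_iff_eq hp (h.good i 𝔭 h𝔭).1).1 hd).symm⟩

lemma IsGoodTuple.exists_of_dvd_tupleNorm {u : ∀ i, Ideal (𝓞 (K i))} (h : IsGoodTuple W u) {p : ℕ}
    (hp : p.Prime) (hdvd : p ∣ tupleNorm u) :
    ∃ i, ∃ 𝔭 ∈ normalizedFactors (u i), Ideal.absNorm 𝔭 = p := by
  rw [tupleNorm, hp.prime.dvd_finsetProd_iff] at hdvd
  obtain ⟨i, -, hi⟩ := hdvd
  exact ⟨i, h.exists_absNorm_eq hp hi⟩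

lemma primeFactors_natPrimeTo {W q : ℕ} :
    (natPrimeTo W q).primeFactors = q.primeFactors.filter (fun p => p.Coprime W) := by
  ext p
  simp only [natPrimeTo, mem_filter]
  constructor
  · intro hp
    have hpp := Nat.prime_of_mem_primeFactors hp
    obtain ⟨r, hr, hd⟩ := (hpp.prime.dvd_finsetProd_iff _).1 (Nat.dvd_of_mem_primeFactors hp)
    have hr' := mem_filter.1 hr
    have := (Nat.prime_dvd_prime_iff_eq hpp (Nat.prime_of_mem_primeFactors hr'.1)).1
      (hpp.dvd_of_dvd_pow hd)
    rwa [this]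
  · rintro ⟨hp, hW⟩
    have hpp := Nat.prime_of_mem_primeFactors hp
    refine Nat.mem_primeFactors.2 ⟨hpp, ?_, Finset.prod_ne_zero_iff.2 fun r hr =>
      pow_ne_zero _ (Nat.prime_of_mem_primeFactors (mem_filter.1 hr).1).ne_zero⟩
    refine dvd_trans (dvd_pow_self p ?_) (dvd_prod_of_mem (fun p => p ^ q.factorization p)
      (mem_filter.2 ⟨hp, hW⟩))
    exact (hpp.factorization_pos_of_dvd (Nat.mem_primeFactors.1 hp).2.2
      (Nat.dvd_of_mem_primeFactors hp)).ne'

variable (F) in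
/-- The total number of projective zeros of the forms modulo `p`, except `(1 : 0)`. -/
def totalRho (p : ℕ) : ℕ := ∑ i, rhoBar (F i) p

lemma hStar_natPrimeTo (q : ℕ) : hStar F (natPrimeTo W q) =
    ∏ p ∈ q.primeFactors.filter (fun p => p.Coprime W), (1 - (totalRho F p : ℝ) / (p + 1))⁻¹ := by
  rw [hStar, primeFactors_natPrimeTo]
  simp [totalRho]

namespace IsFormSystem

lemma totalRho_le (hS : IsFormSystem F d θ W) {p : ℕ} (hp : p.Prime) (hW : p.Coprime W) :
    totalRho F p ≤ ∑ i, d i :=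
  sum_le_sum fun i _ => rhoBar_le hp (hS.hom i) (hS.irr i) (hS.good p hW i).lead

/-- Apart from the origin, the zero sets of the different forms modulo p are disjoint, so their
sizes add. -/
lemma classCount_exists_dvd (hS : IsFormSystem F d θ W) {p : ℕ} (hp : p.Prime)
    (hW : p.Coprime W) (hN : 1 ≤ N) :
    classCount p (fun x => ∃ i, (p : ℤ) ∣ MvPolynomial.eval ![x.1, x.2] (F i)) =
      1 + totalRho F p * (p - 1) := by
  classical
  have h0 : ∀ i, MvPolynomial.eval ![0, 0] (F i) = 0 := by
    intro i
    have hd := degree_pos (hS.hom i) (hS.irr i)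
    rw [MvPolynomial.eval_eq']
    refine sum_eq_zero fun m hm => ?_
    have := hS.hom i (MvPolynomial.mem_support_iff.1 hm)
    rw [Finsupp.weight_apply, Finsupp.sum_fintype _ _ (by simp)] at this
    have h2 : m 0 + m 1 = d i := by simpa using this
    rw [Fin.prod_univ_two]
    simp only [Matrix.cons_val_zero, Matrix.cons_val_one]
    rcases Nat.eq_zero_or_pos (m 0) with h | h
    · rw [zero_pow (by omega : m 1 ≠ 0)]; simp
    · rw [zero_pow (by omega : m 0 ≠ 0)]; simp
  set S : Fin N → Finset (ℕ × ℕ) := fun i => (range p ×ˢ range p).filter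
    (fun z => (p : ℤ) ∣ MvPolynomial.eval ![(z.1 : ℤ), (z.2 : ℤ)] (F i)) with hSdef
  have hmem : ∀ i, (0, 0) ∈ S i := fun i => by
    simp only [hSdef, mem_filter, mem_product, mem_range, hp.pos, and_self, Nat.cast_zero,
      h0, dvd_zero]
  have hcard : ∀ i, ((S i).erase (0, 0)).card = rhoBar (F i) p * (p - 1) := by
    intro i
    rw [card_erase_of_mem (hmem i)]
    have := classCount_dvd_eval hp (hS.hom i) (hS.irr i) (hS.good p hW i)
    rw [classCount] at this
    have h2 : (S i).card = 1 + rhoBar (F i) p * (p - 1) := by convert this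
    omega
  have hset : ((range p ×ˢ range p).filter (fun z : ℕ × ℕ =>
      ∃ i, (p : ℤ) ∣ MvPolynomial.eval ![(z.1 : ℤ), (z.2 : ℤ)] (F i))) =
      insert (0, 0) (univ.biUnion fun i => (S i).erase (0, 0)) := by
    ext z
    simp only [mem_filter, mem_insert, mem_biUnion, mem_erase, hSdef, mem_univ, true_and]
    constructor
    · rintro ⟨hz, i, hi⟩
      by_cases hz0 : z = (0, 0)
      · exact Or.inl hz0
      · exact Or.inr ⟨i, hz0, hz, hi⟩
    · rintro (rfl | ⟨i, hz0, hz, hi⟩)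
      · exact ⟨(mem_filter.1 (hmem ⟨0, hN⟩)).1, ⟨0, hN⟩, (mem_filter.1 (hmem ⟨0, hN⟩)).2⟩
      · exact ⟨hz, i, hi⟩
  rw [classCount]
  have : ((range p ×ˢ range p).filter (fun z : ℕ × ℕ =>
      ∃ i, (p : ℤ) ∣ MvPolynomial.eval ![(z.1 : ℤ), (z.2 : ℤ)] (F i))).card =
      1 + totalRho F p * (p - 1) := by
    rw [hset, card_insert_of_notMem (by simp), card_biUnion, totalRho, sum_mul, add_comm]
    · rw [Finset.sum_congr rfl fun i _ => hcard i]
    · intro i _ j _ hij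
      rw [Function.onFun, Finset.disjoint_left]
      intro z hz hz'
      obtain ⟨hz0, hz1⟩ := mem_erase.1 hz
      obtain ⟨hz2, hz3⟩ := mem_filter.1 hz1
      obtain ⟨-, hz4⟩ := mem_erase.1 hz'
      obtain ⟨h1, h2⟩ := hS.cross p hp hW i j hij _ _ hz3 (mem_filter.1 hz4).2
      rw [mem_product, mem_range, mem_range] at hz2
      refine hz0 (Prod.ext ?_ ?_)
      · exact Nat.eq_zero_of_dvd_of_lt (by exact_mod_cast h1) hz2.1
      · exact Nat.eq_zero_of_dvd_of_lt (by exact_mod_cast h2) hz2.2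
  convert this

/-- The local density of the sieve. -/
lemma density_bounds (hS : IsFormSystem F d θ W) {p : ℕ} (hp : p.Prime) (hW : p.Coprime W) :
    0 < (1 + totalRho F p * (p - 1 : ℝ)) / (p : ℝ) ^ 2 ∧
    (1 + totalRho F p * (p - 1 : ℝ)) / (p : ℝ) ^ 2 ≤ 2 / 3 ∧
    (1 + totalRho F p * (p - 1 : ℝ)) / (p : ℝ) ^ 2 ≤ ((∑ i, d i : ℕ) + 1) / p ∧
    1 - (1 + totalRho F p * (p - 1 : ℝ)) / (p : ℝ) ^ 2 ≤ 1 - (totalRho F p : ℝ) / (p + 1) ∧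
    1 / 2 ≤ 1 - (totalRho F p : ℝ) / (p + 1) ∧
    (1 - (totalRho F p : ℝ) / (p + 1))⁻¹ ≤ 1 + 2 * (∑ i, d i : ℕ) / p := by
  have h1 : (totalRho F p : ℝ) ≤ (∑ i, d i : ℕ) := by exact_mod_cast hS.totalRho_le hp hW
  have h2 : 2 * ((∑ i, d i : ℕ) : ℝ) + 2 < p := by exact_mod_cast hS.large p hp hW
  have h0 : (0 : ℝ) ≤ totalRho F p := Nat.cast_nonneg _
  set D : ℝ := ((∑ i, d i : ℕ) : ℝ) with hD
  set σ : ℝ := (totalRho F p : ℝ) with hσ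
  set P : ℝ := (p : ℝ) with hP
  have hP2 : 2 ≤ P := by rw [hP]; exact_mod_cast hp.two_le
  have hP0 : 0 < P := by linarith
  have h5 : σ * (P - 1) ≤ D * (P - 1) := mul_le_mul_of_nonneg_right h1 (by linarith)
  have h3 : (1 + σ * (P - 1)) / P ^ 2 ≤ (D + 1) / P := by
    rw [div_le_div_iff₀ (by positivity) hP0]
    nlinarith [mul_nonneg (h0.trans h1) hP0.le]
  have h4 : (D + 1) / P ≤ 1 / 2 := by rw [div_le_div_iff₀ hP0 two_pos]; linarith
  have h6 : σ / (P + 1) ≤ D / P := div_le_div₀ (h0.trans h1) h1 hP0 (by linarith)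
  have h7 : σ / (P + 1) ≤ 1 / 2 := h6.trans (le_trans (by gcongr; linarith) h4)
  have h8 : 0 ≤ σ / (P + 1) := by positivity
  refine ⟨?_, by linarith, h3, ?_, by linarith, ?_⟩
  · have : 0 ≤ σ * (P - 1) := mul_nonneg h0 (by linarith)
    positivity
  · have : σ / (P + 1) ≤ (1 + σ * (P - 1)) / P ^ 2 := by
      rw [div_le_div_iff₀ (by positivity) (by positivity)]
      nlinarith
    linarith
  · rw [inv_le_comm₀ (by linarith) (by have := h0.trans h1; positivity), inv_eq_one_div,
      div_le_iff₀ (by have := h0.trans h1; positivity)]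
    have h9 : 2 * D / P = 2 * (D / P) := by ring
    rw [h9]
    have h10 : D / P ≤ 1 / 2 := le_trans (by gcongr; linarith) h4
    nlinarith

/-- The sieve predicates on a lattice, in coordinates. -/
lemma classCount_sieve (hS : IsFormSystem F d θ W) (hN : 1 ≤ N) {v₁ v₂ : ℤ × ℤ} {e : Fin N → ℕ}
    {α β : Fin N → ℤ} (he : ∀ i, 0 < e i) (hec : ∀ i j, i ≠ j → (e i).Coprime (e j))
    (hab : ∀ i, IsCoprime (α i) (e i : ℤ) ∨ IsCoprime (β i) (e i : ℤ)) {T : Finset ℕ}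
    (hT : ∀ p ∈ T, p.Prime ∧ p.Coprime W ∧ p.Coprime (∏ i, e i) ∧
      IsCoprime (v₁.1 * v₂.2 - v₁.2 * v₂.1) (p : ℤ))
    (hdet : ∀ i, IsCoprime (v₁.1 * v₂.2 - v₁.2 * v₂.1) (e i : ℤ)) (P : ℤ × ℤ → Prop)
    (hPdef : ∀ z, P z ↔ (∀ i, (e i : ℤ) ∣ α i * (columnsMap v₁ v₂ z).1 +
        β i * (columnsMap v₁ v₂ z).2) ∧ ∀ p ∈ T, ∃ i, (p : ℤ) ∣
        MvPolynomial.eval ![(columnsMap v₁ v₂ z).1, (columnsMap v₁ v₂ z).2] (F i)) :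
    IsPeriodic ((∏ i, e i) * ∏ p ∈ T, p) P ∧
      classCount ((∏ i, e i) * ∏ p ∈ T, p) P =
        (∏ i, e i) * ∏ p ∈ T, (1 + totalRho F p * (p - 1)) := by
  obtain rfl : P = fun z => (∀ i, (e i : ℤ) ∣ α i * (columnsMap v₁ v₂ z).1 +
        β i * (columnsMap v₁ v₂ z).2) ∧ ∀ p ∈ T, ∃ i, (p : ℤ) ∣
        MvPolynomial.eval ![(columnsMap v₁ v₂ z).1, (columnsMap v₁ v₂ z).2] (F i) :=
    funext fun z => propext (hPdef z)
  have hlin : ∀ i, IsPeriodic (e i) (fun x : ℤ × ℤ => (e i : ℤ) ∣ α i * x.1 + β i * x.2) := by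
    intro i x y h1 h2
    exact Int.ModEq.dvd_iff ((h1.mul_left _).add (h2.mul_left _))
  have hper : ∀ p : ℕ, IsPeriodic p (fun x : ℤ × ℤ =>
      ∃ i, (p : ℤ) ∣ MvPolynomial.eval ![x.1, x.2] (F i)) := fun p x y h1 h2 =>
    exists_congr fun i => isPeriodic_dvd_eval p (F i) x y h1 h2
  have h1 : IsPeriodic (∏ i, e i) (fun z => ∀ i, (e i : ℤ) ∣ α i * (columnsMap v₁ v₂ z).1 +
        β i * (columnsMap v₁ v₂ z).2) := by
    have := IsPeriodic.forall_prod (T := univ) (e := e) (P := fun i z => (e i : ℤ) ∣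
      α i * (columnsMap v₁ v₂ z).1 + β i * (columnsMap v₁ v₂ z).2)
      (fun i _ => (hlin i).comp_columnsMap v₁ v₂)
    simpa using this
  have h2 := IsPeriodic.forall_prod (T := T) (e := fun p => p) (P := fun p z => ∃ i, (p : ℤ) ∣
        MvPolynomial.eval ![(columnsMap v₁ v₂ z).1, (columnsMap v₁ v₂ z).2] (F i))
      (fun p _ => (hper p).comp_columnsMap v₁ v₂)
  refine ⟨(h1.of_dvd (Dvd.intro _ rfl)).and (h2.of_dvd (Dvd.intro_left _ rfl)), ?_⟩
  rw [classCount_mul (prod_pos fun i _ => he i) (prod_pos fun p hp => (hT p hp).1.pos)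
    (Nat.Coprime.prod_right fun p hp => (hT p hp).2.2.1.symm) h1 h2]
  congr 1
  · have := classCount_prod univ e (fun i z => (e i : ℤ) ∣
      α i * (columnsMap v₁ v₂ z).1 + β i * (columnsMap v₁ v₂ z).2) (fun i _ => he i)
      (fun i _ j _ h => hec i j h) (fun i _ => (hlin i).comp_columnsMap v₁ v₂)
    simp only [mem_univ, true_imp_iff] at this
    rw [this]
    refine Finset.prod_congr rfl fun i _ => ?_
    rw [classCount_comp_columnsMap (he i) (hlin i) v₁ v₂ (hdet i), classCount_linear (he i) _ _ (hab i)]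
  · rw [classCount_prod T (fun p => p) _ (fun p hp => (hT p hp).1.pos)
      (fun p hp q hq h => (Nat.coprime_primes (hT p hp).1 (hT q hq).1).2 h)
      (fun p _ => (hper p).comp_columnsMap v₁ v₂)]
    refine Finset.prod_congr rfl fun p hp => ?_
    rw [classCount_comp_columnsMap (hT p hp).1.pos (hper p) v₁ v₂ (hT p hp).2.2.2,
      hS.classCount_exists_dvd (hT p hp).1 (hT p hp).2.1 hN]

end IsFormSystem
end FormSieve
end

/-! ### The size of the sieve product. -/

noncomputable section

section MertensProduct
open Finset UniqueFactorizationMonoid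

variable {N : ℕ} {K : Fin N → Type*} [∀ i, Field (K i)] [∀ i, NumberField (K i)]
  {F : Fin N → MvPolynomial (Fin 2) ℤ} {d : Fin N → ℕ} {θ : ∀ i, 𝓞 (K i)} {W : ℕ}

variable (W) in
/-- The primes up to `ξ` which do not divide `W`. -/
def sievePrimes (ξ : ℝ) : Finset ℕ := (Icc 1 ⌊ξ⌋₊).filter (fun p => p.Prime ∧ p.Coprime W)

lemma mem_sievePrimes {ξ : ℝ} (hξ : 0 ≤ ξ) {p : ℕ} :
    p ∈ sievePrimes W ξ ↔ p.Prime ∧ p.Coprime W ∧ (p : ℝ) ≤ ξ := by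
  rw [sievePrimes, mem_filter, mem_Icc, Nat.le_floor_iff hξ]
  exact ⟨fun h => ⟨h.2.1, h.2.2, h.1.2⟩, fun h => ⟨⟨h.1.pos, h.2.2⟩, h.1, h.2.1⟩⟩

namespace IsFormSystem

/-- Roots modulo p are at least as numerous as degree one primes of norm p, so Mertens' lower bound
carries over. Replacing 1/p by 1/(p+1) costs a convergent sum. -/
lemma exists_le_sum_rhoBar (hS : IsFormSystem F d θ W) (i : Fin N) :
    ∃ C : ℝ, 0 ≤ C ∧ ∀ ξ : ℝ, 2 ≤ ξ → Real.log (Real.log ξ) - C ≤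
      ∑ p ∈ sievePrimes W ξ, (rhoBar (F i) p : ℝ) / (p + 1) := by
  classical
  obtain ⟨C, hC⟩ := exists_mertens_lower (K i) W hS.ne_zero
  set S := ∑' n : ℕ, ((n : ℝ) ^ 2)⁻¹ with hSdef
  have hsum : Summable fun n : ℕ => ((n : ℝ) ^ 2)⁻¹ := Real.summable_nat_pow_inv.2 one_lt_two
  refine ⟨|C| + Module.finrank ℚ (K i) * S, ?_, fun ξ hξ => ?_⟩
  · have : 0 ≤ S := tsum_nonneg fun n => by positivity
    positivity
  set P := (idealsUpTo (K i) ξ).filter (IsGoodPrime W) with hP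
  have hPm : ∀ 𝔭 ∈ P, IsGoodPrime W 𝔭 ∧ (Ideal.absNorm 𝔭 : ℝ) ≤ ξ := fun 𝔭 h𝔭 => by
    obtain ⟨h1, h2⟩ := mem_filter.1 h𝔭
    exact ⟨h2, (mem_idealsUpTo.1 h1).2⟩
  have h1 : ∑ 𝔭 ∈ P, (Ideal.absNorm 𝔭 : ℝ)⁻¹ ≤
      ∑ 𝔭 ∈ P, (1 / ((Ideal.absNorm 𝔭 : ℝ) + 1) + ((Ideal.absNorm 𝔭 : ℝ) ^ 2)⁻¹) := by
    refine sum_le_sum fun 𝔭 h𝔭 => ?_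
    have hp : (0 : ℝ) < Ideal.absNorm 𝔭 := by exact_mod_cast (hPm 𝔭 h𝔭).1.1.pos
    set a : ℝ := (Ideal.absNorm 𝔭 : ℝ)
    rw [inv_eq_one_div, inv_eq_one_div, div_add_div _ _ (by positivity) (by positivity),
      div_le_div_iff₀ hp (by positivity)]
    nlinarith [mul_pos hp hp]
  have h2 : ∑ 𝔭 ∈ P, ((Ideal.absNorm 𝔭 : ℝ) ^ 2)⁻¹ ≤ Module.finrank ℚ (K i) * S := by
    refine (sum_goodPrime_le P ξ hPm (fun n => ((n : ℝ) ^ 2)⁻¹) fun n => by positivity).trans ?_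
    exact mul_le_mul_of_nonneg_left (hsum.sum_le_tsum _ fun n _ => by positivity) (by positivity)
  have h3 : ∑ 𝔭 ∈ P, 1 / ((Ideal.absNorm 𝔭 : ℝ) + 1) ≤
      ∑ p ∈ sievePrimes W ξ, (rhoBar (F i) p : ℝ) / (p + 1) := by
    rw [sum_comp (fun n : ℕ => 1 / ((n : ℝ) + 1)) (fun 𝔭 => Ideal.absNorm 𝔭)]
    refine (sum_le_sum (g := fun p : ℕ => (rhoBar (F i) p : ℝ) / (p + 1)) fun p hp => ?_).trans
      (sum_le_sum_of_subset_of_nonneg ?_ fun _ _ _ => by positivity)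
    · obtain ⟨𝔮, h𝔮, rfl⟩ := mem_image.1 hp
      have hg := (hPm 𝔮 h𝔮).1
      rw [nsmul_eq_mul, mul_one_div]
      refine div_le_div_of_nonneg_right (Nat.cast_le.2 ?_) (by positivity)
      exact card_primes_le_rhoBar hg.1 (hS.hom i) (hS.irr i) (hS.root i) (hS.good _ hg.2 i) _
        fun 𝔭 h𝔭 => (mem_filter.1 h𝔭).2
    · intro p hp
      obtain ⟨𝔮, h𝔮, rfl⟩ := mem_image.1 hp
      have hg := (hPm 𝔮 h𝔮)
      exact (mem_sievePrimes (by linarith)).2 ⟨hg.1.1, hg.1.2, hg.2⟩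
  have h4 := hC ξ hξ
  rw [sum_add_distrib] at h1
  have h5 := le_abs_self C
  have h6 : ∑ 𝔭 ∈ P, (Ideal.absNorm 𝔭 : ℝ)⁻¹ =
    ∑ 𝔭 ∈ (idealsUpTo (K i) ξ).filter (IsGoodPrime W), (Ideal.absNorm 𝔭 : ℝ)⁻¹ := rfl
  have h7 : Real.log (Real.log ξ) - C ≤ ∑ 𝔭 ∈ P, (Ideal.absNorm 𝔭 : ℝ)⁻¹ := by
    rw [h6]; convert h4
  linarith

/-- Each form contributes log log ξ + O(1) to the exponent, giving one factor 1/log ξ per form. The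
constant 3 compares 1 + log ξ with log ξ for ξ ≥ 2, and with 1 for ξ < 2. -/
lemma exists_prod_density_le (hS : IsFormSystem F d θ W) :
    ∃ C : ℝ, 1 ≤ C ∧ ∀ ξ : ℝ, 1 ≤ ξ →
      ∏ p ∈ sievePrimes W ξ, (1 - (totalRho F p : ℝ) / (p + 1)) ≤ C / (1 + Real.log ξ) ^ N := by
  choose c hc0 hc using hS.exists_le_sum_rhoBar
  set C := ∑ i, c i with hC
  have hC0 : 0 ≤ C := sum_nonneg fun i _ => hc0 i
  have he : 1 ≤ Real.exp C := Real.one_le_exp hC0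
  refine ⟨3 ^ N * Real.exp C, ?_, fun ξ hξ => ?_⟩
  · exact one_le_mul_of_one_le_of_one_le (one_le_pow₀ (by norm_num)) he
  have hl : 0 ≤ Real.log ξ := Real.log_nonneg hξ
  have hp1 : ∀ p ∈ sievePrimes W ξ, 0 ≤ 1 - (totalRho F p : ℝ) / (p + 1) := fun p hp => by
    obtain ⟨h1, h2, -⟩ := (mem_sievePrimes (by linarith)).1 hp
    have := (hS.density_bounds h1 h2).2.2.2.2.1
    linarith
  rw [le_div_iff₀ (by positivity)]
  rcases lt_or_ge ξ 2 with h | h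
  · have h1 : ∏ p ∈ sievePrimes W ξ, (1 - (totalRho F p : ℝ) / (p + 1)) ≤ 1 :=
      Finset.prod_le_one hp1 fun p _ => by
        have : 0 ≤ (totalRho F p : ℝ) / (p + 1) := by positivity
        linarith
    have h2 : 1 + Real.log ξ ≤ 3 := by
      have := Real.log_le_sub_one_of_pos (by linarith : 0 < ξ)
      linarith
    calc _ ≤ 1 * 3 ^ N := mul_le_mul h1 (pow_le_pow_left₀ (by linarith) h2 N) (by positivity)
          zero_le_one
      _ ≤ _ := by rw [one_mul]; exact le_mul_of_one_le_right (by positivity) he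
  · have hlog : 0 < Real.log ξ := Real.log_pos (by linarith)
    have h1 : ∏ p ∈ sievePrimes W ξ, (1 - (totalRho F p : ℝ) / (p + 1)) ≤
        Real.exp (C - N * Real.log (Real.log ξ)) := by
      calc _ ≤ ∏ p ∈ sievePrimes W ξ, Real.exp (-((totalRho F p : ℝ) / (p + 1))) :=
            Finset.prod_le_prod hp1 fun p _ => by
              have := Real.add_one_le_exp (-((totalRho F p : ℝ) / (p + 1)))
              linarith
        _ = Real.exp (-∑ p ∈ sievePrimes W ξ, (totalRho F p : ℝ) / (p + 1)) := by
            rw [← Real.exp_sum, sum_neg_distrib]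
        _ ≤ _ := by
            refine Real.exp_le_exp.2 ?_
            have h2 : ∑ p ∈ sievePrimes W ξ, (totalRho F p : ℝ) / (p + 1) =
                ∑ i, ∑ p ∈ sievePrimes W ξ, (rhoBar (F i) p : ℝ) / (p + 1) := by
              rw [sum_comm]
              refine Finset.sum_congr rfl fun p _ => ?_
              rw [totalRho, Nat.cast_sum, sum_div]
            have h3 := sum_le_sum fun i (_ : i ∈ univ) => hc i ξ h
            rw [sum_sub_distrib, sum_const, card_univ, Fintype.card_fin, nsmul_eq_mul] at h3
            linarith
    rw [Real.exp_sub, Real.exp_nat_mul, Real.exp_log hlog] at h1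
    have h2 : 1 + Real.log ξ ≤ 3 * Real.log ξ := by
      have h3 := Real.log_two_gt_d9
      have h4 := Real.log_le_log two_pos h
      linarith
    calc _ ≤ Real.exp C / Real.log ξ ^ N * (3 * Real.log ξ) ^ N :=
          mul_le_mul h1 (pow_le_pow_left₀ (by linarith) h2 N) (by positivity) (by positivity)
      _ = _ := by rw [mul_pow]; field_simp

/-- The product of the local factors over the sieving primes away from `q` and `u`. -/
lemma prod_density_filter_le (hS : IsFormSystem F d θ W) {q : ℕ} (hq : q ≠ 0)
    {u : ∀ i, Ideal (𝓞 (K i))} (hu : IsGoodTuple W u) {ξ : ℝ} (hξ : 0 ≤ ξ) :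
    ∏ p ∈ (sievePrimes W ξ).filter (fun p => ¬ p ∣ q ∧ ¬ p ∣ tupleNorm u),
        (1 - (totalRho F p : ℝ) / (p + 1)) ≤
      (∏ p ∈ sievePrimes W ξ, (1 - (totalRho F p : ℝ) / (p + 1))) *
        (hStar F (natPrimeTo W q) * ∏ i, primeWeight (2 * (∑ i, d i : ℕ)) (u i)) := by
  classical
  set φ : ℕ → ℝ := fun p => 1 - (totalRho F p : ℝ) / (p + 1) with hφ
  have hφ1 : ∀ p : ℕ, p.Prime → p.Coprime W → 0 < φ p ∧ 1 ≤ (φ p)⁻¹ := fun p hp hW => by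
    have h1 := (hS.density_bounds hp hW).2.2.2.2.1
    have h2 : φ p ≤ 1 := by
      have : 0 ≤ (totalRho F p : ℝ) / (p + 1) := by positivity
      simp only [hφ]; linarith
    have h3 : 0 < φ p := by simp only [hφ]; linarith
    exact ⟨h3, (one_le_inv₀ h3).2 h2⟩
  set P := sievePrimes W ξ with hP
  have hPm : ∀ p ∈ P, p.Prime ∧ p.Coprime W := fun p hp => by
    obtain ⟨h1, h2, -⟩ := (mem_sievePrimes hξ).1 hp
    exact ⟨h1, h2⟩
  set P₁ := P.filter (fun p => p ∣ q) with hP₁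
  set P₂ := P.filter (fun p => ¬ p ∣ q ∧ p ∣ tupleNorm u) with hP₂
  set P₃ := P.filter (fun p => ¬ p ∣ q ∧ ¬ p ∣ tupleNorm u) with hP₃
  -- Primes dividing q are unavailable to the sieve and cost h*; those dividing N(u) cost the prime
  -- weights.
  have hsplit : ∏ p ∈ P, φ p = (∏ p ∈ P₁, φ p) * ((∏ p ∈ P₂, φ p) * ∏ p ∈ P₃, φ p) := by
    rw [← prod_filter_mul_prod_filter_not P (fun p => p ∣ q),
      ← prod_filter_mul_prod_filter_not (P.filter fun p => ¬ p ∣ q) (fun p => p ∣ tupleNorm u),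
      filter_filter, filter_filter]
  have hpos : ∀ S ⊆ P, 0 < ∏ p ∈ S, φ p := fun S hS' => prod_pos fun p hp =>
    (hφ1 p (hPm p (hS' hp)).1 (hPm p (hS' hp)).2).1
  have h1 := hpos P₁ (filter_subset _ _)
  have h2 := hpos P₂ (filter_subset _ _)
  have h3 := hpos P₃ (filter_subset _ _)
  have hb1 : (∏ p ∈ P₁, φ p)⁻¹ ≤ hStar F (natPrimeTo W q) := by
    rw [hStar_natPrimeTo, ← prod_inv_distrib]
    refine prod_le_prod_of_subset_of_one_le_real ?_ fun p hp => ?_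
    · intro p hp
      obtain ⟨h4, h5⟩ := mem_filter.1 hp
      exact mem_filter.2 ⟨Nat.mem_primeFactors.2 ⟨(hPm p h4).1, h5, hq⟩, (hPm p h4).2⟩
    · obtain ⟨h4, h5⟩ := mem_filter.1 hp
      exact (hφ1 p (Nat.prime_of_mem_primeFactors h4) h5).2
  have hb2 : (∏ p ∈ P₂, φ p)⁻¹ ≤ ∏ i, primeWeight (2 * (∑ i, d i : ℕ)) (u i) := by
    rw [← prod_inv_distrib]
    set c : ℝ := 2 * (∑ i, d i : ℕ) with hc
    have hc0 : 0 ≤ c := by positivity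
    calc ∏ p ∈ P₂, (φ p)⁻¹ ≤ ∏ p ∈ P₂, (1 + c / p) :=
          Finset.prod_le_prod (fun p hp => by
            have := hPm p (mem_filter.1 hp).1
            exact (inv_pos.2 (hφ1 p this.1 this.2).1).le) fun p hp => by
            have := hPm p (mem_filter.1 hp).1
            exact (hS.density_bounds this.1 this.2).2.2.2.2.2
      _ ≤ ∏ a ∈ univ.sigma (fun i => (normalizedFactors (u i)).toFinset),
            (1 + c / (Ideal.absNorm a.2 : ℕ)) := by
          refine prod_le_prod_of_cover (r := fun a : Σ i, Ideal (𝓞 (K i)) => Ideal.absNorm a.2)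
            (g := fun p : ℕ => 1 + c / p) (fun a _ => ?_) fun p hp => ?_
          · have : 0 ≤ c / (Ideal.absNorm a.2 : ℕ) := by positivity
            linarith
          · obtain ⟨h4, h5⟩ := mem_filter.1 hp
            obtain ⟨i, 𝔭, h𝔭, hN⟩ := hu.exists_of_dvd_tupleNorm (hPm p h4).1 h5.2
            exact ⟨⟨i, 𝔭⟩, mem_sigma.2 ⟨mem_univ _, Multiset.mem_toFinset.2 h𝔭⟩, hN⟩
      _ = _ := by
          rw [prod_sigma]
          refine Finset.prod_congr rfl fun i _ => ?_
          rw [primeWeight]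
  calc ∏ p ∈ P₃, φ p = (∏ p ∈ P, φ p) * ((∏ p ∈ P₁, φ p)⁻¹ * (∏ p ∈ P₂, φ p)⁻¹) := by
        rw [hsplit]; field_simp
    _ ≤ _ := by
        refine mul_le_mul_of_nonneg_left (mul_le_mul hb1 hb2 (by positivity) ?_)
          (hpos P Subset.rfl).le
        exact (inv_pos.2 h1).le.trans hb1

end IsFormSystem
end MertensProduct
end

/-! ### The sieve bound on a lattice box. -/

noncomputable section

section SieveBound
open Finset UniqueFactorizationMonoid

variable {N : ℕ} {K : Fin N → Type*} [∀ i, Field (K i)] [∀ i, NumberField (K i)]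
  {F : Fin N → MvPolynomial (Fin 2) ℤ} {d : Fin N → ℕ} {θ : ∀ i, 𝓞 (K i)} {W : ℕ}

namespace IsFormSystem

/-- The congruences satisfied by the points whose ideals are divisible by `u`. -/
lemma exists_congruences (hS : IsFormSystem F d θ W) {q : ℕ} {x : ℤ × ℤ}
    (hx : IsCoprime x.1 x.2) (hne : ∀ i, MvPolynomial.eval ![x.1, x.2] (F i) ≠ 0)
    {u : ∀ i, Ideal (𝓞 (K i))} (hu : IsGoodTuple W u)
    (hux : ∀ i, u i ∣ formIdeals F θ (q * W) x i) :
    (∀ i, (Ideal.absNorm (u i)).Coprime (q * W)) ∧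
    (∀ i j, i ≠ j → (Ideal.absNorm (u i)).Coprime (Ideal.absNorm (u j))) ∧
    ∃ α β : Fin N → ℤ,
      (∀ i, IsCoprime (α i) (Ideal.absNorm (u i) : ℤ) ∨ IsCoprime (β i) (Ideal.absNorm (u i) : ℤ)) ∧
      ∀ y : ℤ × ℤ, (∀ i, MvPolynomial.eval ![y.1, y.2] (F i) ≠ 0) →
        (∀ i, u i ∣ formIdeals F θ (q * W) y i) →
        ∀ i, (Ideal.absNorm (u i) : ℤ) ∣ α i * y.1 + β i * y.2 := by
  have hsep := hS.isSeparatedTuple_formIdeals hx (Dvd.intro_left q rfl) hne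
  have hmem : ∀ i, ∀ 𝔭 ∈ normalizedFactors (u i),
      𝔭 ∈ normalizedFactors (formIdeals F θ (q * W) x i) := fun i 𝔭 h𝔭 =>
    Multiset.mem_of_le ((dvd_iff_normalizedFactors_le_normalizedFactors (hu.ne_bot i)
      (hsep.ne_bot i)).1 (hux i)) h𝔭
  have hcop : ∀ i, (Ideal.absNorm (u i)).Coprime (q * W) := by
    intro i
    refine Nat.Coprime.symm (Nat.coprime_of_dvd fun p hp h1 h2 => ?_)
    obtain ⟨𝔭, h𝔭, rfl⟩ := hu.exists_absNorm_eq hp h2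
    have := ((hS.mem_normalizedFactors_formIdeals hx (Dvd.intro_left q rfl)).1 (hmem i 𝔭 h𝔭)).2
    exact (Nat.Prime.coprime_iff_not_dvd hp).1 this h1
  refine ⟨hcop, fun i j hij => Nat.coprime_of_dvd fun p hp h1 h2 => ?_, ?_⟩
  · obtain ⟨𝔭, h𝔭, h3⟩ := hu.exists_absNorm_eq hp h1
    obtain ⟨𝔮, h𝔮, h4⟩ := hu.exists_absNorm_eq hp h2
    exact hsep.disj i j hij 𝔭 (hmem i 𝔭 h𝔭) 𝔮 (hmem j 𝔮 h𝔮) (h3.trans h4.symm)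
  · have hlin : ∀ (y : ℤ × ℤ), (∀ i, MvPolynomial.eval ![y.1, y.2] (F i) ≠ 0) →
        (∀ i, u i ∣ formIdeals F θ (q * W) y i) → ∀ i, linearForm (F i) (θ i) y.1 y.2 ∈ u i :=
      fun y hy huy i => Ideal.dvd_span_singleton.1 ((huy i).trans (hS.formIdeals_dvd (hy i)))
    have h1 : ∀ i, ∃ α β : ℤ, (IsCoprime α (Ideal.absNorm (u i) : ℤ) ∨
        IsCoprime β (Ideal.absNorm (u i) : ℤ)) ∧ ∀ s' t', linearForm (F i) (θ i) s' t' ∈ u i →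
          (Ideal.absNorm (u i) : ℤ) ∣ α * s' + β * t' := fun i =>
      exists_linear_congruence (hS.good _ ((hcop i).coprime_dvd_right (Dvd.intro_left q rfl)) i)
        (hS.root i) hx (hlin x hne hux i)
    choose α β hab hcong using h1
    exact ⟨α, β, hab, fun y hy huy i => hcong i _ _ (hlin y hy huy i)⟩

/-- The points of a lattice in a box satisfy a sieve bound. -/
theorem exists_hasSieveBound (hS : IsFormSystem F d θ W) (hN : 1 ≤ N) :
    ∃ (c : ℝ) (s : ℕ) (C : ℝ), 0 ≤ c ∧ 0 < C ∧
      ∀ (q : ℕ) (v₁ v₂ : ℤ × ℤ) (a b : ℤ) (k₁ k₂ : ℕ) (X : Finset (ℤ × ℤ)), q ≠ 0 →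
        (v₁.1 * v₂.2 - v₁.2 * v₂.1).natAbs = q → k₂ ≤ k₁ →
        (∀ x ∈ X, IsCoprime x.1 x.2 ∧ (∀ i, MvPolynomial.eval ![x.1, x.2] (F i) ≠ 0) ∧
          ∃ z ∈ Ico a (a + k₁) ×ˢ Ico b (b + k₂), columnsMap v₁ v₂ z = x) →
        HasSieveBound W c s X (formIdeals F θ (q * W))
          (C * (k₁ * k₂) * hStar F (natPrimeTo W q)) (C * k₁) k₁ := by
  classical
  set D := ∑ i, d i with hD
  obtain ⟨s₀, hs1, hsieve⟩ := exists_sieve_bound ((D : ℝ) + 1) (by positivity)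
  obtain ⟨C₀, hC₀, hprod⟩ := hS.exists_prod_density_le
  set s := ⌈s₀⌉₊ with hs
  set C := 2 * C₀ + 3 * 2 ^ (8 * s) with hC
  have hCpos : 0 < C := by positivity
  refine ⟨2 * (D : ℕ), 6 * s, C, by positivity, hCpos, ?_⟩
  intro q v₁ v₂ a b k₁ k₂ X hq hdet hk hX u hu ξ hξ hξk
  have hpw : 0 ≤ ∏ i, primeWeight (2 * (D : ℕ)) (u i) :=
    prod_nonneg fun i _ => primeWeight_nonneg (by positivity) _
  have hl : 0 ≤ Real.log ξ := Real.log_nonneg hξ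
  have hh : 0 ≤ hStar F (natPrimeTo W q) := by
    rw [hStar_natPrimeTo]
    refine prod_nonneg fun p hp => inv_nonneg.2 ?_
    obtain ⟨h1, h2⟩ := mem_filter.1 hp
    have := (hS.density_bounds (Nat.prime_of_mem_primeFactors h1) h2).2.2.2.2.1
    linarith
  -- A point of the sifted set is needed to produce the linear congruences, since their coefficients
  -- come from a root of θ modulo u. If there is none, the bound is trivial.
  rcases (siftedSet X (formIdeals F θ (q * W)) u ξ).eq_empty_or_nonempty with h0 | ⟨x₀, hx₀⟩
  · rw [h0, card_empty, Nat.cast_zero]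
    positivity
  obtain ⟨hx₀X, hx₀u, -⟩ := mem_filter.1 hx₀
  obtain ⟨hx₀1, hx₀2, -⟩ := hX x₀ hx₀X
  obtain ⟨hcop, hpair, α, β, hab, hcong⟩ := hS.exists_congruences hx₀1 hx₀2 hu hx₀u
  set n := tupleNorm u with hn
  have hn0 : 0 < n := tupleNorm_pos hu.ne_bot
  have hn0' : (0 : ℝ) < n := by exact_mod_cast hn0
  set P := (sievePrimes W ξ).filter (fun p => ¬ p ∣ q ∧ ¬ p ∣ n) with hP
  have hPm : ∀ p ∈ P, p.Prime ∧ p.Coprime W ∧ (p : ℝ) ≤ ξ ∧ ¬ p ∣ q ∧ ¬ p ∣ n := fun p hp => by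
    obtain ⟨h1, h2, h3⟩ := mem_filter.1 hp
    obtain ⟨h4, h5, h6⟩ := (mem_sievePrimes (by linarith)).1 h1
    exact ⟨h4, h5, h6, h2, h3⟩
  set Ω := ((Ico a (a + k₁) ×ˢ Ico b (b + k₂)).filter (fun z => ∀ i,
    (Ideal.absNorm (u i) : ℤ) ∣ α i * (columnsMap v₁ v₂ z).1 + β i * (columnsMap v₁ v₂ z).2))
    with hΩ
  set bad : ℕ → ℤ × ℤ → Prop := fun p z => ∃ i, (p : ℤ) ∣
    MvPolynomial.eval ![(columnsMap v₁ v₂ z).1, (columnsMap v₁ v₂ z).2] (F i) with hbad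
  set g : ℕ → ℝ := fun p => (1 + totalRho F p * (p - 1 : ℝ)) / (p : ℝ) ^ 2 with hg
  -- Doubling ξ guarantees z ≥ 2, as the sieve bound requires; it only affects constants.
  set z : ℝ := 2 * ξ with hz
  have hzs : z ^ s₀ ≤ z ^ s := by
    rw [← Real.rpow_natCast]
    exact Real.rpow_le_rpow_of_exponent_le (by linarith) (Nat.le_ceil _)
  have hX0 : (0 : ℝ) ≤ k₁ * k₂ / n := by positivity
  have hE0 : (0 : ℝ) ≤ 3 * 2 ^ (2 * s) * k₁ := by positivity
  have hcount : ∀ T ⊆ P, ((∏ p ∈ T, p : ℕ) : ℝ) ≤ (z ^ s₀) ^ 2 →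
      |((Ω.filter (fun y => ∀ p ∈ T, bad p y)).card : ℝ) - k₁ * k₂ / n * ∏ p ∈ T, g p| ≤
        3 * 2 ^ (2 * s) * k₁ * ((∏ p ∈ T, p : ℕ) : ℝ) := by
    intro T hT hTz₀
    have hTz := hTz₀.trans (pow_le_pow_left₀ (by positivity) hzs 2)
    set e := ∏ p ∈ T, p with he
    have he0 : 0 < e := prod_pos fun p hp => (hPm p (hT hp)).1.pos
    have he0' : (0 : ℝ) < e := by exact_mod_cast he0
    -- The basis has determinant ±q, so it is invertible modulo anything coprime to q and local
    -- counts do not see the lattice.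
    have hdetc : ∀ m : ℕ, m.Coprime q → IsCoprime (v₁.1 * v₂.2 - v₁.2 * v₂.1) (m : ℤ) := by
      intro m hm
      rw [Int.isCoprime_iff_gcd_eq_one, Int.gcd_eq_natAbs, hdet]
      simpa using hm.symm
    obtain ⟨hper, hcnt⟩ := hS.classCount_sieve hN (v₁ := v₁) (v₂ := v₂)
      (e := fun i => Ideal.absNorm (u i)) (α := α) (β := β)
      (fun i => absNorm_pos_of_ne_bot (hu.ne_bot i)) hpair hab (T := T)
      (fun p hp => by
        obtain ⟨h1, h2, -, h3, h4⟩ := hPm p (hT hp)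
        exact ⟨h1, h2, (Nat.Prime.coprime_iff_not_dvd h1).2 h4,
          hdetc p ((Nat.Prime.coprime_iff_not_dvd h1).2 h3)⟩)
      (fun i => hdetc _ ((hcop i).coprime_dvd_right (Dvd.intro _ rfl)))
      (fun z => (∀ i, (Ideal.absNorm (u i) : ℤ) ∣ α i * (columnsMap v₁ v₂ z).1 +
        β i * (columnsMap v₁ v₂ z).2) ∧ ∀ p ∈ T, bad p z) (fun z => Iff.rfl)
    have hprodn : ∏ i, Ideal.absNorm (u i) = n := rfl
    rw [hprodn] at hper hcnt
    have hbox := abs_card_box_sub_le a b k₁ k₂ (Nat.mul_pos hn0 he0) hper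
    rw [hcnt] at hbox
    have hset : Ω.filter (fun y => ∀ p ∈ T, bad p y) =
        (Ico a (a + k₁) ×ˢ Ico b (b + k₂)).filter (fun z => (∀ i, (Ideal.absNorm (u i) : ℤ) ∣
          α i * (columnsMap v₁ v₂ z).1 + β i * (columnsMap v₁ v₂ z).2) ∧ ∀ p ∈ T, bad p z) := by
      rw [hΩ, filter_filter]
    set R := ∏ p ∈ T, (1 + totalRho F p * (p - 1)) with hR
    have hRe : ((R : ℕ) : ℝ) = (∏ p ∈ T, g p) * (e : ℝ) ^ 2 := by
      rw [hR, he, Nat.cast_prod, Nat.cast_prod, ← prod_pow, ← prod_mul_distrib]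
      refine Finset.prod_congr rfl fun p hp => ?_
      have hp1 := (hPm p (hT hp)).1.one_le
      have hp0 : (p : ℝ) ≠ 0 := by exact_mod_cast (hPm p (hT hp)).1.ne_zero
      rw [hg]; push_cast [hp1]; field_simp
    have hRle : ((R : ℕ) : ℝ) ≤ (e : ℝ) ^ 2 := by
      rw [hRe]
      refine mul_le_of_le_one_left (by positivity) (Finset.prod_le_one (fun p hp => ?_)
        fun p hp => ?_)
      · have := hPm p (hT hp)
        exact (hS.density_bounds this.1 this.2.1).1.le
      · have := hPm p (hT hp)
        linarith [(hS.density_bounds this.1 this.2.1).2.1]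
    have hmain : (k₁ : ℝ) * k₂ * (((n * R : ℕ) : ℝ) / ((n * e : ℕ) : ℝ) ^ 2) =
        k₁ * k₂ / n * ∏ p ∈ T, g p := by
      push_cast
      rw [hRe]
      field_simp
    have herr : ((n * R : ℕ) : ℝ) * (((k₁ : ℝ) + k₂) / ((n * e : ℕ) : ℝ) + 1) ≤
        3 * 2 ^ (2 * s) * k₁ * (e : ℝ) := by
      have hk' : (k₂ : ℝ) ≤ k₁ := by exact_mod_cast hk
      push_cast
      have h1 : (n : ℝ) * R * (((k₁ : ℝ) + k₂) / (n * e) + 1) =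
          (R / e) * (k₁ + k₂) + n * R := by field_simp
      have h2 : (R : ℝ) / e ≤ e := by rw [div_le_iff₀ he0']; nlinarith
      have hξs : ξ ^ (2 * s) ≤ ξ ^ (6 * s) := pow_le_pow_right₀ hξ (by omega)
      -- Here the level condition N(u) ξ^(6s) ≤ k₁ is used: the constant term of the box error is
      -- bounded by k₁ e, like the boundary term.
      have h3 : (n : ℝ) * R ≤ 2 ^ (2 * s) * k₁ * e := by
        calc (n : ℝ) * R ≤ n * (e : ℝ) ^ 2 := by gcongr
          _ = n * e * e := by ring
          _ ≤ n * (z ^ s) ^ 2 * e := by gcongr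
          _ = 2 ^ (2 * s) * (n * ξ ^ (2 * s)) * e := by rw [hz]; ring
          _ ≤ 2 ^ (2 * s) * (n * ξ ^ (6 * s)) * e := by gcongr
          _ ≤ 2 ^ (2 * s) * k₁ * e := by gcongr
      have h4 : (R : ℝ) / e * (k₁ + k₂) ≤ e * (k₁ + k₁) := by gcongr
      have h5 : (1 : ℝ) ≤ 2 ^ (2 * s) := one_le_pow₀ (by norm_num)
      have h6 : (e : ℝ) * (k₁ + k₁) ≤ 2 ^ (2 * s) * (e * (k₁ + k₁)) :=
        le_mul_of_one_le_left (by positivity) h5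
      rw [h1]
      linarith
    have hcard : (Ω.filter (fun y => ∀ p ∈ T, bad p y)).card =
        ((Ico a (a + k₁) ×ˢ Ico b (b + k₂)).filter (fun z => (∀ i, (Ideal.absNorm (u i) : ℤ) ∣
          α i * (columnsMap v₁ v₂ z).1 + β i * (columnsMap v₁ v₂ z).2) ∧
            ∀ p ∈ T, bad p z)).card := by
      rw [hset]
    rw [hcard, ← hmain]
    refine le_trans ?_ herr
    convert hbox using 6
    rfl
  have hselberg := hsieve Ω P bad g (k₁ * k₂ / n) (3 * 2 ^ (2 * s) * k₁) z (by linarith) hX0 hE0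
    (fun p hp => by
      obtain ⟨h1, h2, h3, -⟩ := hPm p hp
      have := hS.large p h1 h2
      exact ⟨h1, by omega, by rw [hz]; linarith⟩)
    (fun p hp => by
      obtain ⟨h1, h2, -⟩ := hPm p hp
      obtain ⟨h3, h4, h5, -⟩ := hS.density_bounds h1 h2
      exact ⟨h3, h4, h5⟩) hcount
  -- A sieving prime p ≤ ξ dividing some F_i would be a prime norm of the point, hence would divide
  -- N(u), which was excluded.
  have hcover : (siftedSet X (formIdeals F θ (q * W)) u ξ).card ≤
      (Ω.filter (fun y => ∀ p ∈ P, ¬ bad p y)).card := by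
    have hsub : siftedSet X (formIdeals F θ (q * W)) u ξ ⊆
        (Ω.filter (fun y => ∀ p ∈ P, ¬ bad p y)).image (columnsMap v₁ v₂) := by
      intro x hx
      obtain ⟨hxX, hxu, hxp⟩ := mem_filter.1 hx
      obtain ⟨hx1, hx2, y, hy, rfl⟩ := hX x hxX
      refine mem_image_of_mem _ (mem_filter.2 ⟨mem_filter.2 ⟨hy, hcong _ hx2 hxu⟩, ?_⟩)
      rintro p hp ⟨i, hi⟩
      obtain ⟨h1, h2, h3, h4, h5⟩ := hPm p hp
      refine h5 (hxp p (hS.mem_primeNorms_of_dvd hx1 (Dvd.intro_left q rfl) (hx2 i) h1 ?_ hi) h3)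
      exact Nat.Coprime.mul_right ((Nat.Prime.coprime_iff_not_dvd h1).2 h4) h2
    exact (card_le_card hsub).trans card_image_le
  have hprodP : ∏ p ∈ P, (1 - g p) ≤ C₀ / (1 + Real.log ξ) ^ N *
      (hStar F (natPrimeTo W q) * ∏ i, primeWeight (2 * (D : ℕ)) (u i)) := by
    calc ∏ p ∈ P, (1 - g p) ≤ ∏ p ∈ P, (1 - (totalRho F p : ℝ) / (p + 1)) :=
          Finset.prod_le_prod (fun p hp => by
            have h := hPm p hp
            have := (hS.density_bounds h.1 h.2.1).2.1
            simp only [hg]; linarith) fun p hp => by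
            have h := hPm p hp
            exact (hS.density_bounds h.1 h.2.1).2.2.2.1
      _ ≤ _ := hS.prod_density_filter_le hq hu (by linarith)
      _ ≤ _ := mul_le_mul_of_nonneg_right (hprod ξ hξ) (by positivity)
  calc ((siftedSet X (formIdeals F θ (q * W)) u ξ).card : ℝ) ≤
        ((Ω.filter (fun y => ∀ p ∈ P, ¬ bad p y)).card : ℝ) := by exact_mod_cast hcover
    _ ≤ 2 * (k₁ * k₂ / n) * ∏ p ∈ P, (1 - g p) + 3 * 2 ^ (2 * s) * k₁ * (z ^ s) ^ 6 := by
        refine hselberg.trans ?_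
        gcongr
    _ ≤ 2 * (k₁ * k₂ / n) * (C₀ / (1 + Real.log ξ) ^ N *
          (hStar F (natPrimeTo W q) * ∏ i, primeWeight (2 * (D : ℕ)) (u i))) +
          3 * 2 ^ (2 * s) * k₁ * (z ^ s) ^ 6 := by gcongr
    _ = 2 * C₀ * (k₁ * k₂) * hStar F (natPrimeTo W q) *
          (∏ i, primeWeight (2 * (D : ℕ)) (u i)) / (n * (1 + Real.log ξ) ^ N) +
          3 * 2 ^ (8 * s) * k₁ * ξ ^ (6 * s) := by
        have h1 : (z ^ s) ^ 6 = 2 ^ (6 * s) * ξ ^ (6 * s) := by rw [hz]; ring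
        have h2 : (2 : ℝ) ^ (8 * s) = 2 ^ (2 * s) * 2 ^ (6 * s) := by rw [← pow_add]; congr 1; ring
        rw [h1, h2]; field_simp
    _ ≤ _ := by
        have h1 : 2 * C₀ ≤ C := by rw [hC]; linarith [pow_pos (two_pos : (0 : ℝ) < 2) (8 * s)]
        have h2 : 3 * 2 ^ (8 * s) ≤ C := by rw [hC]; linarith
        gcongr

end IsFormSystem
end SieveBound
end

/-! ### Counting the grid cells that meet a region. -/

noncomputable section

section GridCovering
open MeasureTheory Set
open scoped ENNReal

/-- Integrate the number of sets covering a point; it is at most k everywhere. -/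
lemma sum_measure_inter_le {α β : Type*} [MeasurableSpace α] (μ : Measure α) (A : Set α)
    (S : Finset β) (B : β → Set α) (hB : ∀ c ∈ S, MeasurableSet (B c)) (k : ℕ)
    (hk : ∀ x, ∀ T ⊆ S, (∀ c ∈ T, x ∈ B c) → T.card ≤ k) :
    ∑ c ∈ S, μ (A ∩ B c) ≤ k * μ A := by
  classical
  calc ∑ c ∈ S, μ (A ∩ B c) = ∑ c ∈ S, ∫⁻ x, (B c).indicator 1 x ∂(μ.restrict A) := by
        refine Finset.sum_congr rfl fun c hc => ?_
        rw [lintegral_indicator_one (hB c hc), Measure.restrict_apply (hB c hc), inter_comm]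
    _ = ∫⁻ x, ∑ c ∈ S, (B c).indicator 1 x ∂(μ.restrict A) :=
        (lintegral_finsetSum _ fun c hc => measurable_one.indicator (hB c hc)).symm
    _ ≤ ∫⁻ _, (k : ℝ≥0∞) ∂(μ.restrict A) := by
        refine lintegral_mono fun x => ?_
        have h : ∑ c ∈ S, (B c).indicator (1 : α → ℝ≥0∞) x =
            ((S.filter (fun c => x ∈ B c)).card : ℝ≥0∞) := by
          rw [Finset.card_filter, Nat.cast_sum]
          refine Finset.sum_congr rfl fun c _ => ?_
          by_cases hx : x ∈ B c <;> simp [hx]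
        simp only [h]
        exact_mod_cast hk x _ (Finset.filter_subset _ _) fun c hc => (Finset.mem_filter.1 hc).2
    _ = k * μ A := by rw [lintegral_const, Measure.restrict_apply_univ]

/-- If the connected set missed the frontier, the interior and the complement of the closure would
disconnect it. -/
lemma IsPreconnected.exists_mem_frontier {X : Type*} [TopologicalSpace X] {t R : Set X}
    (ht : IsPreconnected t) (h1 : (t ∩ R).Nonempty) (h2 : (t ∩ Rᶜ).Nonempty) :
    (t ∩ frontier R).Nonempty := by
  by_contra hne
  rw [not_nonempty_iff_eq_empty, ← disjoint_iff_inter_eq_empty, Set.disjoint_left] at hne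
  have hint : ∀ x ∈ t, x ∈ closure R → x ∈ interior R := fun x hx hcl => by
    by_contra h
    exact hne hx ⟨hcl, h⟩
  obtain ⟨a, ha, haR⟩ := h1
  obtain ⟨b, hb, hbR⟩ := h2
  obtain ⟨z, -, hz1, hz2⟩ := ht _ _ isOpen_interior isClosed_closure.isOpen_compl
    (fun x hx => by
      by_cases h : x ∈ closure R
      · exact Or.inl (hint x hx h)
      · exact Or.inr h)
    ⟨a, ha, hint a ha (subset_closure haR)⟩
    ⟨b, hb, fun h => hbR (interior_subset (hint b hb h))⟩
  exact hz2 (subset_closure (interior_subset hz1))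

/-- The centre of a cell of the grid of mesh `L`. -/
def cellCenter (L : ℝ) (c : ℤ × ℤ) : Fin 2 → ℝ := ![((c.1 : ℝ) + 1 / 2) * L, ((c.2 : ℝ) + 1 / 2) * L]

/-- The distance to the centre of a cell in the sup norm. -/
def cellDist (L : ℝ) (c : ℤ × ℤ) (v : Plane) : ℝ := dist (WithLp.ofLp v) (cellCenter L c)

/-- The cell of the grid of mesh `L` containing a point. -/
def gridIndex (L : ℝ) (v : Plane) : ℤ × ℤ := (⌊v 0 / L⌋, ⌊v 1 / L⌋)

variable {L : ℝ}

lemma cellDist_le_iff {r : ℝ} (hr : 0 ≤ r) {c : ℤ × ℤ} {v : Plane} : cellDist L c v ≤ r ↔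
    |v 0 - ((c.1 : ℝ) + 1 / 2) * L| ≤ r ∧ |v 1 - ((c.2 : ℝ) + 1 / 2) * L| ≤ r := by
  rw [cellDist, dist_pi_le_iff hr, Fin.forall_fin_two, Real.dist_eq, Real.dist_eq]
  rfl

lemma lipschitzWith_cellDist (c : ℤ × ℤ) : LipschitzWith 1 (cellDist L c) := by
  have h := (LipschitzWith.dist_left (cellCenter L c)).comp
    (PiLp.lipschitzWith_ofLp 2 (fun _ : Fin 2 => ℝ))
  rwa [mul_one] at h

lemma cellDist_gridIndex_le (hL : 0 < L) (v : Plane) : cellDist L (gridIndex L v) v ≤ L / 2 := by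
  have h : ∀ a : ℝ, |a - ((⌊a / L⌋ : ℝ) + 1 / 2) * L| ≤ L / 2 := by
    intro a
    have h1 := Int.floor_le (a / L)
    have h2 := Int.lt_floor_add_one (a / L)
    rw [le_div_iff₀ hL] at h1
    rw [div_lt_iff₀ hL] at h2
    rw [abs_le]
    constructor <;> nlinarith
  exact (cellDist_le_iff (by positivity)).2 ⟨h _, h _⟩

/-- A point is near few cells. -/
lemma card_le_nine (hL : 0 < L) (v : Plane) (T : Finset (ℤ × ℤ))
    (hT : ∀ c ∈ T, cellDist L c v ≤ L) : T.card ≤ 9 := by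
  have h : ∀ (a : ℝ) (i : ℤ), |a - ((i : ℝ) + 1 / 2) * L| ≤ L →
      i ∈ Finset.Icc (⌊a / L⌋ - 1) (⌊a / L⌋ + 1) := by
    intro a i hi
    have h1 := Int.floor_le (a / L)
    have h2 := Int.lt_floor_add_one (a / L)
    rw [le_div_iff₀ hL] at h1
    rw [div_lt_iff₀ hL] at h2
    obtain ⟨h3, h4⟩ := abs_le.1 hi
    rw [Finset.mem_Icc]
    constructor
    · by_contra hlt
      have h5 : (i : ℝ) + 2 ≤ ⌊a / L⌋ := by
        have : i + 2 ≤ ⌊a / L⌋ := by omega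
        exact_mod_cast this
      nlinarith
    · by_contra hlt
      have h5 : (⌊a / L⌋ : ℝ) + 2 ≤ i := by
        have : ⌊a / L⌋ + 2 ≤ i := by omega
        exact_mod_cast this
      nlinarith
  have hsub : T ⊆ Finset.Icc (⌊v 0 / L⌋ - 1) (⌊v 0 / L⌋ + 1) ×ˢ
      Finset.Icc (⌊v 1 / L⌋ - 1) (⌊v 1 / L⌋ + 1) := by
    intro c hc
    obtain ⟨h1, h2⟩ := (cellDist_le_iff hL.le).1 (hT c hc)
    exact Finset.mem_product.2 ⟨h _ _ h1, h _ _ h2⟩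
  refine (Finset.card_le_card hsub).trans ?_
  rw [Finset.card_product, Int.card_Icc, Int.card_Icc]
  have : ∀ a : ℤ, (a + 1 + 1 - (a - 1)).toNat = 3 := fun a => by omega
  rw [this, this]

lemma cellDist_isPreconnected_level (c : ℤ × ℤ) (r : ℝ) :
    IsPreconnected {v : Plane | cellDist L c v = r} := by
  have h1 : IsPreconnected (Metric.sphere (cellCenter L c) r) := by
    refine isPreconnected_sphere ?_ _ _
    rw [rank_fin_fun]
    exact_mod_cast one_lt_two
  have h2 := h1.image (WithLp.toLp 2) (PiLp.continuous_toLp 2 (fun _ : Fin 2 => ℝ)).continuousOn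
  convert h2 using 1
  ext v
  constructor
  · intro hv
    exact ⟨WithLp.ofLp v, hv, rfl⟩
  · rintro ⟨u, hu, rfl⟩
    exact hu

/-- If a component of `R` leaves a neighbourhood of a cell, then the neighbourhood contains a
positive proportion of `R` or of its boundary. -/
lemma measure_ge_of_exit (hL : 0 < L) {R : Set Plane} (c : ℤ × ℤ) {s : Set Plane}
    (hs : IsPreconnected s) (hsR : s ⊆ R) {x y : Plane} (hx : x ∈ s) (hy : y ∈ s)
    (hxL : cellDist L c x ≤ L / 2) (hyL : L ≤ cellDist L c y) :
    ENNReal.ofReal (L / 4) ≤ Measure.hausdorffMeasure 1 (frontier R ∩ {v | cellDist L c v ≤ L}) ∨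
      ENNReal.ofReal (L ^ 2 / 4) ≤ volume (R ∩ {v | cellDist L c v ≤ L}) := by
  have hcont : Continuous (cellDist L c) := (lipschitzWith_cellDist c).continuous
  set B : Set Plane := {v | cellDist L c v ≤ L} with hB
  -- The radii whose sphere meets the frontier. Distance is 1-Lipschitz, so the length of the
  -- frontier is at least the measure of A.
  set A : Set ℝ := cellDist L c '' (frontier R ∩ B) with hA
  by_cases hlarge : ENNReal.ofReal (L / 4) ≤ volume A
  · left
    refine hlarge.trans ?_
    rw [← hausdorffMeasure_real]
    simpa using (lipschitzWith_cellDist (L := L) c).hausdorffMeasure_image_le zero_le_one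
      (frontier R ∩ B)
  · right
    have hcompB : IsCompact B := by
      refine Metric.isCompact_of_isClosed_isBounded (isClosed_le hcont continuous_const) ?_
      refine (Metric.isBounded_iff_subset_closedBall (WithLp.toLp 2 (cellCenter L c))).2
        ⟨2 * L, fun v hv => ?_⟩
      obtain ⟨h1, h2⟩ := (cellDist_le_iff hL.le).1 hv
      rw [Metric.mem_closedBall, EuclideanSpace.dist_eq, Fin.sum_univ_two, Real.sqrt_le_left
        (by positivity)]
      have h3 : dist (v 0) ((WithLp.toLp 2 (cellCenter L c) : Plane) 0) ≤ L := h1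
      have h4 : dist (v 1) ((WithLp.toLp 2 (cellCenter L c) : Plane) 1) ≤ L := h2
      nlinarith [dist_nonneg (x := v 0) (y := (WithLp.toLp 2 (cellCenter L c) : Plane) 0),
        dist_nonneg (x := v 1) (y := (WithLp.toLp 2 (cellCenter L c) : Plane) 1)]
    have hAc : IsCompact A := (hcompB.inter_left isClosed_frontier).image hcont
    set T : Set ℝ := Ioo (L / 2) L \ A with hT
    have hTm : MeasurableSet T := measurableSet_Ioo.diff hAc.measurableSet
    -- The component crosses every level between L/2 and L. A sup-norm sphere in the plane is
    -- connected, so if it meets R without meeting the frontier it lies inside R.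
    have hTR : ∀ v : Plane, cellDist L c v ∈ T → v ∈ R := by
      intro v hv
      obtain ⟨⟨h1, h2⟩, h3⟩ := hv
      obtain ⟨w, hw, hwr⟩ := hs.intermediate_value hx hy hcont.continuousOn
        (⟨hxL.trans h1.le, h2.le.trans hyL⟩ : cellDist L c v ∈ Icc _ _)
      by_contra hvR
      obtain ⟨z, hz1, hz2⟩ := (cellDist_isPreconnected_level c (cellDist L c v)).exists_mem_frontier
        ⟨w, hwr, hsR hw⟩ ⟨v, rfl, hvR⟩
      refine h3 ⟨z, ⟨hz2, ?_⟩, hz1⟩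
      have : cellDist L c z = cellDist L c v := hz1
      rw [hB, mem_ofPred_eq, this]
      exact h2.le
    have hTvol : ENNReal.ofReal (L / 4) ≤ volume T := by
      have h1 : ENNReal.ofReal (L / 2) ≤ volume T + volume A := by
        calc ENNReal.ofReal (L / 2) = volume (Ioo (L / 2) L) := by
              rw [Real.volume_Ioo]; congr 1; ring
          _ ≤ volume (T ∪ A) := measure_mono fun t ht => by
              by_cases h : t ∈ A
              · exact Or.inr h
              · exact Or.inl ⟨ht, h⟩
          _ ≤ _ := measure_union_le _ _
      by_contra hlt
      have h2 := ENNReal.add_lt_add (not_le.1 hlt) (not_le.1 hlarge)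
      rw [← ENNReal.ofReal_add (by positivity) (by positivity)] at h2
      have h3 : L / 4 + L / 4 = L / 2 := by ring
      rw [h3] at h2
      exact absurd h1 (not_le.2 h2)
    -- Only the right-hand sides of the square annuli are used: there the sup distance equals the
    -- first coordinate difference, so T times an interval of length L embeds in R.
    set S : Fin 2 → Set ℝ := ![(fun t => t + -(cellCenter L c 0)) ⁻¹' T,
      Icc (cellCenter L c 1 - L / 2) (cellCenter L c 1 + L / 2)] with hS
    have hSm : MeasurableSet (univ.pi S) := by
      refine MeasurableSet.univ_pi fun i => ?_
      fin_cases i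
      · exact (measurable_add_const _) hTm
      · exact measurableSet_Icc
    have hsub : WithLp.ofLp ⁻¹' (univ.pi S) ⊆ R ∩ B := by
      intro v hv
      have h0 : v 0 + -(cellCenter L c 0) ∈ T := hv 0 (mem_univ _)
      have h1 : v 1 ∈ Icc (cellCenter L c 1 - L / 2) (cellCenter L c 1 + L / 2) := hv 1 (mem_univ _)
      have h2 : cellDist L c v = v 0 + -(cellCenter L c 0) := by
        refine le_antisymm ?_ ?_
        · rw [cellDist, dist_pi_le_iff (by linarith [h0.1.1]), Fin.forall_fin_two, Real.dist_eq,
            Real.dist_eq]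
          have h3 := h0.1.1
          refine ⟨le_of_eq (abs_of_nonneg (by linarith)), ?_⟩
          rw [abs_le]
          constructor <;> linarith [h1.1, h1.2]
        · rw [← sub_eq_add_neg]
          exact (le_abs_self _).trans (dist_le_pi_dist (WithLp.ofLp v) (cellCenter L c) 0)
      have h3 : cellDist L c v ∈ T := by rw [h2]; exact h0
      exact ⟨hTR v h3, h3.1.2.le⟩
    calc ENNReal.ofReal (L ^ 2 / 4) = ENNReal.ofReal (L / 4) * ENNReal.ofReal L := by
          rw [← ENNReal.ofReal_mul (by positivity)]; congr 1; ring
      _ ≤ volume T * ENNReal.ofReal L := by gcongr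
      _ = volume (univ.pi S) := by
          rw [volume_pi_pi, Fin.prod_univ_two]
          have h1 : volume (S 0) = volume T := measure_preimage_add_right volume _ T
          have h2 : volume (S 1) = ENNReal.ofReal L := by
            have : S 1 = Icc (cellCenter L c 1 - L / 2) (cellCenter L c 1 + L / 2) := rfl
            rw [this, Real.volume_Icc]; congr 1; ring
          rw [h1, h2]
      _ = volume ((WithLp.ofLp : Plane → Fin 2 → ℝ) ⁻¹' (univ.pi S)) :=
          ((PiLp.volume_preserving_ofLp (Fin 2)).measure_preimage hSm.nullMeasurableSet).symm
      _ ≤ volume (R ∩ B) := measure_mono hsub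

/-- The number of cells of a grid which meet a region. -/
theorem card_gridIndex_le (hL : 0 < L) {R : Set Plane} (hR : Bornology.IsBounded R)
    (hrect : Measure.hausdorffMeasure (1 : ℝ) (frontier R) ≠ ⊤) {m : ℕ}
    (hm : ENat.card (ConnectedComponents R) ≤ m) (S : Finset (ℤ × ℤ))
    (hS : ∀ c ∈ S, ∃ v ∈ R, gridIndex L v = c) :
    (S.card : ℝ) ≤ 36 * (area R / L ^ 2 + boundaryLength R / L) + 9 * m := by
  classical
  set B : ℤ × ℤ → Set Plane := fun c => {v | cellDist L c v ≤ L} with hB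
  have hBm : ∀ c, MeasurableSet (B c) := fun c =>
    (isClosed_le (lipschitzWith_cellDist c).continuous continuous_const).measurableSet
  have hover : ∀ (S' : Finset (ℤ × ℤ)) (x : Plane), ∀ T ⊆ S', (∀ c ∈ T, x ∈ B c) → T.card ≤ 9 :=
    fun S' x T _ hT => card_le_nine hL x T hT
  have hvol : volume R ≠ ⊤ := hR.measure_lt_top.ne
  -- Cells near much boundary, cells near much area, and the rest. In the rest the component through
  -- the chosen point never leaves the neighbourhood of the cell, so each component accounts for at
  -- most nine cells. The constant 36 is 9 divided by the proportion 1/4.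
  set S₁ := S.filter (fun c => ENNReal.ofReal (L / 4) ≤
    Measure.hausdorffMeasure 1 (frontier R ∩ B c)) with hS₁
  set S₂ := S.filter (fun c => ENNReal.ofReal (L ^ 2 / 4) ≤ volume (R ∩ B c)) with hS₂
  set S₃ := S.filter (fun c => c ∉ S₁ ∧ c ∉ S₂) with hS₃
  have h1 : (S₁.card : ℝ) ≤ 36 * (boundaryLength R / L) := by
    have h := sum_measure_inter_le (Measure.hausdorffMeasure (1 : ℝ)) (frontier R) S₁ B
      (fun c _ => hBm c) 9 (hover S₁)
    have h2 : (S₁.card : ℝ≥0∞) * ENNReal.ofReal (L / 4) ≤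
        9 * Measure.hausdorffMeasure (1 : ℝ) (frontier R) := by
      refine le_trans ?_ h
      rw [← nsmul_eq_mul, ← Finset.sum_const]
      exact Finset.sum_le_sum fun c hc => (Finset.mem_filter.1 hc).2
    have h3 := ENNReal.toReal_mono (ENNReal.mul_ne_top (by norm_num) hrect) h2
    rw [ENNReal.toReal_mul, ENNReal.toReal_mul, ENNReal.toReal_ofReal (by positivity),
      ENNReal.toReal_natCast] at h3
    rw [← mul_div_assoc, le_div_iff₀ hL, boundaryLength]
    norm_num at h3
    linarith
  have h2 : (S₂.card : ℝ) ≤ 36 * (area R / L ^ 2) := by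
    have h := sum_measure_inter_le volume R S₂ B (fun c _ => hBm c) 9 (hover S₂)
    have h2 : (S₂.card : ℝ≥0∞) * ENNReal.ofReal (L ^ 2 / 4) ≤ 9 * volume R := by
      refine le_trans ?_ h
      rw [← nsmul_eq_mul, ← Finset.sum_const]
      exact Finset.sum_le_sum fun c hc => (Finset.mem_filter.1 hc).2
    have h3 := ENNReal.toReal_mono (ENNReal.mul_ne_top (by norm_num) hvol) h2
    rw [ENNReal.toReal_mul, ENNReal.toReal_mul, ENNReal.toReal_ofReal (by positivity),
      ENNReal.toReal_natCast] at h3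
    rw [← mul_div_assoc, le_div_iff₀ (by positivity), area]
    norm_num at h3
    linarith
  have h3 : S₃.card ≤ 9 * m := by
    have hfin : Finite (ConnectedComponents R) :=
      ENat.card_lt_top.1 (hm.trans_lt (ENat.natCast_lt_top m))
    have hcm : Nat.card (ConnectedComponents R) ≤ m := by
      rw [ENat.card_eq_coe_natCard] at hm
      exact_mod_cast hm
    choose! v hvR hv using hS
    have hvS : ∀ c : S₃, v c.1 ∈ R := fun c => hvR c.1 (Finset.mem_filter.1 c.2).1
    have hstay : ∀ c : S₃, ∀ y : R, y ∈ connectedComponent (⟨v c.1, hvS c⟩ : R) →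
        cellDist L c.1 y < L := by
      intro c y hy
      by_contra hlt
      obtain ⟨hcS, hc1, hc2⟩ := Finset.mem_filter.1 c.2
      have hpre : IsPreconnected (Subtype.val '' connectedComponent (⟨v c.1, hvS c⟩ : R)) :=
        isPreconnected_connectedComponent.image _ continuous_subtype_val.continuousOn
      rcases measure_ge_of_exit hL c.1 hpre (Subtype.coe_image_subset _ _)
        ⟨_, mem_connectedComponent, rfl⟩ ⟨y, hy, rfl⟩
        (by have := cellDist_gridIndex_le hL (v c.1); rwa [hv c.1 hcS] at this) (not_lt.1 hlt)
        with h | h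
      · exact hc1 (Finset.mem_filter.2 ⟨hcS, h⟩)
      · exact hc2 (Finset.mem_filter.2 ⟨hcS, h⟩)
    set φ : S₃ → ConnectedComponents R := fun c => ConnectedComponents.mk ⟨v c.1, hvS c⟩ with hφ
    have := Fintype.ofFinite (ConnectedComponents R)
    have hcard := Finset.card_le_mul_card_image (f := φ) Finset.univ 9 fun b hb => by
      obtain ⟨c₀, -, rfl⟩ := Finset.mem_image.1 hb
      have h4 := card_le_nine hL (v c₀.1)
        (((Finset.univ.filter fun c => φ c = φ c₀)).map (Function.Embedding.subtype _))
        fun c hc => by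
          obtain ⟨c', hc', rfl⟩ := Finset.mem_map.1 hc
          have h5 := (Finset.mem_filter.1 hc').2
          exact (hstay c' ⟨v c₀.1, hvS c₀⟩ (ConnectedComponents.coe_eq_coe'.1 h5.symm)).le
      rwa [Finset.card_map] at h4
    rw [Finset.card_univ, Fintype.card_coe] at hcard
    refine hcard.trans (Nat.mul_le_mul_left 9 ?_)
    refine (Finset.card_le_univ _).trans ?_
    rwa [← Nat.card_eq_fintype_card]
  have hcov : S ⊆ S₁ ∪ (S₂ ∪ S₃) := by
    intro c hc
    simp only [Finset.mem_union]
    by_cases h4 : c ∈ S₁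
    · exact Or.inl h4
    · by_cases h5 : c ∈ S₂
      · exact Or.inr (Or.inl h5)
      · exact Or.inr (Or.inr (Finset.mem_filter.2 ⟨hc, h4, h5⟩))
  have h4 : S.card ≤ S₁.card + (S₂.card + S₃.card) :=
    (Finset.card_le_card hcov).trans ((Finset.card_union_le _ _).trans
      (Nat.add_le_add_left (Finset.card_union_le _ _) _))
  have h5 : (S.card : ℝ) ≤ S₁.card + (S₂.card + S₃.card) := by exact_mod_cast h4
  have h6 : (S₃.card : ℝ) ≤ 9 * m := by exact_mod_cast h3
  linarith

end GridCovering
end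

/-! ### Reduced bases of planar lattices. -/

noncomputable section

section ReducedBasis

/-- `v₁, v₂` is a basis of the lattice `G`. -/
structure IsLatticeBasis (G : AddSubgroup (ℤ × ℤ)) (v₁ v₂ : ℤ × ℤ) : Prop where
  left_mem : v₁ ∈ G
  right_mem : v₂ ∈ G
  exists_eq : ∀ x ∈ G, ∃ m n : ℤ, x = m • v₁ + n • v₂
  natAbs_det : (v₁.1 * v₂.2 - v₁.2 * v₂.1).natAbs = G.index

lemma IsLatticeBasis.swap {G : AddSubgroup (ℤ × ℤ)} {v₁ v₂ : ℤ × ℤ} (h : IsLatticeBasis G v₁ v₂) :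
    IsLatticeBasis G v₂ v₁ where
  left_mem := h.right_mem
  right_mem := h.left_mem
  exists_eq x hx := by
    obtain ⟨m, n, rfl⟩ := h.exists_eq x hx
    exact ⟨n, m, add_comm _ _⟩
  natAbs_det := by
    rw [← h.natAbs_det, ← Int.natAbs_neg]
    congr 1; ring

lemma IsLatticeBasis.add_zsmul {G : AddSubgroup (ℤ × ℤ)} {v₁ v₂ : ℤ × ℤ}
    (h : IsLatticeBasis G v₁ v₂) (k : ℤ) : IsLatticeBasis G v₁ (v₂ + k • v₁) where
  left_mem := h.left_mem
  right_mem := G.add_mem h.right_mem (G.zsmul_mem h.left_mem k)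
  exists_eq x hx := by
    obtain ⟨m, n, rfl⟩ := h.exists_eq x hx
    exact ⟨m - n * k, n, by module⟩
  natAbs_det := by
    rw [← h.natAbs_det]
    congr 1
    simp only [Prod.fst_add, Prod.snd_add, Prod.smul_fst, Prod.smul_snd, smul_eq_mul]
    ring

/-- A triangular basis: (a, 0) generates the intersection with the horizontal axis, and (b, c)
projects to a generator of the second coordinates. -/
lemma exists_isLatticeBasis {G : AddSubgroup (ℤ × ℤ)} (hG : G.index ≠ 0) :
    ∃ v₁ v₂, IsLatticeBasis G v₁ v₂ := by
  have hmem : ∀ x : ℤ × ℤ, (G.index : ℤ) • x ∈ G := fun x => by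
    rw [natCast_zsmul]; exact G.nsmul_index_mem x
  have hq : (G.index : ℤ) ≠ 0 := by exact_mod_cast hG
  obtain ⟨a, ha⟩ := Int.subgroup_cyclic (G.comap (AddMonoidHom.inl ℤ ℤ))
  obtain ⟨c, hc⟩ := Int.subgroup_cyclic (G.map (AddMonoidHom.snd ℤ ℤ))
  have ha' : ∀ n : ℤ, (n, (0 : ℤ)) ∈ G → ∃ k : ℤ, k * a = n := fun n hn => by
    have h1 : n ∈ G.comap (AddMonoidHom.inl ℤ ℤ) := hn
    rw [ha, AddSubgroup.mem_closure_singleton] at h1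
    simpa using h1
  have haG : (a, (0 : ℤ)) ∈ G := by
    have h1 : a ∈ G.comap (AddMonoidHom.inl ℤ ℤ) := by
      rw [ha]; exact AddSubgroup.subset_closure (Set.mem_singleton a)
    exact h1
  have hc' : ∀ x ∈ G, ∃ k : ℤ, k * c = x.2 := fun x hx => by
    have h1 : x.2 ∈ G.map (AddMonoidHom.snd ℤ ℤ) := ⟨x, hx, rfl⟩
    rw [hc, AddSubgroup.mem_closure_singleton] at h1
    simpa using h1
  have hcG : ∃ b : ℤ, (b, c) ∈ G := by
    have h1 : c ∈ G.map (AddMonoidHom.snd ℤ ℤ) := by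
      rw [hc]; exact AddSubgroup.subset_closure (Set.mem_singleton c)
    obtain ⟨x, hx, rfl⟩ := h1
    exact ⟨x.1, hx⟩
  obtain ⟨b, hb⟩ := hcG
  have ha0 : a ≠ 0 := by
    rintro rfl
    obtain ⟨k, hk⟩ := ha' (G.index : ℤ) (by simpa using hmem (1, 0))
    exact hq (by simpa using hk.symm)
  have hc0 : c ≠ 0 := by
    rintro rfl
    obtain ⟨k, hk⟩ := hc' _ (hmem (0, 1))
    exact hq (by simpa using hk.symm)
  have hgen : ∀ x ∈ G, ∃ m n : ℤ, x = m • (a, (0 : ℤ)) + n • (b, c) := by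
    intro x hx
    obtain ⟨n, hn⟩ := hc' x hx
    have h1 : x - n • (b, c) ∈ G := G.sub_mem hx (G.zsmul_mem hb n)
    have h2 : x - n • (b, c) = (x.1 - n * b, 0) := by
      ext <;> simp [hn]
    rw [h2] at h1
    obtain ⟨m, hm⟩ := ha' _ h1
    refine ⟨m, n, ?_⟩
    ext
    · simp only [Prod.fst_add, Prod.smul_fst, smul_eq_mul]; linarith
    · simp only [Prod.snd_add, Prod.smul_snd, smul_eq_mul]; linarith
  refine ⟨(a, 0), (b, c), haG, hb, hgen, ?_⟩
  set v : Fin 2 → G := ![⟨(a, 0), haG⟩, ⟨(b, c), hb⟩] with hv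
  have hli : LinearIndependent ℤ v := by
    rw [hv, LinearIndependent.pair_iff]
    intro m n hmn
    have h1 := congrArg Subtype.val hmn
    have h2 : m * a + n * b = 0 ∧ n * c = 0 := by simpa [Prod.ext_iff] using h1
    have hn : n = 0 := by
      rcases mul_eq_zero.1 h2.2 with h | h
      · exact h
      · exact absurd h hc0
    have hm := h2.1
    rw [hn, zero_mul, add_zero] at hm
    rcases mul_eq_zero.1 hm with h | h
    · exact ⟨h, hn⟩
    · exact absurd h ha0
  have hsp : ⊤ ≤ Submodule.span ℤ (Set.range v) := by
    rintro ⟨x, hx⟩ -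
    obtain ⟨m, n, h⟩ := hgen x hx
    have h1 : (⟨x, hx⟩ : G) = m • v 0 + n • v 1 := Subtype.ext h
    rw [h1]
    exact Submodule.add_mem _ (Submodule.smul_mem _ _ (Submodule.subset_span ⟨0, rfl⟩))
      (Submodule.smul_mem _ _ (Submodule.subset_span ⟨1, rfl⟩))
  have := AddSubgroup.index_eq_natAbs_det (Module.Basis.finTwoProd ℤ) G (Module.Basis.mk hli hsp)
  rw [this, Module.Basis.det_apply, Matrix.det_fin_two]
  simp [Module.Basis.toMatrix_apply, hv, Int.natAbs_mul]

/-- The square of the Euclidean length. -/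
def sqLength (v : ℤ × ℤ) : ℤ := v.1 ^ 2 + v.2 ^ 2

lemma sqLength_nonneg (v : ℤ × ℤ) : 0 ≤ sqLength v := by unfold sqLength; positivity

lemma norm_toPlane (v : ℤ × ℤ) : ‖toPlane v‖ = √(sqLength v : ℝ) := by
  rw [EuclideanSpace.norm_eq, Fin.sum_univ_two]
  simp [toPlane, sqLength]

/-- A lattice has a reduced basis. -/
theorem exists_reduced_basis {G : AddSubgroup (ℤ × ℤ)} (hG : G.index ≠ 0) :
    ∃ v₁ v₂, IsLatticeBasis G v₁ v₂ ∧ sqLength v₁ ≤ sqLength v₂ ∧ 1 ≤ sqLength v₁ ∧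
      (∀ m n : ℤ, m ^ 2 * sqLength v₁ + n ^ 2 * sqLength v₂ ≤ 2 * sqLength (m • v₁ + n • v₂)) ∧
      (G.index : ℤ) ^ 2 ≤ sqLength v₁ * sqLength v₂ := by
  classical
  -- Reduction by minimality: among all bases one takes the smallest sum of squared lengths.
  -- Comparing with v₂ ± v₁ gives |2 v₁·v₂| ≤ |v₁|².
  have hex : ∃ k : ℕ, ∃ v₁ v₂, IsLatticeBasis G v₁ v₂ ∧ (sqLength v₁ + sqLength v₂).toNat = k := by
    obtain ⟨v₁, v₂, h⟩ := exists_isLatticeBasis hG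
    exact ⟨_, v₁, v₂, h, rfl⟩
  obtain ⟨v₁, v₂, hb, hk⟩ := Nat.find_spec hex
  have hmin : ∀ w₁ w₂, IsLatticeBasis G w₁ w₂ →
      sqLength v₁ + sqLength v₂ ≤ sqLength w₁ + sqLength w₂ := by
    intro w₁ w₂ hw
    have h1 := Nat.find_min' hex ⟨w₁, w₂, hw, rfl⟩
    rw [← hk] at h1
    have h2 := sqLength_nonneg w₁
    have h3 := sqLength_nonneg w₂
    omega
  wlog hle : sqLength v₁ ≤ sqLength v₂ generalizing v₁ v₂ with H
  · exact H v₂ v₁ hb.swap (by rw [add_comm]; exact hk)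
      (fun w₁ w₂ hw => by rw [add_comm]; exact hmin w₁ w₂ hw) (by omega)
  set p := v₁.1 * v₂.1 + v₁.2 * v₂.2 with hp
  have hsq : ∀ m n : ℤ, sqLength (m • v₁ + n • v₂) =
      m ^ 2 * sqLength v₁ + 2 * m * n * p + n ^ 2 * sqLength v₂ := by
    intro m n
    simp only [sqLength, hp, Prod.fst_add, Prod.snd_add, Prod.smul_fst, Prod.smul_snd, smul_eq_mul]
    ring
  have h1 := hmin _ _ (hb.add_zsmul 1)
  have h2 := hmin _ _ (hb.add_zsmul (-1))
  have h3 : sqLength (v₂ + (1 : ℤ) • v₁) = sqLength v₁ + 2 * p + sqLength v₂ := by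
    have := hsq 1 1
    rw [one_smul, one_smul, add_comm v₁] at this
    rw [one_smul, this]; ring
  have h4 : sqLength (v₂ + (-1 : ℤ) • v₁) = sqLength v₁ - 2 * p + sqLength v₂ := by
    have := hsq (-1) 1
    rw [one_smul, add_comm] at this
    rw [this]; ring
  rw [h3] at h1
  rw [h4] at h2
  have hdet : (G.index : ℤ) ^ 2 = (v₁.1 * v₂.2 - v₁.2 * v₂.1) ^ 2 := by
    rw [← hb.natAbs_det, Int.natCast_natAbs, sq_abs]
  -- Lagrange's identity for the determinant and the inner product.
  have hlag : (G.index : ℤ) ^ 2 + p ^ 2 = sqLength v₁ * sqLength v₂ := by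
    rw [hdet, hp, sqLength, sqLength]; ring
  have hq : (0 : ℤ) < (G.index : ℤ) ^ 2 := by positivity
  have hv₁ : 1 ≤ sqLength v₁ := by
    have h5 := sqLength_nonneg v₁
    by_contra h
    have h6 : sqLength v₁ = 0 := by omega
    rw [h6] at hlag
    nlinarith
  refine ⟨v₁, v₂, hb, hle, hv₁, fun m n => ?_, by nlinarith⟩
  rw [hsq]
  have h5 : |2 * p| ≤ sqLength v₁ := by rw [abs_le]; constructor <;> linarith
  have h6 : |m * n * (2 * p)| ≤ |m * n| * sqLength v₁ := by
    rw [abs_mul]; exact mul_le_mul_of_nonneg_left h5 (abs_nonneg _)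
  have h7 : 2 * |m * n| ≤ m ^ 2 + n ^ 2 := by
    rw [abs_mul, ← sq_abs m, ← sq_abs n]
    nlinarith [sq_nonneg (|m| - |n|)]
  have h8 := neg_abs_le (m * n * (2 * p))
  nlinarith [sq_nonneg n, sq_nonneg m]

lemma firstMin_pos_and_le {G : AddSubgroup (ℤ × ℤ)} {v : ℤ × ℤ} (hv : v ∈ G) (h1 : 1 ≤ sqLength v) :
    0 < firstMin G ∧ firstMin G ≤ √(sqLength v : ℝ) := by
  have hne : v ≠ 0 := by rintro rfl; simp [sqLength] at h1
  have hmem : √(sqLength v : ℝ) ∈ {r : ℝ | ∃ x ∈ G, x ≠ 0 ∧ r = ‖toPlane x‖} :=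
    ⟨v, hv, hne, (norm_toPlane v).symm⟩
  have hlow : ∀ r ∈ {r : ℝ | ∃ x ∈ G, x ≠ 0 ∧ r = ‖toPlane x‖}, 1 ≤ r := by
    rintro r ⟨x, -, hx, rfl⟩
    rw [norm_toPlane, Real.one_le_sqrt]
    have : 1 ≤ sqLength x := by
      have h2 := sqLength_nonneg x
      by_contra h
      have h3 : x.1 ^ 2 + x.2 ^ 2 = 0 := by unfold sqLength at h h2; omega
      have h4 : x.1 = 0 := by nlinarith [sq_nonneg x.1, sq_nonneg x.2]
      have h5 : x.2 = 0 := by nlinarith [sq_nonneg x.1, sq_nonneg x.2]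
      exact hx (Prod.ext h4 h5)
    exact_mod_cast this
  exact ⟨zero_lt_one.trans_le (le_csInf ⟨_, hmem⟩ hlow), csInf_le ⟨1, hlow⟩ hmem⟩

end ReducedBasis
end

/-! ### Regular regions and lattice coordinates in a cell. -/

noncomputable section

section Regions
open MeasureTheory Set

variable {N : ℕ} {F : Fin N → MvPolynomial (Fin 2) ℤ} {c₁ : ℝ} {R : Set Plane}

lemma abs_apply_le_supNorm (hR : Bornology.IsBounded R) {v : Plane} (hv : v ∈ R) (j : Fin 2) :
    |v j| ≤ supNorm R := by
  obtain ⟨r, hr⟩ := (Metric.isBounded_iff_subset_closedBall (0 : Plane)).1 hR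
  have hbdd : BddAbove ((fun v : Plane => max |v 0| |v 1|) '' R) := by
    refine ⟨r, ?_⟩
    rintro _ ⟨w, hw, rfl⟩
    have h1 : ‖w‖ ≤ r := by simpa using hr hw
    exact max_le ((PiLp.norm_apply_le w 0).trans h1) ((PiLp.norm_apply_le w 1).trans h1)
  have h := le_csSup hbdd (mem_image_of_mem _ hv)
  have hj : |v j| ≤ max |v 0| |v 1| := by
    fin_cases j
    · exact le_max_left _ _
    · exact le_max_right _ _
  exact hj.trans h

lemma area_le_sq_supNorm (hR : Bornology.IsBounded R) (hne : R.Nonempty) :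
    area R ≤ (2 * supNorm R) ^ 2 := by
  obtain ⟨w, hw⟩ := hne
  have hs : 0 ≤ supNorm R := (abs_nonneg _).trans (abs_apply_le_supNorm hR hw 0)
  set S : Fin 2 → Set ℝ := fun _ => Icc (-supNorm R) (supNorm R) with hS
  have hsub : R ⊆ (WithLp.ofLp : Plane → Fin 2 → ℝ) ⁻¹' (univ.pi S) := fun v hv j _ =>
    abs_le.1 (abs_apply_le_supNorm hR hv j)
  have hSm : MeasurableSet (univ.pi S) := MeasurableSet.univ_pi fun _ => measurableSet_Icc
  have hvol : volume ((WithLp.ofLp : Plane → Fin 2 → ℝ) ⁻¹' (univ.pi S)) =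
      ENNReal.ofReal ((2 * supNorm R) ^ 2) := by
    rw [(PiLp.volume_preserving_ofLp (Fin 2)).measure_preimage hSm.nullMeasurableSet, volume_pi_pi,
      Fin.prod_univ_two]
    simp only [hS, Real.volume_Icc]
    rw [← ENNReal.ofReal_mul (by linarith)]
    congr 1; ring
  rw [area]
  refine ENNReal.toReal_le_of_le_ofReal (by positivity) ?_
  rw [← hvol]
  exact measure_mono hsub

namespace IsRegularRegion

lemma supNorm_nonneg (hR : IsRegularRegion F c₁ R) : 0 ≤ supNorm R := by
  obtain ⟨w, hw⟩ := hR.nonempty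
  exact (abs_nonneg _).trans (abs_apply_le_supNorm hR.bounded hw 0)

lemma one_add_supNorm_le (hR : IsRegularRegion F c₁ R) : 1 + supNorm R ≤ regionK R := by
  have h0 := hR.supNorm_nonneg
  have h1 : 0 ≤ boundaryLength R * Real.log (1 + supNorm R) :=
    mul_nonneg ENNReal.toReal_nonneg (Real.log_nonneg (by linarith))
  have h2 : 0 ≤ area R / (1 + supNorm R) := div_nonneg ENNReal.toReal_nonneg (by linarith)
  unfold regionK
  linarith

lemma one_le_area (hR : IsRegularRegion F c₁ R) (hc₁ : 0 < c₁) : 1 ≤ area R :=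
  (Real.one_le_rpow (by linarith [hR.one_add_supNorm_le, hR.supNorm_nonneg]) hc₁.le).trans hR.area_ge

lemma one_lt_regionK (hR : IsRegularRegion F c₁ R) (hc₁ : 0 < c₁) : 1 < regionK R := by
  have h0 := hR.supNorm_nonneg
  have h1 : 0 ≤ boundaryLength R * Real.log (1 + supNorm R) :=
    mul_nonneg ENNReal.toReal_nonneg (Real.log_nonneg (by linarith))
  have h2 : 0 < area R / (1 + supNorm R) :=
    div_pos (by linarith [hR.one_le_area hc₁]) (by linarith)
  unfold regionK
  linarith

lemma one_lt_area (hR : IsRegularRegion F c₁ R) (hc₁ : 0 < c₁) : 1 < area R :=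
  (Real.one_lt_rpow (hR.one_lt_regionK hc₁) hc₁).trans_le hR.area_ge

/-- The area is the product of 1 + ‖R‖_∞ and area/(1 + ‖R‖_∞), two summands of K_R. -/
lemma area_le_regionK_sq (hR : IsRegularRegion F c₁ R) : area R ≤ regionK R ^ 2 := by
  have h0 := hR.supNorm_nonneg
  have h1 : 0 ≤ boundaryLength R * Real.log (1 + supNorm R) :=
    mul_nonneg ENNReal.toReal_nonneg (Real.log_nonneg (by linarith))
  set s := 1 + supNorm R with hs
  have hs0 : 0 < s := by linarith
  have hA : 0 ≤ area R := ENNReal.toReal_nonneg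
  have h2 : s + area R / s ≤ regionK R := by unfold regionK; linarith
  have h3 : area R = s * (area R / s) := by field_simp
  have h4 : 0 ≤ area R / s := by positivity
  have h5 : (s + area R / s) ^ 2 ≤ regionK R ^ 2 := pow_le_pow_left₀ (by positivity) h2 2
  nlinarith [sq_nonneg (s - area R / s), mul_nonneg hs0.le h4]

/-- Since the area is at least 1, ‖R‖_∞ ≥ 1/2, so the logarithm multiplying the boundary length in
K_R is at least 1/3. -/
lemma boundaryLength_le (hR : IsRegularRegion F c₁ R) (hc₁ : 0 < c₁) :
    boundaryLength R ≤ 3 * regionK R := by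
  have h0 := hR.supNorm_nonneg
  have h1 := hR.one_le_area hc₁
  have h2 := area_le_sq_supNorm hR.bounded hR.nonempty
  have h3 : 1 / 2 ≤ supNorm R := by
    by_contra h
    nlinarith
  have h4 : (1 / 3 : ℝ) ≤ Real.log (1 + supNorm R) := by
    have h5 := Real.one_sub_inv_le_log_of_pos (by linarith : 0 < 1 + supNorm R)
    have h6 : (1 + supNorm R)⁻¹ ≤ (3 / 2 : ℝ)⁻¹ := inv_anti₀ (by norm_num) (by linarith)
    norm_num at h6
    linarith
  have h7 : 0 ≤ boundaryLength R := ENNReal.toReal_nonneg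
  have h8 : boundaryLength R * (1 / 3) ≤ boundaryLength R * Real.log (1 + supNorm R) :=
    mul_le_mul_of_nonneg_left h4 h7
  have h9 : 0 ≤ area R / (1 + supNorm R) := div_nonneg (by linarith) (by linarith)
  unfold regionK
  linarith

lemma abs_le_regionK (hR : IsRegularRegion F c₁ R) {v : Plane} (hv : v ∈ R) (j : Fin 2) :
    |v j| ≤ regionK R := by
  linarith [abs_apply_le_supNorm hR.bounded hv j, hR.one_add_supNorm_le]

/-- The number of cells meeting a regular region. -/
lemma card_gridIndex_le (hR : IsRegularRegion F c₁ R) (hc₁ : 0 < c₁) {m : ℕ}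
    (hm : ENat.card (ConnectedComponents R) ≤ m) {L : ℝ} (hL : 0 < L) (S : Finset (ℤ × ℤ))
    (hS : ∀ c ∈ S, ∃ v ∈ R, gridIndex L v = c) :
    (S.card : ℝ) ≤ 36 * (area R / L ^ 2 + 3 * regionK R / L) + 9 * m := by
  refine (_root_.card_gridIndex_le hL hR.bounded hR.rectifiable hm S hS).trans ?_
  have := hR.boundaryLength_le hc₁
  gcongr

lemma finite_points (hR : IsRegularRegion F c₁ R) : {x : ℤ × ℤ | toPlane x ∈ R}.Finite := by
  obtain ⟨n, hn⟩ := exists_nat_ge (regionK R)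
  refine ((finite_Icc (-(n : ℤ)) n).prod (finite_Icc (-(n : ℤ)) n)).subset fun x hx => ?_
  have h : ∀ a : ℤ, |(a : ℝ)| ≤ regionK R → a ∈ Icc (-(n : ℤ)) n := fun a ha => by
    have h1 : |(a : ℝ)| ≤ n := ha.trans hn
    have h2 : |a| ≤ (n : ℤ) := by exact_mod_cast h1
    exact abs_le.1 h2
  exact ⟨h _ (hR.abs_le_regionK hx 0), h _ (hR.abs_le_regionK hx 1)⟩

lemma eval_ne_zero (hR : IsRegularRegion F c₁ R) {x : ℤ × ℤ} (hx : toPlane x ∈ R) (i : Fin N) :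
    MvPolynomial.eval ![x.1, x.2] (F i) ≠ 0 := by
  intro h
  refine hR.no_zeros _ hx i ?_
  have h1 : (fun j => toPlane x j) = ![(x.1 : ℝ), (x.2 : ℝ)] := by
    ext j; fin_cases j <;> rfl
  rw [h1, aeval_intCast, h, Int.cast_zero]

end IsRegularRegion

/-- Lattice points in a common cell have close coordinates. -/
lemma coordinates_le_of_gridIndex_eq {L : ℝ} (hL : 0 < L) {v₁ v₂ : ℤ × ℤ}
    (hred : ∀ m n : ℤ, m ^ 2 * sqLength v₁ + n ^ 2 * sqLength v₂ ≤ 2 * sqLength (m • v₁ + n • v₂))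
    {a b a' b' : ℤ} (h : gridIndex L (toPlane (a • v₁ + b • v₂)) =
      gridIndex L (toPlane (a' • v₁ + b' • v₂))) :
    |((a - a' : ℤ) : ℝ)| * √(sqLength v₁ : ℝ) ≤ 2 * L ∧
      |((b - b' : ℤ) : ℝ)| * √(sqLength v₂ : ℝ) ≤ 2 * L := by
  set x := a • v₁ + b • v₂ with hx
  set y := a' • v₁ + b' • v₂ with hy
  have hxy : x - y = (a - a') • v₁ + (b - b') • v₂ := by rw [hx, hy]; module
  have hdiff : ∀ s t : ℝ, ⌊s / L⌋ = ⌊t / L⌋ → (s - t) ^ 2 ≤ L ^ 2 := by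
    intro s t hst
    have h1 := Int.abs_sub_lt_one_of_floor_eq_floor hst
    rw [← sub_div, abs_div, abs_of_pos hL, div_lt_one hL] at h1
    rw [← sq_abs (s - t)]
    exact pow_le_pow_left₀ (abs_nonneg _) h1.le 2
  have h1 := hdiff _ _ (Prod.ext_iff.1 h).1
  have h2 := hdiff _ _ (Prod.ext_iff.1 h).2
  -- Points of a common cell differ by at most L in each coordinate; the reduced basis then bounds
  -- both coefficients separately.
  have h3 : (sqLength (x - y) : ℝ) ≤ 2 * L ^ 2 := by
    have : (sqLength (x - y) : ℝ) = (toPlane x 0 - toPlane y 0) ^ 2 +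
        (toPlane x 1 - toPlane y 1) ^ 2 := by
      simp [sqLength, toPlane]
    rw [this]; linarith
  have h4 : ((a - a' : ℤ) : ℝ) ^ 2 * (sqLength v₁ : ℝ) + ((b - b' : ℤ) : ℝ) ^ 2 * sqLength v₂ ≤
      2 * (sqLength (x - y) : ℝ) := by
    rw [hxy]; exact_mod_cast hred (a - a') (b - b')
  have h5 : (0 : ℝ) ≤ sqLength v₁ := by exact_mod_cast sqLength_nonneg v₁
  have h6 : (0 : ℝ) ≤ sqLength v₂ := by exact_mod_cast sqLength_nonneg v₂
  constructor
  · refine abs_le_of_sq_le_sq' ?_ (by positivity) |>.2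
    rw [mul_pow, Real.sq_sqrt h5, sq_abs]
    nlinarith [mul_nonneg (sq_nonneg ((b - b' : ℤ) : ℝ)) h6]
  · refine abs_le_of_sq_le_sq' ?_ (by positivity) |>.2
    rw [mul_pow, Real.sq_sqrt h6, sq_abs]
    nlinarith [mul_nonneg (sq_nonneg ((a - a' : ℤ) : ℝ)) h5]

/-- The points of a lattice in a cell belong to a box in coordinates. -/
lemma exists_coordinate_box {G : AddSubgroup (ℤ × ℤ)} {v₁ v₂ : ℤ × ℤ} (hb : IsLatticeBasis G v₁ v₂)
    (hred : ∀ m n : ℤ, m ^ 2 * sqLength v₁ + n ^ 2 * sqLength v₂ ≤ 2 * sqLength (m • v₁ + n • v₂))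
    (h₁ : 1 ≤ sqLength v₁) (h₂ : 1 ≤ sqLength v₂) {L : ℝ} (hL : 0 < L) (c : ℤ × ℤ) :
    ∃ a b : ℤ, ∀ x ∈ G, gridIndex L (toPlane x) = c →
      ∃ z ∈ Finset.Ico a (a + (2 * ⌊2 * L / √(sqLength v₁ : ℝ)⌋₊ + 1 : ℕ)) ×ˢ
        Finset.Ico b (b + (2 * ⌊2 * L / √(sqLength v₂ : ℝ)⌋₊ + 1 : ℕ)), columnsMap v₁ v₂ z = x := by
  by_cases hne : ∃ x ∈ G, gridIndex L (toPlane x) = c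
  swap
  · exact ⟨0, 0, fun x hx hc => absurd ⟨x, hx, hc⟩ hne⟩
  obtain ⟨y, hy, hyc⟩ := hne
  obtain ⟨a, b, rfl⟩ := hb.exists_eq y hy
  have hs : ∀ v : ℤ × ℤ, 1 ≤ sqLength v → 0 < √(sqLength v : ℝ) := fun v hv =>
    Real.sqrt_pos.2 (by exact_mod_cast hv)
  have hbox : ∀ (r : ℝ) (a a' : ℤ), 0 < r → |((a' - a : ℤ) : ℝ)| * r ≤ 2 * L →
      a' ∈ Finset.Ico (a - ⌊2 * L / r⌋₊) (a - ⌊2 * L / r⌋₊ + (2 * ⌊2 * L / r⌋₊ + 1 : ℕ)) := by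
    intro r a a' hr h
    rw [← le_div_iff₀ hr] at h
    have h1 : (a' - a).natAbs ≤ ⌊2 * L / r⌋₊ := by
      refine Nat.le_floor ?_
      rw [Nat.cast_natAbs, Int.cast_abs]
      exact h
    rw [Finset.mem_Ico]
    omega
  refine ⟨a - ⌊2 * L / √(sqLength v₁ : ℝ)⌋₊, b - ⌊2 * L / √(sqLength v₂ : ℝ)⌋₊, fun x hx hxc => ?_⟩
  obtain ⟨a', b', rfl⟩ := hb.exists_eq x hx
  obtain ⟨h3, h4⟩ := coordinates_le_of_gridIndex_eq hL hred (hxc.trans hyc.symm)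
  refine ⟨(a', b'), Finset.mem_product.2 ⟨hbox _ _ _ (hs v₁ h₁) h3, hbox _ _ _ (hs v₂ h₂) h4⟩, ?_⟩
  ext <;> simp [columnsMap]

end Regions
end

/-! ### Summation over the lattice points of a region. -/

noncomputable section

section LatticeSums
open Finset

variable {N : ℕ} {K : Fin N → Type*} [∀ i, Field (K i)] [∀ i, NumberField (K i)]
  {F : Fin N → MvPolynomial (Fin 2) ℤ} {d : Fin N → ℕ} {θ : ∀ i, 𝓞 (K i)} {W : ℕ}

lemma IsFormSystem.exists_prod_formIdeals_le (hS : IsFormSystem F d θ W) (A B ε : Fin N → ℝ)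
    (hB : ∀ i, 0 < B i) (hε : ∀ i, 0 < ε i) (M : ℝ) :
    ∃ P : ℝ, 0 < P ∧ ∀ f : ∀ i, Ideal (𝓞 (K i)) → ℝ,
      (∀ i, IsPseudomultiplicative (A i) (B i) (ε i) (f i)) → (∀ i, f i ⊤ ≤ M) →
      ∀ (n : ℕ) (x : ℤ × ℤ) (Y : ℝ), W ∣ n → IsCoprime x.1 x.2 →
        (∀ i, MvPolynomial.eval ![x.1, x.2] (F i) ≠ 0) → 1 ≤ Y → |(x.1 : ℝ)| ≤ Y →
        |(x.2 : ℝ)| ≤ Y → 0 ≤ ∏ i, f i (formIdeals F θ n x i) ∧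
          ∏ i, f i (formIdeals F θ n x i) ≤ P * Y ^ (∑ i, d i * ε i) := by
  obtain ⟨D, hD1, hD⟩ := hS.exists_absNorm_formIdeals_le
  have hD0 : 0 < D := by linarith
  refine ⟨∏ i, (max 1 M * (B i * D ^ ε i)), prod_pos fun i _ => by
    have := hB i; positivity, fun f hf hM n x Y hn hx hne hY h1 h2 => ?_⟩
  have hY0 : 0 < Y := by linarith
  have hbot := (hS.isSeparatedTuple_formIdeals hx hn hne).ne_bot
  refine ⟨prod_nonneg fun i _ => (hf i).nonneg _ (hbot i), ?_⟩
  rw [Real.rpow_sum_of_pos hY0, ← prod_mul_distrib]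
  refine Finset.prod_le_prod (fun i _ => (hf i).nonneg _ (hbot i)) fun i _ => ?_
  have hBi := hB i
  calc f i (formIdeals F θ n x i) ≤ f i ⊤ *
        (B i * (Ideal.absNorm (formIdeals F θ n x i) : ℝ) ^ ε i) :=
        apply_le_top_mul_rpow (hf i) (hbot i)
    _ ≤ max 1 M * (B i * (D * Y ^ d i) ^ ε i) := by
        have h3 := (hf i).nonneg ⊤ top_ne_bot
        gcongr
        · exact (hM i).trans (le_max_right _ _)
        · exact (hε i).le
        · exact hD n x Y h1 h2 hne i
    _ = _ := by
        rw [Real.mul_rpow hD0.le (by positivity), ← Real.rpow_natCast Y, ← Real.rpow_mul hY0.le]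
        ring

/-- Combines a uniform bound on each cell with the number of cells meeting R. -/
lemma sum_le_of_cells {c₁ : ℝ} {R : Set Plane} (hR : IsRegularRegion F c₁ R) (hc₁ : 0 < c₁) {m : ℕ}
    (hm : ENat.card (ConnectedComponents R) ≤ m) {L b : ℝ} (hL : 0 < L) (hb : 0 ≤ b)
    (X : Finset (ℤ × ℤ)) (hX : ∀ x ∈ X, toPlane x ∈ R) (φ : ℤ × ℤ → ℝ)
    (h : ∀ c, ∑ x ∈ X.filter (fun x => gridIndex L (toPlane x) = c), φ x ≤ b) :
    ∑ x ∈ X, φ x ≤ (36 * (area R / L ^ 2 + 3 * regionK R / L) + 9 * m) * b := by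
  classical
  have hcard := hR.card_gridIndex_le hc₁ hm hL (X.image fun x => gridIndex L (toPlane x))
    fun c hc => by
      obtain ⟨x, hx, rfl⟩ := mem_image.1 hc
      exact ⟨_, hX x hx, rfl⟩
  rw [← sum_fiberwise_of_maps_to (fun x hx => mem_image_of_mem (fun x => gridIndex L (toPlane x)) hx)]
  refine (sum_le_sum fun c _ => h c).trans ?_
  rw [sum_const, nsmul_eq_mul]
  exact mul_le_mul_of_nonneg_right hcard hb

lemma card_le_of_box {v₁ v₂ : ℤ × ℤ} {a b : ℤ} {k₁ k₂ : ℕ} (X : Finset (ℤ × ℤ))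
    (hX : ∀ x ∈ X, ∃ z ∈ Ico a (a + k₁) ×ˢ Ico b (b + k₂), columnsMap v₁ v₂ z = x) :
    X.card ≤ k₁ * k₂ := by
  classical
  have hsub : X ⊆ (Ico a (a + k₁) ×ˢ Ico b (b + k₂)).image (columnsMap v₁ v₂) := fun x hx =>
    mem_image.2 (hX x hx)
  refine (card_le_card hsub).trans (card_image_le.trans ?_)
  rw [card_product, Int.card_Ico, Int.card_Ico]
  simp

set_option maxHeartbeats 4000000 in
/-- The mean value bound on a lattice, with the sums over square-free ideals. -/
theorem IsFormSystem.exists_lattice_sum_le (hS : IsFormSystem F d θ W) (hN : 1 ≤ N)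
    (A B εs : Fin N → ℝ) (c₁ ε M : ℝ) (m : ℕ) (hc₁ : 0 < c₁) (hε : 0 < ε)
    (hB : ∀ i, 0 < B i) (hεs : ∀ i, 0 < εs i) :
    ∃ C : ℝ, 0 < C ∧ ∀ f : ∀ i, Ideal (𝓞 (K i)) → ℝ,
      (∀ i, IsPseudomultiplicative (A i) (B i) (εs i) (f i)) → (∀ i, f i ⊤ ≤ M) →
      ∀ R : Set Plane, IsRegularRegion F c₁ R → ENat.card (ConnectedComponents R) ≤ m →
      ∀ G : AddSubgroup (ℤ × ℤ), G.index ≠ 0 →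
      ∀ X : Finset (ℤ × ℤ), (∀ x ∈ X, IsCoprime x.1 x.2 ∧ toPlane x ∈ R ∧ x ∈ G) →
        ∑ x ∈ X, ∏ i, f i (formIdeals F θ (G.index * W) x i) ≤
          C * (area R / Real.log (area R) ^ N * (hStar F (natPrimeTo W G.index) / G.index) *
            ∏ i, squarefreeSum (f i) W (area R) +
              regionK R ^ (1 + epsZero c₁ d εs + ε) / firstMin G) := by
  classical
  set T := ∑ i, (d i : ℝ) * εs i with hT
  have hT0 : 0 ≤ T := sum_nonneg fun i _ => mul_nonneg (by positivity) (hεs i).le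
  have hsup : 0 ≤ ⨆ i, εs i := Real.iSup_nonneg fun i => (hεs i).le
  have he1 : T ≤ epsZero c₁ d εs := by
    rw [epsZero]
    refine le_mul_of_one_le_left hT0 (le_max_of_le_left ?_)
    have : 0 < 4 / c₁ := by positivity
    linarith
  -- For c₁ ≤ 2 the second entry of the maximum is at least 20/c₁ ≥ 10. The exponent 10T is what the
  -- mean value theorem needs.
  have he2 : c₁ ≤ 2 → 10 * T ≤ epsZero c₁ d εs := by
    intro hc
    rw [epsZero]
    refine mul_le_mul_of_nonneg_right (le_max_of_le_right ?_) hT0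
    rw [le_div_iff₀ hc₁]
    linarith
  set e₀ := epsZero c₁ d εs with he₀
  set δ := ε / 3 with hδ
  have hδ0 : 0 < δ := by positivity
  obtain ⟨c, s, Cs, hc, hCs, hsieve⟩ := hS.exists_hasSieveBound hN
  obtain ⟨D, hD1, hD⟩ := hS.exists_absNorm_formIdeals_le
  obtain ⟨P, hP0, hP⟩ := hS.exists_prod_formIdeals_le A B εs hB hεs M
  -- The mean value theorem requires small ε_i. It is guarded by T < 1/9, which the large-area case
  -- will force, so that the constants can be fixed before R.
  have hNT : ∃ Cn Y₀ : ℝ, 0 < Cn ∧ 2 ≤ Y₀ ∧ (T < 1 / 9 → ∀ f : ∀ i, Ideal (𝓞 (K i)) → ℝ,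
      (∀ i, IsPseudomultiplicative (A i) (B i) (εs i) (f i)) → (∀ i, f i ⊤ ≤ M) →
      ∀ (X : Finset (ℤ × ℤ)) (𝔫 : ℤ × ℤ → ∀ i, Ideal (𝓞 (K i))) (H E k Y V : ℝ),
        Y₀ ≤ Y → 0 ≤ H → 0 ≤ E → (∀ x ∈ X, IsSeparatedTuple W (𝔫 x)) →
        (∀ x ∈ X, ∀ i, (Ideal.absNorm (𝔫 x i) : ℝ) ≤ D * Y ^ d i) →
        Y ^ (4 * T + δ) ≤ V → (Y ^ (4 * T + δ)) ^ ((5 : ℝ) / 4) ≤ k →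
        HasSieveBound W c s X 𝔫 H E k →
        ∑ x ∈ X, ∏ i, f i (𝔫 x i) ≤
          Cn * (H * (∏ i, squarefreeSum (f i) W V) / Real.log Y ^ N + E * Y ^ (10 * T + 3 * δ))) := by
    by_cases h : T < 1 / 9
    · have h9 : ∀ i, εs i ≤ 1 / 9 := fun i => by
        have h1 := single_le_sum (f := fun i => (d i : ℝ) * εs i)
          (fun i _ => mul_nonneg (Nat.cast_nonneg _) (hεs i).le) (mem_univ i)
        have h2 : (1 : ℝ) ≤ d i := by exact_mod_cast degree_pos (hS.hom i) (hS.irr i)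
        have h3 := mul_le_mul_of_nonneg_right h2 (hεs i).le
        rw [← hT] at h1
        linarith
      obtain ⟨Cn, Y₀, h1, h2, h3⟩ :=
        exists_sum_le_of_hasSieveBound N K W A B εs d h9 c hc s M D δ hD1 hδ0
      exact ⟨Cn, Y₀, h1, h2, fun _ f hf hM => h3 f hf hM (ℤ × ℤ)⟩
    · exact ⟨1, 2, one_pos, le_rfl, fun h' => absurd h' h⟩
  obtain ⟨Cn, Y₀, hCn, hY₀, hNT⟩ := hNT
  -- In the large-area case V exceeds this constant, and V ≤ Y² then yields Y ≥ Y₀.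
  set C₀ := Y₀ ^ 2 with hC₀
  have hC₀1 : 1 ≤ C₀ := by nlinarith
  -- The cell count at mesh V/Y: 36(1 + 3) + 9m times Y²/V.
  set κ : ℝ := 144 + 9 * m with hκ
  have hκ0 : 0 < κ := by positivity
  set Γ₁ := 25 * P * (36 * C₀ + 108 + 18 * m) with hΓ₁
  set Γ₂ := 5 * κ * P with hΓ₂
  set Γ₃ := κ * Cn * Cs * (30 * 2 ^ N) with hΓ₃
  set Γ₄ := κ * Cn * Cs * 5 with hΓ₄
  have hΓ₁0 : 0 < Γ₁ := by positivity
  have hΓ₂0 : 0 < Γ₂ := by positivity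
  have hΓ₃0 : 0 < Γ₃ := by positivity
  have hΓ₄0 : 0 < Γ₄ := by positivity
  refine ⟨Γ₁ + Γ₂ + Γ₃ + Γ₄, by positivity, fun f hf hM R hR hm G hG X hX => ?_⟩
  obtain ⟨v₁, v₂, hb, hle, h₁, hred, hq⟩ := exists_reduced_basis hG
  have h₂ : 1 ≤ sqLength v₂ := h₁.trans hle
  obtain ⟨hfm0, hfm⟩ := firstMin_pos_and_le hb.left_mem h₁
  set ℓ₁ := √(sqLength v₁ : ℝ) with hℓ₁
  set ℓ₂ := √(sqLength v₂ : ℝ) with hℓ₂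
  have hℓ₁1 : 1 ≤ ℓ₁ := by rw [hℓ₁, Real.one_le_sqrt]; exact_mod_cast h₁
  have hℓle : ℓ₁ ≤ ℓ₂ := Real.sqrt_le_sqrt (by exact_mod_cast hle)
  have hℓ₁0 : 0 < ℓ₁ := by linarith
  have hℓ₂0 : 0 < ℓ₂ := by linarith
  set q : ℝ := (G.index : ℝ) with hqdef
  have hq0 : 0 < q := by rw [hqdef]; exact_mod_cast Nat.pos_of_ne_zero hG
  have hqℓ : q ≤ ℓ₁ * ℓ₂ := by
    rw [hℓ₁, hℓ₂, ← Real.sqrt_mul (by exact_mod_cast sqLength_nonneg v₁)]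
    refine Real.le_sqrt_of_sq_le ?_
    rw [hqdef]; exact_mod_cast hq
  set V := area R with hV
  set Y := regionK R with hY
  have hV1 : 1 < V := hR.one_lt_area hc₁
  have hY1 : 1 < Y := hR.one_lt_regionK hc₁
  have hY0 : 0 < Y := by linarith
  have hV0 : 0 < V := by linarith
  have hVY : V ≤ Y ^ 2 := hR.area_le_regionK_sq
  have hlV : 0 < Real.log V := Real.log_pos hV1
  -- Regularity gives Y^c₁ ≤ V ≤ Y², so exponents above 2 do not occur.
  have hc2 : c₁ ≤ 2 := by
    have h3 : Y ^ c₁ ≤ Y ^ (2 : ℝ) := by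
      rw [Real.rpow_two]; exact hR.area_ge.trans hVY
    exact (Real.rpow_le_rpow_left_iff hY1).1 h3
  have he10 := he2 hc2
  have hhs : 0 ≤ hStar F (natPrimeTo W G.index) := by
    rw [hStar_natPrimeTo]
    refine prod_nonneg fun p hp => inv_nonneg.2 ?_
    obtain ⟨h3, h4⟩ := mem_filter.1 hp
    have := (hS.density_bounds (Nat.prime_of_mem_primeFactors h3) h4).2.2.2.2.1
    linarith
  set h := hStar F (natPrimeTo W G.index) with hh
  set S := ∏ i, squarefreeSum (f i) W V with hSdef
  have hS0 : 0 ≤ S := prod_nonneg fun i _ => squarefreeSum_nonneg (hf i) W V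
  set E := Y ^ (1 + e₀ + ε) with hE
  have hE0 : 0 < E := by positivity
  have hEfm : E / ℓ₁ ≤ E / firstMin G := div_le_div_of_nonneg_left hE0.le hfm0 hfm
  set main := V / Real.log V ^ N * (h / q) * S with hmain
  have hmain0 : 0 ≤ main := by positivity
  have hEfm0 : 0 ≤ E / firstMin G := by positivity
  suffices hsuff : ∑ x ∈ X, ∏ i, f i (formIdeals F θ (G.index * W) x i) ≤
      Γ₃ * main + (Γ₁ + Γ₂ + Γ₄) * (E / ℓ₁) by
    refine hsuff.trans ?_
    have h3 : (Γ₁ + Γ₂ + Γ₄) * (E / ℓ₁) ≤ (Γ₁ + Γ₂ + Γ₄) * (E / firstMin G) :=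
      mul_le_mul_of_nonneg_left hEfm (by positivity)
    have h4 : 0 ≤ (Γ₁ + Γ₂ + Γ₄) * main := by positivity
    have h5 : 0 ≤ Γ₃ * (E / firstMin G) := by positivity
    have h6 : (Γ₁ + Γ₂ + Γ₃ + Γ₄) * (main + E / firstMin G) = Γ₃ * main +
      (Γ₁ + Γ₂ + Γ₄) * (E / firstMin G) + (Γ₁ + Γ₂ + Γ₄) * main + Γ₃ * (E / firstMin G) := by ring
    rw [h6]
    linarith
  have hEℓ : 0 ≤ E / ℓ₁ := by positivity
  set φ : ℤ × ℤ → ℝ := fun x => ∏ i, f i (formIdeals F θ (G.index * W) x i) with hφ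
  have hXR : ∀ x ∈ X, toPlane x ∈ R := fun x hx => (hX x hx).2.1
  have hXY : ∀ x ∈ X, |(x.1 : ℝ)| ≤ Y ∧ |(x.2 : ℝ)| ≤ Y := fun x hx =>
    ⟨hR.abs_le_regionK (hXR x hx) 0, hR.abs_le_regionK (hXR x hx) 1⟩
  have hXne : ∀ x ∈ X, ∀ i, MvPolynomial.eval ![x.1, x.2] (F i) ≠ 0 := fun x hx i =>
    hR.eval_ne_zero (hXR x hx) i
  have hφP : ∀ x ∈ X, φ x ≤ P * Y ^ T := fun x hx =>
    (hP f hf hM _ x Y (Dvd.intro_left _ rfl) (hX x hx).1 (hXne x hx) hY1.le (hXY x hx).1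
      (hXY x hx).2).2
  rcases X.eq_empty_or_nonempty with rfl | ⟨x₀, hx₀⟩
  · rw [sum_empty]; positivity
  -- A non-zero lattice point in R has length at most √2 Y, and reducedness bounds ℓ₁ by √2 times
  -- that length.
  have hℓY : ℓ₁ ≤ 2 * Y := by
    obtain ⟨a, b, hab⟩ := hb.exists_eq x₀ (hX x₀ hx₀).2.2
    have hne : a ≠ 0 ∨ b ≠ 0 := by
      by_contra hcon
      push Not at hcon
      rw [hcon.1, hcon.2, zero_smul, zero_smul, add_zero] at hab
      have := (hX x₀ hx₀).1
      rw [hab] at this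
      exact not_isCoprime_zero_zero this
    have h3 : sqLength v₁ ≤ 2 * sqLength x₀ := by
      rw [hab]
      refine le_trans ?_ (hred a b)
      have h4 : 0 ≤ a ^ 2 * sqLength v₁ := by positivity
      have h5 : 0 ≤ b ^ 2 * sqLength v₂ := by positivity
      rcases hne with h6 | h6
      · have h7 : 1 ≤ a ^ 2 := by have := sq_pos_of_ne_zero h6; omega
        have h8 := mul_le_mul_of_nonneg_right h7 (sqLength_nonneg v₁)
        linarith only [h5, h8]
      · have h7 : 1 ≤ b ^ 2 := by have := sq_pos_of_ne_zero h6; omega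
        have h8 := mul_le_mul_of_nonneg_right h7 (sqLength_nonneg v₂)
        linarith only [h4, h8, hle]
    refine Real.sqrt_le_iff.2 ⟨by linarith, ?_⟩
    have h4 : ((sqLength v₁ : ℤ) : ℝ) ≤ 2 * ((x₀.1 : ℝ) ^ 2 + (x₀.2 : ℝ) ^ 2) := by
      have : ((sqLength v₁ : ℤ) : ℝ) ≤ ((2 * sqLength x₀ : ℤ) : ℝ) := by exact_mod_cast h3
      refine this.trans (le_of_eq ?_)
      simp [sqLength]
    have h5 : (x₀.1 : ℝ) ^ 2 ≤ Y ^ 2 := by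
      rw [← sq_abs]; exact pow_le_pow_left₀ (abs_nonneg _) (hXY x₀ hx₀).1 2
    have h6 : (x₀.2 : ℝ) ^ 2 ≤ Y ^ 2 := by
      rw [← sq_abs]; exact pow_le_pow_left₀ (abs_nonneg _) (hXY x₀ hx₀).2 2
    linarith
  have htriv : ∀ (L : ℝ), 0 < L → ∀ c',
      ∑ x ∈ X.filter (fun x => gridIndex L (toPlane x) = c'), φ x ≤
        ((2 * ⌊2 * L / ℓ₁⌋₊ + 1 : ℕ) * (2 * ⌊2 * L / ℓ₂⌋₊ + 1 : ℕ) : ℝ) * (P * Y ^ T) := by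
    intro L hL c'
    obtain ⟨a, b, hab⟩ := exists_coordinate_box hb hred h₁ h₂ hL c'
    have h3 := card_le_of_box (X.filter fun x => gridIndex L (toPlane x) = c') fun x hx =>
      hab x (hX x (mem_filter.1 hx).1).2.2 (mem_filter.1 hx).2
    calc _ ≤ ((X.filter fun x => gridIndex L (toPlane x) = c').card : ℝ) * (P * Y ^ T) := by
          rw [← nsmul_eq_mul, ← sum_const]
          exact sum_le_sum fun x hx => hφP x (mem_filter.1 hx).1
      _ ≤ _ := by
          refine mul_le_mul_of_nonneg_right ?_ (by positivity)
          exact_mod_cast h3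
  -- The threshold is where the number of cells of mesh ℓ₁, each holding at most 25 points, times
  -- the trivial bound Y^T is already O(E/ℓ₁).
  by_cases hsmall : V ≤ C₀ * ℓ₁ * Y ^ (1 + e₀ + ε - T)
  · -- small area
    set E' := Y ^ (1 + e₀ + ε - T) with hE'
    have hE'0 : 0 < E' := by positivity
    have hEE : E' * Y ^ T = E := by rw [hE', hE, ← Real.rpow_add hY0]; congr 1; ring
    have hYE : Y ≤ E' := by
      calc Y = Y ^ (1 : ℝ) := (Real.rpow_one Y).symm
        _ ≤ E' := Real.rpow_le_rpow_of_exponent_le hY1.le (by linarith)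
    have hcell : ∀ c', ∑ x ∈ X.filter (fun x => gridIndex ℓ₁ (toPlane x) = c'), φ x ≤
        25 * (P * Y ^ T) := by
      intro c'
      refine (htriv ℓ₁ hℓ₁0 c').trans (mul_le_mul_of_nonneg_right ?_ (by positivity))
      have h3 : ⌊2 * ℓ₁ / ℓ₁⌋₊ ≤ 2 := by
        rw [mul_div_assoc, div_self hℓ₁0.ne', mul_one]
        exact (Nat.floor_ofNat (R := ℝ) 2).le
      have h4 : ⌊2 * ℓ₁ / ℓ₂⌋₊ ≤ 2 := by
        refine le_trans (Nat.floor_mono ?_) h3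
        exact div_le_div_of_nonneg_left (by positivity) hℓ₁0 hℓle
      have h5 : (2 * ⌊2 * ℓ₁ / ℓ₁⌋₊ + 1) * (2 * ⌊2 * ℓ₁ / ℓ₂⌋₊ + 1) ≤ 5 * 5 :=
        Nat.mul_le_mul (by omega) (by omega)
      exact_mod_cast h5
    have h3 := sum_le_of_cells hR hc₁ hm hℓ₁0 (by positivity) X hXR φ hcell
    refine h3.trans ?_
    have h4 : V / ℓ₁ ^ 2 ≤ C₀ * (E' / ℓ₁) := by
      rw [div_le_iff₀ (by positivity)]
      calc V ≤ C₀ * ℓ₁ * E' := hsmall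
        _ = C₀ * (E' / ℓ₁) * ℓ₁ ^ 2 := by field_simp
    have h5 : 3 * Y / ℓ₁ ≤ 3 * (E' / ℓ₁) := by
      rw [← mul_div_assoc]; gcongr
    have h6 : (1 : ℝ) ≤ 2 * (E' / ℓ₁) := by
      rw [← mul_div_assoc, le_div_iff₀ hℓ₁0]; linarith
    have h7 : (9 : ℝ) * m ≤ 9 * m * (2 * (E' / ℓ₁)) := le_mul_of_one_le_right (by positivity) h6
    calc (36 * (V / ℓ₁ ^ 2 + 3 * Y / ℓ₁) + 9 * m) * (25 * (P * Y ^ T)) ≤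
          (36 * (C₀ * (E' / ℓ₁) + 3 * (E' / ℓ₁)) + 9 * m * (2 * (E' / ℓ₁))) * (25 * (P * Y ^ T)) :=
          mul_le_mul_of_nonneg_right (by linarith) (by positivity)
      _ = Γ₁ * (E / ℓ₁) := by rw [hΓ₁, ← hEE]; ring
      _ ≤ (Γ₁ + Γ₂ + Γ₄) * (E / ℓ₁) :=
          mul_le_mul_of_nonneg_right (by linarith) hEℓ
      _ ≤ _ := by
          have : 0 ≤ Γ₃ * main := by positivity
          linarith
  · -- large area
    have hbig := not_le.1 hsmall
    have hY9 : Y ^ (1 + 9 * T + ε) ≤ Y ^ (1 + e₀ + ε - T) :=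
      Real.rpow_le_rpow_of_exponent_le hY1.le (by linarith)
    have hVbig : C₀ * (ℓ₁ * Y ^ (1 + 9 * T + ε)) < V := by
      refine lt_of_le_of_lt ?_ hbig
      rw [mul_assoc]
      gcongr
    have hVbig' : ℓ₁ * Y ^ (1 + 9 * T + ε) < V :=
      lt_of_le_of_lt (le_mul_of_one_le_left (by positivity) hC₀1) hVbig
    have hpow1 : 1 ≤ Y ^ (1 + 9 * T + ε) := Real.one_le_rpow hY1.le (by linarith)
    have hYY₀ : Y₀ ≤ Y := by
      have h3 : C₀ ≤ Y ^ 2 := by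
        refine le_trans (le_trans ?_ hVbig.le) hVY
        exact le_mul_of_one_le_right (by positivity)
          (one_le_mul_of_one_le_of_one_le hℓ₁1 hpow1)
      exact (sq_le_sq₀ (by linarith) hY0.le).1 h3
    -- Forced by Y^(1+9T+ε) < V ≤ Y².
    have hT9 : T < 1 / 9 := by
      have h3 : Y ^ (1 + 9 * T + ε) < Y ^ (2 : ℝ) := by
        rw [Real.rpow_two]
        refine lt_of_lt_of_le (lt_of_le_of_lt ?_ hVbig') hVY
        exact le_mul_of_one_le_left (by positivity) hℓ₁1
      have := (Real.rpow_lt_rpow_left_iff hY1).1 h3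
      linarith
    -- With this mesh the area and boundary terms in the cell count are both of order Y²/V.
    set L := V / Y with hL
    have hL0 : 0 < L := by positivity
    have hLbig : Y ^ (9 * T + ε) ≤ L / ℓ₁ := by
      rw [hL, div_div, le_div_iff₀ (by positivity)]
      have : Y ^ (1 + 9 * T + ε) = Y * Y ^ (9 * T + ε) := by
        rw [← Real.rpow_one_add' hY0.le (by linarith)]; congr 1; ring
      rw [this] at hVbig'
      exact le_of_eq_of_le (by ring) hVbig'.le
    have hL1 : 1 ≤ L / ℓ₁ := (Real.one_le_rpow hY1.le (by linarith)).trans hLbig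
    set k₁ := 2 * ⌊2 * L / ℓ₁⌋₊ + 1 with hk₁
    set k₂ := 2 * ⌊2 * L / ℓ₂⌋₊ + 1 with hk₂
    have hk₁le : (k₁ : ℝ) ≤ 5 * (L / ℓ₁) := by
      have h3 := Nat.floor_le (by positivity : 0 ≤ 2 * L / ℓ₁)
      have h4 : 2 * L / ℓ₁ = 2 * (L / ℓ₁) := by ring
      rw [hk₁]; push_cast
      linarith
    have hk₁ge : L / ℓ₁ ≤ k₁ := by
      have h3 := Nat.lt_floor_add_one (2 * L / ℓ₁)
      have h4 : 2 * L / ℓ₁ = 2 * (L / ℓ₁) := by ring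
      rw [hk₁]; push_cast
      linarith
    have hk : k₂ ≤ k₁ := by
      have : ⌊2 * L / ℓ₂⌋₊ ≤ ⌊2 * L / ℓ₁⌋₊ :=
        Nat.floor_mono (div_le_div_of_nonneg_left (by positivity) hℓ₁0 hℓle)
      omega
    have hcells : 36 * (V / L ^ 2 + 3 * Y / L) + 9 * m ≤ κ * (Y ^ 2 / V) := by
      have h3 : V / L ^ 2 = Y ^ 2 / V := by rw [hL]; field_simp
      have h4 : 3 * Y / L = 3 * (Y ^ 2 / V) := by rw [hL]; field_simp
      have h5 : 1 ≤ Y ^ 2 / V := by rwa [le_div_iff₀ hV0, one_mul]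
      have h6 : (9 : ℝ) * m ≤ 9 * m * (Y ^ 2 / V) := le_mul_of_one_le_right (by positivity) h5
      rw [h3, h4, hκ]
      linarith
    have hYVL : Y ^ 2 / V * (L / ℓ₁) = Y / ℓ₁ := by rw [hL]; field_simp
    have htotal : ∀ b, 0 ≤ b → (∀ c', ∑ x ∈ X.filter (fun x => gridIndex L (toPlane x) = c'), φ x ≤ b) →
        ∑ x ∈ X, φ x ≤ κ * (Y ^ 2 / V) * b := fun b hb0 hcell =>
      (sum_le_of_cells hR hc₁ hm hL0 hb0 X hXR φ hcell).trans
        (mul_le_mul_of_nonneg_right hcells hb0)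
    -- If 2L < ℓ₂ the coordinate box is a single row, and the trivial bound costs only Y^(1+T)/ℓ₁.
    -- Otherwise both sides are comparable to L/ℓ_i and the box has O(L²/q) points.
    by_cases hflat : 2 * L < ℓ₂
    · have hk₂1 : k₂ = 1 := by
        have : ⌊2 * L / ℓ₂⌋₊ = 0 := by
          rw [Nat.floor_eq_zero, div_lt_one hℓ₂0]; exact hflat
        omega
      have h3 := htotal (5 * (L / ℓ₁) * (P * Y ^ T)) (by positivity) fun c' => by
        refine (htriv L hL0 c').trans (mul_le_mul_of_nonneg_right ?_ (by positivity))
        rw [← hk₁, ← hk₂, hk₂1]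
        simpa using hk₁le
      refine h3.trans ?_
      have h4 : Y * Y ^ T ≤ E := by
        rw [hE, ← Real.rpow_one_add' hY0.le (by linarith)]
        exact Real.rpow_le_rpow_of_exponent_le hY1.le (by linarith)
      calc κ * (Y ^ 2 / V) * (5 * (L / ℓ₁) * (P * Y ^ T)) =
            κ * 5 * P * (Y ^ 2 / V * (L / ℓ₁)) * Y ^ T := by ring
        _ = Γ₂ * (Y * Y ^ T / ℓ₁) := by rw [hYVL, hΓ₂]; ring
        _ ≤ Γ₂ * (E / ℓ₁) := by gcongr
        _ ≤ (Γ₁ + Γ₂ + Γ₄) * (E / ℓ₁) := mul_le_mul_of_nonneg_right (by linarith) hEℓ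
        _ ≤ _ := by
            have : 0 ≤ Γ₃ * main := by positivity
            linarith
    · have hk₂le : (k₂ : ℝ) ≤ 6 * (L / ℓ₂) := by
        have h3 := Nat.floor_le (by positivity : 0 ≤ 2 * L / ℓ₂)
        have h4 : 2 * L / ℓ₂ = 2 * (L / ℓ₂) := by ring
        have h5 : 1 ≤ 2 * (L / ℓ₂) := by
          rw [← h4, le_div_iff₀ hℓ₂0]; linarith
        rw [hk₂]; push_cast
        linarith
      have hkk : (k₁ : ℝ) * k₂ ≤ 30 * (L ^ 2 / q) := by
        calc (k₁ : ℝ) * k₂ ≤ (5 * (L / ℓ₁)) * (6 * (L / ℓ₂)) := by gcongr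
          _ = 30 * (L ^ 2 / (ℓ₁ * ℓ₂)) := by field_simp; ring
          _ ≤ _ := by gcongr
      have hlY : Real.log V ≤ 2 * Real.log Y := by
        have := Real.log_le_log hV0 hVY
        rwa [Real.log_pow] at this
      have hlY0 : 0 < Real.log Y := Real.log_pos hY1
      have hlog : 1 / Real.log Y ^ N ≤ 2 ^ N / Real.log V ^ N := by
        rw [div_le_div_iff₀ (by positivity) (by positivity), one_mul, ← mul_pow]
        exact pow_le_pow_left₀ hlV.le hlY N
      have hYV : Y ^ (4 * T + δ) ≤ V := by
        refine le_trans ?_ hVbig'.le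
        refine (Real.rpow_le_rpow_of_exponent_le hY1.le ?_).trans
          (le_mul_of_one_le_left (by positivity) hℓ₁1)
        linarith
      -- The level of the sieve: 5/4 (4T + δ) is at most 9T + ε, and k₁ ≥ L/ℓ₁ ≥ Y^(9T+ε).
      have hYk : (Y ^ (4 * T + δ)) ^ ((5 : ℝ) / 4) ≤ k₁ := by
        rw [← Real.rpow_mul hY0.le]
        refine le_trans (Real.rpow_le_rpow_of_exponent_le hY1.le ?_) (hLbig.trans hk₁ge)
        linarith
      set b := Cn * (Cs * (30 * (L ^ 2 / q)) * h * S * (2 ^ N / Real.log V ^ N) +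
        Cs * (5 * (L / ℓ₁)) * Y ^ (10 * T + 3 * δ)) with hbdef
      have hcell : ∀ c', ∑ x ∈ X.filter (fun x => gridIndex L (toPlane x) = c'), φ x ≤ b := by
        intro c'
        obtain ⟨a, b', hab⟩ := exists_coordinate_box hb hred h₁ h₂ hL0 c'
        set X' := X.filter (fun x => gridIndex L (toPlane x) = c') with hX'
        have hmem : ∀ x ∈ X', x ∈ X := fun x hx => (mem_filter.1 hx).1
        have hsb := hsieve G.index v₁ v₂ a b' k₁ k₂ X' hG hb.natAbs_det hk fun x hx =>
          ⟨(hX x (hmem x hx)).1, hXne x (hmem x hx),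
            hab x (hX x (hmem x hx)).2.2 (mem_filter.1 hx).2⟩
        refine (hNT hT9 f hf hM X' (formIdeals F θ (G.index * W)) _ _ _ Y V hYY₀ (by positivity)
          (by positivity) (fun x hx => hS.isSeparatedTuple_formIdeals (hX x (hmem x hx)).1
            (Dvd.intro_left _ rfl) (hXne x (hmem x hx)))
          (fun x hx => hD _ x Y (hXY x (hmem x hx)).1 (hXY x (hmem x hx)).2 (hXne x (hmem x hx)))
          hYV hYk hsb).trans ?_
        rw [hbdef]
        refine mul_le_mul_of_nonneg_left (add_le_add ?_ ?_) hCn.le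
        · rw [div_eq_mul_one_div]
          gcongr
        · gcongr
      refine (htotal b (by positivity) hcell).trans ?_
      have h3 : Y * Y ^ (10 * T + 3 * δ) ≤ E := by
        rw [hE, ← Real.rpow_one_add' hY0.le (by linarith)]
        refine Real.rpow_le_rpow_of_exponent_le hY1.le ?_
        rw [hδ]; linarith
      have h4 : Y ^ 2 / V * L ^ 2 = V := by rw [hL]; field_simp
      calc κ * (Y ^ 2 / V) * b = Γ₃ * ((Y ^ 2 / V * L ^ 2) / Real.log V ^ N * (h / q) * S) +
            Γ₄ * ((Y ^ 2 / V * (L / ℓ₁)) * Y ^ (10 * T + 3 * δ)) := by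
            rw [hbdef, hΓ₃, hΓ₄]; ring
        _ = Γ₃ * main + Γ₄ * (Y * Y ^ (10 * T + 3 * δ) / ℓ₁) := by
            rw [h4, hYVL]; ring
        _ ≤ Γ₃ * main + Γ₄ * (E / ℓ₁) := by gcongr
        _ ≤ _ := by
            have : Γ₄ * (E / ℓ₁) ≤ (Γ₁ + Γ₂ + Γ₄) * (E / ℓ₁) :=
              mul_le_mul_of_nonneg_right (by linarith) hEℓ
            linarith

end LatticeSums
end

/-! ### The main theorem. -/

theorem theorem1p1
    (N : ℕ) (hN : 1 ≤ N)
    (F : Fin N → MvPolynomial (Fin 2) ℤ) (d : Fin N → ℕ)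
    (hhom : ∀ i, (F i).IsHomogeneous (d i))
    (hirr : ∀ i, Irreducible (MvPolynomial.map (Int.castRingHom ℚ) (F i)))
    (hcop : ∀ i j, i ≠ j → IsRelPrime (MvPolynomial.map (Int.castRingHom ℚ) (F i))
      (MvPolynomial.map (Int.castRingHom ℚ) (F j)))
    (K : Fin N → Type*) [∀ i, Field (K i)] [∀ i, NumberField (K i)]
    (θ : ∀ i, 𝓞 (K i)) (hθ : ∀ i, IsFormRoot (F i) (d i) (θ i))
    (A : Fin N → ℝ) :
    ∃ w₀ : ℝ, ∀ w : ℝ, w₀ < w →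
      ∀ (c₁ c₂ ε M : ℝ) (m : ℕ) (B εs : Fin N → ℝ), 0 < c₁ → 0 < c₂ → 0 < ε →
      ∃ C : ℝ, 0 < C ∧
        ∀ f : ∀ i, Ideal (𝓞 (K i)) → ℝ,
          (∀ i, IsPseudomultiplicative (A i) (B i) (εs i) (f i)) →
          (∀ i, f i ⊤ ≤ M) →
        ∀ R : Set Plane, IsRegularRegion F c₁ R → ENat.card (ConnectedComponents R) ≤ m →
        ∀ G : AddSubgroup (ℤ × ℤ), G.index ≠ 0 → (G.index : ℝ) ≤ area R ^ c₂ →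
          ∑ᶠ x ∈ {x : ℤ × ℤ | Int.gcd x.1 x.2 = 1 ∧ toPlane x ∈ R ∧ x ∈ G},
              ∏ i, f i (idealPrimeTo (G.index * primorial ⌊w⌋₊)
                (Ideal.span {(leadCoeffX (F i) : 𝓞 (K i)) * (x.1 : 𝓞 (K i))
                  - θ i * (x.2 : 𝓞 (K i))}))
            ≤ C * (area R / Real.log (area R) ^ N
                  * (hStar F (natPrimeTo (primorial ⌊w⌋₊) G.index) / (G.index : ℝ))
                  * ∏ i, eulerMajorant (f i) w (area R)
                + regionK R ^ (1 + epsZero c₁ d εs + ε) / firstMin G) := by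
  obtain ⟨w₀, hw₀, hsys⟩ := exists_isFormSystem hhom hirr hcop hθ
  refine ⟨w₀, fun w hw c₁ c₂ ε M m B εs hc₁ hc₂ hε => ?_⟩
  -- Without positive B_i and ε_i no function belongs to the class.
  by_cases hpos : ∀ i, 0 < B i ∧ 0 < εs i
  swap
  · exact ⟨1, one_pos, fun f hf => absurd (fun i => ⟨(hf i).B_pos, (hf i).eps_pos⟩) hpos⟩
  have hS := hsys w hw
  obtain ⟨C, hC, hsum⟩ := hS.exists_lattice_sum_le hN A B εs c₁ ε M m hc₁ hε
    (fun i => (hpos i).1) (fun i => (hpos i).2)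
  -- The price, max(1, M) per form, of passing from square-free sums to E_f; as it is at least 1, it
  -- may multiply the error term too.
  set Q := (max 1 M) ^ N with hQ
  have hQ1 : 1 ≤ Q := one_le_pow₀ (le_max_left _ _)
  refine ⟨C * Q, by positivity, fun f hf hM R hR hm G hG _ => ?_⟩
  -- Needed because a `finsum` with infinite support would be zero by convention; boundedness of R
  -- rules this out.
  have hfin : {x : ℤ × ℤ | Int.gcd x.1 x.2 = 1 ∧ toPlane x ∈ R ∧ x ∈ G}.Finite :=
    hR.finite_points.subset fun x hx => hx.2.1
  rw [finsum_mem_eq_finite_toFinset_sum _ hfin]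
  have hX : ∀ x ∈ hfin.toFinset, IsCoprime x.1 x.2 ∧ toPlane x ∈ R ∧ x ∈ G := fun x hx => by
    obtain ⟨h1, h2⟩ := hfin.mem_toFinset.1 hx
    exact ⟨Int.isCoprime_iff_gcd_eq_one.2 h1, h2⟩
  refine (hsum f hf hM R hR hm G hG _ hX).trans ?_
  set V := area R with hV
  have hV1 : 1 < V := hR.one_lt_area hc₁
  have hlV : 0 < Real.log V := Real.log_pos hV1
  have hK : 0 < regionK R := by linarith [hR.one_lt_regionK hc₁]
  have hprod : ∏ i, squarefreeSum (f i) (primorial ⌊w⌋₊) V ≤ Q * ∏ i, eulerMajorant (f i) w V := by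
    calc _ ≤ ∏ i, (max 1 M * eulerMajorant (f i) w V) :=
          Finset.prod_le_prod (fun i _ => squarefreeSum_nonneg (hf i) _ _) fun i _ =>
            squarefreeSum_le_eulerMajorant (hf i) (hM i) (by linarith) V
      _ = _ := by rw [Finset.prod_mul_distrib]; simp [hQ]
  have hh : 0 ≤ hStar F (natPrimeTo (primorial ⌊w⌋₊) G.index) := by
    rw [hStar_natPrimeTo]
    refine Finset.prod_nonneg fun p hp => inv_nonneg.2 ?_
    obtain ⟨h1, h2⟩ := Finset.mem_filter.1 hp
    have := (hS.density_bounds (Nat.prime_of_mem_primeFactors h1) h2).2.2.2.2.1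
    linarith
  have hfm : 0 < firstMin G := by
    obtain ⟨v₁, v₂, hb, -, h₁, -⟩ := exists_reduced_basis hG
    exact (firstMin_pos_and_le hb.left_mem h₁).1
  set e := regionK R ^ (1 + epsZero c₁ d εs + ε) / firstMin G with he
  have he0 : 0 ≤ e := by positivity
  set a := V / Real.log V ^ N * (hStar F (natPrimeTo (primorial ⌊w⌋₊) G.index) / G.index) with ha
  have ha0 : 0 ≤ a := by positivity
  rw [mul_assoc C Q]
  refine mul_le_mul_of_nonneg_left ?_ hC.le
  have h1 := mul_le_mul_of_nonneg_left hprod ha0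
  have h2 : e ≤ Q * e := le_mul_of_one_le_left he0 hQ1
  calc _ ≤ a * (Q * ∏ i, eulerMajorant (f i) w V) + Q * e := add_le_add h1 h2
    _ = _ := by ring
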